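/- Let $F$ be a non-archimedean local field of characteristic $0$, $E/F$ a quadratic extension, $\iota$ the non-trivial element of $\mathrm{Gal}(E/F)$, $|x|_E=|N_{E/F}(x)|_F$ with $|\cdot|_F$ the normalized absolute value, and $\tau\in E^\times$ with $\mathrm{tr}_{E/F}(\tau)=0$. All inductions are smooth; $\mathrm{Ind}$ denotes normalized induction (functions with $f(pg)=\delta_P(p)^{1/2}\sigma(p)f(g)$), and groups act by right translation. $C_c^\infty(S\backslash G)$ is the space of locally constant, compactly supported functions on $S\backslash G$. **Orthogonal case.** Let $V_F$ be a non-degenerate quadratic space over $F$ of dimension $2m$ with bilinear form $q_F$, let $V=V_F\otimes_FE$ with the extended form $q$, and let $r$ be the Witt index of $V$. Let $\mathbf V_\tau$ be $V$ viewed as an $F$-space with the form $\mathrm{tr}_{E/F}(\tau q)$, so that $\mathrm O(V)\subset\mathbf H=\mathrm O(\mathbf V_\tau)$, let $\mathbf Q\subset\mathbf H$ be the stabilizer of the Lagrangian $\tau V_F$, and for $s\in\mathbb C$ let $I(s)=\mathrm{Ind}_{\mathbf Q}^{\mathbf H}(|\det|_F^s)$, where $\det$ is the determinant of the action on $\tau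 V_F$. Identify $\mathbf Q\backslash\mathbf H$ with the set $\mathcal X$ of Lagrangians of $\mathbf V_\tau$ by $\mathbf Qh\mapsto h^{-1}(\tau V_F)$. For $L\in\mathcal X$ put $L_{\mathrm{an}}=\{x\in L: q(x,y)=0\ \forall y\in L\}$ (an $E$-subspace of $V$), and let $\mathcal X_k=\{L\in\mathcal X:\dim_EL_{\mathrm{an}}=k\}$. Let $I_k(s)\subset I(s)$ be the space of sections that vanish on the closure of $\mathcal X_k$. Then $$0=I_0(s)\subset I_1(s)\subset\cdots\subset I_{r+1}(s)=I(s)$$ is a filtration by $\mathrm O(V)$-subrepresentations. For $0\le k\le r$ there are decompositions $V=(X_k\oplus Y_k)\perp V_{2m-2k}$, where $X_k,Y_k$ are isotropic $E$-subspaces in duality under $q$ with $\dim_E X_k=k$, together with an $F$-form $V_{2m-2k,F}$ of the quadratic space $V_{2m-2k}$; and for every such choice, with $Q_k$ the stabilizer of $X_k$ in $\mathrm O(V)$, the quotient $J_k(s)=I_{k+1}(s)/I_k(s)$ satisfies, as a representation of $\mathrm O(V)$, $$J_k(s)\cong\bigoplus_{V'_{2m-2k,F}\in H^1(E/F,\mathrm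 O(V_{2m-2k}))}\mathrm{Ind}_{Q_k}^{\mathrm O(V)}\Big(|\det{}_{X_k}|_E^{s+\frac k2}\otimes C_c^\infty\big(\mathrm O(V'_{2m-2k,F})\backslash\mathrm O(V_{2m-2k})\big)\Big).$$ Here $H^1(E/F,\mathrm O(V_{2m-2k}))=\{g\in\mathrm O(V_{2m-2k}): g\,\iota(g)=1\}/(g\sim hg\,\iota(h)^{-1})$, with $\iota$ acting through the $F$-form $V_{2m-2k,F}$, and the class of $g$ corresponds to the $F$-form $V'_{2m-2k,F}=\{v\in V_{2m-2k}: g\,\iota(v)=v\}$ (for any choice of representatives $g$). In particular $$J_0(s)=I_1(s)\cong\bigoplus_{V'_F\in H^1(E/F,\mathrm O(V))}C_c^\infty\big(\mathrm O(V'_F)\backslash\mathrm O(V)\big),$$ where the $F$-structure on $V$ is $V_F$, and up to isomorphism $J_0(s)$ does not depend on $s$. **Symplectic case.** Let $W_F=X_F\oplus Y_F$ be a symplectic space over $F$ of dimension $2n$ with a complete polarization, $W=W_F\otimes_FE$ with the extended form $q$, and $\mathbf W$ the space $W$ viewed as an $F$-space with the form $\mathrm{tr}_{E/F}\circ q$,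 so that $\mathrm{Sp}(W)\subset\mathbf G=\mathrm{Sp}(\mathbf W)$. Let $\mathbf P\subset\mathbf G$ be the stabilizer of the Lagrangian $X_F\oplus\tau Y_F$, let $I(s)=\mathrm{Ind}_{\mathbf P}^{\mathbf G}(|\det|_F^s)$, where $\det$ is the determinant of the action on $X_F\oplus\tau Y_F$, and define $\mathcal X_k$, $I_k(s)$ and $J_k(s)=I_{k+1}(s)/I_k(s)$ as above, with $\mathbf P\backslash\mathbf G$ identified with the set of Lagrangians of $\mathbf W$. Then $0=I_0(s)\subset I_1(s)\subset\cdots\subset I_{n+1}(s)=I(s)$ is a filtration by $\mathrm{Sp}(W)$-subrepresentations. For $0\le k\le n$ there are decompositions $W=(X_k\oplus Y_k)\perp W_{2n-2k}$, where $X_k,Y_k$ are isotropic $E$-subspaces in duality with $\dim_EX_k=k$, together with an $F$-form $W_{2n-2k,F}=X'_F\oplus Y'_F$ of the symplectic space $W_{2n-2k}$ with a complete polarization; and for every such choice, with $P_k$ the stabilizer of $X_k$ in $\mathrm{Sp}(W)$, $$J_k(s)\cong\mathrm{Ind}_{P_k}^{\mathrm{Sp}(W)}\Big(|\det{}_{X_k}|_E^{s+\frac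 k2}\otimes C_c^\infty\big(\mathrm{Sp}(W_{2n-2k,F})^\tau\backslash\mathrm{Sp}(W_{2n-2k})\big)\Big).$$ Here $\mathrm{Sp}(W_{2n-2k,F})^\tau=c_\tau\,\mathrm{Sp}(W_{2n-2k,F})\,c_\tau^{-1}$, where $c_\tau$ acts on $X'_F\otimes_FE$ by the scalar $\tau$ and on $Y'_F\otimes_FE$ by the identity. In particular $J_0(s)=I_1(s)\cong C_c^\infty(\mathrm{Sp}(W_F)^\tau\backslash\mathrm{Sp}(W))$, with $c_\tau$ defined by $W_F=X_F\oplus Y_F$, and up to isomorphism $J_0(s)$ does not depend on $s$. -/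

import Mathlib

open scoped TensorProduct NNReal Pointwise DirectSum

noncomputable section

namespace BaseChangeDoubling

/-! ## Normalized absolute values -/

/-- The normalized absolute value `|x|_F = q ^ (-ord x)` of a non-archimedean local field `F` whose
residue field has `q` elements. -/
def normAbs (F : Type*) [Field F] [ValuativeRel F] [TopologicalSpace F]
    [IsNonarchimedeanLocalField F] : F →*₀ ℝ≥0 :=
  (WithZeroMulInt.toNNReal (e := (Nat.card (IsLocalRing.ResidueField (ValuativeRel.valuation F).integer) : ℝ≥0))
      (Nat.cast_ne_zero.mpr Nat.card_pos.ne')).comp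
    ((IsNonarchimedeanLocalField.valueGroupWithZeroIsoInt F).toMulEquiv.toMonoidWithZeroHom.comp
      (ValuativeRel.valuation F).toMonoidWithZeroHom)

/-- The absolute value `|x|_K = |N_{K/F}(x)|_F` of a finite extension `K` of `F`; for `K = F` this
is `|x|_F`, since `N_{F/F}` is the identity. -/
def relAbs (F K : Type*) [Field F] [ValuativeRel F] [TopologicalSpace F]
    [IsNonarchimedeanLocalField F] [Field K] [Algebra F K] : K →* ℝ≥0 :=
  (normAbs F : F →* ℝ≥0).comp (Algebra.norm F)

/-- The character `g ↦ χ(g) ^ s` attached to a character `χ` with non-negative values. -/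
def posPow {G : Type*} [Group G] (χ : G →* ℝ≥0) (s : ℂ) : G →* ℂ where
  toFun g := ((χ g : ℝ) : ℂ) ^ s
  map_one' := by simp
  map_mul' g h := by
    rw [map_mul, NNReal.coe_mul, Complex.ofReal_mul]
    exact Complex.mul_cpow_ofReal_nonneg (χ g).2 (χ h).2 s

/-- The twist `χ ⊗ σ` of a representation by a character. -/
def twist {G A : Type*} [Group G] [AddCommGroup A] [Module ℂ A] (χ : G →* ℂ)
    (σ : Representation ℂ G A) : Representation ℂ G A where
  toFun g := χ g • σ g
  map_one' := by simp
  map_mul' g h := by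
    ext v
    simp [mul_smul, smul_comm (χ g) (χ h)]

/-! ## Isometry groups -/

section Isometry

variable {K M : Type*} [Field K] [AddCommGroup M] [Module K M]

/-- The isometry group of a bilinear form: `O(M)` if the form is symmetric, `Sp(M)` if it is
alternating (and non-degenerate). -/
def isomGroup (B : LinearMap.BilinForm K M) : Subgroup (M ≃ₗ[K] M) where
  carrier := {g | ∀ x y, B (g x) (g y) = B x y}
  one_mem' := fun _ _ => rfl
  mul_mem' := by
    intro g h hg hh x y
    rw [LinearEquiv.mul_apply, LinearEquiv.mul_apply, hg, hh]
  inv_mem' := by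
    intro g hg x y
    have h := hg (g⁻¹ x) (g⁻¹ y)
    have e : ∀ z, g (g⁻¹ z) = z := fun z => g.apply_symm_apply z
    rw [e, e] at h
    exact h.symm

variable {B : LinearMap.BilinForm K M}

theorem isom_apply (g : isomGroup B) (x y : M) : B (g • x) (g • y) = B x y := g.2 x y

theorem isom_inv_apply (g : isomGroup B) (x y : M) : B (g⁻¹ • x) y = B x (g • y) := by
  have h := isom_apply g (g⁻¹ • x) y
  rw [smul_inv_smul] at h
  exact h.symm

/-- The topology of the isometry group of a finite-dimensional space `M`: the topology of pointwise
convergence on `M`, where `M` carries its canonical (module) topology. -/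
instance [TopologicalSpace K] : TopologicalSpace (isomGroup B) :=
  TopologicalSpace.induced (fun g (v : M) => g • v)
    (@Pi.topologicalSpace M (fun _ => M) (fun _ => moduleTopology K M))

instance [TopologicalSpace K] : SeparatelyContinuousMul (isomGroup B) := by
  let _ : TopologicalSpace M := moduleTopology K M
  have : IsModuleTopology K M := ⟨rfl⟩
  have := IsModuleTopology.toContinuousAdd K M
  have key : ∀ v : M, Continuous (fun g : isomGroup B => g • v) := fun v =>
    (continuous_apply v).comp continuous_induced_dom
  constructor
  · intro a
    refine continuous_induced_rng.2 (continuous_pi fun v => ?_)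
    have : Continuous (fun x : M => a • x) :=
      IsModuleTopology.continuous_of_linearMap (R := K) ((a : M ≃ₗ[K] M) : M →ₗ[K] M)
    simpa [Function.comp_def, mul_smul] using this.comp (key v)
  · intro a
    refine continuous_induced_rng.2 (continuous_pi fun v => ?_)
    simpa [Function.comp_def, mul_smul] using key (a • v)

variable (B) in
/-- The stabilizer in the isometry group of a subspace `X` (for `X` isotropic: a parabolic
subgroup). -/
abbrev stab (X : Submodule K M) : Subgroup (isomGroup B) :=
  MulAction.stabilizer (isomGroup B) (X : Set M)

variable {X : Submodule K M}

theorem stab_smul_mem (p : stab B X) {x : M} (hx : x ∈ X) : (p : isomGroup B) • x ∈ X := by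
  have h : (p : isomGroup B) • (X : Set M) = X := p.2
  have h2 : (p : isomGroup B) • x ∈ (p : isomGroup B) • (X : Set M) := Set.smul_mem_smul_set hx
  rw [h] at h2
  exact h2

variable (B X) in
/-- The restriction homomorphism `p ↦ p|_X` on the stabilizer of `X`. -/
def restr : stab B X →* Module.End K X where
  toFun p := ((p : isomGroup B) : M →ₗ[K] M).restrict (fun _ hx => stab_smul_mem p hx)
  map_one' := rfl
  map_mul' _ _ := rfl

variable (B X) in
/-- The character `p ↦ det(p|_X)` of the stabilizer of `X`. -/
def detOn : stab B X →* K := (LinearMap.det : Module.End K X →* K).comp (restr B X)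

variable (B X) in
/-- The Lie algebra of the unipotent radical of the stabilizer `P` of the isotropic subspace `X`:
the skew endomorphisms that act by `0` on `X`, on `X^⊥ / X` and hence on `M / X^⊥`. -/
def nilRadical : Submodule K (Module.End K M) where
  carrier := {a | (∀ x y, B (a x) y + B x (a y) = 0) ∧ (∀ x ∈ X, a x = 0) ∧
    ∀ v, (∀ x ∈ X, B x v = 0) → a v ∈ X}
  zero_mem' := by simp
  add_mem' := by
    rintro a b ⟨ha, ha', ha''⟩ ⟨hb, hb', hb''⟩
    refine ⟨fun x y => ?_, fun x hx => ?_, fun v hv => X.add_mem (ha'' v hv) (hb'' v hv)⟩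
    · have h1 := ha x y
      have h2 := hb x y
      simp only [LinearMap.add_apply, map_add]
      linear_combination h1 + h2
    · simp [ha' x hx, hb' x hx]
  smul_mem' := by
    rintro c a ⟨ha, ha', ha''⟩
    refine ⟨fun x y => ?_, fun x hx => ?_, fun v hv => X.smul_mem c (ha'' v hv)⟩
    · have h1 := ha x y
      simp only [LinearMap.smul_apply, map_smul, smul_eq_mul]
      linear_combination c * h1
    · simp [ha' x hx]

theorem conj_mem_nilRadical (p : stab B X) {a : Module.End K M} (ha : a ∈ nilRadical B X) :
    (((p : isomGroup B) : M ≃ₗ[K] M) : M →ₗ[K] M) ∘ₗ a ∘ₗ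
      (((p⁻¹ : stab B X) : isomGroup B) : M ≃ₗ[K] M) ∈ nilRadical B X := by
  obtain ⟨h1, h2, h3⟩ := ha
  set g : isomGroup B := (p : isomGroup B) with hg
  have hgi : ((p⁻¹ : stab B X) : isomGroup B) = g⁻¹ := rfl
  have app : ∀ v : M, ((g : M ≃ₗ[K] M) : M →ₗ[K] M) (a
      ((((p⁻¹ : stab B X) : isomGroup B) : M ≃ₗ[K] M) v)) = g • a (g⁻¹ • v) := fun v => rfl
  refine ⟨fun x y => ?_, fun x hx => ?_, fun v hv => ?_⟩
  · simp only [LinearMap.comp_apply, LinearEquiv.coe_coe] at app ⊢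
    rw [app, app]
    have e1 : B (g • a (g⁻¹ • x)) y = B (a (g⁻¹ • x)) (g⁻¹ • y) := by
      rw [← isom_apply g (a (g⁻¹ • x)) (g⁻¹ • y), smul_inv_smul]
    have e2 : B x (g • a (g⁻¹ • y)) = B (g⁻¹ • x) (a (g⁻¹ • y)) := (isom_inv_apply g _ _).symm
    rw [e1, e2]
    exact h1 _ _
  · simp only [LinearMap.comp_apply, LinearEquiv.coe_coe] at app ⊢
    have h0 : a (g⁻¹ • x) = 0 := h2 _ (stab_smul_mem p⁻¹ hx)
    rw [app, h0, smul_zero]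
  · simp only [LinearMap.comp_apply, LinearEquiv.coe_coe] at app ⊢
    rw [app]
    refine stab_smul_mem p (h3 _ fun x hx => ?_)
    have : B (g • x) (g • g⁻¹ • v) = B x (g⁻¹ • v) := isom_apply g _ _
    rw [← this, smul_inv_smul]
    exact hv _ (stab_smul_mem p hx)

variable (B X) in
/-- The adjoint action of the stabilizer `P` of `X` on the Lie algebra of its unipotent radical. -/
def adNil : stab B X →* Module.End K (nilRadical B X) where
  toFun p :=
    { toFun := fun a => ⟨_, conj_mem_nilRadical p a.2⟩
      map_add' := fun a b => Subtype.ext (LinearMap.ext fun v => by simp)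
      map_smul' := fun c a => Subtype.ext (LinearMap.ext fun v => by simp) }
  map_one' := rfl
  map_mul' p q := by
    refine LinearMap.ext fun a => Subtype.ext (LinearMap.ext fun v => ?_)
    have : (p * q)⁻¹ = q⁻¹ * p⁻¹ := mul_inv_rev p q
    simp only [this]
    rfl

variable (B X) in
/-- The modulus character `δ_P(p) = |det(Ad(p) | Lie N)|` of the parabolic subgroup `P = MN`
stabilizing `X`. -/
def modulus (F : Type*) [Field F] [ValuativeRel F] [TopologicalSpace F]
    [IsNonarchimedeanLocalField F] [Algebra F K] : stab B X →* ℝ≥0 :=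
  (relAbs F K).comp
    ((LinearMap.det : Module.End K (nilRadical B X) →* K).comp (adNil B X))

end Isometry

/-! ## Smooth induction and function spaces -/

section Induction

variable {G : Type*} [Group G] [TopologicalSpace G] [SeparatelyContinuousMul G]

/-- Right translation of functions on a group. -/
def rightTranslation (G A : Type*) [Group G] [AddCommGroup A] [Module ℂ A] :
    Representation ℂ G (G → A) where
  toFun h :=
    { toFun := fun f g => f (g * h)
      map_add' := fun _ _ => rfl
      map_smul' := fun _ _ => rfl }
  map_one' := by ext; simp
  map_mul' h h' := by
    refine LinearMap.ext fun f => funext fun g => ?_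
    simp [mul_assoc]

variable {P : Subgroup G} {A : Type*} [AddCommGroup A] [Module ℂ A]

/-- The space of the unnormalized smooth induction of a representation `σ` of a subgroup `P`: the
functions `f : G → A` with `f (p g) = σ(p) f(g)` that are right invariant under some open subgroup
of `G`. -/
def unInd (σ : Representation ℂ P A) : Submodule ℂ (G → A) where
  carrier := {f | (∀ (p : P) (g : G), f (p * g) = σ p (f g)) ∧
    ∃ U : Subgroup G, IsOpen (U : Set G) ∧ ∀ u ∈ U, ∀ g, f (g * u) = f g}
  zero_mem' := ⟨by simp, ⊤, by simp, by simp⟩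
  add_mem' := by
    rintro f f' ⟨hf, U, hU, hfU⟩ ⟨hf', U', hU', hfU'⟩
    refine ⟨by simp [hf, hf'], U ⊓ U', hU.inter hU', fun u hu g => ?_⟩
    simp [hfU u hu.1, hfU' u hu.2]
  smul_mem' := by
    rintro c f ⟨hf, U, hU, hfU⟩
    exact ⟨by simp [hf], U, hU, fun u hu g => by simp [hfU u hu]⟩

theorem unInd_stable (σ : Representation ℂ P A) (h : G) :
    unInd σ ≤ (unInd σ).comap (rightTranslation G A h) := by
  rintro f ⟨hf, U, hU, hfU⟩
  refine ⟨fun p g => ?_, U.comap (MulAut.conj h⁻¹).toMonoidHom, ?_, fun u hu g => ?_⟩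
  · change f (p * g * h) = σ p (f (g * h))
    rw [mul_assoc, hf]
  · have hc : Continuous (fun x : G => h⁻¹ * x * h) :=
      (SeparatelyContinuousMul.continuous_mul_const (a := h)).comp
        (SeparatelyContinuousMul.continuous_const_mul (a := h⁻¹))
    have := hU.preimage hc
    convert this using 1
    ext x
    simp
  · change f (g * u * h) = f (g * h)
    have hu' : h⁻¹ * u * h ∈ U := by simpa using hu
    rw [← hfU _ hu' (g * h)]
    congr 1
    group

/-- The unnormalized smooth induction of `σ`, on which `G` acts by right translation. -/
def unIndRep (σ : Representation ℂ P A) : Representation ℂ G (unInd σ) :=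
  (rightTranslation G A).subrepresentation (unInd σ) (unInd_stable σ)

/-- The space `C_c^∞(S \ G)`: the left `S`-invariant, locally constant functions on `G` that are
compactly supported modulo `S`. -/
def ccInf (S : Subgroup G) : Submodule ℂ (G → ℂ) where
  carrier := {φ | (∀ s ∈ S, ∀ g, φ (s * g) = φ g) ∧ IsLocallyConstant φ ∧
    ∃ C : Set G, IsCompact C ∧ Function.support φ ⊆ (S : Set G) * C}
  zero_mem' := ⟨by simp, IsLocallyConstant.const 0, ∅, isCompact_empty, by simp⟩
  add_mem' := by
    rintro φ φ' ⟨h1, h2, C, hC, h3⟩ ⟨h1', h2', C', hC', h3'⟩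
    refine ⟨fun s hs g => by simp [h1 s hs, h1' s hs], h2.add h2', C ∪ C', hC.union hC', ?_⟩
    rw [Set.mul_union]
    exact (Function.support_add φ φ').trans (Set.union_subset_union h3 h3')
  smul_mem' := by
    rintro c φ ⟨h1, h2, C, hC, h3⟩
    exact ⟨fun s hs g => by simp [h1 s hs], h2.comp (fun z => c * z), C, hC,
      (Function.support_const_smul_subset c φ).trans h3⟩

theorem ccInf_stable (S : Subgroup G) (h : G) :
    ccInf S ≤ (ccInf S).comap (rightTranslation G ℂ h) := by
  have hc : ∀ a : G, Continuous (fun x : G => x * a) := fun a =>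
    SeparatelyContinuousMul.continuous_mul_const
  rintro φ ⟨h1, h2, C, hC, h3⟩
  refine ⟨fun s hs g => ?_, h2.comp_continuous (hc h), (fun x => x * h⁻¹) '' C,
    hC.image (hc h⁻¹), fun g hg => ?_⟩
  · change φ (s * g * h) = φ (g * h)
    rw [mul_assoc, h1 s hs]
  · obtain ⟨s, hs, c, hcC, e⟩ := h3 (show g * h ∈ Function.support φ from hg)
    refine ⟨s, hs, c * h⁻¹, ⟨c, hcC, rfl⟩, ?_⟩
    have e' : s * c = g * h := e
    change s * (c * h⁻¹) = g
    rw [← mul_assoc, e', mul_inv_cancel_right]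

/-- The representation of `G` on `C_c^∞(S \ G)` by right translation. -/
def ccInfRep (S : Subgroup G) : Representation ℂ G (ccInf S) :=
  (rightTranslation G ℂ).subrepresentation (ccInf S) (ccInf_stable S)

end Induction

/-- Normalized induction `Ind_P^G(σ)` from the stabilizer `P` of an isotropic subspace `X`: the
unnormalized induction of `δ_P^{1/2} ⊗ σ`. -/
abbrev normIndRep (F : Type*) {K M A : Type*} [Field F] [ValuativeRel F] [TopologicalSpace F]
    [IsNonarchimedeanLocalField F] [Field K] [TopologicalSpace K] [Algebra F K] [AddCommGroup M]
    [Module K M] [AddCommGroup A] [Module ℂ A] (B : LinearMap.BilinForm K M) (X : Submodule K M)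
    (σ : Representation ℂ (stab B X) A) :
    Representation ℂ (isomGroup B) (unInd (twist (posPow (modulus B X F) (1 / 2)) σ)) :=
  unIndRep (twist (posPow (modulus B X F) (1 / 2)) σ)

/-! ## Levi decompositions -/

/-- A decomposition `M = (X ⊕ Y) ⊕ M0` of a space with a form, where `X` and `Y` are isotropic, in
duality with each other, `dim X = k`, and `M0` is the orthogonal complement of `X ⊕ Y`. It gives the
Levi subgroup `GL(X) × Isom(M0)` of the stabilizer of `X`. -/
structure LeviDatum {K M : Type*} [Field K] [AddCommGroup M] [Module K M]
    (B : LinearMap.BilinForm K M) (k : ℕ) where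
  X : Submodule K M
  Y : Submodule K M
  M0 : Submodule K M
  finrank_X : Module.finrank K X = k
  isotropic_X : ∀ x ∈ X, ∀ x' ∈ X, B x x' = 0
  isotropic_Y : ∀ y ∈ Y, ∀ y' ∈ Y, B y y' = 0
  separating_X : ∀ x ∈ X, (∀ y ∈ Y, B x y = 0) → x = 0
  separating_Y : ∀ y ∈ Y, (∀ x ∈ X, B x y = 0) → y = 0
  orthogonal : ∀ u ∈ X ⊔ Y, ∀ v ∈ M0, B u v = 0 ∧ B v u = 0
  isCompl : IsCompl M0 (X ⊔ Y)

namespace LeviDatum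

variable {K M : Type*} [Field K] [AddCommGroup M] [Module K M] {B : LinearMap.BilinForm K M} {k : ℕ}
  (D : LeviDatum B k)

/-- The projection `M → M0` along `X ⊕ Y`. -/
def proj : M →ₗ[K] D.M0 := D.M0.projectionOnto (D.X ⊔ D.Y) D.isCompl

theorem proj_of_mem {x : M} (hx : x ∈ D.X) : D.proj x = 0 :=
  (Submodule.projectionOnto_apply_eq_zero_iff D.isCompl).2 (Submodule.mem_sup_left hx)

theorem proj_coe (v : D.M0) : D.proj (v : M) = v := Submodule.projectionOnto_apply_left D.isCompl v

/-- An element of the stabilizer of `X` acts on `M0` by its Levi component modulo `X`. -/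
theorem smul_sub_proj_mem (p : stab B D.X) {v : M} (hv : v ∈ D.M0) :
    (p : isomGroup B) • v - (D.proj ((p : isomGroup B) • v) : M) ∈ D.X := by
  set w : M := (p : isomGroup B) • v with hw
  have hmem : w - (D.proj w : M) ∈ D.X ⊔ D.Y := by
    rw [← Submodule.projectionOnto_apply_eq_zero_iff D.isCompl]
    change D.proj (w - (D.proj w : M)) = 0
    rw [map_sub, D.proj_coe, sub_self]
  obtain ⟨x, hx, y, hy, e⟩ := Submodule.mem_sup.1 hmem
  have hperp : ∀ x' ∈ D.X, B x' w = 0 := by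
    intro x' hx'
    rw [hw, ← isom_inv_apply]
    exact (D.orthogonal _ (Submodule.mem_sup_left (stab_smul_mem p⁻¹ hx')) v hv).1
  have hy0 : y = 0 := by
    refine D.separating_Y y hy fun x' hx' => ?_
    have hy' : y = w - (D.proj w : M) - x := by rw [← e]; abel
    rw [hy', map_sub, map_sub, hperp x' hx', D.isotropic_X x' hx' x hx,
      (D.orthogonal x' (Submodule.mem_sup_left hx') _ (D.proj w).2).1]
    simp
  rw [← e, hy0, add_zero]
  exact hx

theorem proj_mul (p q : stab B D.X) (v : D.M0) :
    D.proj (((p * q : stab B D.X) : isomGroup B) • (v : M)) =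
      D.proj ((p : isomGroup B) • (D.proj ((q : isomGroup B) • (v : M)) : M)) := by
  have h := stab_smul_mem p (D.smul_sub_proj_mem q v.2)
  rw [smul_sub] at h
  have h2 := D.proj_of_mem h
  rw [map_sub, sub_eq_zero] at h2
  rw [← h2, ← mul_smul]
  rfl

/-- The Levi component of an element of the stabilizer of `X` is an isometry of `M0`. -/
def leviEquiv (p : stab B D.X) : D.M0 ≃ₗ[K] D.M0 where
  toFun v := D.proj ((p : isomGroup B) • (v : M))
  map_add' v w := by rw [Submodule.coe_add, smul_add, map_add]
  map_smul' c v := by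
    have : (p : isomGroup B) • (c • (v : M)) = c • ((p : isomGroup B) • (v : M)) :=
      map_smul ((p : isomGroup B) : M ≃ₗ[K] M) c (v : M)
    rw [Submodule.coe_smul, this, map_smul, RingHom.id_apply]
  invFun v := D.proj (((p⁻¹ : stab B D.X) : isomGroup B) • (v : M))
  left_inv v := by
    refine (D.proj_mul p⁻¹ p v).symm.trans ?_
    rw [inv_mul_cancel]
    exact (congrArg D.proj (one_smul _ _)).trans (D.proj_coe v)
  right_inv v := by
    refine (D.proj_mul p p⁻¹ v).symm.trans ?_
    rw [mul_inv_cancel]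
    exact (congrArg D.proj (one_smul _ _)).trans (D.proj_coe v)

/-- The projection of the stabilizer of `X` to the factor `Isom(M0)` of its Levi quotient
`GL(X) × Isom(M0)`. -/
def levi : stab B D.X →* isomGroup (B.restrict D.M0) where
  toFun p := ⟨D.leviEquiv p, by
    intro v w
    change B (D.proj ((p : isomGroup B) • (v : M)) : M) (D.proj ((p : isomGroup B) • (w : M)) : M)
      = B (v : M) (w : M)
    have hv := D.smul_sub_proj_mem p v.2
    have hw := D.smul_sub_proj_mem p w.2
    rw [← isom_apply (p : isomGroup B) (v : M) (w : M)]
    set a := (p : isomGroup B) • (v : M)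
    set b := (p : isomGroup B) • (w : M)
    have ea : a = (D.proj a : M) + (a - (D.proj a : M)) := by abel
    have eb : b = (D.proj b : M) + (b - (D.proj b : M)) := by abel
    have h1 := D.isotropic_X _ hv _ hw
    have h2 := (D.orthogonal _ (Submodule.mem_sup_left hv) _ (D.proj b).2).1
    have h3 := (D.orthogonal _ (Submodule.mem_sup_left hw) _ (D.proj a).2).2
    conv_rhs => rw [ea, eb]
    rw [map_add, map_add, LinearMap.add_apply, LinearMap.add_apply, h1, h2, h3]
    simp⟩
  map_one' := by
    refine Subtype.ext (LinearEquiv.ext fun v => ?_)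
    exact (congrArg D.proj (one_smul _ _)).trans (D.proj_coe v)
  map_mul' p q := Subtype.ext (LinearEquiv.ext fun v => D.proj_mul p q v)

end LeviDatum

/-! ## Doubled spaces and degenerate principal series -/

section Doubled

variable (F : Type*) {E V : Type*} [Field F] [Field E] [Algebra F E] [AddCommGroup V] [Module F V]
  [Module E V] [IsScalarTower F E V]

/-- The `F`-bilinear form `(x, y) ↦ tr_{E/F}(c · B(x, y))` on an `E`-space `V` with an `E`-bilinear
form `B`, viewed as an `F`-space. -/
def doubledForm (c : E) (B : LinearMap.BilinForm E V) : LinearMap.BilinForm F V :=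
  LinearMap.mk₂ F (fun x y => Algebra.trace F E (c * B x y))
    (by intro x x' y; simp [mul_add])
    (by
      intro a x y
      rw [← algebraMap_smul E a x, map_smul, LinearMap.smul_apply, smul_eq_mul, mul_left_comm,
        ← Algebra.smul_def, map_smul])
    (by intro x y y'; simp [mul_add])
    (by
      intro a x y
      rw [← algebraMap_smul E a y, map_smul, smul_eq_mul, mul_left_comm,
        ← Algebra.smul_def, map_smul])

/-- The embedding of the isometry group of the `E`-space `V` into the isometry group of its doubled
space. -/
def toDoubled (c : E) (B : LinearMap.BilinForm E V) :
    isomGroup B →* isomGroup (doubledForm F c B) where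
  toFun g := ⟨(g : V ≃ₗ[E] V).restrictScalars F, fun x y => by
    change Algebra.trace F E (c * B (g • x) (g • y)) = Algebra.trace F E (c * B x y)
    rw [isom_apply]⟩
  map_one' := rfl
  map_mul' _ _ := rfl

variable {F}

/-- `L_an = {x ∈ L | B(x, y) = 0 for all y ∈ L}` is an `E`-subspace of `V` of dimension `k` over
`E`. -/
def anDimEq (B : LinearMap.BilinForm E V) (L : Submodule F V) (k : ℕ) : Prop :=
  ∃ U : Submodule E V, (∀ x, x ∈ U ↔ x ∈ L ∧ ∀ y ∈ L, B x y = 0) ∧ Module.finrank E U = k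

theorem anDimEq_map {B : LinearMap.BilinForm E V} {L : Submodule F V} {k : ℕ} (h : isomGroup B)
    (hL : anDimEq B L k) :
    anDimEq B (L.map ((h : V ≃ₗ[E] V).restrictScalars F : V →ₗ[F] V)) k := by
  obtain ⟨U, hU, hk⟩ := hL
  have hm : ∀ {x : V}, x ∈ L.map ((h : V ≃ₗ[E] V).restrictScalars F : V →ₗ[F] V) ↔
      h⁻¹ • x ∈ L := by
    intro x
    constructor
    · rintro ⟨y, hy, rfl⟩
      have : h⁻¹ • (h • y) = y := inv_smul_smul h y
      exact this.symm ▸ hy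
    · intro hx
      exact ⟨h⁻¹ • x, hx, smul_inv_smul h x⟩
  refine ⟨U.map ((h : V ≃ₗ[E] V) : V →ₗ[E] V), fun x => ?_, ?_⟩
  · have hmU : x ∈ U.map ((h : V ≃ₗ[E] V) : V →ₗ[E] V) ↔ h⁻¹ • x ∈ U := by
      constructor
      · rintro ⟨y, hy, rfl⟩
        have : h⁻¹ • (h • y) = y := inv_smul_smul h y
        exact this.symm ▸ hy
      · intro hx
        exact ⟨h⁻¹ • x, hx, smul_inv_smul h x⟩
    rw [hmU, hU, hm]
    refine and_congr_right fun _ => ⟨fun H y hy => ?_, fun H y hy => ?_⟩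
    · have := H _ (hm.1 hy)
      rwa [isom_inv_apply, smul_inv_smul] at this
    · rw [isom_inv_apply]
      exact H _ (hm.2 (by rwa [inv_smul_smul]))
  · rw [← hk]
    exact LinearEquiv.finrank_eq ((h : V ≃ₗ[E] V).submoduleMap U).symm

variable [ValuativeRel F] [TopologicalSpace F] [IsNonarchimedeanLocalField F]

section

variable {M : Type*} [AddCommGroup M] [Module F M]

/-- The character `|det|_F^s` of the Siegel parabolic subgroup stabilizing `L`, as a representation
on `ℂ`. -/
def siegelChar (B : LinearMap.BilinForm F M) (L : Submodule F M) (s : ℂ) :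
    Representation ℂ (stab B L) ℂ :=
  twist (posPow ((relAbs F F).comp (detOn B L)) s) (Representation.trivial ℂ (stab B L) ℂ)

/-- The space of the degenerate principal series `I(s) = Ind_P(|det|_F^s)`, where `P` is the
stabilizer of the Lagrangian subspace `L`. -/
abbrev degPS (B : LinearMap.BilinForm F M) (L : Submodule F M) (s : ℂ) :
    Submodule ℂ (isomGroup B → ℂ) :=
  unInd (twist (posPow (modulus B L F) (1 / 2)) (siegelChar B L s))

end

variable (c : E) (B : LinearMap.BilinForm E V) (L : Submodule F V) (s : ℂ)

/-- The Lagrangian subspace `g⁻¹ L` attached to the coset `P g`. -/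
def translate (g : isomGroup (doubledForm F c B)) : Submodule F V :=
  L.map (((g⁻¹ : isomGroup (doubledForm F c B)) : V ≃ₗ[F] V) : V →ₗ[F] V)

/-- The preimage in the group of the `k`-th stratum of `P \ G`, which consists of the Lagrangians
`L' = g⁻¹ L` with `dim_E L'_an = k`. -/
def stratum (k : ℕ) : Set (isomGroup (doubledForm F c B)) :=
  {g | anDimEq B (translate c B L g) k}

/-- The subspace `I_k(s)` of `I(s)` of the sections that vanish on the closure of the `k`-th
stratum. -/
def filt (k : ℕ) : Submodule ℂ (isomGroup (doubledForm F c B) → ℂ) where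
  carrier := {f | f ∈ degPS (doubledForm F c B) L s ∧ ∀ g ∈ closure (stratum c B L k), f g = 0}
  zero_mem' := ⟨Submodule.zero_mem _, fun _ _ => rfl⟩
  add_mem' := by
    rintro f f' ⟨hf, h⟩ ⟨hf', h'⟩
    exact ⟨Submodule.add_mem _ hf hf', fun g hg => by rw [Pi.add_apply, h g hg, h' g hg, add_zero]⟩
  smul_mem' := by
    rintro a f ⟨hf, h⟩
    exact ⟨Submodule.smul_mem _ a hf, fun g hg => by rw [Pi.smul_apply, h g hg, smul_zero]⟩

/-- Right translation of functions on the isometry group of the doubled space by elements of the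
isometry group of `V`. -/
def resTranslation :
    Representation ℂ (isomGroup B) (isomGroup (doubledForm F c B) → ℂ) :=
  (rightTranslation (isomGroup (doubledForm F c B)) ℂ).comp (toDoubled F c B)

theorem filt_stable (k : ℕ) (h : isomGroup B) :
    filt c B L s k ≤ (filt c B L s k).comap (resTranslation c B h) := by
  rintro f ⟨hfI, hf⟩
  refine ⟨unInd_stable _ (toDoubled F c B h) hfI, fun g hg => ?_⟩
  change f (g * toDoubled F c B h) = 0
  refine hf _ ?_
  have hc : Continuous (fun x => x * toDoubled F c B h) :=
    SeparatelyContinuousMul.continuous_mul_const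
  refine closure_mono ?_ (image_closure_subset_closure_image hc ⟨g, hg, rfl⟩)
  rintro _ ⟨x, hx, rfl⟩
  have h1 : anDimEq B (translate c B L x) k := hx
  have h2 := anDimEq_map h⁻¹ h1
  change anDimEq B (translate c B L (x * toDoubled F c B h)) k
  have e : translate c B L (x * toDoubled F c B h) = (translate c B L x).map
      (((h⁻¹ : isomGroup B) : V ≃ₗ[E] V).restrictScalars F : V →ₗ[F] V) := by
    unfold translate
    rw [← Submodule.map_comp]
    congr 1
  rw [e]
  exact h2

/-- `I_k(s)` as a representation of the isometry group of `V`. -/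
def filtRep (k : ℕ) : Representation ℂ (isomGroup B) (filt c B L s k) :=
  (resTranslation c B).subrepresentation (filt c B L s k) (filt_stable c B L s k)

/-- The successive quotient `J_k(s) = I_{k+1}(s) / I_k(s)` as a representation of the isometry group
of `V`. (Where `I_k(s)` is not contained in `I_{k+1}(s)`, it is replaced by the intersection.) -/
def gradedRep (k : ℕ) : Representation ℂ (isomGroup B)
    (filt c B L s (k + 1) ⧸ (filt c B L s k).submoduleOf (filt c B L s (k + 1))) :=
  (filtRep c B L s (k + 1)).quotient _ fun h _ hf => filt_stable c B L s k h hf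

/-- The representation `|det_X|_E^z ⊗ C_c^∞(S \ Isom(M0))` of the Levi subgroup
`GL(X) × Isom(M0)`, inflated to the stabilizer of `X`. -/
def inducingRep {B : LinearMap.BilinForm E V} [TopologicalSpace E] {k : ℕ} (D : LeviDatum B k)
    (S : Subgroup (isomGroup (B.restrict D.M0))) (z : ℂ) :
    Representation ℂ (stab B D.X) (ccInf S) :=
  twist (posPow ((relAbs F E).comp (detOn B D.X)) z) ((ccInfRep S).comp D.levi)

end Doubled

/-! ## Forms over `F` and Galois cohomology -/

section Cohomology

variable {F E U N : Type*} [Field F] [Field E] [Algebra F E] [AddCommGroup U] [Module F U]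
  [Module E U] [IsScalarTower F E U] [AddCommGroup N] [Module F N]

/-- The map `j : N → U` exhibits the `E`-space `U` with the form `B` as the base change of an
`F`-space `N` with an `F`-valued form. -/
structure IsFForm (B : LinearMap.BilinForm E U) (j : N →ₗ[F] U) : Prop where
  isBaseChange : IsBaseChange E j
  rational : ∀ x y, ∃ a : F, B (j x) (j y) = algebraMap F E a

variable {B : LinearMap.BilinForm E U} {j : N →ₗ[F] U}

/-- The action `e • j x ↦ ι(e) • j x` of `ι ∈ Gal(E/F)` on `U = E ⊗ N`. -/
def galConj (hj : IsFForm B j) (ι : E ≃ₐ[F] E) : U ≃ₗ[F] U :=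
  ((hj.isBaseChange.equiv.restrictScalars F).symm.trans
    (TensorProduct.congr ι.toLinearEquiv (LinearEquiv.refl F N))).trans
      (hj.isBaseChange.equiv.restrictScalars F)

theorem galConj_smul_apply (hj : IsFForm B j) (ι : E ≃ₐ[F] E) (e : E) (x : N) :
    galConj hj ι (e • j x) = ι e • j x := by
  have h1 : hj.isBaseChange.equiv.symm (e • j x) = e ⊗ₜ[F] x := by
    rw [LinearEquiv.symm_apply_eq]
    rfl
  change hj.isBaseChange.equiv ((TensorProduct.congr ι.toLinearEquiv (LinearEquiv.refl F N))
    (hj.isBaseChange.equiv.symm (e • j x))) = _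
  rw [h1]
  rfl

theorem galConj_induction (hj : IsFForm B j) {p : U → Prop} (u : U)
    (h : ∀ (e : E) (x : N), p (e • j x)) (hadd : ∀ u v, p u → p v → p (u + v)) : p u := by
  rw [← hj.isBaseChange.equiv.apply_symm_apply u]
  induction hj.isBaseChange.equiv.symm u using TensorProduct.induction_on with
  | zero =>
    have := h 0 0
    simpa using this
  | tmul e x => exact h e x
  | add a b ha hb => rw [map_add]; exact hadd _ _ ha hb

theorem galConj_smul (hj : IsFForm B j) (ι : E ≃ₐ[F] E) (e : E) (u : U) :
    galConj hj ι (e • u) = ι e • galConj hj ι u := by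
  induction u using galConj_induction hj with
  | h e' x => rw [← mul_smul, galConj_smul_apply, galConj_smul_apply, map_mul, mul_smul]
  | hadd u v hu hv => rw [smul_add, map_add, map_add, smul_add, hu, hv]

theorem form_galConj (hj : IsFForm B j) (ι : E ≃ₐ[F] E) (u v : U) :
    B (galConj hj ι u) (galConj hj ι v) = ι (B u v) := by
  induction u using galConj_induction hj with
  | hadd u u' hu hu' => simp only [map_add, LinearMap.add_apply, hu, hu']
  | h e x =>
    induction v using galConj_induction hj with
    | hadd v v' hv hv' => simp only [map_add, hv, hv']
    | h e' x' =>
      obtain ⟨a, ha⟩ := hj.rational x x'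
      simp [galConj_smul_apply, ha]

/-- The action `ι(g) = ι ∘ g ∘ ι⁻¹` of `ι ∈ Gal(E/F)` on the isometry group of `U`. -/
def galAct (hj : IsFForm B j) (ι : E ≃ₐ[F] E) : isomGroup B →* isomGroup B where
  toFun g := ⟨{ ((galConj hj ι).symm.trans ((g : U ≃ₗ[E] U).restrictScalars F)).trans
        (galConj hj ι) with
      map_smul' := fun e u => by
        change galConj hj ι (g • (galConj hj ι).symm (e • u)) =
          e • galConj hj ι (g • (galConj hj ι).symm u)
        have h1 : (galConj hj ι).symm (e • u) = ι.symm e • (galConj hj ι).symm u := by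
          rw [LinearEquiv.symm_apply_eq, galConj_smul, LinearEquiv.apply_symm_apply,
            AlgEquiv.apply_symm_apply]
        have h2 : ∀ (a : E) (w : U), g • (a • w) = a • (g • w) := fun a w =>
          map_smul (g : U ≃ₗ[E] U) a w
        rw [h1, h2, galConj_smul, AlgEquiv.apply_symm_apply] }, fun x y => by
      change B (galConj hj ι (g • (galConj hj ι).symm x))
        (galConj hj ι (g • (galConj hj ι).symm y)) = B x y
      rw [form_galConj, isom_apply, ← form_galConj hj, LinearEquiv.apply_symm_apply,
        LinearEquiv.apply_symm_apply]⟩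
  map_one' := Subtype.ext (LinearEquiv.ext fun u => (galConj hj ι).apply_symm_apply u)
  map_mul' g h := by
    refine Subtype.ext (LinearEquiv.ext fun u => ?_)
    change galConj hj ι (g • h • (galConj hj ι).symm u) =
      galConj hj ι (g • (galConj hj ι).symm (galConj hj ι (h • (galConj hj ι).symm u)))
    rw [LinearEquiv.symm_apply_apply]

/-- The cocycles `{g | g ι(g) = 1}`. -/
abbrev Cocycle (hj : IsFForm B j) (ι : E ≃ₐ[F] E) : Type _ :=
  {g : isomGroup B // g * galAct hj ι g = 1}

/-- Two cocycles `g`, `g'` are equivalent if `g' = h g ι(h)⁻¹` for some `h`. -/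
def cohomologous (hj : IsFForm B j) (ι : E ≃ₐ[F] E) : Setoid (Cocycle hj ι) where
  r g g' := ∃ h : isomGroup B, (g' : isomGroup B) = h * g * (galAct hj ι h)⁻¹
  iseqv :=
    { refl := fun g => ⟨1, by simp⟩
      symm := by
        rintro g g' ⟨h, e⟩
        exact ⟨h⁻¹, by rw [e, map_inv]; group⟩
      trans := by
        rintro g g' g'' ⟨h, e⟩ ⟨h', e'⟩
        exact ⟨h' * h, by rw [e', e, map_mul]; group⟩ }

/-- The cohomology set `H^1(E/F, Isom(U))`, for a quadratic extension `E/F` with `ι` the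
non-trivial element of `Gal(E/F)`. -/
abbrev H1 (hj : IsFForm B j) (ι : E ≃ₐ[F] E) : Type _ := Quotient (cohomologous hj ι)

/-- A system of representatives of the cohomology classes by cocycles. -/
abbrev Representatives (hj : IsFForm B j) (ι : E ≃ₐ[F] E) : Type _ :=
  {c : H1 hj ι → Cocycle hj ι // ∀ x, (Quotient.mk _ (c x) : H1 hj ι) = x}

/-- The `F`-form `{v ∈ U | g ι(v) = v}` of `U` attached to a cocycle `g`. -/
def twistedForm (hj : IsFForm B j) (ι : E ≃ₐ[F] E) (g : Cocycle hj ι) : Submodule F U :=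
  LinearMap.eqLocus
    (((g : isomGroup B) : U ≃ₗ[E] U).restrictScalars F ∘ₗ (galConj hj ι : U →ₗ[F] U)) LinearMap.id

/-- The isometries of `U` that map the `F`-subspace `L` onto itself. If `L` is an `F`-form of `U`,
this is the isometry group of `L` over `F`, embedded in the isometry group of `U` by extension of
scalars. -/
abbrev rationalIsom (B : LinearMap.BilinForm E U) (L : Submodule F U) : Subgroup (isomGroup B) :=
  MulAction.stabilizer (isomGroup B) (L : Set U)

/-- The similitude `c_τ` of `U = E ⊗ N` that acts on `E ⊗ X` by the scalar `τ` and on `E ⊗ Y` by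
the identity, where `N = X ⊕ Y`. -/
def similitude (hj : IsFForm B j) {X Y : Submodule F N} (hXY : IsCompl X Y) (τ : E) : U →ₗ[E] U :=
  τ • hj.isBaseChange.lift (j ∘ₗ X.projection Y hXY) +
    hj.isBaseChange.lift (j ∘ₗ Y.projection X hXY.symm)

/-- The subgroup `Isom(N)^τ = c_τ Isom(N) c_τ⁻¹` of `Isom(U)`. -/
def twistedIsom (hj : IsFForm B j) {X Y : Submodule F N} (hXY : IsCompl X Y) (τ : E) :
    Subgroup (isomGroup B) where
  carrier := {g | ∃ h ∈ rationalIsom B (LinearMap.range j),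
    ∀ v, g • similitude hj hXY τ v = similitude hj hXY τ (h • v)}
  one_mem' := ⟨1, Subgroup.one_mem _, fun v => by rw [one_smul, one_smul]⟩
  mul_mem' := by
    rintro g g' ⟨h, hh, e⟩ ⟨h', hh', e'⟩
    exact ⟨h * h', Subgroup.mul_mem _ hh hh', fun v => by rw [mul_smul, e', e, mul_smul]⟩
  inv_mem' := by
    rintro g ⟨h, hh, e⟩
    exact ⟨h⁻¹, Subgroup.inv_mem _ hh, fun v => by rw [inv_smul_eq_iff, e, smul_inv_smul]⟩

/-- The standard `F`-form `N → E ⊗ N`, `x ↦ 1 ⊗ x`, of the base change of an `F`-space with a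
form. -/
theorem isFForm_baseChange (B : LinearMap.BilinForm F N) :
    IsFForm (LinearMap.BilinForm.baseChange E B) (TensorProduct.mk F E N 1) where
  isBaseChange := TensorProduct.isBaseChange F N E
  rational x y := ⟨B x y, by
    simp [Algebra.algebraMap_eq_smul_one]⟩

end Cohomology

/-! ## Levi decompositions with an `F`-structure -/

section RationalDatum

variable {E V : Type*} [Field E] [AddCommGroup V] [Module E V]

/-- A decomposition `V = (X ⊕ Y) ⊕ V_0` with `dim_E X = k` as above, together with an `F`-form
`V_{0,F}` of the space `V_0`. -/
structure RationalDatum (F : Type*) [Field F] [Algebra F E] [Module F V] [IsScalarTower F E V]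
    (B : LinearMap.BilinForm E V) (k : ℕ) extends LeviDatum B k where
  M0F : Submodule F M0
  isFForm : IsFForm (B.restrict M0) M0F.subtype

/-- A decomposition with an `F`-form `V_{0,F}` as above, together with a complete polarization of
`V_{0,F}`. -/
structure PolarizedDatum (F : Type*) [Field F] [Algebra F E] [Module F V] [IsScalarTower F E V]
    (B : LinearMap.BilinForm E V) (k : ℕ) extends RationalDatum F B k where
  XF : Submodule F M0F
  YF : Submodule F M0F
  isotropic_XF : ∀ x ∈ XF, ∀ x' ∈ XF, B ((x : M0) : V) ((x' : M0) : V) = 0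
  isotropic_YF : ∀ y ∈ YF, ∀ y' ∈ YF, B ((y : M0) : V) ((y' : M0) : V) = 0
  isCompl_XF : IsCompl XF YF

variable {F : Type*} [Field F] [ValuativeRel F] [TopologicalSpace F] [IsNonarchimedeanLocalField F]
  [Algebra F E] [TopologicalSpace E] [Module F V] [IsScalarTower F E V]
  {B : LinearMap.BilinForm E V} {k : ℕ}

/-- The isometry group `O(V'_{0,F})` of the `F`-form of `V_0` attached to a cocycle, as a subgroup of
`O(V_0)`. -/
abbrev RationalDatum.formGroup (D : RationalDatum F B k) (ι : E ≃ₐ[F] E)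
    (g : Cocycle D.isFForm ι) : Subgroup (isomGroup (B.restrict D.M0)) :=
  rationalIsom (B.restrict D.M0) (twistedForm D.isFForm ι g)

/-- The systems of representatives of `H^1(E/F, O(V_0))` by cocycles. -/
abbrev RationalDatum.Reps (D : RationalDatum F B k) (ι : E ≃ₐ[F] E) : Type _ :=
  Representatives D.isFForm ι

/-- For a symmetric form: the representation
`⨁_{V'_{0,F}} Ind_Q(|det_X|_E^{s + k/2} ⊗ C_c^∞(O(V'_{0,F}) \ O(V_0)))`, where `Q` is the stabilizer
of `X` and the sum is over `H^1(E/F, O(V_0))`. -/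
def RationalDatum.orthRep (D : RationalDatum F B k) {ι : E ≃ₐ[F] E}
    (c : D.Reps ι) (s : ℂ) :
    Representation ℂ (isomGroup B) (⨁ x : H1 D.isFForm ι,
      unInd (twist (posPow (modulus B D.X F) (1 / 2))
        (inducingRep (F := F) D.toLeviDatum (D.formGroup ι (c.1 x)) (s + (k : ℂ) / 2)))) :=
  Representation.directSum fun x : H1 D.isFForm ι => normIndRep F B D.X
    (inducingRep (F := F) D.toLeviDatum (D.formGroup ι (c.1 x)) (s + (k : ℂ) / 2))

/-- For an alternating form: the representation
`Ind_P(|det_X|_E^{s + k/2} ⊗ C_c^∞(Sp(W_{0,F})^τ \ Sp(W_0)))`, where `P` is the stabilizer of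
`X`. -/
def PolarizedDatum.sympRep (D : PolarizedDatum F B k) (τ : E) (s : ℂ) :
    Representation ℂ (isomGroup B) (unInd (twist (posPow (modulus B D.X F) (1 / 2))
      (inducingRep (F := F) D.toLeviDatum (twistedIsom D.isFForm D.isCompl_XF τ) (s + (k : ℂ) / 2)))) :=
  normIndRep F B D.X
    (inducingRep (F := F) D.toLeviDatum (twistedIsom D.isFForm D.isCompl_XF τ) (s + (k : ℂ) / 2))

end RationalDatum

/-! ## The base change doubled spaces of the two cases -/

section Cases

variable {F : Type*} (E : Type*) {U : Type*} [Field F] [Field E] [Algebra F E] [AddCommGroup U]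
  [Module F U]

/-- The `E`-bilinear form on `U ⊗_F E` extending an `F`-bilinear form on `U`. -/
abbrev extForm (q : LinearMap.BilinForm F U) : LinearMap.BilinForm E (E ⊗[F] U) :=
  LinearMap.BilinForm.baseChange E q

variable (U) {E}

/-- The Lagrangian `τ V_F` of the `τ`-twisted doubled space of a quadratic space `V_F`. -/
def orthLagrangian (τ : E) : Submodule F (E ⊗[F] U) :=
  LinearMap.range (TensorProduct.mk F E U τ)

variable {U}

/-- The Lagrangian `X_F ⊕ τ Y_F` of the doubled space of a symplectic space
`W_F = X_F ⊕ Y_F`. -/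
def sympLagrangian (XF YF : Submodule F U) (τ : E) : Submodule F (E ⊗[F] U) :=
  XF.map (TensorProduct.mk F E U 1) ⊔ YF.map (TensorProduct.mk F E U τ)

end Cases

end BaseChangeDoubling

end

open BaseChangeDoubling

set_option linter.unusedSectionVars false
set_option linter.unusedSimpArgs false
set_option linter.style.haveILetI false

namespace BaseChangeDoubling

/-! ## Non-degenerate symmetric and alternating forms -/

/-- A non-degenerate `ε`-symmetric form, `ε = ±1`. -/
structure IsEps {K M : Type*} [Field K] [AddCommGroup M] [Module K M] (ε : ℤ)
    (B : LinearMap.BilinForm K M) : Prop where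
  eps : ε = 1 ∨ ε = -1
  swap : ∀ x y, B y x = (ε : K) * B x y
  sep : ∀ x, (∀ y, B x y = 0) → x = 0

section Algebra

variable {K M : Type*} [Field K] [AddCommGroup M] [Module K M] {ε : ℤ}
  {B : LinearMap.BilinForm K M}

theorem IsEps.sq (hB : IsEps ε B) : (ε : K) * ε = 1 := by
  rcases hB.eps with rfl | rfl <;> simp

theorem IsEps.isRefl (hB : IsEps ε B) : B.IsRefl := fun x y h => by rw [hB.swap x y, h, mul_zero]

theorem IsEps.comm_zero (hB : IsEps ε B) {x y : M} (h : B x y = 0) : B y x = 0 := hB.isRefl x y h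

theorem IsEps.sep' (hB : IsEps ε B) (x : M) (h : ∀ y, B y x = 0) : x = 0 :=
  hB.sep x fun y => hB.comm_zero (h y)

theorem IsEps.nondegenerate (hB : IsEps ε B) : B.Nondegenerate := ⟨hB.sep, hB.sep'⟩

theorem isom_smul_smul (g : isomGroup B) (a : K) (x : M) : g • (a • x) = a • (g • x) :=
  map_smul (g : M ≃ₗ[K] M) a x

/-- A linear endomorphism preserving a non-degenerate form is an isometry. -/
theorem exists_isom_of_preserving [FiniteDimensional K M] (hB : IsEps ε B) (f : M →ₗ[K] M)
    (hf : ∀ x y, B (f x) (f y) = B x y) : ∃ g : isomGroup B, ∀ x, g • x = f x := by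
  have hinj : Function.Injective f := by
    rw [← LinearMap.ker_eq_bot, LinearMap.ker_eq_bot']
    intro x hx
    refine hB.sep x fun y => ?_
    rw [← hf, hx, map_zero, LinearMap.zero_apply]
  exact ⟨⟨LinearEquiv.ofInjectiveEndo f hinj, fun x y => hf x y⟩, fun x => rfl⟩

namespace LeviDatum

variable {k : ℕ}

section
variable (D : LeviDatum B k)

/-- The pairing of `Y` with `X`, as a map from `Y` to the dual of `X`. -/
def dualY : D.Y →ₗ[K] Module.Dual K D.X := (B.flip.domRestrict₁₂ D.Y D.X)

theorem dualY_injective : Function.Injective D.dualY := by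
  rw [← LinearMap.ker_eq_bot, LinearMap.ker_eq_bot']
  intro y hy
  exact Subtype.ext (D.separating_Y y y.2 fun x hx => LinearMap.congr_fun hy ⟨x, hx⟩)

/-- The pairing of `X` with `Y`, as a map from `X` to the dual of `Y`. -/
def dualX : D.X →ₗ[K] Module.Dual K D.Y := (B.domRestrict₁₂ D.X D.Y)

theorem dualX_injective : Function.Injective D.dualX := by
  rw [← LinearMap.ker_eq_bot, LinearMap.ker_eq_bot']
  intro x hx
  exact Subtype.ext (D.separating_X x x.2 fun y hy => LinearMap.congr_fun hx ⟨y, hy⟩)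

end

variable [FiniteDimensional K M] (D : LeviDatum B k)

theorem finrank_Y : Module.finrank K D.Y = k := by
  have h1 := LinearMap.finrank_le_finrank_of_injective D.dualX_injective
  have h2 := LinearMap.finrank_le_finrank_of_injective D.dualY_injective
  rw [Subspace.dual_finrank_eq] at h1 h2
  have := D.finrank_X
  omega

/-- The identification of `Y` with the dual of `X`. -/
noncomputable def equivY : D.Y ≃ₗ[K] Module.Dual K D.X :=
  LinearEquiv.ofInjectiveOfFinrankEq D.dualY D.dualY_injective (by
    rw [Subspace.dual_finrank_eq, D.finrank_X, D.finrank_Y])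

/-- The identification of `X` with the dual of `Y`. -/
noncomputable def equivX : D.X ≃ₗ[K] Module.Dual K D.Y :=
  LinearEquiv.ofInjectiveOfFinrankEq D.dualX D.dualX_injective (by
    rw [Subspace.dual_finrank_eq, D.finrank_X, D.finrank_Y])

@[simp] theorem equivY_apply (y : D.Y) (x : D.X) : D.equivY y x = B (x : M) (y : M) := rfl

/-- The projection to `Y` along `X ⊕ M0`. -/
noncomputable def projY : M →ₗ[K] D.Y :=
  (D.equivY.symm : Module.Dual K D.X →ₗ[K] D.Y) ∘ₗ (D.X.subtype.dualMap ∘ₗ B.flip)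

theorem form_projY (x : D.X) (m : M) : B (x : M) (D.projY m : M) = B (x : M) m := by
  have h : D.equivY (D.projY m) = (D.X.subtype.dualMap ∘ₗ B.flip) m :=
    D.equivY.apply_symm_apply _
  exact LinearMap.congr_fun h x

/-- The projection to `X` along `Y ⊕ M0`. -/
noncomputable def projX (ε : ℤ) : M →ₗ[K] D.X :=
  (ε : K) • ((D.equivX.symm : Module.Dual K D.Y →ₗ[K] D.X) ∘ₗ (D.Y.subtype.dualMap ∘ₗ B.flip))

theorem projX_form (hB : IsEps ε B) (m : M) (y : D.Y) :
    B (D.projX ε m : M) (y : M) = B m (y : M) := by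
  have h : D.equivX (D.projX ε m) = (ε : K) • (D.Y.subtype.dualMap ∘ₗ B.flip) m := by
    unfold projX
    rw [LinearMap.smul_apply, map_smul]
    congr 1
    exact D.equivX.apply_symm_apply _
  have h2 := LinearMap.congr_fun h y
  change B (D.projX ε m : M) (y : M) = (ε : K) * B (y : M) m at h2
  rw [h2, hB.swap m y, ← mul_assoc, hB.sq, one_mul]

theorem mem_M0_iff (v : M) :
    v ∈ D.M0 ↔ (∀ x ∈ D.X, B x v = 0) ∧ ∀ y ∈ D.Y, B v y = 0 := by
  constructor
  · intro hv
    exact ⟨fun x hx => (D.orthogonal x (Submodule.mem_sup_left hx) v hv).1,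
      fun y hy => (D.orthogonal y (Submodule.mem_sup_right hy) v hv).2⟩
  · rintro ⟨h1, h2⟩
    have hv : v ∈ D.M0 ⊔ (D.X ⊔ D.Y) := by rw [D.isCompl.sup_eq_top]; trivial
    obtain ⟨w, hw, u, hu, e⟩ := Submodule.mem_sup.1 hv
    obtain ⟨x, hx, y, hy, e'⟩ := Submodule.mem_sup.1 hu
    have hy0 : y = 0 := D.separating_Y y hy fun x' hx' => by
      have := h1 x' hx'
      rw [← e, ← e', map_add, map_add, (D.orthogonal x' (Submodule.mem_sup_left hx') w hw).1,
        D.isotropic_X x' hx' x hx] at this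
      simpa using this
    have hx0 : x = 0 := D.separating_X x hx fun y' hy' => by
      have := h2 y' hy'
      rw [← e, ← e', hy0, add_zero, map_add, LinearMap.add_apply,
        (D.orthogonal y' (Submodule.mem_sup_right hy') w hw).2] at this
      simpa using this
    rw [← e, ← e', hx0, hy0]
    simpa using hw

theorem decomp (hB : IsEps ε B) (m : M) :
    (D.proj m : M) + D.projX ε m + D.projY m = m := by
  have hmem : m - D.projX ε m - D.projY m ∈ D.M0 := by
    rw [D.mem_M0_iff]
    refine ⟨fun x hx => ?_, fun y hy => ?_⟩
    · rw [map_sub, map_sub, D.isotropic_X x hx _ (D.projX ε m).2, D.form_projY ⟨x, hx⟩ m]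
      simp
    · rw [map_sub, map_sub, LinearMap.sub_apply, LinearMap.sub_apply,
        D.isotropic_Y _ (D.projY m).2 y hy, D.projX_form hB m ⟨y, hy⟩]
      simp
  have h1 : D.proj (m - D.projX ε m - D.projY m) = ⟨_, hmem⟩ := D.proj_coe ⟨_, hmem⟩
  have h2 : D.proj (D.projY m : M) = 0 :=
    (Submodule.projectionOnto_apply_eq_zero_iff D.isCompl).2
      (Submodule.mem_sup_right (D.projY m).2)
  rw [map_sub, map_sub, h2, D.proj_of_mem (D.projX ε m).2, sub_zero, sub_zero] at h1
  have h3 : (D.proj m : M) = m - D.projX ε m - D.projY m := congrArg Subtype.val h1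
  rw [h3]
  abel

theorem form_decomp (hB : IsEps ε B) (m m' : M) :
    B m m' = B (D.proj m : M) (D.proj m' : M) + B (D.projX ε m : M) (D.projY m' : M)
      + (ε : K) * B (D.projX ε m' : M) (D.projY m : M) := by
  conv_lhs => rw [← D.decomp hB m, ← D.decomp hB m']
  have e1 : ∀ (v : D.M0) (x : D.X), B (v : M) (x : M) = 0 := fun v x =>
    (D.orthogonal _ (Submodule.mem_sup_left x.2) v v.2).2
  have e2 : ∀ (v : D.M0) (x : D.X), B (x : M) (v : M) = 0 := fun v x =>
    (D.orthogonal _ (Submodule.mem_sup_left x.2) v v.2).1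
  have e3 : ∀ (v : D.M0) (x : D.Y), B (v : M) (x : M) = 0 := fun v x =>
    (D.orthogonal _ (Submodule.mem_sup_right x.2) v v.2).2
  have e4 : ∀ (v : D.M0) (x : D.Y), B (x : M) (v : M) = 0 := fun v x =>
    (D.orthogonal _ (Submodule.mem_sup_right x.2) v v.2).1
  have e5 : ∀ (x x' : D.X), B (x : M) (x' : M) = 0 := fun x x' => D.isotropic_X _ x.2 _ x'.2
  have e6 : ∀ (x x' : D.Y), B (x : M) (x' : M) = 0 := fun x x' => D.isotropic_Y _ x.2 _ x'.2
  simp only [map_add, LinearMap.add_apply, e1, e2, e3, e4, e5, e6, add_zero, zero_add]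
  rw [hB.swap (D.projX ε m' : M) (D.projY m : M)]
  ring

theorem projY_of_mem_X (x : D.X) : D.projY (x : M) = 0 :=
  Subtype.ext (D.separating_Y _ (D.projY _).2 fun x' hx' => by
    rw [D.form_projY ⟨x', hx'⟩, D.isotropic_X x' hx' _ x.2])

theorem projY_of_mem_M0 (v : D.M0) : D.projY (v : M) = 0 :=
  Subtype.ext (D.separating_Y _ (D.projY _).2 fun x' hx' => by
    rw [D.form_projY ⟨x', hx'⟩, (D.orthogonal x' (Submodule.mem_sup_left hx') _ v.2).1])

theorem projY_coe (y : D.Y) : D.projY (y : M) = y := by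
  apply D.equivY.injective
  ext x
  simp [D.form_projY]

theorem projX_of_mem_Y (hB : IsEps ε B) (y : D.Y) : D.projX ε (y : M) = 0 :=
  Subtype.ext (D.separating_X _ (D.projX ε _).2 fun y' hy' => by
    rw [D.projX_form hB _ ⟨y', hy'⟩, D.isotropic_Y _ y.2 y' hy'])

theorem projX_of_mem_M0 (hB : IsEps ε B) (v : D.M0) : D.projX ε (v : M) = 0 :=
  Subtype.ext (D.separating_X _ (D.projX ε _).2 fun y' hy' => by
    rw [D.projX_form hB _ ⟨y', hy'⟩, (D.orthogonal y' (Submodule.mem_sup_right hy') _ v.2).2])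

theorem projX_coe (hB : IsEps ε B) (x : D.X) : D.projX ε (x : M) = x := by
  apply D.equivX.injective
  ext y
  exact D.projX_form hB _ y

theorem proj_of_mem_Y (y : D.Y) : D.proj (y : M) = 0 :=
  (Submodule.projectionOnto_apply_eq_zero_iff D.isCompl).2 (Submodule.mem_sup_right y.2)

/-- An isomorphism `X ≃ X'` and an isometry `M0 ≃ M0'` extend to an isometry of `M` which maps `Y`
to `Y'`. -/
theorem exists_extend (hB : IsEps ε B) (D D' : LeviDatum B k) (a : D.X ≃ₗ[K] D'.X)
    (e : D.M0 →ₗ[K] D'.M0) (he : ∀ v w, B (e v : M) (e w : M) = B (v : M) (w : M)) :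
    ∃ g : isomGroup B, (∀ x : D.X, g • (x : M) = a x) ∧ (∀ v : D.M0, g • (v : M) = e v) ∧
      ∀ y : D.Y, g • (y : M) ∈ D'.Y ∧
        ∀ x : D.X, B (a x : M) (g • (y : M)) = B (x : M) (y : M) := by
  let c : D.Y →ₗ[K] D'.Y := (D'.equivY.symm : _ →ₗ[K] _) ∘ₗ
    ((a.symm : D'.X →ₗ[K] D.X).dualMap ∘ₗ (D.equivY : D.Y →ₗ[K] _))
  have hc : ∀ (x : D.X) (y : D.Y), B (a x : M) (c y : M) = B (x : M) (y : M) := by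
    intro x y
    have h : D'.equivY (c y) = (a.symm : D'.X →ₗ[K] D.X).dualMap (D.equivY y) :=
      D'.equivY.apply_symm_apply _
    have h2 := LinearMap.congr_fun h (a x)
    simpa using h2
  let f : M →ₗ[K] M := D'.M0.subtype ∘ₗ e ∘ₗ D.proj +
    D'.X.subtype ∘ₗ (a : D.X →ₗ[K] D'.X) ∘ₗ D.projX ε + D'.Y.subtype ∘ₗ c ∘ₗ D.projY
  have hf : ∀ m, f m = (e (D.proj m) : M) + (a (D.projX ε m) : M) + (c (D.projY m) : M) :=
    fun m => rfl
  have p1 : ∀ m, D'.proj (f m) = e (D.proj m) := fun m => by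
    rw [hf, map_add, map_add, D'.proj_coe, D'.proj_of_mem_Y, D'.proj_of_mem (a _).2, add_zero,
      add_zero]
  have p2 : ∀ m, D'.projX ε (f m) = a (D.projX ε m) := fun m => by
    rw [hf, map_add, map_add, D'.projX_coe hB, D'.projX_of_mem_Y hB, D'.projX_of_mem_M0 hB,
      add_zero, zero_add]
  have p3 : ∀ m, D'.projY (f m) = c (D.projY m) := fun m => by
    rw [hf, map_add, map_add, D'.projY_coe, D'.projY_of_mem_X, D'.projY_of_mem_M0,
      add_zero, zero_add]
  obtain ⟨g, hg⟩ := exists_isom_of_preserving hB f (fun m m' => by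
    rw [D'.form_decomp hB (f m), D.form_decomp hB m, p1, p1, p2, p2, p3, p3, he, hc, hc])
  refine ⟨g, fun x => ?_, fun v => ?_, fun y => ?_⟩
  · rw [hg, hf, D.proj_of_mem x.2, D.projX_coe hB, D.projY_of_mem_X]
    simp
  · rw [hg, hf, D.proj_coe, D.projX_of_mem_M0 hB, D.projY_of_mem_M0]
    simp
  · have : g • (y : M) = c y := by
      rw [hg, hf, D.proj_of_mem_Y, D.projX_of_mem_Y hB, D.projY_coe]
      simp
    rw [this]
    exact ⟨(c y).2, fun x => hc x y⟩

end LeviDatum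

/-- Isotropic subspaces in duality with each other give a decomposition. -/
def LeviDatum.ofDual [FiniteDimensional K M] (hB : IsEps ε B) (X Y : Submodule K M)
    (hX : ∀ x ∈ X, ∀ x' ∈ X, B x x' = 0) (hY : ∀ y ∈ Y, ∀ y' ∈ Y, B y y' = 0)
    (sX : ∀ x ∈ X, (∀ y ∈ Y, B x y = 0) → x = 0) (sY : ∀ y ∈ Y, (∀ x ∈ X, B x y = 0) → y = 0) :
    LeviDatum B (Module.finrank K X) where
  X := X
  Y := Y
  M0 := B.orthogonal (X ⊔ Y)
  finrank_X := rfl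
  isotropic_X := hX
  isotropic_Y := hY
  separating_X := sX
  separating_Y := sY
  orthogonal := fun u hu v hv => ⟨hv u hu, hB.comm_zero (hv u hu)⟩
  isCompl := by
    refine ((LinearMap.BilinForm.isCompl_orthogonal_iff_disjoint hB.isRefl).2 ?_).symm
    rw [Submodule.disjoint_def]
    intro u hu hu'
    obtain ⟨x, hx, y, hy, rfl⟩ := Submodule.mem_sup.1 hu
    have hx0 : x = 0 := sX x hx fun y' hy' => hB.comm_zero (by
      have : B y' (x + y) = 0 := hu' y' (Submodule.mem_sup_right hy')
      rw [map_add, hY y' hy' y hy, add_zero] at this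
      exact this)
    have hy0 : y = 0 := sY y hy fun x' hx' => by
      have : B x' (x + y) = 0 := hu' x' (Submodule.mem_sup_left hx')
      rwa [map_add, hX x' hx' x hx, zero_add] at this
    rw [hx0, hy0, add_zero]

variable [FiniteDimensional K M]

theorem exists_forall_form_eq (hB : IsEps ε B) {X : Submodule K M} (f : Module.Dual K X) :
    ∃ y : M, ∀ x : X, B (x : M) y = f x := by
  obtain ⟨f', hf'⟩ := LinearMap.exists_extend f
  refine ⟨(B.flip.toDual hB.nondegenerate.flip).symm f', fun x => ?_⟩
  have := LinearMap.BilinForm.apply_toDual_symm_apply (hB := hB.nondegenerate.flip) f' (x : M)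
  rw [LinearMap.BilinForm.flip_apply] at this
  rw [this, ← hf']
  rfl

/-- Every isotropic subspace is part of a decomposition. -/
theorem exists_leviDatum [CharZero K] (hB : IsEps ε B) (X : Submodule K M)
    (hX : ∀ x ∈ X, ∀ x' ∈ X, B x x' = 0) :
    ∃ D : LeviDatum B (Module.finrank K X), D.X = X := by
  classical
  let b := Module.finBasis K X
  choose y hy using fun i => exists_forall_form_eq hB (b.coord i)
  have hy1 : ∀ i j, B (b i : M) (y j) = if i = j then 1 else 0 := fun i j => by
    rw [hy, Module.Basis.coord_apply, Module.Basis.repr_self, Finsupp.single_apply]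
  have hy2 : ∀ i j, B (y j) (b i : M) = if i = j then (ε : K) else 0 := fun i j => by
    rw [hB.swap (b i : M), hy1, mul_ite, mul_one, mul_zero]
  let y' : Fin (Module.finrank K X) → M := fun j =>
    y j - (2⁻¹ : K) • ∑ i, B (y j) (y i) • (b i : M)
  have hb0 : ∀ i j, B (b i : M) (b j : M) = 0 := fun i j => hX _ (b i).2 _ (b j).2
  have h1 : ∀ i j, B (b i : M) (y' j) = if i = j then 1 else 0 := fun i j => by
    simp [y', hy1, hb0]
  have h2 : ∀ i j, B (y' i) (y' j) = 0 := fun i j => by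
    have e1 : B (y' i) (y' j) = B (y i) (y j) - 2⁻¹ * ∑ l, B (y j) (y l) * B (y i) (b l : M)
        - 2⁻¹ * ∑ l, B (y i) (y l) * B (b l : M) (y' j) := by
      simp [y']
    rw [e1]
    simp only [hy2, h1, mul_ite, mul_one, mul_zero, Finset.sum_ite_eq', Finset.mem_univ, if_true]
    rw [hB.swap (y i) (y j), mul_right_comm, hB.sq]
    ring
  have hspan : ∀ z ∈ Submodule.span K (Set.range y'), ∃ c : Fin (Module.finrank K X) → K,
      z = ∑ i, c i • y' i := fun z hz => by
    obtain ⟨c, hc⟩ := (Submodule.mem_span_range_iff_exists_fun K).1 hz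
    exact ⟨c, hc.symm⟩
  refine ⟨LeviDatum.ofDual hB X (Submodule.span K (Set.range y')) hX ?_ ?_ ?_, rfl⟩
  · intro z hz z' hz'
    obtain ⟨c, rfl⟩ := hspan z hz
    obtain ⟨c', rfl⟩ := hspan z' hz'
    simp [h2]
  · intro x hx hxy
    have : (⟨x, hx⟩ : X) = 0 := by
      apply b.ext_elem
      intro i
      have h3 := hxy (y' i) (Submodule.subset_span ⟨i, rfl⟩)
      have h4 : B ((∑ j, b.repr ⟨x, hx⟩ j • b j : X) : M) (y' i) = b.repr ⟨x, hx⟩ i := by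
        rw [Submodule.coe_sum, map_sum, LinearMap.sum_apply]
        simp [h1]
      rw [b.sum_repr] at h4
      rw [← h4]
      simpa using h3
    simpa using congrArg Subtype.val this
  · intro z hz hxz
    obtain ⟨c, rfl⟩ := hspan z hz
    have : ∀ i, c i = 0 := fun i => by
      have := hxz (b i : M) (b i).2
      simpa [h1] using this
    simp [this]

/-- Exchanging `X` and `Y`. -/
def LeviDatum.swap {k : ℕ} (D : LeviDatum B k) (hB : IsEps ε B) : LeviDatum B k where
  X := D.Y
  Y := D.X
  M0 := D.M0
  finrank_X := D.finrank_Y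
  isotropic_X := D.isotropic_Y
  isotropic_Y := D.isotropic_X
  separating_X := fun y hy h => D.separating_Y y hy fun x hx => hB.comm_zero (h x hx)
  separating_Y := fun x hx h => D.separating_X x hx fun y hy => hB.comm_zero (h y hy)
  orthogonal := fun u hu v hv => D.orthogonal u (sup_comm D.Y D.X ▸ hu) v hv
  isCompl := sup_comm D.X D.Y ▸ D.isCompl

/-- The image of a subspace under an isometry. -/
def moveBy (g : isomGroup B) (X : Submodule K M) : Submodule K M :=
  X.map ((g : M ≃ₗ[K] M) : M →ₗ[K] M)

theorem coe_moveBy (g : isomGroup B) (X : Submodule K M) : (moveBy g X : Set M) = g • (X : Set M) :=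
  rfl

theorem finrank_moveBy (g : isomGroup B) (X : Submodule K M) :
    Module.finrank K (moveBy g X) = Module.finrank K X :=
  (LinearEquiv.finrank_eq ((g : M ≃ₗ[K] M).submoduleMap X)).symm

theorem smul_coe_eq_of_forall {g : isomGroup B} {X X' : Submodule K M}
    (h : ∀ x ∈ X, g • x ∈ X') (hd : Module.finrank K X' ≤ Module.finrank K X) :
    g • (X : Set M) = X' := by
  have hle : moveBy g X ≤ X' := by
    rintro _ ⟨x, hx, rfl⟩
    exact h x hx
  rw [← coe_moveBy, Submodule.eq_of_le_of_finrank_le hle (by rwa [finrank_moveBy])]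

/-- Isotropic subspaces of the same dimension are conjugate under the isometry group. -/
theorem exists_smul_eq_of_isotropic [CharZero K] (hB : IsEps ε B) {X X' : Submodule K M}
    (hX : ∀ x ∈ X, ∀ x' ∈ X, B x x' = 0) (hX' : ∀ x ∈ X', ∀ x' ∈ X', B x x' = 0)
    (hd : Module.finrank K X = Module.finrank K X') :
    ∃ g : isomGroup B, g • (X : Set M) = X' := by
  set R := X ⊓ B.orthogonal X' with hR
  set R' := X' ⊓ B.orthogonal X with hR'
  obtain ⟨A0, hA0⟩ := Submodule.exists_isCompl (R.submoduleOf X)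
  obtain ⟨A0', hA0'⟩ := Submodule.exists_isCompl (R'.submoduleOf X')
  have key : ∀ (X R : Submodule K M) (A0 : Submodule K X), R ≤ X → IsCompl (R.submoduleOf X) A0 →
      A0.map X.subtype ≤ X ∧ (∀ x ∈ X, ∃ r ∈ R, ∃ a ∈ A0.map X.subtype, x = r + a) ∧
        ∀ x ∈ R, x ∈ A0.map X.subtype → x = 0 := by
    intro X R A0 hRX h
    refine ⟨Submodule.map_subtype_le X A0, fun x hx => ?_, ?_⟩
    · have : (⟨x, hx⟩ : X) ∈ R.submoduleOf X ⊔ A0 := by rw [h.sup_eq_top]; trivial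
      obtain ⟨r, hr, a, ha, e⟩ := Submodule.mem_sup.1 this
      exact ⟨r, hr, a, ⟨a, ha, rfl⟩, (congrArg Subtype.val e).symm⟩
    · rintro x hx ⟨a, ha, rfl⟩
      have := (Submodule.disjoint_def.1 h.disjoint) a hx ha
      simp [this]
  obtain ⟨hA, hAs, hAd⟩ := key X R A0 inf_le_left hA0
  obtain ⟨hA', hAs', hAd'⟩ := key X' R' A0' inf_le_left hA0'
  set A := A0.map X.subtype
  set A' := A0'.map X'.subtype
  have hRo : ∀ x ∈ R, ∀ y ∈ X', B x y = 0 := fun x hx y hy => hB.comm_zero (hx.2 y hy)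
  have hRo' : ∀ x ∈ R', ∀ y ∈ X, B x y = 0 := fun x hx y hy => hB.comm_zero (hx.2 y hy)
  have s1 : ∀ x ∈ A, (∀ y ∈ A', B x y = 0) → x = 0 := fun x hx h =>
    hAd x ⟨hA hx, fun y hy => by
      obtain ⟨r, hr, a, ha, rfl⟩ := hAs' y hy
      refine hB.comm_zero ?_
      rw [map_add, h a ha, hB.comm_zero (hRo' r hr x (hA hx)), add_zero]⟩ hx
  have s2 : ∀ y ∈ A', (∀ x ∈ A, B x y = 0) → y = 0 := fun y hy h =>
    hAd' y ⟨hA' hy, fun x hx => by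
      obtain ⟨r, hr, a, ha, rfl⟩ := hAs x hx
      change B (r + a) y = 0
      rw [map_add, LinearMap.add_apply, h a ha, hRo r hr y (hA' hy), add_zero]⟩ hy
  let D := LeviDatum.ofDual hB A A' (fun x hx y hy => hX x (hA hx) y (hA hy))
    (fun x hx y hy => hX' x (hA' hx) y (hA' hy)) s1 s2
  have hDY : Module.finrank K D.X = Module.finrank K (D.swap hB).X := by
    rw [D.finrank_X, (D.swap hB).finrank_X]
  obtain ⟨g, hg1, hg2, -⟩ := LeviDatum.exists_extend hB D (D.swap hB)
    (LinearEquiv.ofFinrankEq _ _ hDY) LinearMap.id (fun _ _ => rfl)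
  have hRM : ∀ x ∈ R, x ∈ D.M0 := fun x hx => (D.mem_M0_iff x).2
    ⟨fun a ha => hX a (hA ha) x hx.1, fun a ha => hRo x hx a (hA' ha)⟩
  have hgX : ∀ x ∈ X, g • x ∈ R ⊔ A' := by
    intro x hx
    obtain ⟨r, hr, a, ha, rfl⟩ := hAs x hx
    rw [smul_add]
    refine Submodule.add_mem_sup ?_ ?_
    · have := hg2 ⟨r, hRM r hr⟩
      exact this ▸ hr
    · have := hg1 ⟨a, ha⟩
      exact this ▸ Subtype.mem _
  have hX1 : ∀ x ∈ moveBy g X, x ∈ R ⊔ A' := by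
    rintro _ ⟨x, hx, rfl⟩
    exact hgX x hx
  have iso : ∀ x ∈ moveBy g X ⊔ X', ∀ y ∈ moveBy g X ⊔ X', B x y = 0 := by
    have e : moveBy g X ⊔ X' ≤ R ⊔ X' := sup_le
      (le_trans hX1 (sup_le_sup_left hA' R)) le_sup_right
    intro x hx y hy
    obtain ⟨r, hr, a, ha, rfl⟩ := Submodule.mem_sup.1 (e hx)
    obtain ⟨r', hr', a', ha', rfl⟩ := Submodule.mem_sup.1 (e hy)
    rw [map_add, map_add, LinearMap.add_apply, LinearMap.add_apply, hX r hr.1 r' hr'.1,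
      hX' a ha a' ha', hRo r hr a' ha', hB.comm_zero (hRo r' hr' a ha)]
    simp
  obtain ⟨D2, hD2⟩ := exists_leviDatum hB (moveBy g X ⊔ X') iso
  have hd2 : Module.finrank K (moveBy g X) = Module.finrank K X' := by rw [finrank_moveBy, hd]
  have h1 : moveBy g X ≤ D2.X := by rw [hD2]; exact le_sup_left
  have h2 : X' ≤ D2.X := by rw [hD2]; exact le_sup_right
  obtain ⟨a, ha⟩ := Submodule.exists_linearEquiv_restrict_eq
    (((Submodule.submoduleOfEquivOfLe h1).trans (LinearEquiv.ofFinrankEq _ _ hd2)).trans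
      (Submodule.submoduleOfEquivOfLe h2).symm)
  obtain ⟨g', hg', -⟩ := LeviDatum.exists_extend hB D2 D2 a LinearMap.id (fun _ _ => rfl)
  refine ⟨g' * g, smul_coe_eq_of_forall (fun x hx => ?_) hd.ge⟩
  have hx1 : g • x ∈ moveBy g X := ⟨x, hx, rfl⟩
  rw [mul_smul, hg' ⟨g • x, h1 hx1⟩, ← ha ⟨⟨g • x, h1 hx1⟩, hx1⟩]
  exact Subtype.mem _

end Algebra

/-! ## The modulus character -/

section SkewMatrices

open Matrix

variable {K : Type*} [Field K] {k : ℕ}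

/-- The matrices with `Sᵀ = -ε S`. -/
def skewMatrices (K : Type*) [Field K] (ε : ℤ) (k : ℕ) :
    Submodule K (Matrix (Fin k) (Fin k) K) where
  carrier := {S | ∀ i j, S j i = -(ε : K) * S i j}
  zero_mem' := by simp
  add_mem' := by
    intro S T hS hT i j
    rw [Matrix.add_apply, Matrix.add_apply, hS i j, hT i j]
    ring
  smul_mem' := by
    intro c S hS i j
    rw [Matrix.smul_apply, Matrix.smul_apply, hS i j, smul_eq_mul, smul_eq_mul]
    ring

theorem mem_skewMatrices_iff {ε : ℤ} {S : Matrix (Fin k) (Fin k) K} :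
    S ∈ skewMatrices K ε k ↔ Sᵀ = -(ε : K) • S := by
  rw [← Matrix.ext_iff]
  rfl

/-- The action `S ↦ A S Aᵀ` on the matrices with `Sᵀ = -ε S`. -/
def congrSkew (K : Type*) [Field K] (ε : ℤ) (k : ℕ) :
    Matrix (Fin k) (Fin k) K →* Module.End K (skewMatrices K ε k) where
  toFun A :=
    { toFun := fun S => ⟨A * S.1 * Aᵀ, by
        have h := mem_skewMatrices_iff.1 S.2
        rw [mem_skewMatrices_iff, transpose_mul, transpose_mul, transpose_transpose, h]
        simp [Matrix.mul_assoc]⟩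
      map_add' := fun S T => Subtype.ext (by simp [Matrix.mul_add, Matrix.add_mul])
      map_smul' := fun c S => Subtype.ext (by simp) }
  map_one' := by ext; simp
  map_mul' A A' := by
    refine LinearMap.ext fun S => Subtype.ext ?_
    simp [Matrix.mul_assoc]

/-- The pairs `i < j`, together with the pairs `i = j` for `ε = -1`. -/
abbrev SkewIndex (ε : ℤ) (k : ℕ) : Type := {p : Fin k × Fin k // p.1 < p.2 ∨ (ε = -1 ∧ p.1 = p.2)}

/-- The coordinates of a matrix with `Sᵀ = -ε S`. -/
def skewCoord [CharZero K] (ε : ℤ) (hε : ε = 1 ∨ ε = -1) (k : ℕ) :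
    skewMatrices K ε k ≃ₗ[K] (SkewIndex ε k → K) where
  toFun S p := S.1 p.1.1 p.1.2
  map_add' _ _ := rfl
  map_smul' _ _ := rfl
  invFun c := ⟨fun i j => if h : i < j ∨ (ε = -1 ∧ i = j) then c ⟨(i, j), h⟩ else
      if h : j < i then -(ε : K) * c ⟨(j, i), Or.inl h⟩ else 0, by
    intro i j
    rcases lt_trichotomy i j with h | h | h
    · have h2 : ¬ (j < i ∨ ε = -1 ∧ j = i) := by
        rintro (h' | ⟨_, h'⟩)
        · exact absurd h h'.asymm
        · exact h.ne h'.symm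
      simp [h, h2]
    · subst h
      rcases hε with rfl | rfl <;> simp
    · have h2 : ¬ (i < j ∨ ε = -1 ∧ i = j) := by
        rintro (h' | ⟨_, h'⟩)
        · exact absurd h h'.asymm
        · exact h.ne h'.symm
      have : (ε : K) * ε = 1 := by rcases hε with rfl | rfl <;> simp
      simp [h, h2, ← mul_assoc, this]⟩
  left_inv S := by
    refine Subtype.ext (Matrix.ext fun i j => ?_)
    change (if h : i < j ∨ (ε = -1 ∧ i = j) then S.1 i j else
      if h : j < i then -(ε : K) * S.1 j i else 0) = S.1 i j
    split_ifs with h1 h2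
    · rfl
    · exact (S.2 j i).symm
    · have hij : i = j := by
        push Not at h1
        exact le_antisymm (not_lt.1 h2) h1.1
      subst hij
      have h3 : ε = 1 := hε.resolve_right fun h => h1 (Or.inr ⟨h, rfl⟩)
      have h4 := S.2 i i
      have h5 : (ε : K) = 1 := by rw [h3, Int.cast_one]
      have : (2 : K) * S.1 i i = 0 := by linear_combination h4 + (-S.1 i i) * h5
      exact ((mul_eq_zero.1 this).resolve_left two_ne_zero).symm
  right_inv c := by
    funext p
    change (if h : p.1.1 < p.1.2 ∨ (ε = -1 ∧ p.1.1 = p.1.2) then c ⟨p.1, h⟩ else _) = c p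
    rw [dif_pos p.2]

theorem prod_skewIndex (ε : ℤ) (hε : ε = 1 ∨ ε = -1) (d : Fin k → K) (hd : ∏ i, d i ≠ 0) :
    ∏ p : SkewIndex ε k, d p.1.1 * d p.1.2 = (∏ i, d i) ^ ((k : ℤ) - ε) := by
  have hlt : (∏ p ∈ (Finset.univ : Finset (Fin k × Fin k)).filter (fun p => p.1 < p.2),
      d p.1 * d p.2) * ∏ i, d i = (∏ i, d i) ^ k := by
    have e1 : ∏ p ∈ (Finset.univ : Finset (Fin k × Fin k)).filter (fun p => p.1 < p.2), d p.2 =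
        ∏ p ∈ (Finset.univ : Finset (Fin k × Fin k)).filter (fun p => p.2 < p.1), d p.1 := by
      refine Finset.prod_nbij' Prod.swap Prod.swap ?_ ?_ ?_ ?_ ?_ <;> simp
    have e2 : ∏ i, d i =
        ∏ p ∈ (Finset.univ : Finset (Fin k × Fin k)).filter (fun p => p.1 = p.2), d p.1 := by
      refine Finset.prod_nbij' (fun i => (i, i)) Prod.fst ?_ ?_ ?_ ?_ ?_ <;> simp +contextual
    have e3 : ∏ p : Fin k × Fin k, d p.1 = (∏ i, d i) ^ k := by
      rw [Fintype.prod_prod_type]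
      simp [Finset.prod_pow]
    rw [Finset.prod_mul_distrib, e1, ← e3]
    nth_rw 1 [e2]
    rw [← Finset.prod_filter_mul_prod_filter_not Finset.univ (fun p : Fin k × Fin k => p.1 < p.2),
      mul_assoc]
    congr 1
    rw [← Finset.prod_filter_mul_prod_filter_not
      (Finset.univ.filter fun p : Fin k × Fin k => ¬ p.1 < p.2) (fun p => p.2 < p.1)]
    rw [Finset.filter_filter, Finset.filter_filter]
    congr 1
    · refine Finset.prod_congr (Finset.filter_congr fun p _ => ?_) fun _ _ => rfl
      constructor
      · intro h; exact ⟨h.not_gt, h⟩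
      · intro h; exact h.2
    · refine Finset.prod_congr (Finset.filter_congr fun p _ => ?_) fun _ _ => rfl
      constructor
      · intro h; rw [h]; simp
      · intro h; exact le_antisymm (not_lt.1 h.2) (not_lt.1 h.1)
  have hlt' : ∏ p ∈ (Finset.univ : Finset (Fin k × Fin k)).filter (fun p => p.1 < p.2),
      d p.1 * d p.2 = (∏ i, d i) ^ ((k : ℤ) - 1) := by
    rw [zpow_sub_one₀ hd, zpow_natCast, ← hlt, mul_assoc, mul_inv_cancel₀ hd, mul_one]
  have hsub : ∏ p : SkewIndex ε k, d p.1.1 * d p.1.2 =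
      ∏ p ∈ (Finset.univ : Finset (Fin k × Fin k)).filter
        (fun p => p.1 < p.2 ∨ (ε = -1 ∧ p.1 = p.2)), d p.1 * d p.2 :=
    (Finset.prod_subtype _ (by simp) (fun p : Fin k × Fin k => d p.1 * d p.2)).symm
  rw [hsub]
  rcases hε with rfl | rfl
  · simpa using hlt'
  · have e2 : ∏ p ∈ (Finset.univ : Finset (Fin k × Fin k)).filter (fun p => p.1 = p.2),
        d p.1 * d p.2 = (∏ i, d i) * ∏ i, d i := by
      rw [← Finset.prod_mul_distrib]
      symm
      refine Finset.prod_nbij' (fun i => (i, i)) Prod.fst ?_ ?_ ?_ ?_ ?_ <;> simp +contextual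
    have e3 : (Finset.univ : Finset (Fin k × Fin k)).filter
        (fun p => p.1 < p.2 ∨ ((-1 : ℤ) = -1 ∧ p.1 = p.2)) =
        (Finset.univ.filter (fun p => p.1 < p.2)) ∪ (Finset.univ.filter (fun p => p.1 = p.2)) := by
      ext p
      simp
    rw [e3, Finset.prod_union, e2, hlt', sub_neg_eq_add, zpow_sub_one₀ hd, zpow_add_one₀ hd]
    · field_simp
    · rw [Finset.disjoint_filter]
      intro p _ h h'
      exact h.ne h'

theorem det_congrSkew_diagonal [CharZero K] {ε : ℤ} (hε : ε = 1 ∨ ε = -1) (d : Fin k → K)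
    (hd : ∏ i, d i ≠ 0) :
    LinearMap.det (congrSkew K ε k (diagonal d)) = (∏ i, d i) ^ ((k : ℤ) - ε) := by
  rw [← prod_skewIndex ε hε d hd, ← LinearMap.det_conj _ (skewCoord ε hε k)]
  have h : ∀ p : SkewIndex ε k, d p.1.1 * d p.1.2 =
      (LinearMap.mulLeft K (d p.1.1 * d p.1.2)).det := fun p => (LinearMap.det_mulLeft _).symm
  rw [Finset.prod_congr rfl fun p _ => h p, ← LinearMap.det_pi]
  congr 1
  refine LinearMap.ext fun c => funext fun p => ?_
  obtain ⟨S, rfl⟩ := (skewCoord ε hε k).surjective c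
  have : (diagonal d * S.1 * (diagonal d)ᵀ) p.1.1 p.1.2 = d p.1.1 * d p.1.2 * S.1 p.1.1 p.1.2 := by
    rw [diagonal_transpose, mul_diagonal, diagonal_mul]
    ring
  simp only [LinearMap.comp_apply, LinearEquiv.coe_coe, LinearEquiv.symm_apply_apply]
  exact this

theorem det_congrSkew [CharZero K] {ε : ℤ} (hε : ε = 1 ∨ ε = -1) (A : Matrix (Fin k) (Fin k) K)
    (hA : A.det ≠ 0) :
    LinearMap.det (congrSkew K ε k A) = A.det ^ ((k : ℤ) - ε) := by
  refine Matrix.diagonal_transvection_induction_of_det_ne_zero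
    (fun A => LinearMap.det (congrSkew K ε k A) = A.det ^ ((k : ℤ) - ε)) A hA ?_ ?_ ?_
  · intro d hd
    rw [det_diagonal] at hd ⊢
    exact det_congrSkew_diagonal hε d hd
  · intro t
    rw [TransvectionStruct.det, _root_.one_zpow]
    obtain ⟨i, j, hij, c⟩ := t
    change LinearMap.det (congrSkew K ε k (transvection i j c)) = 1
    let d : Fin k → K := fun l => if l = i then 2 else 1
    have hd : ∏ l, d l ≠ 0 := Finset.prod_ne_zero_iff.2 fun l _ => by
      change (if l = i then (2 : K) else 1) ≠ 0
      split_ifs <;> simp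
    have hdet := det_congrSkew_diagonal (K := K) hε d hd
    have h0 : LinearMap.det (congrSkew K ε k (diagonal d)) ≠ 0 := by
      rw [hdet]
      exact zpow_ne_zero _ hd
    have h1 : diagonal d * transvection i j c =
        transvection i j c * transvection i j c * diagonal d := by
      rw [transvection_mul_transvection_same i j hij c c]
      ext a b
      rw [diagonal_mul, mul_diagonal]
      simp only [transvection, Matrix.add_apply, one_apply, Matrix.single_apply, d]
      by_cases h1 : a = i
      · by_cases h2 : b = j
        · subst h1 h2
          simp [hij, hij.symm]
          ring
        · have h2' : ¬ j = b := fun h => h2 h.symm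
          subst h1
          by_cases h3 : a = b
          · subst h3; simp [h2']
          · simp [h2', h3]
      · have h1' : ¬ i = a := fun h => h1 h.symm
        by_cases h3 : a = b
        · subst h3; simp [h1, h1']
        · simp [h1', h3]
    have h2 : transvection i j c * transvection i j (-c) = 1 := by
      rw [transvection_mul_transvection_same i j hij, add_neg_cancel, transvection_zero]
    have h3 : LinearMap.det (congrSkew K ε k (transvection i j c)) ≠ 0 := by
      intro h
      have := congrArg (fun M => LinearMap.det (congrSkew K ε k M)) h2
      simp [h] at this
    have h4 := congrArg (fun M => LinearMap.det (congrSkew K ε k M)) h1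
    simp only [map_mul] at h4
    have h5 := mul_right_cancel₀ h0 ((mul_comm _ _).trans h4)
    exact (mul_eq_left₀ h3).1 h5.symm
  · intro A A' _ _ h h'
    rw [map_mul, map_mul, h, h', det_mul, mul_zpow]

end SkewMatrices

section Determinants

variable {K M N X : Type*} [Field K] [AddCommGroup M] [Module K M] [AddCommGroup N] [Module K N]
  [AddCommGroup X] [Module K X] [FiniteDimensional K M] [FiniteDimensional K N]
  [FiniteDimensional K X] {ε : ℤ} {B : LinearMap.BilinForm K M}

/-- The endomorphism `f ↦ α ∘ f ∘ β` of `Hom(N, X)`. -/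
def homConj (α : Module.End K X) (β : Module.End K N) : Module.End K (N →ₗ[K] X) :=
  (LinearMap.llcomp K N X X α) ∘ₗ (LinearMap.lcomp K X β)

theorem homConj_apply (α : Module.End K X) (β : Module.End K N) (f : N →ₗ[K] X) :
    homConj α β f = α ∘ₗ f ∘ₗ β := rfl

theorem det_homConj (α : Module.End K X) (β : Module.End K N) :
    LinearMap.det (homConj α β) =
      LinearMap.det α ^ Module.finrank K N * LinearMap.det β ^ Module.finrank K X := by
  let bN := Module.finBasis K N
  let bX := Module.finBasis K X
  have h : homConj α β = homConj α (LinearMap.id (M := N)) * homConj (LinearMap.id (M := X)) β := rfl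
  rw [h, map_mul]
  congr 1
  · let e : (N →ₗ[K] X) ≃ₗ[K] (Fin (Module.finrank K N) → X) := bN.constr K |>.symm
    rw [← LinearMap.det_conj _ e]
    have : (e : (N →ₗ[K] X) →ₗ[K] _) ∘ₗ homConj α LinearMap.id ∘ₗ (e.symm : _ →ₗ[K] (N →ₗ[K] X)) =
        (LinearMap.pi (fun i => α.comp (LinearMap.proj i)) :
          (Fin (Module.finrank K N) → X) →ₗ[K] _) := by
      refine LinearMap.ext fun c => funext fun i => ?_
      obtain ⟨f, rfl⟩ := e.surjective c
      simp [homConj_apply, e, Module.Basis.constr]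
    rw [this, LinearMap.det_pi]
    simp
  · let e : (N →ₗ[K] X) ≃ₗ[K] (Fin (Module.finrank K X) → Fin (Module.finrank K N) → K) :=
      LinearMap.toMatrix bN bX
    rw [← LinearMap.det_conj _ e]
    have : (e : (N →ₗ[K] X) →ₗ[K] _) ∘ₗ homConj LinearMap.id β ∘ₗ
        (e.symm : _ →ₗ[K] (N →ₗ[K] X)) =
        (LinearMap.pi (fun i => (Matrix.toLin' (LinearMap.toMatrix bN bN β).transpose).comp
          (LinearMap.proj i)) : (Fin (Module.finrank K X) → Fin (Module.finrank K N) → K) →ₗ[K] _) := by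
      refine LinearMap.ext fun c => funext fun i => ?_
      obtain ⟨f, rfl⟩ := e.surjective c
      simp only [LinearMap.comp_apply, LinearEquiv.coe_coe, LinearEquiv.symm_apply_apply]
      rw [homConj_apply, LinearMap.id_comp]
      change LinearMap.toMatrix bN bX (f ∘ₗ β) i = _
      rw [LinearMap.toMatrix_comp bN bN bX]
      funext j
      simp [Matrix.mul_apply, Matrix.toLin'_apply, Matrix.mulVec, dotProduct, e, mul_comm]
      rfl
    refine (congrArg LinearMap.det this).trans ?_
    rw [LinearMap.det_pi]
    simp [LinearMap.det_toMatrix]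

theorem det_isom_sq (hB : IsEps ε B) (g : isomGroup B) :
    LinearMap.det ((g : M ≃ₗ[K] M) : M →ₗ[K] M) * LinearMap.det ((g : M ≃ₗ[K] M) : M →ₗ[K] M) =
      1 := by
  let e := B.toDual hB.nondegenerate
  have h : (e : M →ₗ[K] Module.Dual K M) ∘ₗ ((g⁻¹ : M ≃ₗ[K] M) : M →ₗ[K] M) ∘ₗ
      (e.symm : Module.Dual K M →ₗ[K] M) = ((g : M ≃ₗ[K] M) : M →ₗ[K] M).dualMap := by
    refine LinearMap.ext fun f => ?_
    obtain ⟨x, rfl⟩ := e.surjective f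
    refine LinearMap.ext fun y => ?_
    simp only [LinearMap.comp_apply, LinearEquiv.coe_coe, LinearEquiv.symm_apply_apply]
    exact isom_inv_apply g x y
  have h1 := congrArg LinearMap.det h
  rw [LinearMap.det_conj, LinearMap.det_dualMap] at h1
  nth_rw 1 [← h1]
  rw [← LinearMap.det_comp]
  have : ((g⁻¹ : M ≃ₗ[K] M) : M →ₗ[K] M) ∘ₗ ((g : M ≃ₗ[K] M) : M →ₗ[K] M) = LinearMap.id := by
    ext x
    exact (g : M ≃ₗ[K] M).symm_apply_apply x
  rw [this, LinearMap.det_id]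

end Determinants

namespace LeviDatum

variable {K M : Type*} [Field K] [AddCommGroup M] [Module K M] [FiniteDimensional K M] {ε : ℤ}
  {B : LinearMap.BilinForm K M} {k : ℕ}

theorem isEps_M0 (hB : IsEps ε B) (D : LeviDatum B k) : IsEps ε (B.restrict D.M0) where
  eps := hB.eps
  swap := fun x y => hB.swap x y
  sep := fun v hv => Subtype.ext (hB.sep v fun m => by
    rw [D.form_decomp hB, D.projX_of_mem_M0 hB, D.projY_of_mem_M0, D.proj_coe]
    simpa using hv (D.proj m))

theorem finrank_M0 (D : LeviDatum B k) :
    Module.finrank K D.M0 + 2 * k = Module.finrank K M := by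
  have h1 := Submodule.finrank_add_eq_of_isCompl D.isCompl
  have h2 := Submodule.finrank_sup_add_finrank_inf_eq D.X D.Y
  have h3 : D.X ⊓ D.Y = ⊥ := by
    rw [Submodule.eq_bot_iff]
    rintro x ⟨hx, hy⟩
    exact D.separating_X x hx fun y hy' => D.isotropic_Y x hy y hy'
  rw [h3, finrank_bot, D.finrank_X, D.finrank_Y] at h2
  omega

variable {ι : Type*} [Finite ι] (D : LeviDatum B k) (b : Module.Basis ι K D.X)

/-- The basis of `Y` dual to a basis of `X`. -/
noncomputable def dualVec (i : ι) : D.Y := D.equivY.symm (b.coord i)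

theorem form_dualVec [DecidableEq ι] (x : D.X) (i : ι) :
    B (x : M) (D.dualVec b i : M) = b.repr x i :=
  LinearMap.congr_fun (D.equivY.apply_symm_apply (b.coord i)) x

theorem projY_eq_sum [Fintype ι] [DecidableEq ι] (m : M) :
    D.projY m = ∑ i, B (b i : M) m • D.dualVec b i := by
  apply D.equivY.injective
  refine b.ext fun j => ?_
  rw [D.equivY_apply, D.form_projY, map_sum, LinearMap.sum_apply]
  simp [form_dualVec, Finsupp.single_apply]

/-- The action of the Lie algebra of the unipotent radical on `M0`. -/
def nilM0 : nilRadical B D.X →ₗ[K] (D.M0 →ₗ[K] D.X) where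
  toFun a := LinearMap.codRestrict D.X (a.1 ∘ₗ D.M0.subtype) (fun v => a.2.2.2 v
    fun x hx => (D.orthogonal x (Submodule.mem_sup_left hx) v v.2).1)
  map_add' _ _ := rfl
  map_smul' _ _ := rfl

theorem nilM0_apply (a : nilRadical B D.X) (v : D.M0) : (D.nilM0 a v : M) = a.1 v := rfl

theorem nilM0_adNil (p : stab B D.X) (a : nilRadical B D.X) :
    D.nilM0 (adNil B D.X p a) = homConj (restr B D.X p)
      ((D.leviEquiv p⁻¹ : D.M0 →ₗ[K] D.M0)) (D.nilM0 a) := by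
  refine LinearMap.ext fun v => Subtype.ext ?_
  change (p : isomGroup B) • a.1 (((p⁻¹ : stab B D.X) : isomGroup B) • (v : M)) =
    (p : isomGroup B) • a.1 (D.proj (((p⁻¹ : stab B D.X) : isomGroup B) • (v : M)) : M)
  have h := a.2.2.1 _ (D.smul_sub_proj_mem p⁻¹ v.2)
  rw [map_sub, sub_eq_zero] at h
  rw [h]

theorem nilM0_surjective (hB : IsEps ε B) : Function.Surjective D.nilM0 := by
  intro f
  let e := (B.restrict D.M0).toDual (D.isEps_M0 hB).nondegenerate
  let t : D.Y →ₗ[K] D.M0 := (e.symm : _ →ₗ[K] D.M0) ∘ₗ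
    ((D.X.subtype ∘ₗ f).dualMap ∘ₗ (B ∘ₗ D.Y.subtype))
  have ht : ∀ (y : D.Y) (v : D.M0), B (t y : M) (v : M) = B (y : M) (f v : M) := fun y v => by
    have h : e (t y) = (D.X.subtype ∘ₗ f).dualMap ((B ∘ₗ D.Y.subtype) y) := e.apply_symm_apply _
    exact LinearMap.congr_fun h v
  let a : Module.End K M := D.X.subtype ∘ₗ f ∘ₗ D.proj - D.M0.subtype ∘ₗ t ∘ₗ D.projY
  have ha : ∀ m, a m = (f (D.proj m) : M) - (t (D.projY m) : M) := fun m => rfl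
  have ha' : ∀ m m', B (a m) m' = B (f (D.proj m) : M) (D.projY m' : M)
      - B (D.projY m : M) (f (D.proj m') : M) := fun m m' => by
    rw [ha, map_sub, LinearMap.sub_apply, ← D.form_projY (f (D.proj m)) m', ← ht]
    congr 1
    rw [D.form_decomp hB, D.projX_of_mem_M0 hB, D.projY_of_mem_M0, D.proj_coe]
    simp
  refine ⟨⟨a, fun m m' => ?_, fun x hx => ?_, fun v hv => ?_⟩, ?_⟩
  · rw [hB.swap (a m') m, ha', ha', hB.swap (f (D.proj m) : M) (D.projY m' : M),
      hB.swap (f (D.proj m') : M) (D.projY m : M), mul_sub, ← mul_assoc, hB.sq]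
    ring
  · rw [ha, D.proj_of_mem hx, D.projY_of_mem_X ⟨x, hx⟩]
    simp
  · have : D.projY v = 0 := Subtype.ext (D.separating_Y _ (D.projY v).2 fun x hx => by
      rw [D.form_projY ⟨x, hx⟩, hv x hx])
    rw [ha, this, map_zero]
    simp
  · refine LinearMap.ext fun v => Subtype.ext ?_
    rw [nilM0_apply]
    change a v = _
    rw [ha, D.proj_coe, D.projY_of_mem_M0]
    simp

theorem nil_apply_eq (hB : IsEps ε B) {a : nilRadical B D.X} (ha : a ∈ LinearMap.ker D.nilM0)
    (m : M) : a.1 m = a.1 (D.projY m) := by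
  conv_lhs => rw [← D.decomp hB m]
  have h1 : a.1 (D.proj m : M) = 0 :=
    congrArg Subtype.val (LinearMap.congr_fun (LinearMap.mem_ker.1 ha) (D.proj m))
  rw [map_add, map_add, h1, a.2.2.1 _ (D.projX ε m).2, zero_add, zero_add]

theorem nil_apply_mem (hB : IsEps ε B) {a : nilRadical B D.X} (ha : a ∈ LinearMap.ker D.nilM0)
    (m : M) : a.1 m ∈ D.X := by
  have hperp : ∀ x ∈ D.X, B x (a.1 m) = 0 := fun x hx => by
    have := a.2.1 x m
    rwa [a.2.2.1 x hx, map_zero, LinearMap.zero_apply, zero_add] at this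
  have hY : D.projY (a.1 m) = 0 := Subtype.ext (D.separating_Y _ (D.projY _).2 fun x hx => by
    rw [D.form_projY ⟨x, hx⟩, hperp x hx])
  have h0 : (D.proj (a.1 m)) = 0 := by
    refine (D.isEps_M0 hB).sep _ fun v => ?_
    change B (D.proj (a.1 m) : M) (v : M) = 0
    have h1 : B (a.1 m) (v : M) = B (D.proj (a.1 m) : M) (v : M) := by
      rw [D.form_decomp hB (a.1 m), D.projX_of_mem_M0 hB, D.projY_of_mem_M0, D.proj_coe]
      simp
    have h2 : a.1 (v : M) = 0 :=
      congrArg Subtype.val (LinearMap.congr_fun (LinearMap.mem_ker.1 ha) v)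
    have h3 := a.2.1 m v
    rw [h2, map_zero, add_zero] at h3
    rw [← h1, h3]
  rw [← D.decomp hB (a.1 m), hY, h0]
  simp

/-- The matrix of an element of the centre of the nilradical. -/
noncomputable def nilMatrix (b : Module.Basis (Fin k) K D.X) (hB : IsEps ε B) :
    LinearMap.ker D.nilM0 →ₗ[K] skewMatrices K ε k where
  toFun a := ⟨Matrix.of fun i j => B (a.1.1 (D.dualVec b i)) (D.dualVec b j), fun i j => by
    have h := a.1.2.1 (D.dualVec b i) (D.dualVec b j)
    rw [hB.swap (a.1.1 (D.dualVec b j : M)) (D.dualVec b i : M)] at h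
    simp only [Matrix.of_apply]
    have h2 := hB.sq
    linear_combination (ε : K) * h - (B (a.1.1 (D.dualVec b j : M)) (D.dualVec b i : M)) * h2⟩
  map_add' a a' := Subtype.ext (by ext i j; simp)
  map_smul' c a := Subtype.ext (by ext i j; simp)

theorem nilMatrix_apply (b : Module.Basis (Fin k) K D.X) (hB : IsEps ε B)
    (a : LinearMap.ker D.nilM0) (i j : Fin k) :
    (D.nilMatrix b hB a).1 i j = B (a.1.1 (D.dualVec b i)) (D.dualVec b j) := rfl

theorem nil_form_eq (b : Module.Basis (Fin k) K D.X) (hB : IsEps ε B)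
    (a : LinearMap.ker D.nilM0) (m m' : M) : B (a.1.1 m) m' =
      ∑ i, ∑ j, B (b i : M) m * B (b j : M) m' * (D.nilMatrix b hB a).1 i j := by
  rw [D.nil_apply_eq hB a.2, ← D.form_projY ⟨_, D.nil_apply_mem hB a.2 _⟩ m', D.projY_eq_sum b m,
    D.projY_eq_sum b m']
  simp only [Submodule.coe_sum, Submodule.coe_smul, map_sum, map_smul, LinearMap.sum_apply,
    LinearMap.smul_apply, smul_eq_mul, nilMatrix_apply]
  rw [Finset.sum_comm]
  refine Finset.sum_congr rfl fun i _ => ?_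
  simp only [Finset.mul_sum]
  refine Finset.sum_congr rfl fun j _ => ?_
  ring

theorem nilMatrix_bijective (b : Module.Basis (Fin k) K D.X) (hB : IsEps ε B) :
    Function.Bijective (D.nilMatrix b hB) := by
  constructor
  · refine (injective_iff_map_eq_zero _).2 fun a ha => ?_
    refine Subtype.ext (Subtype.ext (LinearMap.ext fun m => hB.sep _ fun m' => ?_))
    rw [D.nil_form_eq b hB, ha]
    simp
  · intro S
    let a : Module.End K M :=
      ∑ i, ∑ j, S.1 i j • (B (b i : M)).smulRight (b j : M)
    have ha : ∀ m, a m = ∑ i, ∑ j, (S.1 i j * B (b i : M) m) • (b j : M) := fun m => by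
      simp [a, LinearMap.sum_apply, mul_smul]
    have hX : ∀ m, a m ∈ D.X := fun m => by
      rw [ha]
      exact Submodule.sum_mem _ fun i _ => Submodule.sum_mem _ fun j _ =>
        Submodule.smul_mem _ _ (b j).2
    have hf : ∀ m m', B (a m) m' = ∑ i, ∑ j, S.1 i j * B (b i : M) m * B (b j : M) m' :=
      fun m m' => by simp [ha, LinearMap.sum_apply]
    have hM0 : ∀ m, (∀ x ∈ D.X, B x m = 0) → a m = 0 := fun m hm => by
      rw [ha]
      simp [hm _ (b _).2]
    let a' : nilRadical B D.X := ⟨a, fun m m' => by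
      rw [hB.swap (a m') m, hf, hf, Finset.sum_comm, Finset.mul_sum, ← Finset.sum_add_distrib]
      refine Finset.sum_eq_zero fun j _ => ?_
      rw [Finset.mul_sum, ← Finset.sum_add_distrib]
      refine Finset.sum_eq_zero fun i _ => ?_
      rw [S.2 j i]
      ring, fun x hx => hM0 x
        fun x' hx' => D.isotropic_X x' hx' x hx, fun v _ => hX v⟩
    have hker : a' ∈ LinearMap.ker D.nilM0 := LinearMap.mem_ker.2 (LinearMap.ext fun v =>
      Subtype.ext (hM0 v fun x hx => (D.orthogonal x (Submodule.mem_sup_left hx) v v.2).1))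
    refine ⟨⟨a', hker⟩, Subtype.ext (Matrix.ext fun i j => ?_)⟩
    rw [nilMatrix_apply]
    change B (a _) _ = _
    rw [hf]
    simp [form_dualVec, Finsupp.single_apply]

theorem adNil_mem_ker (p : stab B D.X) :
    LinearMap.ker D.nilM0 ≤ (LinearMap.ker D.nilM0).comap (adNil B D.X p) := by
  intro a ha
  rw [Submodule.mem_comap, LinearMap.mem_ker, nilM0_adNil, LinearMap.mem_ker.1 ha, map_zero]

theorem nilMatrix_adNil (b : Module.Basis (Fin k) K D.X) (hB : IsEps ε B) (p : stab B D.X)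
    (a : LinearMap.ker D.nilM0) :
    D.nilMatrix b hB ((adNil B D.X p).restrict (D.adNil_mem_ker p) a) =
      congrSkew K ε k (LinearMap.toMatrix b b (restr B D.X p)) (D.nilMatrix b hB a) := by
  refine Subtype.ext (Matrix.ext fun i j => ?_)
  have hA : ∀ i j, B (b j : M) (((p⁻¹ : stab B D.X) : isomGroup B) • (D.dualVec b i : M)) =
      LinearMap.toMatrix b b (restr B D.X p) i j := fun i j => by
    rw [LinearMap.toMatrix_apply, ← D.form_dualVec b]
    change B (b j : M) (((p : isomGroup B)⁻¹) • (D.dualVec b i : M)) =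
      B ((p : isomGroup B) • (b j : M)) _
    rw [← isom_apply (p : isomGroup B), smul_inv_smul]
  have h1 : (D.nilMatrix b hB ((adNil B D.X p).restrict (D.adNil_mem_ker p) a)).1 i j =
      B (a.1.1 (((p⁻¹ : stab B D.X) : isomGroup B) • (D.dualVec b i : M)))
        (((p⁻¹ : stab B D.X) : isomGroup B) • (D.dualVec b j : M)) := by
    change B ((p : isomGroup B) • (a.1.1 (((p⁻¹ : stab B D.X) : isomGroup B) •
      (D.dualVec b i : M)))) _ = B _ ((p : isomGroup B)⁻¹ • _)
    rw [← isom_apply (p : isomGroup B) _ ((p : isomGroup B)⁻¹ • (D.dualVec b j : M)), smul_inv_smul]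
  rw [h1, D.nil_form_eq b hB]
  simp only [hA]
  change _ = ((LinearMap.toMatrix b b (restr B D.X p)) * (D.nilMatrix b hB a).1 *
    (LinearMap.toMatrix b b (restr B D.X p)).transpose) i j
  simp only [Matrix.mul_apply, Matrix.transpose_apply, Finset.sum_mul]
  rw [Finset.sum_comm]
  refine Finset.sum_congr rfl fun _ _ => Finset.sum_congr rfl fun _ _ => ?_
  ring

theorem detOn_ne_zero (p : stab B D.X) : detOn B D.X p ≠ 0 := fun h => by
  have h1 : detOn B D.X (p * p⁻¹) = 1 := by rw [mul_inv_cancel, map_one]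
  rw [map_mul, h, zero_mul] at h1
  exact zero_ne_one h1

theorem det_adNil [CharZero K] (hB : IsEps ε B) (p : stab B D.X) :
    LinearMap.det (adNil B D.X p) = detOn B D.X p ^ ((k : ℤ) - ε) *
      (detOn B D.X p ^ Module.finrank K D.M0 *
        LinearMap.det (D.leviEquiv p⁻¹ : D.M0 →ₗ[K] D.M0) ^ k) := by
  let b : Module.Basis (Fin k) K D.X := (Module.finBasis K D.X).reindex (finCongr D.finrank_X)
  have hdet : (LinearMap.toMatrix b b (restr B D.X p)).det = detOn B D.X p :=
    LinearMap.det_toMatrix b _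
  let W : Submodule K (nilRadical B D.X) := LinearMap.ker D.nilM0
  have : Module.Free K W := Module.Free.of_divisionRing K W
  have : Module.Free K (nilRadical B D.X ⧸ W) := Module.Free.of_divisionRing K _
  have hW : W ≤ W.comap (adNil B D.X p) := D.adNil_mem_ker p
  rw [LinearMap.det_eq_det_mul_det W _ hW]
  congr 1
  · rw [← hdet, ← det_congrSkew hB.eps _ (hdet ▸ D.detOn_ne_zero p)]
    let e := LinearEquiv.ofBijective _ (D.nilMatrix_bijective b hB)
    rw [← LinearMap.det_conj _ e]
    congr 1
    refine LinearMap.ext fun S => ?_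
    obtain ⟨a, rfl⟩ := e.surjective S
    simp only [LinearMap.comp_apply, LinearEquiv.coe_coe, LinearEquiv.symm_apply_apply]
    exact D.nilMatrix_adNil b hB p a
  · have h1 : detOn B D.X p ^ Module.finrank K D.M0 *
        LinearMap.det (D.leviEquiv p⁻¹ : D.M0 →ₗ[K] D.M0) ^ k =
        LinearMap.det (homConj (restr B D.X p) ((D.leviEquiv p⁻¹ : D.M0 →ₗ[K] D.M0))) := by
      rw [det_homConj, D.finrank_X]
      rfl
    rw [h1]
    let e := D.nilM0.quotKerEquivOfSurjective (D.nilM0_surjective hB)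
    rw [← LinearMap.det_conj _ e]
    congr 1
    refine LinearMap.ext fun f => ?_
    obtain ⟨q, rfl⟩ := e.surjective f
    obtain ⟨a, rfl⟩ := Submodule.Quotient.mk_surjective _ q
    simp only [LinearMap.comp_apply, LinearEquiv.coe_coe, LinearEquiv.symm_apply_apply]
    exact D.nilM0_adNil p a

end LeviDatum

section Modulus

variable (F : Type*) {K M : Type*} [Field F] [ValuativeRel F] [TopologicalSpace F]
  [IsNonarchimedeanLocalField F] [Field K] [Algebra F K] [AddCommGroup M] [Module K M]
  [FiniteDimensional K M] {ε : ℤ} {B : LinearMap.BilinForm K M} {k : ℕ}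

theorem relAbs_eq_one_of_sq {x : K} (h : x * x = 1) : relAbs F K x = 1 := by
  have h1 : relAbs F K x ^ 2 = 1 := by rw [sq, ← map_mul, h, map_one]
  exact (pow_eq_one_iff_of_nonneg zero_le two_ne_zero).1 h1

theorem relAbs_detOn_ne_zero {X : Submodule K M} (p : stab B X) :
    relAbs F K (detOn B X p) ≠ 0 := fun h => by
  have h1 : relAbs F K (detOn B X (p * p⁻¹)) = 1 := by rw [mul_inv_cancel, map_one, map_one]
  rw [map_mul, map_mul, h, zero_mul] at h1
  exact zero_ne_one h1

/-- The modulus character of the stabilizer of an isotropic subspace. -/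
theorem LeviDatum.modulus_eq [CharZero K] (hB : IsEps ε B) (D : LeviDatum B k)
    (p : stab B D.X) : modulus B D.X F p =
      relAbs F K (detOn B D.X p) ^ ((Module.finrank K M : ℤ) - k - ε) := by
  have h0 : relAbs F K (detOn B D.X p) ≠ 0 := relAbs_detOn_ne_zero F p
  have h1 : relAbs F K (LinearMap.det (D.leviEquiv p⁻¹ : D.M0 →ₗ[K] D.M0)) = 1 :=
    relAbs_eq_one_of_sq F (det_isom_sq (D.isEps_M0 hB) (D.levi p⁻¹))
  have hz : ∀ (x : K) (n : ℤ), x ≠ 0 → relAbs F K (x ^ n) = relAbs F K x ^ n := fun x n hx => by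
    have hx0 : relAbs F K x ≠ 0 := fun h => by
      have := (map_mul (relAbs F K) x x⁻¹).symm
      rw [mul_inv_cancel₀ hx, map_one, h, zero_mul] at this
      exact zero_ne_one this
    have hinv : relAbs F K x⁻¹ = (relAbs F K x)⁻¹ := by
      refine eq_inv_of_mul_eq_one_left ?_
      rw [← map_mul, inv_mul_cancel₀ hx, map_one]
    rcases n with n | n
    · simp
    · rw [zpow_negSucc, zpow_negSucc, ← inv_pow, map_pow, hinv, inv_pow]
  change relAbs F K (LinearMap.det (adNil B D.X p)) = _
  rw [D.det_adNil hB, map_mul, map_mul, map_pow, map_pow, h1, one_pow, mul_one,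
    hz _ _ (D.detOn_ne_zero p), ← zpow_natCast, ← zpow_add₀ h0]
  congr 1
  have := D.finrank_M0
  omega

end Modulus

/-! ## Solutions of quadratic equations near the origin -/

open Topology Filter

theorem eventually_exists_quadratic {𝕜 E G : Type*} [NontriviallyNormedField 𝕜] [CompleteSpace 𝕜]
    [NormedAddCommGroup E] [NormedSpace 𝕜 E] [FiniteDimensional 𝕜 E]
    [NormedAddCommGroup G] [NormedSpace 𝕜 G] [FiniteDimensional 𝕜 G]
    (l : E →ₗ[𝕜] G) (hl : Function.Surjective l) (q : E →ₗ[𝕜] E →ₗ[𝕜] G) {N : Set E}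
    (hN : N ∈ 𝓝 0) : ∀ᶠ z in 𝓝 (0 : G), ∃ x ∈ N, l x + q x x = z := by
  have : CompleteSpace E := FiniteDimensional.complete 𝕜 E
  have : CompleteSpace G := FiniteDimensional.complete 𝕜 G
  let L : E →L[𝕜] G := LinearMap.toContinuousLinearMap l
  let Q : E →L[𝕜] E →L[𝕜] G :=
    LinearMap.toContinuousLinearMap ((LinearMap.toContinuousLinearMap : _ ≃ₗ[𝕜] _).toLinearMap ∘ₗ q)
  let f : E → G := fun x => L x + Q x x
  have hf : HasStrictFDerivAt f L 0 := by
    have h1 : HasStrictFDerivAt (fun x => Q x x) (0 : E →L[𝕜] G) 0 := by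
      have h2 := (Q.hasStrictFDerivAt (x := 0)).clm_apply (hasStrictFDerivAt_id (𝕜 := 𝕜) (0 : E))
      have h3 : Q 0 ∘SL ContinuousLinearMap.id 𝕜 E + Q.flip (id 0) = 0 := by
        ext
        simp
      rw [h3] at h2
      exact h2
    have h2 := (L.hasStrictFDerivAt (x := 0)).add h1
    rw [add_zero] at h2
    exact h2
  have h := hf.map_nhds_eq_of_surj (LinearMap.range_eq_top.2 hl)
  have h0 : f 0 = 0 := by simp [f]
  rw [h0] at h
  rw [← h, Filter.eventually_map]
  filter_upwards [hN] with x hx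
  exact ⟨x, hx, rfl⟩

section LocalField

variable {F : Type*} [Field F] [ValuativeRel F] [TopologicalSpace F] [IsNonarchimedeanLocalField F]

theorem eventually_exists_quadratic_pi {a b : ℕ}
    (l : (Fin a → F) →ₗ[F] (Fin b → F)) (hl : Function.Surjective l)
    (q : (Fin a → F) →ₗ[F] (Fin a → F) →ₗ[F] (Fin b → F)) {N : Set (Fin a → F)} (hN : N ∈ 𝓝 0) :
    ∀ᶠ z in 𝓝 (0 : Fin b → F), ∃ x ∈ N, l x + q x x = z := by
  letI := IsTopologicalAddGroup.rightUniformSpace F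
  haveI := isUniformAddGroup_of_addCommGroup (G := F)
  letI : (Valued.v (R := F)).RankOne :=
  { hom' := ValuativeRel.IsRankLeOne.nonempty.some.emb (R := F).comp
      MonoidWithZeroHom.ValueGroup₀.embedding
    strictMono' := ValuativeRel.IsRankLeOne.nonempty.some.strictMono.comp
      MonoidWithZeroHom.ValueGroup₀.embedding_strictMono }
  haveI : CompleteSpace F := inferInstance
  letI : NontriviallyNormedField F :=
    Valued.toNontriviallyNormedField F (ValuativeRel.ValueGroupWithZero F)
  exact eventually_exists_quadratic l hl q hN

variable (F) in
theorem localField_t2 : T2Space F := by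
  letI := IsTopologicalAddGroup.rightUniformSpace F
  haveI := isUniformAddGroup_of_addCommGroup (G := F)
  letI : (Valued.v (R := F)).RankOne :=
  { hom' := ValuativeRel.IsRankLeOne.nonempty.some.emb (R := F).comp
      MonoidWithZeroHom.ValueGroup₀.embedding
    strictMono' := ValuativeRel.IsRankLeOne.nonempty.some.strictMono.comp
      MonoidWithZeroHom.ValueGroup₀.embedding_strictMono }
  letI : NontriviallyNormedField F :=
    Valued.toNontriviallyNormedField F (ValuativeRel.ValueGroupWithZero F)
  exact inferInstanceAs (T2Space F)

variable (F) in
theorem localField_totallyDisconnected : TotallyDisconnectedSpace F := by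
  letI := IsTopologicalAddGroup.rightUniformSpace F
  haveI := isUniformAddGroup_of_addCommGroup (G := F)
  letI : (Valued.v (R := F)).RankOne :=
  { hom' := ValuativeRel.IsRankLeOne.nonempty.some.emb (R := F).comp
      MonoidWithZeroHom.ValueGroup₀.embedding
    strictMono' := ValuativeRel.IsRankLeOne.nonempty.some.strictMono.comp
      MonoidWithZeroHom.ValueGroup₀.embedding_strictMono }
  letI : NontriviallyNormedField F :=
    Valued.toNontriviallyNormedField F (ValuativeRel.ValueGroupWithZero F)
  haveI : IsUltrametricDist F := IsUltrametricDist.isUltrametricDist_of_isNonarchimedean_norm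
    (Valued.isNonarchimedean_norm F (ValuativeRel.ValueGroupWithZero F))
  exact inferInstanceAs (TotallyDisconnectedSpace F)

section Modules

variable {M W : Type*} [AddCommGroup M] [Module F M] [FiniteDimensional F M] [TopologicalSpace M]
  [IsModuleTopology F M] [AddCommGroup W] [Module F W] [FiniteDimensional F W] [TopologicalSpace W]
  [IsModuleTopology F W]

/-- Coordinates with respect to a basis as a homeomorphism. -/
theorem continuous_equivFun {ι : Type*} [Finite ι] (b : Module.Basis ι F M) :
    Continuous b.equivFun ∧ Continuous b.equivFun.symm :=
  have := IsModuleTopology.toContinuousAdd F M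
  ⟨IsModuleTopology.continuous_of_linearMap (R := F) (b.equivFun : M →ₗ[F] (ι → F)),
    IsModuleTopology.continuous_of_linearMap (R := F) (b.equivFun.symm : (ι → F) →ₗ[F] M)⟩

variable (F M) in
theorem exists_homeomorph_pi : ∃ n : ℕ, Nonempty (M ≃ₜ (Fin n → F)) :=
  ⟨_, ⟨{ (Module.finBasis F M).equivFun.toEquiv with
    continuous_toFun := (continuous_equivFun (Module.finBasis F M)).1
    continuous_invFun := (continuous_equivFun (Module.finBasis F M)).2 }⟩⟩

theorem module_t2 (F M : Type*) [Field F] [ValuativeRel F] [TopologicalSpace F]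
    [IsNonarchimedeanLocalField F] [AddCommGroup M] [Module F M] [FiniteDimensional F M]
    [TopologicalSpace M] [IsModuleTopology F M] : T2Space M := by
  obtain ⟨n, ⟨e⟩⟩ := exists_homeomorph_pi F M
  have := localField_t2 F
  exact e.symm.t2Space

theorem module_locallyCompact (F M : Type*) [Field F] [ValuativeRel F] [TopologicalSpace F]
    [IsNonarchimedeanLocalField F] [AddCommGroup M] [Module F M] [FiniteDimensional F M]
    [TopologicalSpace M] [IsModuleTopology F M] : LocallyCompactSpace M := by
  obtain ⟨n, ⟨e⟩⟩ := exists_homeomorph_pi F M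
  exact e.isClosedEmbedding.locallyCompactSpace

theorem module_totallyDisconnected (F M : Type*) [Field F] [ValuativeRel F] [TopologicalSpace F]
    [IsNonarchimedeanLocalField F] [AddCommGroup M] [Module F M] [FiniteDimensional F M]
    [TopologicalSpace M] [IsModuleTopology F M] : TotallyDisconnectedSpace M := by
  obtain ⟨n, ⟨e⟩⟩ := exists_homeomorph_pi F M
  have := localField_totallyDisconnected F
  exact ⟨e.isEmbedding.isTotallyDisconnected (isTotallyDisconnected_of_totallyDisconnectedSpace _)⟩

theorem eventually_exists_quadratic_module (l : M →ₗ[F] W) (hl : Function.Surjective l)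
    (q : M →ₗ[F] M →ₗ[F] W) {N : Set M} (hN : N ∈ 𝓝 0) :
    ∀ᶠ z in 𝓝 (0 : W), ∃ x ∈ N, l x + q x x = z := by
  let e := (Module.finBasis F M).equivFun
  let e' := (Module.finBasis F W).equivFun
  have he := continuous_equivFun (Module.finBasis F M)
  have he' := continuous_equivFun (Module.finBasis F W)
  have h0 : Tendsto e.symm (𝓝 0) (𝓝 0) := by
    have := he.2.tendsto 0
    rwa [map_zero] at this
  have h0' : Tendsto e' (𝓝 0) (𝓝 0) := by
    have := he'.1.tendsto 0
    rwa [map_zero] at this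
  have h := eventually_exists_quadratic_pi (e'.toLinearMap ∘ₗ l ∘ₗ e.symm.toLinearMap)
    (e'.surjective.comp (hl.comp e.symm.surjective))
    ((q.compl₁₂ e.symm.toLinearMap e.symm.toLinearMap).compr₂ e'.toLinearMap) (h0 hN)
  filter_upwards [h0'.eventually h] with z hz
  obtain ⟨x, hx, e1⟩ := hz
  refine ⟨e.symm x, hx, e'.injective ?_⟩
  rw [← e1, map_add]
  rfl

end Modules

end LocalField

/-! ## The topology of isometry groups -/

section Topology

variable {F : Type*} [Field F] [ValuativeRel F] [TopologicalSpace F] [IsNonarchimedeanLocalField F]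
  {K : Type*} [Field K] [Algebra F K] [FiniteDimensional F K] [TopologicalSpace K]
  [IsModuleTopology F K] {M : Type*} [AddCommGroup M] [Module F M] [Module K M]
  [IsScalarTower F K M] [FiniteDimensional K M] [TopologicalSpace M]

theorem isTopologicalRing_ext (F K : Type*) [Field F] [TopologicalSpace F] [IsTopologicalRing F]
    [Field K] [Algebra F K] [FiniteDimensional F K] [TopologicalSpace K] [IsModuleTopology F K] :
    IsTopologicalRing K := IsModuleTopology.isTopologicalRing F K

theorem isModuleTopology_ext (F K M : Type*) [Field F] [TopologicalSpace F] [IsTopologicalRing F]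
    [Field K] [Algebra F K] [FiniteDimensional F K] [TopologicalSpace K] [IsModuleTopology F K]
    [AddCommGroup M] [Module F M] [Module K M] [IsScalarTower F K M] [FiniteDimensional K M]
    [TopologicalSpace M] [IsModuleTopology F M] : IsModuleTopology K M := by
  have := isTopologicalRing_ext F K
  have := FiniteDimensional.trans F K M
  let e := (Module.finBasis K M).equivFun
  let e' : M ≃ₗ[F] (Fin (Module.finrank K M) → K) := e.restrictScalars F
  have := IsModuleTopology.toContinuousAdd F M
  have h1 : Continuous e' := IsModuleTopology.continuous_of_linearMap (R := F) e'.toLinearMap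
  have h2 : Continuous e'.symm :=
    IsModuleTopology.continuous_of_linearMap (R := F) e'.symm.toLinearMap
  exact IsModuleTopology.iso (R := K)
    ({ e.symm with continuous_toFun := h2, continuous_invFun := h1 } :
      (Fin (Module.finrank K M) → K) ≃L[K] M)

variable {ε : ℤ} {B : LinearMap.BilinForm K M}

section
variable [IsModuleTopology K M]

theorem isInducing_isom : IsInducing (fun (g : isomGroup B) (v : M) => g • v) := by
  constructor
  rw [eq_moduleTopology K M]
  rfl

theorem continuous_isom_smul (v : M) : Continuous fun g : isomGroup B => g • v :=
  (continuous_apply v).comp isInducing_isom.continuous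

theorem continuous_isom_iff {Z : Type*} [TopologicalSpace Z] {f : Z → isomGroup B} :
    Continuous f ↔ ∀ v : M, Continuous fun z => f z • v := by
  rw [(isInducing_isom (B := B)).continuous_iff, continuous_pi_iff]
  rfl

theorem continuous_coord [IsTopologicalRing K] {ι : Type*} [Finite ι] (b : Module.Basis ι K M)
    (i : ι) : Continuous fun v : M => b.repr v i :=
  IsModuleTopology.continuous_of_linearMap (R := K) (b.coord i)

theorem continuous_isom_smul₂ [IsTopologicalRing K] :
    Continuous fun p : isomGroup B × M => p.1 • p.2 := by
  have := IsModuleTopology.toContinuousAdd K M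
  let b := Module.finBasis K M
  have h : (fun p : isomGroup B × M => p.1 • p.2) =
      fun p => ∑ i, b.repr p.2 i • (p.1 • b i) := by
    funext p
    conv_lhs => rw [← b.sum_repr p.2]
    rw [Finset.smul_sum]
    exact Finset.sum_congr rfl fun i _ => isom_smul_smul _ _ _
  rw [h]
  exact continuous_finsetSum _ fun i _ => ((continuous_coord b i).comp continuous_snd).smul
    ((continuous_isom_smul (b i)).comp continuous_fst)

theorem continuous_form [IsTopologicalRing K] :
    Continuous fun p : M × M => B p.1 p.2 :=
  IsModuleTopology.continuous_bilinear_of_finite_left B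

theorem isTopologicalGroup_isom [IsTopologicalRing K] (hB : IsEps ε B) :
    IsTopologicalGroup (isomGroup B) where
  continuous_mul := continuous_isom_iff.2 fun v => by
    have h : (fun p : isomGroup B × isomGroup B => (p.1 * p.2) • v) =
        (fun p : isomGroup B × M => p.1 • p.2) ∘ fun p => (p.1, p.2 • v) := by
      funext p
      exact mul_smul _ _ _
    rw [h]
    exact continuous_isom_smul₂.comp
      (continuous_fst.prodMk ((continuous_isom_smul v).comp continuous_snd))
  continuous_inv := continuous_isom_iff.2 fun v => by
    let b := Module.finBasis K M
    let φ : M →ₗ[K] (Fin (Module.finrank K M) → K) := LinearMap.pi fun i => B.flip (b i)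
    have hφ : Function.Injective φ := by
      refine (injective_iff_map_eq_zero φ).2 fun m hm => hB.sep m fun y => ?_
      have h : B m = 0 := b.ext fun i => congrFun hm i
      rw [h, LinearMap.zero_apply]
    let e := LinearEquiv.ofInjectiveOfFinrankEq φ hφ (by simp)
    have := IsModuleTopology.toContinuousAdd K M
    have he : Continuous e.symm :=
      IsModuleTopology.continuous_of_linearMap (R := K) e.symm.toLinearMap
    have h : (fun g : isomGroup B => g⁻¹ • v) = fun g => e.symm (fun i => B v (g • b i)) := by
      funext g
      rw [LinearEquiv.eq_symm_apply]
      funext i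
      exact isom_inv_apply g v (b i)
    rw [h]
    exact he.comp (continuous_pi fun i => continuous_form.comp
      (continuous_const.prodMk (continuous_isom_smul (b i))))

theorem isClosedEmbedding_isom [IsTopologicalRing K] [T2Space K] [T2Space M] (hB : IsEps ε B)
    {ι : Type*} [Finite ι] (b : Module.Basis ι K M) :
    IsClosedEmbedding fun (g : isomGroup B) (i : ι) => g • b i := by
  have := Fintype.ofFinite ι
  refine ⟨⟨⟨le_antisymm ?_ ?_⟩, ?_⟩, ?_⟩
  · exact (continuous_pi fun i => continuous_isom_smul (b i)).le_induced
  · have hid : @Continuous _ _ (TopologicalSpace.induced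
        (fun (g : isomGroup B) (i : ι) => g • b i) inferInstance) _ (id : isomGroup B → isomGroup B) := by
      letI τ := TopologicalSpace.induced (fun (g : isomGroup B) (i : ι) => g • b i) inferInstance
      refine (@continuous_isom_iff _ _ _ _ _ _ _ _ _ _ (isomGroup B) τ id).2 fun v => ?_
      have h : (fun g : isomGroup B => id g • v) = fun g => ∑ i, b.repr v i • (g • b i) := by
        funext g
        conv_lhs => rw [← b.sum_repr v]
        rw [Finset.smul_sum]
        exact Finset.sum_congr rfl fun i _ => isom_smul_smul _ _ _
      rw [h]
      have := IsModuleTopology.toContinuousAdd K M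
      have hc : ∀ i, Continuous fun g : isomGroup B => g • b i := fun i =>
        (continuous_apply i).comp (continuous_induced_dom (f := fun (g : isomGroup B) (i : ι) => g • b i))
      exact continuous_finsetSum _ fun i _ => (hc i).const_smul _
    exact continuous_id_iff_le.1 hid
  · intro g h e
    refine Subtype.ext (LinearEquiv.toLinearMap_injective (b.ext fun i => ?_))
    exact congrFun e i
  · have h : Set.range (fun (g : isomGroup B) (i : ι) => g • b i) =
        ⋂ i, ⋂ j, {w : ι → M | B (w i) (w j) = B (b i) (b j)} := by
      ext w
      simp only [Set.mem_range, Set.mem_iInter, Set.mem_ofPred_eq]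
      constructor
      · rintro ⟨g, rfl⟩ i j
        exact isom_apply g _ _
      · intro hw
        have hf : ∀ x y, B (b.constr K w x) (b.constr K w y) = B x y := by
          intro x y
          have : B.compl₁₂ (b.constr K w) (b.constr K w) = B := by
            refine b.ext fun i => b.ext fun j => ?_
            rw [LinearMap.compl₁₂_apply, b.constr_basis, b.constr_basis, hw i j]
          exact LinearMap.congr_fun (LinearMap.congr_fun this x) y
        obtain ⟨g, hg⟩ := exists_isom_of_preserving hB (b.constr K w) hf
        exact ⟨g, funext fun i => by rw [hg, Module.Basis.constr_basis]⟩
    rw [h]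
    exact isClosed_iInter fun i => isClosed_iInter fun j =>
      isClosed_eq (continuous_form.comp ((continuous_apply i).prodMk (continuous_apply j)))
        continuous_const

end

end Topology

/-- In a locally compact totally disconnected group, every neighbourhood of the identity contains a
compact open subgroup. -/
theorem exists_compact_open_subgroup {G : Type*} [Group G] [TopologicalSpace G]
    [IsTopologicalGroup G] [T2Space G] [LocallyCompactSpace G] [TotallyDisconnectedSpace G]
    {W : Set G} (hW : W ∈ 𝓝 1) :
    ∃ U : Subgroup G, IsOpen (U : Set G) ∧ IsCompact (U : Set G) ∧ (U : Set G) ⊆ W := by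
  obtain ⟨C, hC, hCW, hCc⟩ := local_compact_nhds hW
  obtain ⟨V, hV, hV1, hVC⟩ := loc_compact_Haus_tot_disc_of_zero_dim.mem_nhds_iff.1 hC
  have hVc : IsCompact V := hCc.of_isClosed_subset hV.1 hVC
  have key : ∀ᶠ g in 𝓝 (1 : G), ∀ v ∈ V, v * g ∈ V := by
    refine hVc.eventually_forall_of_forall_eventually fun v hv => ?_
    have hc : Continuous fun p : G × G => p.2 * p.1 := continuous_snd.mul continuous_fst
    exact hc.continuousAt.eventually (hV.2.mem_nhds (by simpa using hv))
  have key' : ∀ᶠ g in 𝓝 (1 : G), ∀ v ∈ V, v * g⁻¹ ∈ V := by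
    have h : Tendsto (fun g : G => g⁻¹) (𝓝 1) (𝓝 1) := by
      have := continuous_inv.tendsto (1 : G)
      rwa [inv_one] at this
    exact h.eventually key
  let U : Subgroup G :=
    { carrier := {g | (∀ v ∈ V, v * g ∈ V) ∧ ∀ v ∈ V, v * g⁻¹ ∈ V}
      one_mem' := by simp
      mul_mem' := by
        rintro g h ⟨hg, hg'⟩ ⟨hh, hh'⟩
        refine ⟨fun v hv => ?_, fun v hv => ?_⟩
        · rw [← mul_assoc]
          exact hh _ (hg _ hv)
        · rw [mul_inv_rev, ← mul_assoc]
          exact hg' _ (hh' _ hv)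
      inv_mem' := by
        rintro g ⟨hg, hg'⟩
        exact ⟨hg', by simpa using hg⟩ }
  have hU : IsOpen (U : Set G) := Subgroup.isOpen_of_mem_nhds U (g := 1) (key.and key')
  have hUV : (U : Set G) ⊆ V := fun g hg => by simpa using hg.1 1 hV1
  exact ⟨U, hU, hVc.of_isClosed_subset (U.isClosed_of_isOpen hU) hUV,
    hUV.trans (hVC.trans hCW)⟩

/-! ## Compact induction and functions on a stratum -/

section CompactInduction

open Topology Filter

variable {G H : Type*} [Group G] [TopologicalSpace G] [IsTopologicalGroup G]
  [Group H] [TopologicalSpace H] [IsTopologicalGroup H]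

/-- The double coset `Q h j(G)`. -/
def orbitSet (j : G →* H) (Q : Subgroup H) (h : H) : Set H :=
  {z | ∃ q ∈ Q, ∃ g, z = q * h * j g}

theorem eventually_mem_mul_mul [T2Space H] [LocallyCompactSpace H] [SigmaCompactSpace H]
    [SigmaCompactSpace G] {j : G →* H} (hj : Continuous j) {Q : Subgroup H}
    (hQ : IsClosed (Q : Set H)) {h : H} (hT : IsLocallyClosed (orbitSet j Q h))
    {V : Set H} (hV : V ∈ 𝓝 1) {W : Set G} (hW : W ∈ 𝓝 1) :
    ∀ᶠ z in 𝓝[orbitSet j Q h] h, ∃ q ∈ Q, q ∈ V ∧ ∃ g ∈ W, z = q * h * j g := by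
  let T := orbitSet j Q h
  have := hT.locallyCompactSpace
  have : SigmaCompactSpace Q := hQ.sigmaCompactSpace
  let act : MulAction (Q × G) T :=
    { smul := fun p z => ⟨p.1 * z * j p.2⁻¹, by
        obtain ⟨q, hq, g, e⟩ := z.2
        refine ⟨p.1 * q, Q.mul_mem p.1.2 hq, g * p.2⁻¹, ?_⟩
        rw [e, map_mul]
        group⟩
      one_smul := fun z => Subtype.ext (by
        change ((1 : Q) : H) * z * j (1 : G)⁻¹ = z
        simp)
      mul_smul := fun p p' z => Subtype.ext (by
        change ((p.1 * p'.1 : Q) : H) * z * j (p.2 * p'.2)⁻¹ =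
          p.1 * (p'.1 * z * j p'.2⁻¹) * j p.2⁻¹
        simp [mul_assoc]) }
  have hsm : ∀ (p : Q × G) (z : T), ((p • z : T) : H) = p.1 * z * j p.2⁻¹ := fun _ _ => rfl
  have : ContinuousSMul (Q × G) T := ⟨by
    refine Continuous.subtype_mk (f := fun p : (Q × G) × T => (p.1.1 : H) * p.2 * j p.1.2⁻¹) ?_ _
    have h1 : Continuous fun p : (Q × G) × T => j p.1.2⁻¹ := hj.comp (by fun_prop)
    have h2 : Continuous fun p : (Q × G) × T => (p.1.1 : H) * (p.2 : H) := by fun_prop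
    exact h2.mul h1⟩
  have : MulAction.IsPretransitive (Q × G) T := by
    constructor
    rintro ⟨z, q, hq, g, rfl⟩ ⟨z', q', hq', g', rfl⟩
    refine ⟨(⟨q' * q⁻¹, Q.mul_mem hq' (Q.inv_mem hq)⟩, g'⁻¹ * g), Subtype.ext ?_⟩
    rw [hsm]
    simp [mul_assoc]
  have hh : h ∈ T := ⟨1, Q.one_mem, 1, by simp⟩
  have hUV : ((Subtype.val ⁻¹' V : Set Q) ×ˢ (W⁻¹)) ∈ 𝓝 (1 : Q × G) :=
    prod_mem_nhds (continuous_subtype_val.continuousAt.preimage_mem_nhds (by simpa using hV))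
      (by simpa using inv_mem_nhds_one G hW)
  have key := smul_singleton_mem_nhds_of_sigmaCompact hUV (⟨h, hh⟩ : T)
  rw [nhdsWithin_eq_map_subtype_coe hh, eventually_map]
  filter_upwards [key] with z hz
  obtain ⟨p, hp, w, hw, rfl⟩ := hz
  rw [Set.mem_singleton_iff] at hw
  subst hw
  refine ⟨p.1, p.1.2, hp.1, p.2⁻¹, hp.2, ?_⟩
  exact hsm _ _

/-- The smooth compact induction of the character `χ` of `S`: the functions with
`φ (s g) = χ(s) φ(g)` that are right invariant under an open subgroup and compactly supported
modulo `S`. -/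
def compInd (S : Subgroup G) (χ : S →* ℂ) : Submodule ℂ (G → ℂ) where
  carrier := {φ | (∀ (s : S) (g : G), φ (s * g) = χ s * φ g) ∧
    (∃ U : Subgroup G, IsOpen (U : Set G) ∧ ∀ u ∈ U, ∀ g, φ (g * u) = φ g) ∧
    ∃ C : Set G, IsCompact C ∧ Function.support φ ⊆ (S : Set G) * C}
  zero_mem' := ⟨by simp, ⟨⊤, by simp, by simp⟩, ∅, isCompact_empty, by simp⟩
  add_mem' := by
    rintro φ φ' ⟨h1, ⟨U, hU, h2⟩, C, hC, h3⟩ ⟨h1', ⟨U', hU', h2'⟩, C', hC', h3'⟩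
    refine ⟨fun s g => by simp [h1 s, h1' s, mul_add], ⟨U ⊓ U', hU.inter hU', fun u hu g => ?_⟩,
      C ∪ C', hC.union hC', ?_⟩
    · simp [h2 u hu.1, h2' u hu.2]
    · rw [Set.mul_union]
      exact (Function.support_add φ φ').trans (Set.union_subset_union h3 h3')
  smul_mem' := by
    rintro c φ ⟨h1, ⟨U, hU, h2⟩, C, hC, h3⟩
    exact ⟨fun s g => by simp [h1 s, mul_left_comm], ⟨U, hU, fun u hu g => by simp [h2 u hu]⟩,
      C, hC, (Function.support_const_smul_subset c φ).trans h3⟩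

theorem compInd_stable (S : Subgroup G) (χ : S →* ℂ) (h : G) :
    compInd S χ ≤ (compInd S χ).comap (rightTranslation G ℂ h) := by
  rintro φ ⟨h1, ⟨U, hU, h2⟩, C, hC, h3⟩
  refine ⟨fun s g => ?_, ⟨U.comap (MulAut.conj h⁻¹).toMonoidHom, ?_, fun u hu g => ?_⟩,
    (fun x => x * h⁻¹) '' C, hC.image (continuous_mul_const h⁻¹), fun g hg => ?_⟩
  · change φ (s * g * h) = χ s * φ (g * h)
    rw [mul_assoc, h1]
  · have hc : Continuous (fun x : G => h⁻¹ * x * h) := by fun_prop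
    have := hU.preimage hc
    convert this using 1
    ext x
    simp
  · change φ (g * u * h) = φ (g * h)
    have hu' : h⁻¹ * u * h ∈ U := by simpa using hu
    rw [← h2 _ hu' (g * h)]
    congr 1
    group
  · obtain ⟨s, hs, c, hcC, e⟩ := h3 (show g * h ∈ Function.support φ from hg)
    refine ⟨s, hs, c * h⁻¹, ⟨c, hcC, rfl⟩, ?_⟩
    have e' : s * c = g * h := e
    change s * (c * h⁻¹) = g
    rw [← mul_assoc, e', mul_inv_cancel_right]

/-- The compact induction as a representation, by right translation. -/
def compIndRep (S : Subgroup G) (χ : S →* ℂ) : Representation ℂ G (compInd S χ) :=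
  (rightTranslation G ℂ).subrepresentation (compInd S χ) (compInd_stable S χ)

/-- The subgroup `{g | h j(g) h⁻¹ ∈ Q}`. -/
abbrev stabAt (j : G →* H) (Q : Subgroup H) (h : H) : Subgroup G :=
  Q.comap ((MulAut.conj h).toMonoidHom.comp j)

/-- The character `g ↦ χ (h j(g) h⁻¹)`. -/
abbrev charAt (j : G →* H) {Q : Subgroup H} (χ : Q →* ℂ) (h : H) : stabAt j Q h →* ℂ :=
  χ.comp (((MulAut.conj h).toMonoidHom.comp j).subgroupComap Q)

theorem mem_stabAt {j : G →* H} {Q : Subgroup H} {h : H} {g : G} :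
    g ∈ stabAt j Q h ↔ h * j g * h⁻¹ ∈ Q := Iff.rfl

/-- A closed set `Z`, a closed subset `Z'`, such that `Z \ Z'` is the disjoint union of the double
cosets `Q zᵢ j(G)`, which are open in it. -/
structure OrbitDecomposition (j : G →* H) (Q : Subgroup H) (Z Z' : Set H) {I : Type*}
    (z : I → H) : Prop where
  isClosed : IsClosed Z
  isClosed' : IsClosed Z'
  subset : Z' ⊆ Z
  mul_mem : ∀ q ∈ Q, ∀ h ∈ Z, ∀ g, q * h * j g ∈ Z
  mul_mem' : ∀ q ∈ Q, ∀ h ∈ Z', ∀ g, q * h * j g ∈ Z'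
  rep_mem : ∀ i, z i ∈ Z \ Z'
  exists_eq : ∀ h ∈ Z \ Z', ∃ i, h ∈ orbitSet j Q (z i)
  eq_of_mem : ∀ i i', z i' ∈ orbitSet j Q (z i) → i = i'
  open_orbit : ∀ h ∈ Z \ Z', ∀ᶠ h' in 𝓝[Z \ Z'] h, h' ∈ orbitSet j Q h

namespace OrbitDecomposition

variable {j : G →* H} {Q : Subgroup H} {Z Z' : Set H} {I : Type*} {z : I → H}

theorem orbitSet_subset (D : OrbitDecomposition j Q Z Z' z) {h : H} (hh : h ∈ Z \ Z') :
    orbitSet j Q h ⊆ Z \ Z' := by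
  rintro _ ⟨q, hq, g, rfl⟩
  refine ⟨D.mul_mem q hq h hh.1 g, fun hn => hh.2 ?_⟩
  have := D.mul_mem' q⁻¹ (Q.inv_mem hq) _ hn g⁻¹
  simpa [mul_assoc] using this

theorem orbitSet_trans {h h' : H} (hh : h' ∈ orbitSet j Q h) : orbitSet j Q h' = orbitSet j Q h := by
  obtain ⟨q, hq, g, rfl⟩ := hh
  ext x
  constructor
  · rintro ⟨q', hq', g', rfl⟩
    exact ⟨q' * q, Q.mul_mem hq' hq, g * g', by simp [mul_assoc]⟩
  · rintro ⟨q', hq', g', rfl⟩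
    exact ⟨q' * q⁻¹, Q.mul_mem hq' (Q.inv_mem hq), g⁻¹ * g', by simp [mul_assoc]⟩

theorem isLocallyClosed (D : OrbitDecomposition j Q Z Z' z) {h : H} (hh : h ∈ Z \ Z') :
    IsLocallyClosed (orbitSet j Q h) := by
  have hsub := D.orbitSet_subset hh
  have key : ∀ x ∈ orbitSet j Q h, ∃ O : Set H, IsOpen O ∧ x ∈ O ∧ O ∩ (Z \ Z') ⊆ orbitSet j Q h := by
    intro x hx
    have h1 := D.open_orbit x (hsub hx)
    rw [orbitSet_trans hx] at h1
    obtain ⟨O, hO, hxO, hOs⟩ := mem_nhdsWithin.1 h1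
    exact ⟨O, hO, hxO, hOs⟩
  choose O hO hxO hOs using key
  refine ⟨(⋃ x, ⋃ hx, O x hx) ∩ Z'ᶜ, Z, ?_, D.isClosed, ?_⟩
  · exact (isOpen_iUnion fun x => isOpen_iUnion fun hx => hO x hx).inter D.isClosed'.isOpen_compl
  · ext x
    constructor
    · intro hx
      exact ⟨⟨Set.mem_iUnion₂.2 ⟨x, hx, hxO x hx⟩, (hsub hx).2⟩, (hsub hx).1⟩
    · rintro ⟨⟨hx1, hx2⟩, hx3⟩
      obtain ⟨y, hy, hxy⟩ := Set.mem_iUnion₂.1 hx1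
      exact hOs y hy ⟨hxy, hx3, hx2⟩

theorem eventually_nhdsWithin (D : OrbitDecomposition j Q Z Z' z)
    [T2Space H] [LocallyCompactSpace H] [SigmaCompactSpace H]
    [SigmaCompactSpace G] (hj : Continuous j) (hQ : IsClosed (Q : Set H)) {h : H} (hh : h ∈ Z \ Z')
    {V : Set H} (hV : V ∈ 𝓝 1) {W : Set G} (hW : W ∈ 𝓝 1) :
    ∀ᶠ x in 𝓝[Z] h, ∃ q ∈ Q, q ∈ V ∧ ∃ g ∈ W, x = q * h * j g := by
  have h1 := eventually_mem_mul_mul hj hQ (D.isLocallyClosed hh) hV hW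
  have h2 : ∀ᶠ x in 𝓝[Z \ Z'] h, ∃ q ∈ Q, q ∈ V ∧ ∃ g ∈ W, x = q * h * j g := by
    rw [eventually_nhdsWithin_iff] at h1
    filter_upwards [D.open_orbit h hh, nhdsWithin_le_nhds h1] with x hx1 hx2
    exact hx2 hx1
  have h3 : ∀ᶠ x in 𝓝 h, x ∉ Z' := D.isClosed'.isOpen_compl.mem_nhds hh.2
  rw [eventually_nhdsWithin_iff] at h2 ⊢
  filter_upwards [h2, h3] with x hx1 hx2 hx3
  exact hx1 ⟨hx3, hx2⟩

end OrbitDecomposition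

end CompactInduction

section StratumSections

open Topology Filter

variable {G H : Type*} [Group G] [TopologicalSpace G] [IsTopologicalGroup G]
  [Group H] [TopologicalSpace H] [IsTopologicalGroup H] [T2Space H] [LocallyCompactSpace H]
  [SigmaCompactSpace H] [TotallyDisconnectedSpace H] [T2Space G] [LocallyCompactSpace G]
  [SigmaCompactSpace G] [TotallyDisconnectedSpace G]

/-- An equivariant function on a closed set `Z` that is locally constant extends to a section of
the induced representation. -/
theorem exists_extension {Q : Subgroup H} {χ : Q →* ℂ} {K0 : Set H}
    (hK0 : IsCompact K0) (hK : ∀ h : H, ∃ q ∈ Q, ∃ k ∈ K0, h = q * k) {Z : Set H}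
    (hZ : IsClosed Z) (hQZ : ∀ q ∈ Q, ∀ h ∈ Z, q * h ∈ Z) (f0 : H → ℂ)
    (h1 : ∀ (q : Q), ∀ h ∈ Z, f0 (q * h) = χ q * f0 h)
    (h2 : ∀ h ∈ Z, ∀ᶠ x in 𝓝[Z] h, f0 x = f0 h) :
    ∃ f : H → ℂ, (∀ (q : Q) (h : H), f (q * h) = χ q * f h) ∧
      (∃ U : Subgroup H, IsOpen (U : Set H) ∧ ∀ u ∈ U, ∀ g, f (g * u) = f g) ∧
      ∀ h ∈ Z, f h = f0 h := by
  classical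
  have key : ∀ h ∈ Z, ∃ U : Subgroup H, IsOpen (U : Set H) ∧ ∀ u ∈ U, h * u ∈ Z → f0 (h * u) = f0 h := by
    intro h hh
    have := h2 h hh
    rw [eventually_nhdsWithin_iff] at this
    have h3 : {u : H | h * u ∈ Z → f0 (h * u) = f0 h} ∈ 𝓝 (1 : H) := by
      have hc : ContinuousAt (fun u : H => h * u) 1 := (continuous_const_mul h).continuousAt
      exact hc.preimage_mem_nhds (by rw [mul_one]; exact this)
    obtain ⟨U, hU, -, hUs⟩ := exists_compact_open_subgroup h3
    exact ⟨U, hU, fun u hu => hUs hu⟩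
  choose! U hU hUf using key
  have hcomp : IsCompact (K0 ∩ Z) := hK0.inter_right hZ
  obtain ⟨t, htZ, ht⟩ := hcomp.elim_nhds_subcover (fun h => h • (U h : Set H)) (fun h hh =>
    ((hU h hh.2).smul h).mem_nhds ⟨1, (U h).one_mem, by simp⟩)
  let V : Subgroup H := ⨅ h : t, U h
  have hV : IsOpen (V : Set H) := by
    have : (V : Set H) = ⋂ h : t, (U h : Set H) := by simp [V]
    rw [this]
    exact isOpen_iInter_of_finite fun h => hU h (htZ h h.2).2
  have hinv : ∀ h ∈ Z, ∀ v ∈ V, h * v ∈ Z → f0 (h * v) = f0 h := by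
    intro h hh v hv hhv
    obtain ⟨q, hq, k, hk, rfl⟩ := hK h
    have hkZ : k ∈ Z := by simpa using hQZ q⁻¹ (Q.inv_mem hq) _ hh
    have hkvZ : k * v ∈ Z := by simpa [mul_assoc] using hQZ q⁻¹ (Q.inv_mem hq) _ hhv
    obtain ⟨x, hx, u, hu, e⟩ := Set.mem_iUnion₂.1 (ht ⟨hk, hkZ⟩)
    have e' : x * u = k := e
    have hvx : v ∈ U x := by
      have := (Subgroup.mem_iInf.1 hv) ⟨x, hx⟩
      exact this
    have a1 : f0 k = f0 x := by
      rw [← e']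
      exact hUf x (htZ x hx).2 u hu (by rw [e']; exact hkZ)
    have a2 : f0 (k * v) = f0 x := by
      rw [← e', mul_assoc]
      exact hUf x (htZ x hx).2 (u * v) ((U x).mul_mem hu hvx) (by rw [← mul_assoc, e']; exact hkvZ)
    have b1 := h1 ⟨q, hq⟩ k hkZ
    have b2 := h1 ⟨q, hq⟩ (k * v) hkvZ
    rw [mul_assoc]
    exact b2.trans (by rw [a2, ← a1]; exact b1.symm)
  let f : H → ℂ := fun h => if hh : ∃ v ∈ V, h * v ∈ Z then f0 (h * hh.choose) else 0
  have hf : ∀ h, ∀ v ∈ V, h * v ∈ Z → f h = f0 (h * v) := by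
    intro h v hv hhv
    have hh : ∃ v ∈ V, h * v ∈ Z := ⟨v, hv, hhv⟩
    have e : f h = f0 (h * hh.choose) := dif_pos hh
    rw [e]
    have := hinv _ hhv (v⁻¹ * hh.choose) (V.mul_mem (V.inv_mem hv) hh.choose_spec.1)
      (by simpa [mul_assoc] using hh.choose_spec.2)
    simpa [mul_assoc] using this
  have hf0 : ∀ h, (¬ ∃ v ∈ V, h * v ∈ Z) → f h = 0 := fun h hh => dif_neg hh
  refine ⟨f, fun q h => ?_, ⟨V, hV, fun u hu h => ?_⟩, fun h hh => ?_⟩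
  · by_cases hh : ∃ v ∈ V, h * v ∈ Z
    · obtain ⟨v, hv, hhv⟩ := hh
      have := hQZ q q.2 _ hhv
      rw [← mul_assoc] at this
      rw [hf _ v hv hhv, hf _ v hv this, mul_assoc, h1 q _ hhv]
    · rw [hf0 h hh, hf0, mul_zero]
      rintro ⟨v, hv, hhv⟩
      exact hh ⟨v, hv, by simpa [mul_assoc] using hQZ _ (Q.inv_mem q.2) _ hhv⟩
  · by_cases hh : ∃ v ∈ V, h * v ∈ Z
    · obtain ⟨v, hv, hhv⟩ := hh
      rw [hf _ v hv hhv, hf _ (u⁻¹ * v) (V.mul_mem (V.inv_mem hu) hv) (by simpa [mul_assoc] using hhv)]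
      simp [mul_assoc]
    · rw [hf0 h hh, hf0]
      rintro ⟨v, hv, hhv⟩
      exact hh ⟨u * v, V.mul_mem hu hv, by simpa [mul_assoc] using hhv⟩
  · rw [hf h 1 V.one_mem (by simpa using hh), mul_one]

namespace OrbitDecomposition

variable {j : G →* H} {Q : Subgroup H} {Z Z' : Set H} {I : Type*} {z : I → H}

theorem exists_lift (D : OrbitDecomposition j Q Z Z' z) (hj : Continuous j)
    (hQ : IsClosed (Q : Set H)) {χ : Q →* ℂ}
    (hχ : ∃ V ∈ 𝓝 (1 : H), ∀ q : Q, (q : H) ∈ V → χ q = 1) {K0 : Set H}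
    (hK0 : IsCompact K0) (hK : ∀ h : H, ∃ q ∈ Q, ∃ k ∈ K0, h = q * k) (i : I) {φ : G → ℂ}
    (hφ : φ ∈ compInd (stabAt j Q (z i)) (charAt j χ (z i))) :
    ∃ f : H → ℂ, (∀ (q : Q) (h : H), f (q * h) = χ q * f h) ∧
      (∃ U : Subgroup H, IsOpen (U : Set H) ∧ ∀ u ∈ U, ∀ g, f (g * u) = f g) ∧
      (∀ h ∈ Z', f h = 0) ∧ (∀ g, f (z i * j g) = φ g) ∧
      ∀ i', i' ≠ i → ∀ g, f (z i' * j g) = 0 := by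
  classical
  obtain ⟨hφ1, ⟨U, hU, hφ2⟩, C, hC, hφ3⟩ := hφ
  obtain ⟨V, hV, hχV⟩ := hχ
  let T := orbitSet j Q (z i)
  have hT : T ⊆ Z \ Z' := D.orbitSet_subset (D.rep_mem i)
  let f0 : H → ℂ := fun h => if hh : ∃ (q : Q) (g : G), h = q * z i * j g then
    χ hh.choose * φ hh.choose_spec.choose else 0
  have hwd : ∀ (q q' : Q) (g g' : G), (q : H) * z i * j g = q' * z i * j g' →
      χ q * φ g = χ q' * φ g' := by
    intro q q' g g' e
    have e2 : z i * j (g' * g⁻¹) * (z i)⁻¹ = ((q'⁻¹ * q : Q) : H) := by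
      have : z i * j g' = (q' : H)⁻¹ * (q * z i * j g) := by rw [e]; group
      rw [map_mul, ← mul_assoc, this, map_inv]
      push_cast
      group
    have hs : g' * g⁻¹ ∈ stabAt j Q (z i) := by
      rw [mem_stabAt, e2]
      exact (q'⁻¹ * q : Q).2
    have h3 := hφ1 ⟨g' * g⁻¹, hs⟩ g
    have h4 : charAt j χ (z i) ⟨g' * g⁻¹, hs⟩ = χ (q'⁻¹ * q) := by
      change χ _ = χ _
      congr 1
      exact Subtype.ext e2
    rw [h4] at h3
    simp only [inv_mul_cancel_right] at h3
    rw [h3, ← mul_assoc, ← map_mul]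
    simp
  have hf0 : ∀ (q : Q) (g : G), f0 (q * z i * j g) = χ q * φ g := by
    intro q g
    have hh : ∃ (q' : Q) (g' : G), (q : H) * z i * j g = q' * z i * j g' := ⟨q, g, rfl⟩
    have e : f0 (q * z i * j g) = χ hh.choose * φ hh.choose_spec.choose := dif_pos hh
    rw [e]
    exact (hwd _ _ _ _ hh.choose_spec.choose_spec).symm
  have hf0n : ∀ h, h ∉ T → f0 h = 0 := by
    intro h hh
    refine dif_neg ?_
    rintro ⟨q, g, e⟩
    exact hh ⟨q, q.2, g, e⟩
  have hclosed : IsClosed (Function.support f0) := by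
    have hsupp : IsClosed (Function.support φ) := by
      rw [← isOpen_compl_iff, isOpen_iff_mem_nhds]
      intro g hg
      filter_upwards [(hU.smul g).mem_nhds ⟨1, U.one_mem, by simp⟩] with x hx
      obtain ⟨u, hu, rfl⟩ := hx
      have : φ (g * u) = φ g := hφ2 u hu g
      simpa [this] using hg
    have hC' : IsCompact ((fun g => z i * j g) '' (C ∩ Function.support φ)) :=
      (hC.inter_right hsupp).image (by fun_prop)
    have e : Function.support f0 =
        (Q : Set H) * ((fun g => z i * j g) '' (C ∩ Function.support φ)) := by
      ext h
      constructor
      · intro hh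
        have hhT : h ∈ T := by
          by_contra hn
          exact hh (hf0n h hn)
        obtain ⟨q, hq, g, rfl⟩ := hhT
        have hg : φ g ≠ 0 := by
          intro h0
          refine hh ?_
          rw [hf0 ⟨q, hq⟩, h0, mul_zero]
        obtain ⟨s, hs, c, hc, e⟩ := hφ3 hg
        have e' : s * c = g := e
        have hc0 : φ c ≠ 0 := by
          intro h0
          apply hg
          rw [← e', hφ1 ⟨s, hs⟩, h0, mul_zero]
        refine ⟨q * (z i * j s * (z i)⁻¹), Q.mul_mem hq hs, _, ⟨c, ⟨hc, hc0⟩, rfl⟩, ?_⟩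
        change q * (z i * j s * (z i)⁻¹) * (z i * j c) = q * z i * j g
        rw [← e', map_mul]
        group
      · rintro ⟨q, hq, _, ⟨c, ⟨hc, hc0⟩, rfl⟩, rfl⟩
        have : f0 (q * (z i * j c)) = χ ⟨q, hq⟩ * φ c := by
          rw [← mul_assoc]
          exact hf0 ⟨q, hq⟩ c
        change f0 (q * (z i * j c)) ≠ 0
        rw [this]
        refine mul_ne_zero (fun h0 => ?_) hc0
        have := map_mul χ ⟨q, hq⟩ ⟨q, hq⟩⁻¹
        rw [mul_inv_cancel, map_one, h0, zero_mul] at this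
        exact one_ne_zero this
    rw [e]
    exact hQ.mul_right_of_isCompact hC'
  have hA : ∀ (q : Q), ∀ h ∈ Z, f0 (q * h) = χ q * f0 h := by
    intro q h hh
    by_cases hhT : h ∈ T
    · obtain ⟨q', hq', g, rfl⟩ := hhT
      have e1 := hf0 ⟨q', hq'⟩ g
      have e2 := hf0 (q * ⟨q', hq'⟩) g
      simp only [Subgroup.coe_mul] at e1 e2
      rw [e1, ← mul_assoc, ← mul_assoc, e2, map_mul, mul_assoc]
    · rw [hf0n h hhT, hf0n, mul_zero]
      rintro ⟨q', hq', g, e⟩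
      refine hhT ⟨q⁻¹ * q', Q.mul_mem (Q.inv_mem q.2) hq', g, ?_⟩
      rw [mul_assoc, mul_assoc, ← mul_assoc q', ← e]
      simp
  have hB : ∀ h ∈ Z, ∀ᶠ x in 𝓝[Z] h, f0 x = f0 h := by
    intro h hh
    by_cases hhT : h ∈ T
    · filter_upwards [D.eventually_nhdsWithin hj hQ (hT hhT) hV (hU.mem_nhds U.one_mem)] with x hx
      obtain ⟨q, hq, hqV, g, hg, rfl⟩ := hx
      obtain ⟨q', hq', g', rfl⟩ := hhT
      have e1 := hf0 ⟨q', hq'⟩ g'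
      have e2 := hf0 (⟨q, hq⟩ * ⟨q', hq'⟩) (g' * g)
      simp only [Subgroup.coe_mul] at e1 e2
      have e3 : q * (q' * z i * j g') * j g = q * q' * z i * j (g' * g) := by
        rw [map_mul]; group
      rw [e3, e1, e2, hφ2 g hg, map_mul, hχV ⟨q, hq⟩ hqV, one_mul]
    · rw [hf0n h hhT]
      have : ∀ᶠ x in 𝓝 h, f0 x = 0 := by
        filter_upwards [hclosed.isOpen_compl.mem_nhds (x := h) (by simpa using hf0n h hhT)] with x hx
        simpa using hx
      exact nhdsWithin_le_nhds this
  obtain ⟨f, hf1, hf2, hf3⟩ := exists_extension (Q := Q) (χ := χ) hK0 hK D.isClosed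
    (fun q hq h hh => by simpa using D.mul_mem q hq h hh 1) f0 hA hB
  refine ⟨f, hf1, hf2, fun h hh => ?_, fun g => ?_, fun i' hi' g => ?_⟩
  · rw [hf3 h (D.subset hh)]
    exact hf0n h fun hn => (hT hn).2 hh
  · rw [hf3]
    · simpa using hf0 1 g
    · exact (hT ⟨1, Q.one_mem, g, by simp⟩).1
  · rw [hf3]
    · refine hf0n _ fun hn => hi' ?_
      refine (D.eq_of_mem i i' ?_).symm
      obtain ⟨q, hq, g', e⟩ := hn
      refine ⟨q, hq, g' * g⁻¹, ?_⟩
      rw [map_mul, ← mul_assoc, ← e]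
      simp
    · exact (D.orbitSet_subset (D.rep_mem i') ⟨1, Q.one_mem, g, by simp⟩).1

/-- The support in `Z` of a section that vanishes on `Z'` is contained in finitely many sets
`Q h j(W)` with `W` compact. -/
theorem exists_finite_cover (D : OrbitDecomposition j Q Z Z' z) (hj : Continuous j)
    (hQ : IsClosed (Q : Set H)) {χ : Q →* ℂ} {K0 : Set H}
    (hK0 : IsCompact K0) (hK : ∀ h : H, ∃ q ∈ Q, ∃ k ∈ K0, h = q * k) {f : H → ℂ}
    (hf1 : ∀ (q : Q) (h : H), f (q * h) = χ q * f h)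
    (hf2 : ∃ U : Subgroup H, IsOpen (U : Set H) ∧ ∀ u ∈ U, ∀ g, f (g * u) = f g)
    (hf3 : ∀ h ∈ Z', f h = 0) :
    ∃ (t : Finset H) (W : Set G), IsCompact W ∧ (∀ h ∈ t, h ∈ Z \ Z') ∧
      ∀ h ∈ Z, f h ≠ 0 → ∃ h' ∈ t, ∃ q ∈ Q, ∃ w ∈ W, h = q * h' * j w := by
  obtain ⟨W, hWc, hW⟩ := exists_compact_mem_nhds (1 : G)
  obtain ⟨U, hU, hf2⟩ := hf2
  have hsupp : IsClosed (Function.support f) := by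
    rw [← isOpen_compl_iff, isOpen_iff_mem_nhds]
    intro g hg
    filter_upwards [(hU.smul g).mem_nhds ⟨1, U.one_mem, by simp⟩] with x hx
    obtain ⟨u, hu, rfl⟩ := hx
    have : f (g * u) = f g := hf2 u hu g
    simpa [this] using hg
  have hcomp : IsCompact (K0 ∩ (Z ∩ Function.support f)) := hK0.inter_right (D.isClosed.inter hsupp)
  have hmem : ∀ h ∈ K0 ∩ (Z ∩ Function.support f), h ∈ Z \ Z' := fun h hh =>
    ⟨hh.2.1, fun hn => hh.2.2 (hf3 h hn)⟩
  obtain ⟨t, htZ, ht⟩ := hcomp.elim_nhdsWithin_subcover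
    (fun h => {x | ∃ q ∈ Q, ∃ w ∈ W, x = q * h * j w}) (fun h hh => by
      have := D.eventually_nhdsWithin hj hQ (hmem h hh) univ_mem hW
      refine mem_of_superset (nhdsWithin_mono h ?_ this) ?_
      · exact fun x hx => hx.2.1
      · rintro x ⟨q, hq, -, w, hw, e⟩
        exact ⟨q, hq, w, hw, e⟩)
  refine ⟨t, W, hWc, fun h hh => hmem h (htZ h hh), fun h hh hfh => ?_⟩
  obtain ⟨q, hq, k, hk, rfl⟩ := hK h
  have hkZ : k ∈ Z := by simpa using D.mul_mem q⁻¹ (Q.inv_mem hq) _ hh 1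
  have hfk : f k ≠ 0 := by
    intro h0
    apply hfh
    have := hf1 ⟨q, hq⟩ k
    rw [h0, mul_zero] at this
    exact this
  obtain ⟨x, hx, q', hq', w, hw, e⟩ := Set.mem_iUnion₂.1 (ht ⟨hk, hkZ, hfk⟩)
  exact ⟨x, hx, q * q', Q.mul_mem hq hq', w, hw, by rw [e]; group⟩

end OrbitDecomposition

end StratumSections

section DirectSums

variable {G I : Type*} [Group G] {V W : I → Type*} [∀ i, AddCommMonoid (V i)] [∀ i, Module ℂ (V i)]
  [∀ i, AddCommMonoid (W i)] [∀ i, Module ℂ (W i)]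

theorem nonempty_directSum_equiv (ρ : ∀ i, Representation ℂ G (V i))
    (σ : ∀ i, Representation ℂ G (W i)) (e : ∀ i, Nonempty ((ρ i).Equiv (σ i))) :
    Nonempty ((Representation.directSum ρ).Equiv (Representation.directSum σ)) := by
  let e' := fun i => (e i).some
  refine ⟨Representation.Equiv.mk
    (DFinsupp.mapRange.linearEquiv fun i => (e' i).toLinearEquiv) fun g => ?_⟩
  refine LinearMap.ext fun x => DFinsupp.ext fun i => ?_
  exact LinearMap.congr_fun ((e' i).isIntertwining' g) (x i)

theorem nonempty_directSum_unique [Unique I] (ρ : ∀ i, Representation ℂ G (V i)) :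
    Nonempty ((Representation.directSum ρ).Equiv (ρ default)) := by
  classical
  refine ⟨Representation.Equiv.mk (LinearEquiv.ofBijective
    (DirectSum.component ℂ I V default) ⟨fun x y h => ?_, fun v => ?_⟩) fun g => ?_⟩
  · refine DFinsupp.ext fun i => ?_
    rw [Unique.eq_default i]
    exact h
  · exact ⟨DirectSum.lof ℂ I V default v, DirectSum.component.lof_self ℂ _ v⟩
  · rfl

end DirectSums

section StratumQuotient

open Topology Filter

variable {G H : Type*} [Group G] [TopologicalSpace G] [IsTopologicalGroup G]
  [Group H] [TopologicalSpace H] [IsTopologicalGroup H] [T2Space H] [LocallyCompactSpace H]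
  [SigmaCompactSpace H] [TotallyDisconnectedSpace H] [T2Space G] [LocallyCompactSpace G]
  [SigmaCompactSpace G] [TotallyDisconnectedSpace G]
  {j : G →* H} {Q : Subgroup H} {Z Z' : Set H} {I : Type*} {z : I → H}

/-- Restriction of sections to the stratum `Z \ Z'` identifies the sections vanishing on `Z'`,
modulo those vanishing on `Z`, with the direct sum of the compact inductions attached to the
orbits. -/
theorem OrbitDecomposition.exists_restriction (D : OrbitDecomposition j Q Z Z' z)
    (hj : Continuous j) (hQ : IsClosed (Q : Set H)) {χ : Q →* ℂ}
    (hχ : ∃ V ∈ 𝓝 (1 : H), ∀ q : Q, (q : H) ∈ V → χ q = 1) {K0 : Set H}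
    (hK0 : IsCompact K0) (hK : ∀ h : H, ∃ q ∈ Q, ∃ k ∈ K0, h = q * k)
    {A : Submodule ℂ (H → ℂ)}
    (hA : ∀ f, f ∈ A ↔ (∀ (q : Q) (h : H), f (q * h) = χ q * f h) ∧
      (∃ U : Subgroup H, IsOpen (U : Set H) ∧ ∀ u ∈ U, ∀ g, f (g * u) = f g) ∧
      ∀ h ∈ Z', f h = 0)
    (ρ : Representation ℂ G A) (hρ : ∀ g (f : A) h, (ρ g f).1 h = f.1 (h * j g)) :
    ∃ Θ : A →ₗ[ℂ] ⨁ i, compInd (stabAt j Q (z i)) (charAt j χ (z i)),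
      Function.Surjective Θ ∧ (∀ f, Θ f = 0 ↔ ∀ h ∈ Z, f.1 h = 0) ∧
      ∀ g f, Θ (ρ g f) =
        Representation.directSum (fun i => compIndRep (stabAt j Q (z i)) (charAt j χ (z i))) g
          (Θ f) := by
  classical
  let Vi : I → Submodule ℂ (G → ℂ) := fun i => compInd (stabAt j Q (z i)) (charAt j χ (z i))
  let ev : (⨁ i, Vi i) →ₗ[ℂ] (I → G → ℂ) :=
    LinearMap.pi fun i => (Vi i).subtype ∘ₗ DirectSum.component ℂ I (fun i => Vi i) i
  have hev : ∀ x i, ev x i = (x i).1 := fun _ _ => rfl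
  have hevinj : Function.Injective ev := by
    intro x y h
    exact DFinsupp.ext fun i => Subtype.ext (congrFun h i)
  let T : A →ₗ[ℂ] (I → G → ℂ) :=
    { toFun := fun f i g => f.1 (z i * j g)
      map_add' := fun _ _ => rfl
      map_smul' := fun _ _ => rfl }
  have hT : ∀ f i g, T f i g = f.1 (z i * j g) := fun _ _ _ => rfl
  have hle : ∀ f, T f ∈ LinearMap.range ev := by
    intro f
    obtain ⟨hf1, ⟨U, hU, hf2⟩, hf3⟩ := (hA f).1 f.2
    obtain ⟨t, W, hW, ht, hcov⟩ := D.exists_finite_cover hj hQ hK0 hK hf1 ⟨U, hU, hf2⟩ hf3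
    choose idx q hq a hidx using fun h : t => D.exists_eq h (ht h h.2)
    have hcov2 : ∀ i g, T f i g ≠ 0 → ∃ h : t, idx h = i ∧ ∃ s ∈ stabAt j Q (z i), ∃ w ∈ W,
        g = s * (a h * w) := by
      intro i g hg
      have hmem : z i * j g ∈ Z :=
        (D.orbitSet_subset (D.rep_mem i) ⟨1, Q.one_mem, g, by simp⟩).1
      obtain ⟨h', hh, p, hp, w, hw, e⟩ := hcov _ hmem hg
      let h : t := ⟨h', hh⟩
      have hx : h' = q h * z (idx h) * j (a h) := hidx h
      have hi : idx h = i := by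
        refine (D.eq_of_mem _ _ ⟨p * q h, Q.mul_mem hp (hq h), a h * w * g⁻¹, ?_⟩)
        rw [eq_comm, map_mul, ← mul_assoc, map_inv, mul_inv_eq_iff_eq_mul, e]
        conv_rhs => rw [hx]
        rw [map_mul]
        group
      refine ⟨h, hi, g * (a h * w)⁻¹, ?_, w, hw, by group⟩
      have e2 : z i * j (g * (a h * w)⁻¹) * (z i)⁻¹ = p * q h := by
        rw [map_mul, ← mul_assoc, e, mul_assoc]
        conv_lhs => rw [hx, hi]
        rw [map_inv, map_mul]
        group
      rw [mem_stabAt, e2]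
      exact Q.mul_mem hp (hq h)
    have hmem : ∀ i, T f i ∈ Vi i := by
      intro i
      refine ⟨fun s g => ?_, ⟨U.comap j, hU.preimage hj, fun u hu g => ?_⟩,
        ⋃ h : t, (fun w => a h * w) '' W, isCompact_iUnion fun h =>
          hW.image (continuous_const_mul _), fun g hg => ?_⟩
      · have := hf1 ⟨z i * j s * (z i)⁻¹, s.2⟩ (z i * j g)
        rw [hT, hT, map_mul]
        refine Eq.trans ?_ this
        simp [mul_assoc]
      · rw [hT, hT, map_mul, ← mul_assoc, hf2 _ hu]
      · obtain ⟨h, -, s, hs, w, hw, e⟩ := hcov2 i g hg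
        exact ⟨s, hs, _, Set.mem_iUnion.2 ⟨h, w, hw, rfl⟩, e.symm⟩
    have hzero : ∀ i, i ∉ t.attach.image idx → T f i = 0 := by
      intro i hi
      by_contra hne
      obtain ⟨g, hg⟩ := Function.ne_iff.1 hne
      obtain ⟨h, e, -⟩ := hcov2 i g hg
      exact hi (Finset.mem_image.2 ⟨h, Finset.mem_attach _ _, e⟩)
    refine ⟨DirectSum.mk (fun i => Vi i) (t.attach.image idx) fun i => ⟨T f i, hmem i⟩, ?_⟩
    funext i
    rw [hev]
    by_cases hi : i ∈ t.attach.image idx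
    · rw [DirectSum.mk_apply_of_mem hi]
    · rw [DirectSum.mk_apply_of_notMem hi, hzero i hi]
      rfl
  let e := LinearEquiv.ofInjective ev hevinj
  let Θ : A →ₗ[ℂ] ⨁ i, Vi i := (e.symm : _ →ₗ[ℂ] _) ∘ₗ T.codRestrict (LinearMap.range ev) hle
  have hΘ : ∀ f, ev (Θ f) = T f := by
    intro f
    have : e (Θ f) = T.codRestrict (LinearMap.range ev) hle f := e.apply_symm_apply _
    exact congrArg Subtype.val this
  refine ⟨Θ, fun x => ?_, fun f => ?_, fun g f => ?_⟩
  · induction x using DirectSum.induction_on with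
    | zero => exact ⟨0, map_zero Θ⟩
    | add x y hx hy =>
      obtain ⟨f, rfl⟩ := hx
      obtain ⟨f', rfl⟩ := hy
      exact ⟨f + f', map_add Θ f f'⟩
    | of i φ =>
      obtain ⟨f, hf1, hf2, hf3, hf4, hf5⟩ := D.exists_lift hj hQ hχ hK0 hK i φ.2
      refine ⟨⟨f, (hA f).2 ⟨hf1, hf2, hf3⟩⟩, hevinj ?_⟩
      rw [hΘ]
      funext i' g
      rw [hT, hev]
      by_cases hi : i' = i
      · subst hi
        rw [DirectSum.of_eq_same]
        exact hf4 g
      · rw [DirectSum.of_eq_of_ne _ _ _ hi]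
        exact hf5 i' hi g
  · rw [← map_eq_zero_iff ev hevinj, hΘ]
    obtain ⟨hf1, -, hf3⟩ := (hA f).1 f.2
    constructor
    · intro h0 h hh
      by_cases hh' : h ∈ Z'
      · exact hf3 h hh'
      · obtain ⟨i, q, hq, g, rfl⟩ := D.exists_eq h ⟨hh, hh'⟩
        have := hf1 ⟨q, hq⟩ (z i * j g)
        simp only at this
        rw [mul_assoc, this]
        have h2 : T f i g = 0 := by rw [h0]; rfl
        rw [hT] at h2
        rw [h2, mul_zero]
    · intro h0
      funext i g
      exact h0 _ (D.orbitSet_subset (D.rep_mem i) ⟨1, Q.one_mem, g, by simp⟩).1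
  · apply hevinj
    rw [hΘ]
    funext i x
    rw [hT, hρ, hev]
    have h1 := congrFun (congrFun (hΘ f) i) (x * g)
    rw [hev, hT, map_mul, ← mul_assoc] at h1
    exact h1.symm

theorem ccInf_eq_compInd (S : Subgroup G) : ccInf S = compInd S 1 := by
  ext φ
  constructor
  · rintro ⟨h1, h2, C, hC, h3⟩
    refine ⟨fun s g => by simpa using h1 s s.2 g, ?_, C, hC, h3⟩
    have key : ∀ c : G, ∃ U : Subgroup G, IsOpen (U : Set G) ∧ ∀ u ∈ U, φ (c * u) = φ c := by
      intro c
      have h4 : {u : G | φ (c * u) = φ c} ∈ 𝓝 (1 : G) := by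
        have hc : ContinuousAt (fun u : G => c * u) 1 := (continuous_const_mul c).continuousAt
        have := (IsLocallyConstant.iff_eventually_eq φ).1 h2 c
        exact hc.preimage_mem_nhds (t := {x | φ x = φ c}) (by rw [mul_one]; exact this)
      obtain ⟨U, hU, -, hUs⟩ := exists_compact_open_subgroup h4
      exact ⟨U, hU, fun u hu => hUs hu⟩
    choose U hU hUφ using key
    obtain ⟨t, -, ht⟩ := hC.elim_nhds_subcover (fun c => c • (U c : Set G)) (fun c _ =>
      ((hU c).smul c).mem_nhds ⟨1, (U c).one_mem, by simp⟩)
    let V : Subgroup G := ⨅ c : t, U c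
    have hV : IsOpen (V : Set G) := by
      have : (V : Set G) = ⋂ c : t, (U c : Set G) := by simp [V]
      rw [this]
      exact isOpen_iInter_of_finite fun c => hU c
    have hVC : ∀ c ∈ C, ∀ v ∈ V, φ (c * v) = φ c := by
      intro c hc v hv
      obtain ⟨x, hx, u, hu, e⟩ := Set.mem_iUnion₂.1 (ht hc)
      have e' : x * u = c := e
      have hvx : v ∈ U x := (Subgroup.mem_iInf.1 hv) ⟨x, hx⟩
      rw [← e', mul_assoc, hUφ x _ ((U x).mul_mem hu hvx), hUφ x u hu]
    have hne : ∀ g, φ g ≠ 0 → ∀ v ∈ V, φ (g * v) = φ g := by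
      intro g hg v hv
      obtain ⟨s, hs, c, hc, e⟩ := h3 hg
      have e' : s * c = g := e
      rw [← e', mul_assoc, h1 s hs, h1 s hs, hVC c hc v hv]
    refine ⟨V, hV, fun u hu g => ?_⟩
    by_cases hg : φ g = 0
    · by_contra hgu
      have h5 : φ (g * u) ≠ 0 := fun h0 => hgu (by rw [h0, hg])
      have := hne _ h5 u⁻¹ (V.inv_mem hu)
      rw [mul_inv_cancel_right] at this
      exact hgu this.symm
    · exact hne g hg u hu
  · rintro ⟨h1, ⟨U, hU, h2⟩, C, hC, h3⟩
    refine ⟨fun s hs g => by simpa using h1 ⟨s, hs⟩ g, ?_, C, hC, h3⟩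
    rw [IsLocallyConstant.iff_eventually_eq]
    intro g
    filter_upwards [(hU.smul g).mem_nhds ⟨1, U.one_mem, by simp⟩] with x hx
    obtain ⟨u, hu, rfl⟩ := hx
    exact h2 u hu g

theorem nonempty_compInd_equiv_ccInf (S : Subgroup G) (χ : S →* ℂ) (hχ : χ = 1) :
    Nonempty ((compIndRep S χ).Equiv (ccInfRep S)) := by
  subst hχ
  exact ⟨Representation.Equiv.mk (LinearEquiv.ofEq _ _ (ccInf_eq_compInd S).symm)
    fun g => LinearMap.ext fun x => rfl⟩

end StratumQuotient

section Stages

open Topology Filter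

variable {G L : Type*} [Group G] [TopologicalSpace G] [IsTopologicalGroup G]
  [T2Space G] [LocallyCompactSpace G] [TotallyDisconnectedSpace G]
  [Group L] [TopologicalSpace L] [IsTopologicalGroup L]
  [T2Space L] [LocallyCompactSpace L] [TotallyDisconnectedSpace L]

/-- Induction in stages: compact induction from the preimage `S` in `R` of a subgroup `T` of a
quotient `L` of `R`, for a cocompact subgroup `R`. -/
theorem nonempty_compInd_equiv_unInd {R : Subgroup G} (hR : IsClosed (R : Set G)) {K1 : Set G}
    (hK1 : IsCompact K1) (hK : ∀ g : G, ∃ p ∈ R, ∃ k ∈ K1, g = p * k)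
    (l : R →* L) (hl : Continuous l) (jj : L →* R) (hjj : Continuous jj) (hlj : ∀ m, l (jj m) = m)
    (ψ : R →* ℂ) (hψ : ∀ m, ψ (jj m) = 1) (T : Subgroup L) {S : Subgroup G}
    (hS : ∀ g, g ∈ S ↔ ∃ hg : g ∈ R, l ⟨g, hg⟩ ∈ T) (χ : S →* ℂ)
    (hχ : ∀ (s : S) (hs : (s : G) ∈ R), χ s = ψ ⟨s, hs⟩)
    (σ : Representation ℂ R (ccInf T))
    (hσ : ∀ p (f : ccInf T) m, (σ p f).1 m = ψ p * f.1 (m * l p)) :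
    Nonempty ((compIndRep S χ).Equiv (unIndRep σ)) := by
  have hjS : ∀ m ∈ T, ((jj m : R) : G) ∈ S := fun m hm =>
    (hS _).2 ⟨(jj m).2, by
      have : l ⟨jj m, (jj m).2⟩ = m := hlj m
      rwa [this]⟩
  have hfwd : ∀ φ ∈ compInd S χ, ∀ g : G, (fun m : L => φ (jj m * g)) ∈ ccInf T := by
    rintro φ ⟨h1, ⟨U, hU, h2⟩, C, hC, h3⟩ g
    refine ⟨fun s hs m => ?_, ?_, ?_⟩
    · have := h1 ⟨jj s, hjS s hs⟩ (jj m * g)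
      rw [hχ _ (jj s).2] at this
      have e : ψ ⟨jj s, (jj s).2⟩ = 1 := hψ s
      change φ (jj (s * m) * g) = φ (jj m * g)
      rw [map_mul, Subgroup.coe_mul, mul_assoc]
      exact this.trans (by rw [e, one_mul])
    · rw [IsLocallyConstant.iff_eventually_eq]
      intro m
      have hc : Continuous fun m : L => (jj m : G) * g := by fun_prop
      have : ∀ᶠ x in 𝓝 ((jj m : G) * g), φ x = φ (jj m * g) := by
        filter_upwards [(hU.smul ((jj m : G) * g)).mem_nhds ⟨1, U.one_mem, by simp⟩] with x hx
        obtain ⟨u, hu, rfl⟩ := hx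
        exact h2 u hu _
      exact hc.continuousAt.eventually this
    · have hC' : IsCompact ((Subtype.val : R → G) ⁻¹' ((fun x => x * g⁻¹) '' C)) :=
        hR.isClosedEmbedding_subtypeVal.isCompact_preimage (hC.image (continuous_mul_const _))
      refine ⟨_, hC'.image hl, fun m hm => ?_⟩
      obtain ⟨s, hs, c, hc, e⟩ := h3 (show (jj m : G) * g ∈ Function.support φ from hm)
      have e' : s * c = jj m * g := e
      obtain ⟨hsR, hsT⟩ := (hS s).1 hs
      have e2 : c * g⁻¹ = s⁻¹ * jj m := by
        rw [mul_inv_eq_iff_eq_mul, mul_assoc, ← e']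
        group
      refine ⟨_, hsT, _, ⟨⟨s, hsR⟩⁻¹ * jj m, ⟨c, hc, e2⟩, rfl⟩, ?_⟩
      change l ⟨s, hsR⟩ * l (⟨s, hsR⟩⁻¹ * jj m) = m
      rw [← map_mul, mul_inv_cancel_left, hlj]
  let Φ : compInd S χ → G → ccInf T := fun φ g => ⟨fun m => φ.1 (jj m * g), hfwd φ.1 φ.2 g⟩
  have hΦ : ∀ φ, Φ φ ∈ unInd σ := by
    rintro ⟨φ, h1, ⟨U, hU, h2⟩, h3⟩
    refine ⟨fun p g => Subtype.ext (funext fun m => ?_), U, hU, fun u hu g =>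
      Subtype.ext (funext fun m => ?_)⟩
    · rw [hσ]
      change φ (jj m * (p * g)) = ψ p * φ (jj (m * l p) * g)
      let p' : R := jj m * p * (jj (m * l p))⁻¹
      have hp'l : l p' = 1 := by simp [p', hlj]
      have hp'S : (p' : G) ∈ S := (hS _).2 ⟨p'.2, by
        have : l ⟨p', p'.2⟩ = 1 := hp'l
        rw [this]
        exact T.one_mem⟩
      have hp'ψ : χ ⟨p', hp'S⟩ = ψ p := by
        rw [hχ _ p'.2]
        change ψ p' = ψ p
        have h5 : p' * jj (m * l p) = jj m * p := inv_mul_cancel_right _ _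
        have h6 : ψ p' * ψ (jj (m * l p)) = ψ (jj m) * ψ p := by rw [← map_mul, ← map_mul, h5]
        rwa [hψ, hψ, one_mul, mul_one] at h6
      have h6 := h1 ⟨p', hp'S⟩ (jj (m * l p) * g)
      rw [hp'ψ] at h6
      rw [← h6]
      congr 1
      simp [p', mul_assoc]
    · change φ (jj m * (g * u)) = φ (jj m * g)
      rw [← mul_assoc, h2 u hu]
  have hbwd : ∀ Ψ ∈ unInd σ, (fun g : G => (Ψ g).1 1) ∈ compInd S χ := by
    rintro Ψ ⟨h1, U, hU, h2⟩
    have h1' : ∀ (p : R) (g : G) (m : L), (Ψ (p * g)).1 m = ψ p * (Ψ g).1 (m * l p) := by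
      intro p g m
      rw [h1, hσ]
    refine ⟨fun s g => ?_, ⟨U, hU, fun u hu g => by
      change (Ψ (g * u)).1 1 = (Ψ g).1 1
      rw [h2 u hu]⟩, ?_⟩
    · obtain ⟨hsR, hsT⟩ := (hS s).1 s.2
      have := h1' ⟨s, hsR⟩ g 1
      simp only at this
      change (Ψ (s * g)).1 1 = χ s * (Ψ g).1 1
      rw [this, hχ s hsR, one_mul]
      have h5 := (Ψ g).2.1 _ hsT 1
      rw [mul_one] at h5
      rw [h5]
    · obtain ⟨U', hU', hU'c, hU's⟩ := exists_compact_open_subgroup (hU.mem_nhds U.one_mem)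
      choose C hC hCs using fun g => (Ψ g).2.2.2
      obtain ⟨t, -, ht⟩ := hK1.elim_nhds_subcover (fun c => c • (U' : Set G)) (fun c _ =>
        (hU'.smul c).mem_nhds ⟨1, U'.one_mem, by simp⟩)
      refine ⟨⋃ k ∈ t, ((fun m => ((jj m : R) : G)) '' C k) * (k • (U' : Set G)),
        t.finite_toSet.isCompact_biUnion fun k _ => ((hC k).image (by fun_prop)).mul
          (hU'c.smul k), fun g hg => ?_⟩
      obtain ⟨p, hp, k, hk, rfl⟩ := hK g
      obtain ⟨x, hx, u, hu, e⟩ := Set.mem_iUnion₂.1 (ht hk)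
      have e' : x * u = k := e
      have h5 := h1' ⟨p, hp⟩ k 1
      simp only at h5
      have hne : (Ψ x).1 (l ⟨p, hp⟩) ≠ 0 := by
        intro h0
        apply hg
        change (Ψ (p * k)).1 1 = 0
        rw [h5, ← e', h2 u (hU's hu), one_mul, h0, mul_zero]
      obtain ⟨s, hs, c, hc, e2⟩ := hCs x hne
      have e2' : s * c = l ⟨p, hp⟩ := e2
      refine ⟨p * (jj c : G)⁻¹, ?_, jj c * k, ?_, ?_⟩
      · refine (hS _).2 ⟨R.mul_mem hp (R.inv_mem (jj c).2), ?_⟩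
        have : l (⟨p, hp⟩ * (jj c)⁻¹) = s := by
          rw [map_mul, ← e2', map_inv, hlj, mul_inv_cancel_right]
        exact this.symm ▸ hs
      · exact Set.mem_iUnion₂.2 ⟨x, hx, _, ⟨c, hc, rfl⟩, k, ⟨u, hu, e'⟩, rfl⟩
      · change p * (jj c : G)⁻¹ * (jj c * k) = p * k
        group
  refine ⟨Representation.Equiv.mk
    { toFun := fun φ => ⟨Φ φ, hΦ φ⟩
      map_add' := fun _ _ => rfl
      map_smul' := fun _ _ => rfl
      invFun := fun Ψ => ⟨fun g => (Ψ.1 g).1 1, hbwd Ψ.1 Ψ.2⟩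
      left_inv := fun φ => Subtype.ext (funext fun g => ?_)
      right_inv := fun Ψ => Subtype.ext (funext fun g => Subtype.ext (funext fun m => ?_)) }
    fun g => LinearMap.ext fun φ => Subtype.ext (funext fun x => Subtype.ext (funext fun m => ?_))⟩
  · change φ.1 (jj 1 * g) = φ.1 g
    simp
  · change (Ψ.1 (jj m * g)).1 1 = (Ψ.1 g).1 m
    rw [Ψ.2.1, hσ, hψ, hlj]
    simp
  · change φ.1 (jj m * x * g) = φ.1 (jj m * (x * g))
    rw [mul_assoc]

end Stages

/-! ## Compactness -/

section LocalFieldCompactness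

open Topology Filter

variable (F : Type*) [Field F] [ValuativeRel F] [TopologicalSpace F] [IsNonarchimedeanLocalField F]

theorem one_lt_card_residue : (1 : ℝ≥0) <
    (Nat.card (IsLocalRing.ResidueField (ValuativeRel.valuation F).integer) : ℝ≥0) := by
  exact_mod_cast Finite.one_lt_card

theorem normAbs_lt_iff (a b : F) :
    normAbs F a < normAbs F b ↔ ValuativeRel.valuation F a < ValuativeRel.valuation F b := by
  have h1 := WithZeroMulInt.toNNReal_strictMono (one_lt_card_residue F)
  have h2 := (IsNonarchimedeanLocalField.valueGroupWithZeroIsoInt F).strictMono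
  exact (h1.comp h2).lt_iff_lt

theorem exists_one_lt_normAbs : ∃ a : F, 1 < normAbs F a := by
  obtain ⟨a, ha⟩ := ValuativeRel.valuation_surjective
    ((IsNonarchimedeanLocalField.valueGroupWithZeroIsoInt F).symm
      ((Multiplicative.ofAdd (1 : ℤ) : Multiplicative ℤ) : WithZero (Multiplicative ℤ)))
  refine ⟨a, ?_⟩
  have h1 : (1 : ℝ≥0) = normAbs F 1 := (map_one _).symm
  rw [h1, normAbs_lt_iff, ha, map_one]
  rw [← map_one (IsNonarchimedeanLocalField.valueGroupWithZeroIsoInt F).symm]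
  refine (IsNonarchimedeanLocalField.valueGroupWithZeroIsoInt F).symm.strictMono ?_
  rw [← WithZero.coe_one, WithZero.coe_lt_coe, ← ofAdd_zero]
  exact Multiplicative.ofAdd_lt.2 one_pos

theorem exists_compact_normAbs_le (R : ℝ≥0) :
    ∃ C : Set F, IsCompact C ∧ ∀ a, normAbs F a ≤ R → a ∈ C := by
  obtain ⟨a, ha⟩ := exists_one_lt_normAbs F
  obtain ⟨n, hn⟩ := pow_unbounded_of_one_lt R ha
  rw [← map_pow] at hn
  refine ⟨_, IsNonarchimedeanLocalField.isCompact_closedBall F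
    (ValuativeRel.valuation F (a ^ n)), fun b hb => ?_⟩
  exact ((normAbs_lt_iff F b (a ^ n)).1 (hb.trans_lt hn)).le

theorem sigmaCompactSpace_localField : SigmaCompactSpace F := by
  choose C hC hCs using fun n : ℕ => exists_compact_normAbs_le F n
  refine ⟨⟨C, hC, Set.eq_univ_of_forall fun x => ?_⟩⟩
  obtain ⟨n, hn⟩ := exists_nat_ge (normAbs F x)
  exact Set.mem_iUnion.2 ⟨n, hCs n x hn⟩

theorem eventually_normAbs_eq {a : F} (ha : a ≠ 0) : ∀ᶠ x in 𝓝 a, normAbs F x = normAbs F a := by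
  have h1 : ∀ᶠ y in 𝓝 (0 : F), normAbs F (1 + y) = 1 := by
    refine (IsValuativeTopology.mem_nhds_zero_iff _).2 ⟨1, fun y hy => ?_⟩
    have hy' : ValuativeRel.valuation F y < 1 := by simpa using hy
    have h2 : ValuativeRel.valuation F (1 + y) = 1 := Valuation.map_one_add_of_lt _ hy'
    rw [← map_one (normAbs F)]
    refine le_antisymm (not_lt.1 fun h => ?_) (not_lt.1 fun h => ?_)
    · rw [normAbs_lt_iff, h2, map_one] at h
      exact lt_irrefl _ h
    · rw [normAbs_lt_iff, h2, map_one] at h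
      exact lt_irrefl _ h
  have hc : Tendsto (fun x : F => (x - a) / a) (𝓝 a) (𝓝 0) := by
    have : Continuous fun x : F => (x - a) / a := by fun_prop
    simpa using this.tendsto a
  filter_upwards [hc.eventually h1] with x hx
  have e : x = a * (1 + (x - a) / a) := by field_simp; ring
  conv_lhs => rw [e, map_mul, hx, mul_one]

variable (K : Type*) [Field K] [Algebra F K] [FiniteDimensional F K] [TopologicalSpace K]
  [IsModuleTopology F K]

theorem continuous_norm_ext : Continuous (Algebra.norm F : K → F) := by
  let b := Module.finBasis F K
  have h : (Algebra.norm F : K → F) = fun x => (Algebra.leftMulMatrix b x).det := by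
    funext x
    exact Algebra.norm_eq_matrix_det b x
  rw [h]
  refine Continuous.matrix_det (continuous_matrix fun i j => ?_)
  exact IsModuleTopology.continuous_of_linearMap (R := F)
    (Matrix.entryLinearMap F F i j ∘ₗ (Algebra.leftMulMatrix b).toLinearMap)

theorem relAbs_eq_zero_iff (x : K) : relAbs F K x = 0 ↔ x = 0 := by
  change normAbs F (Algebra.norm F x) = 0 ↔ _
  rw [map_eq_zero, Algebra.norm_eq_zero_iff]

theorem eventually_relAbs_eq {a : K} (ha : a ≠ 0) :
    ∀ᶠ x in 𝓝 a, relAbs F K x = relAbs F K a :=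
  (continuous_norm_ext F K).continuousAt.eventually
    (eventually_normAbs_eq F (Algebra.norm_ne_zero_iff.2 ha))

theorem exists_compact_relAbs_le_one :
    ∃ C : Set K, IsCompact C ∧ ∀ a, relAbs F K a ≤ 1 → a ∈ C := by
  have hring := isTopologicalRing_ext F K
  have := localField_t2 F
  have := module_t2 F K
  let b := Module.finBasis F K
  obtain ⟨C1, hC1, hC1s⟩ := exists_compact_normAbs_le F 1
  have hsum : Continuous fun m : Fin (Module.finrank F K) → F => ∑ j, m j • b j :=
    continuous_finsetSum _ fun j _ => by
      have h1 : Continuous fun a : F => a • b j :=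
        IsModuleTopology.continuous_of_linearMap (R := F) (LinearMap.toSpanSingleton F K (b j))
      exact h1.comp (continuous_apply j)
  let A : Fin (Module.finrank F K) → Set K := fun i =>
    (fun m : Fin (Module.finrank F K) → F => ∑ j, m j • b j) ''
      (Set.univ.pi (fun _ => C1) ∩ {m | m i = 1})
  have hAc : ∀ i, IsCompact (A i) := fun i => by
    refine IsCompact.image ?_ hsum
    exact (isCompact_univ_pi fun _ => hC1).inter_right
      (isClosed_eq (continuous_apply i) continuous_const)
  have hA0 : ∀ i, ∀ y ∈ A i, y ≠ 0 := by
    rintro i _ ⟨m, ⟨-, hm⟩, rfl⟩ h0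
    have := congrArg (fun v => b.repr v i) h0
    have e : (1 : F) = 0 := by
      simp only [b.repr_sum_self, map_zero, Finsupp.zero_apply] at this
      exact hm.symm.trans this
    exact one_ne_zero e
  have hmin : ∀ i, ∃ δ : ℝ≥0, 0 < δ ∧ ∀ y ∈ A i, δ ≤ relAbs F K y := by
    intro i
    rcases (A i).eq_empty_or_nonempty with h | h
    · exact ⟨1, one_pos, by simp [h]⟩
    · obtain ⟨y, hy, hmin⟩ := (hAc i).exists_isMinOn h (f := relAbs F K) fun y hy =>
        (tendsto_nhds_of_eventually_eq (eventually_relAbs_eq F K (hA0 i y hy))).mono_left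
          nhdsWithin_le_nhds
      exact ⟨_, pos_iff_ne_zero.2 fun h0 => hA0 i y hy ((relAbs_eq_zero_iff F K y).1 h0),
        fun x hx => hmin hx⟩
  choose δ hδ hδA using hmin
  choose C2 hC2 hC2s using fun i => exists_compact_normAbs_le F (max 1 (δ i)⁻¹)
  have hsm : Continuous fun p : F × K => p.1 • p.2 := by
    have := IsModuleTopology.toContinuousSMul F K
    exact continuous_smul
  refine ⟨{0} ∪ ⋃ i, (fun p : F × K => p.1 • p.2) '' (C2 i ×ˢ A i), ?_, fun x hx => ?_⟩
  · exact isCompact_singleton.union (isCompact_iUnion fun i => ((hC2 i).prod (hAc i)).image hsm)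
  by_cases hx0 : x = 0
  · exact Or.inl hx0
  refine Or.inr (Set.mem_iUnion.2 ?_)
  have : Nonempty (Fin (Module.finrank F K)) := Fin.pos_iff_nonempty.1 Module.finrank_pos
  obtain ⟨i, hi⟩ := Finite.exists_max fun i => normAbs F (b.repr x i)
  have hi0 : b.repr x i ≠ 0 := by
    intro h0
    refine hx0 (b.ext_elem fun l => ?_)
    have := hi l
    rw [h0, map_zero, nonpos_iff_eq_zero, map_eq_zero] at this
    rw [this, map_zero, Finsupp.zero_apply]
  let y : K := (b.repr x i)⁻¹ • x
  have hy : y ∈ A i := by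
    refine ⟨fun l => (b.repr x i)⁻¹ * b.repr x l, ⟨fun l _ => hC1s _ ?_, inv_mul_cancel₀ hi0⟩, ?_⟩
    · rw [map_mul, map_inv₀]
      exact inv_mul_le_one_of_le₀ (hi l) zero_le
    · change ∑ l, ((b.repr x i)⁻¹ * b.repr x l) • b l = (b.repr x i)⁻¹ • x
      simp_rw [mul_smul]
      rw [← Finset.smul_sum, b.sum_repr]
  have hxy : x = b.repr x i • y := by rw [smul_inv_smul₀ hi0]
  refine ⟨i, (b.repr x i, y), ⟨hC2s i _ ?_, hy⟩, hxy.symm⟩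
  have hnorm : relAbs F K x = normAbs F (b.repr x i) ^ Module.finrank F K * relAbs F K y := by
    conv_lhs => rw [hxy, Algebra.smul_def, map_mul]
    congr 1
    change normAbs F (Algebra.norm F (algebraMap F K _)) = _
    rw [Algebra.norm_algebraMap, map_pow]
  rw [hnorm] at hx
  by_cases h1 : normAbs F (b.repr x i) ≤ 1
  · exact h1.trans (le_max_left _ _)
  · refine le_trans ?_ (le_max_right _ _)
    have h2 : normAbs F (b.repr x i) ≤ normAbs F (b.repr x i) ^ Module.finrank F K :=
      le_self_pow₀ (not_le.1 h1).le Module.finrank_pos.ne'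
    rw [← one_div, le_div_iff₀ (hδ i)]
    exact le_trans (mul_le_mul' h2 (hδA i y hy)) hx

end LocalFieldCompactness

section Frames

open Topology Filter

variable {K : Type*} [Field K] {M : Type*} [AddCommGroup M] [Module K M]

theorem linearIndependent_of_minor {n k : ℕ} (c : Module.Basis (Fin n) K M) {v : Fin k → M}
    {I : Fin k → Fin n} (h : (Matrix.of fun i l => c.repr (v i) (I l)).det ≠ 0) :
    LinearIndependent K v := by
  rw [Fintype.linearIndependent_iff]
  intro g hg
  have h1 : Matrix.vecMul g (Matrix.of fun i l => c.repr (v i) (I l)) = 0 := by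
    funext l
    have := congrArg (fun w => c.repr w (I l)) hg
    simpa [Matrix.vecMul, dotProduct, Finsupp.finsetSum_apply] using this
  exact congrFun (Matrix.eq_zero_of_vecMul_eq_zero h h1)

theorem exists_minor_ne_zero {n k : ℕ} (c : Module.Basis (Fin n) K M) {v : Fin k → M}
    (h : LinearIndependent K v) :
    ∃ I : Fin k → Fin n, (Matrix.of fun i l => c.repr (v i) (I l)).det ≠ 0 := by
  let A : Matrix (Fin k) (Fin n) K := Matrix.of fun i j => c.repr (v i) j
  have hrow : LinearIndependent K A.row := by
    have := h.map' (c.equivFun : M →ₗ[K] (Fin n → K)) (LinearEquiv.ker _)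
    exact this
  have hrank : Module.finrank K (Submodule.span K (Set.range A.col)) = k := by
    rw [← Matrix.rank_eq_finrank_span_cols, hrow.rank_matrix, Fintype.card_fin]
  obtain ⟨f, hf1, -, hf3⟩ := Submodule.exists_fun_fin_finrank_span_eq K (Set.range A.col)
  choose J hJ using hf1
  let e : Fin k ≃ Fin (Module.finrank K (Submodule.span K (Set.range A.col))) :=
    finCongr hrank.symm
  refine ⟨fun l => J (e l), ?_⟩
  have h2 : LinearIndependent K (Matrix.of fun i l => c.repr (v i) (J (e l))).col := by
    have h3 : (Matrix.of fun i l => c.repr (v i) (J (e l))).col = f ∘ e := by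
      funext l
      change _ = f (e l)
      rw [← hJ]
      rfl
    rw [h3]
    exact hf3.comp e e.injective
  rw [Matrix.linearIndependent_cols_iff_isUnit, Matrix.isUnit_iff_isUnit_det] at h2
  exact h2.ne_zero

variable [TopologicalSpace K] [IsTopologicalRing K] [T2Space K] [TopologicalSpace M]
  [FiniteDimensional K M] [IsModuleTopology K M]

theorem isOpen_linearIndependent {k : ℕ} : IsOpen {v : Fin k → M | LinearIndependent K v} := by
  let c := Module.finBasis K M
  have e : {v : Fin k → M | LinearIndependent K v} =
      ⋃ I : Fin k → Fin (Module.finrank K M),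
        {v | (Matrix.of fun i l => c.repr (v i) (I l)).det ≠ 0} := by
    ext v
    rw [Set.mem_iUnion]
    exact ⟨exists_minor_ne_zero c, fun ⟨I, hI⟩ => linearIndependent_of_minor c hI⟩
  rw [e]
  refine isOpen_iUnion fun I => ?_
  have hc : Continuous fun v : Fin k → M => (Matrix.of fun i l => c.repr (v i) (I l)).det :=
    Continuous.matrix_det (continuous_matrix fun i l =>
      (continuous_coord c (I l)).comp (continuous_apply i))
  exact isOpen_compl_singleton.preimage hc

end Frames

section Iwasawa

open Topology Filter

theorem exists_compact_frames (F : Type*) [Field F] [ValuativeRel F] [TopologicalSpace F]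
    [IsNonarchimedeanLocalField F] {K : Type*} [Field K] [Algebra F K] [FiniteDimensional F K]
    [TopologicalSpace K] [IsModuleTopology F K] {M : Type*} [AddCommGroup M] [Module K M]
    [FiniteDimensional K M] [TopologicalSpace M] [IsModuleTopology K M] (k : ℕ) :
    ∃ C : Set (Fin k → M), IsCompact C ∧ (∀ v ∈ C, LinearIndependent K v) ∧
      ∀ X : Submodule K M, Module.finrank K X = k → ∃ v ∈ C, Submodule.span K (Set.range v) = X := by
  have := isTopologicalRing_ext F K
  have := localField_t2 F
  have := module_t2 F K
  have := IsModuleTopology.toContinuousAdd K M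
  have := IsModuleTopology.toContinuousSMul K M
  obtain ⟨n, ⟨c⟩⟩ : ∃ n, Nonempty (Module.Basis (Fin n) K M) := ⟨_, ⟨Module.finBasis K M⟩⟩
  obtain ⟨C, hC, hCs⟩ := exists_compact_relAbs_le_one F K
  let φ : (Fin k → Fin n → K) → (Fin k → M) := fun m i => ∑ j, m i j • c j
  have hφ : Continuous φ := by fun_prop
  have hrepr : ∀ m i j, c.repr (φ m i) j = m i j := fun m i j => by
    simp only [φ, c.repr_sum_self]
  let S : (Fin k → Fin n) → Set (Fin k → Fin n → K) := fun I =>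
    Set.univ.pi (fun _ => Set.univ.pi fun _ => C) ∩ {m | ∀ i l, m i (I l) = if i = l then 1 else 0}
  have hS : ∀ I, IsCompact (S I) := fun I => by
    refine IsCompact.inter_right (isCompact_univ_pi fun _ => isCompact_univ_pi fun _ => hC) ?_
    simp only [Set.ofPred_forall]
    exact isClosed_iInter fun i => isClosed_iInter fun l =>
      isClosed_eq (by fun_prop) continuous_const
  have hli : ∀ I, ∀ m ∈ S I, LinearIndependent K (φ m) := by
    intro I m hm
    refine linearIndependent_of_minor c (I := I) ?_
    have : (Matrix.of fun i l => c.repr (φ m i) (I l)) = 1 := by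
      ext i l
      rw [Matrix.of_apply, hrepr, hm.2, Matrix.one_apply]
    rw [this, Matrix.det_one]
    exact one_ne_zero
  refine ⟨⋃ I, φ '' S I, isCompact_iUnion fun I => (hS I).image hφ, ?_, fun X hX => ?_⟩
  · intro v hv
    obtain ⟨I, m, hm, rfl⟩ := Set.mem_iUnion.1 hv
    exact hli I m hm
  let x : Module.Basis (Fin k) K X := Module.finBasisOfFinrankEq K X hX
  have hx : LinearIndependent K fun i => (x i : M) :=
    x.linearIndependent.map' X.subtype (Submodule.ker_subtype X)
  let A : Matrix (Fin k) (Fin n) K := Matrix.of fun i j => c.repr (x i : M) j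
  obtain ⟨I0, hI0⟩ := exists_minor_ne_zero c hx
  have : Nonempty (Fin k → Fin n) := ⟨I0⟩
  obtain ⟨I, hI⟩ := Finite.exists_max fun I : Fin k → Fin n => relAbs F K (A.submatrix id I).det
  have hdet : (A.submatrix id I).det ≠ 0 := by
    intro h0
    have := hI I0
    simp only [h0] at this
    rw [(relAbs_eq_zero_iff F K 0).2 rfl, nonpos_iff_eq_zero, relAbs_eq_zero_iff] at this
    exact hI0 this
  let N := (A.submatrix id I)⁻¹
  have hN : N * A.submatrix id I = 1 := Matrix.nonsing_inv_mul _ hdet.isUnit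
  let A' := N * A
  have hsub : ∀ J : Fin k → Fin n, A'.submatrix id J = N * A.submatrix id J := fun J => rfl
  have hA'I : ∀ i l, A' i (I l) = if i = l then 1 else 0 := by
    intro i l
    have := congrFun (congrFun ((hsub I).trans hN) i) l
    rw [Matrix.one_apply] at this
    exact this
  have hA'le : ∀ i j, relAbs F K (A' i j) ≤ 1 := by
    intro i j
    have h1 : A'.submatrix id (Function.update I i j) =
        (1 : Matrix (Fin k) (Fin k) K).updateCol i fun r => A' r j := by
      ext r l
      rw [Matrix.submatrix_apply, id, Matrix.updateCol_apply]
      by_cases hl : l = i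
      · subst hl; simp
      · rw [Function.update_of_ne hl, if_neg hl, hA'I, Matrix.one_apply]
    have h2 : (A'.submatrix id (Function.update I i j)).det = A' i j := by
      rw [h1, ← Matrix.cramer_apply, Matrix.cramer_one]
      rfl
    have h3 : N.det * (A.submatrix id I).det = 1 := by rw [← Matrix.det_mul, hN, Matrix.det_one]
    rw [← h2, hsub, Matrix.det_mul, map_mul]
    refine (mul_le_mul_right (hI (Function.update I i j)) _).trans ?_
    rw [← map_mul, h3, map_one]
  have hm : (fun i j => A' i j) ∈ S I := ⟨fun i _ j _ => hCs _ (hA'le i j), hA'I⟩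
  refine ⟨φ fun i j => A' i j, Set.mem_iUnion.2 ⟨I, _, hm, rfl⟩, ?_⟩
  have hmem : ∀ i, φ (fun i j => A' i j) i ∈ X := by
    intro i
    have : φ (fun i j => A' i j) i = ∑ l, N i l • (x l : M) := by
      refine c.ext_elem fun j => ?_
      refine (hrepr _ i j).trans ?_
      simp [A', Matrix.mul_apply, A, Finsupp.finsetSum_apply]
    rw [this]
    exact X.sum_mem fun l _ => X.smul_mem _ (x l).2
  refine Submodule.eq_of_le_of_finrank_eq (Submodule.span_le.2 ?_) ?_
  · rintro _ ⟨i, rfl⟩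
    exact hmem i
  · rw [finrank_span_eq_card (hli I _ hm), Fintype.card_fin, hX]

end Iwasawa

section Stabilizers

variable {K : Type*} [Field K] {M : Type*} [AddCommGroup M] [Module K M]
  [FiniteDimensional K M] {ε : ℤ} {B : LinearMap.BilinForm K M}

theorem mem_stab_iff (X : Submodule K M) (g : isomGroup B) :
    g ∈ stab B X ↔ ∀ x ∈ X, g • x ∈ X :=
  ⟨fun h _ hx => stab_smul_mem ⟨g, h⟩ hx, fun h => smul_coe_eq_of_forall h le_rfl⟩

/-- The orbit of a frame of an isotropic subspace consists of all isotropic frames. -/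
theorem exists_smul_frame [CharZero K] (hB : IsEps ε B) {k : ℕ} {v w : Fin k → M}
    (hv : LinearIndependent K v) (hw : LinearIndependent K w) (hv0 : ∀ i j, B (v i) (v j) = 0)
    (hw0 : ∀ i j, B (w i) (w j) = 0) : ∃ g : isomGroup B, ∀ i, g • v i = w i := by
  have iso : ∀ u : Fin k → M, (∀ i j, B (u i) (u j) = 0) →
      ∀ x ∈ Submodule.span K (Set.range u), ∀ y ∈ Submodule.span K (Set.range u), B x y = 0 := by
    intro u hu x hx y hy
    induction hx using Submodule.span_induction with
    | zero => simp
    | add a b _ _ ha hb => rw [map_add, LinearMap.add_apply, ha, hb, add_zero]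
    | smul c a _ ha => rw [map_smul, LinearMap.smul_apply, ha, smul_zero]
    | mem a ha =>
      obtain ⟨i, rfl⟩ := ha
      induction hy using Submodule.span_induction with
      | zero => simp
      | add a b _ _ ha hb => rw [map_add, ha, hb, add_zero]
      | smul c a _ ha => rw [map_smul, ha, smul_zero]
      | mem a ha =>
        obtain ⟨j, rfl⟩ := ha
        exact hu i j
  obtain ⟨g, hg⟩ := exists_smul_eq_of_isotropic hB (iso v hv0) (iso w hw0)
    (by rw [finrank_span_eq_card hv, finrank_span_eq_card hw])
  obtain ⟨D, hD⟩ := exists_leviDatum hB _ (iso w hw0)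
  let bw : Module.Basis (Fin k) K D.X := (Module.Basis.span hw).map (LinearEquiv.ofEq _ _ hD.symm)
  have hbw : ∀ i, ((bw i : D.X) : M) = w i := fun i => by
    simp [bw, Module.Basis.span_apply]
  have hgv : ∀ i, g • v i ∈ D.X := by
    intro i
    rw [hD, ← SetLike.mem_coe, ← hg]
    exact Set.smul_mem_smul_set (Submodule.subset_span ⟨i, rfl⟩)
  let u : Fin k → D.X := fun i => ⟨g • v i, hgv i⟩
  have hu : LinearIndependent K u := by
    refine LinearIndependent.of_comp D.X.subtype ?_
    exact hv.map' ((g : M ≃ₗ[K] M) : M →ₗ[K] M) (LinearEquiv.ker _)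
  let bu : Module.Basis (Fin k) K D.X := basisOfLinearIndependentOfCardEqFinrank' u hu (by
    rw [Fintype.card_fin, D.finrank_X, finrank_span_eq_card hw, Fintype.card_fin])
  have hbu : ∀ i, bu i = u i := fun i => by simp [bu]
  obtain ⟨g', hg', -, -⟩ := LeviDatum.exists_extend hB D D (bu.equiv bw (Equiv.refl _))
    LinearMap.id fun _ _ => rfl
  refine ⟨g' * g, fun i => ?_⟩
  have := hg' (bu i)
  rw [Module.Basis.equiv_apply, Equiv.refl_apply, hbw, hbu] at this
  rw [mul_smul]
  exact this

namespace LeviDatum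

variable {k : ℕ} (D : LeviDatum B k)

/-- The embedding of `Isom(M0)` in the stabilizer of `X`. -/
noncomputable def emb (hB : IsEps ε B) : isomGroup (B.restrict D.M0) →* stab B D.X where
  toFun m := ⟨⟨
    { toFun := fun v => v - (D.proj v : M) + (m • D.proj v : D.M0)
      map_add' := fun v w => by
        simp only [map_add, smul_add, Submodule.coe_add]
        abel
      map_smul' := fun c v => by
        simp only [map_smul, isom_smul_smul, Submodule.coe_smul, RingHom.id_apply, smul_add,
          smul_sub]
      invFun := fun v => v - (D.proj v : M) + (m⁻¹ • D.proj v : D.M0)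
      left_inv := fun v => by simp [D.proj_coe]
      right_inv := fun v => by simp [D.proj_coe] }, fun v w => by
      change B (v - (D.proj v : M) + (m • D.proj v : D.M0))
        (w - (D.proj w : M) + (m • D.proj w : D.M0)) = B v w
      rw [D.form_decomp hB, D.form_decomp hB v w]
      have h := isom_apply m (D.proj v) (D.proj w)
      simp only [map_add, map_sub, D.proj_coe, D.projX_of_mem_M0 hB, D.projY_of_mem_M0, sub_self,
        zero_add, sub_zero, add_zero]
      congr 2⟩, by
    rw [mem_stab_iff]
    intro x hx
    change x - (D.proj x : M) + (m • D.proj x : D.M0) ∈ D.X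
    rw [D.proj_of_mem hx]
    simpa using hx⟩
  map_one' := by
    refine Subtype.ext (Subtype.ext (LinearEquiv.ext fun v => ?_))
    change v - (D.proj v : M) + ((1 : isomGroup (B.restrict D.M0)) • D.proj v : D.M0) = v
    simp
  map_mul' m m' := by
    refine Subtype.ext (Subtype.ext (LinearEquiv.ext fun v => ?_))
    change v - (D.proj v : M) + ((m * m') • D.proj v : D.M0) =
      (v - (D.proj v : M) + (m' • D.proj v : D.M0)) -
        (D.proj (v - (D.proj v : M) + (m' • D.proj v : D.M0)) : M) +
        (m • D.proj (v - (D.proj v : M) + (m' • D.proj v : D.M0)) : D.M0)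
    simp [D.proj_coe, mul_smul]

theorem emb_smul (hB : IsEps ε B) (m : isomGroup (B.restrict D.M0)) (v : M) :
    ((D.emb hB m : stab B D.X) : isomGroup B) • v = v - (D.proj v : M) + (m • D.proj v : D.M0) :=
  rfl

theorem emb_smul_of_mem (hB : IsEps ε B) (m : isomGroup (B.restrict D.M0)) {x : M} (hx : x ∈ D.X) :
    ((D.emb hB m : stab B D.X) : isomGroup B) • x = x := by
  rw [emb_smul, D.proj_of_mem hx]
  simp

theorem emb_smul_coe (hB : IsEps ε B) (m : isomGroup (B.restrict D.M0)) (v : D.M0) :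
    ((D.emb hB m : stab B D.X) : isomGroup B) • (v : M) = (m • v : D.M0) := by
  rw [emb_smul, D.proj_coe]
  simp

theorem levi_emb (hB : IsEps ε B) (m : isomGroup (B.restrict D.M0)) : D.levi (D.emb hB m) = m := by
  refine Subtype.ext (LinearEquiv.ext fun v => ?_)
  change D.proj ((D.emb hB m : isomGroup B) • (v : M)) = m • v
  rw [D.emb_smul_coe hB, D.proj_coe]

theorem detOn_emb (hB : IsEps ε B) (m : isomGroup (B.restrict D.M0)) :
    detOn B D.X (D.emb hB m) = 1 := by
  have : restr B D.X (D.emb hB m) = LinearMap.id := by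
    ext x
    exact D.emb_smul_of_mem hB m x.2
  change LinearMap.det (restr B D.X (D.emb hB m)) = 1
  rw [this, LinearMap.det_id]

end LeviDatum

end Stabilizers

section IsomTopology

open Topology Filter

variable {K : Type*} [Field K] [TopologicalSpace K] {M : Type*} [AddCommGroup M] [Module K M]
  [FiniteDimensional K M] {ε : ℤ} {B : LinearMap.BilinForm K M}

theorem exists_homeomorph_coords (K M : Type*) [Field K] [TopologicalSpace K] [AddCommGroup M]
    [Module K M] [FiniteDimensional K M] [IsTopologicalRing K] [TopologicalSpace M]
    [IsModuleTopology K M] : ∃ n : ℕ, Nonempty (M ≃ₜ (Fin n → K)) := by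
  let b := Module.finBasis K M
  have := IsModuleTopology.toContinuousAdd K M
  have h1 : Continuous b.equivFun :=
    IsModuleTopology.continuous_of_linearMap (R := K) (b.equivFun : M →ₗ[K] (Fin (Module.finrank K M) → K))
  have h2 : Continuous b.equivFun.symm :=
    IsModuleTopology.continuous_of_linearMap (R := K) (b.equivFun.symm : (Fin (Module.finrank K M) → K) →ₗ[K] M)
  exact ⟨_, ⟨{ b.equivFun.toEquiv with
    continuous_toFun := h1
    continuous_invFun := h2 }⟩⟩

/-- The isometry group of a form over a finite extension of a local field is a locally compact,
totally disconnected and σ-compact topological group. -/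
theorem isom_topology (F : Type*) [Field F] [ValuativeRel F] [TopologicalSpace F]
    [IsNonarchimedeanLocalField F] [Algebra F K] [FiniteDimensional F K] [IsModuleTopology F K]
    (hB : IsEps ε B) :
    IsTopologicalGroup (isomGroup B) ∧ T2Space (isomGroup B) ∧ LocallyCompactSpace (isomGroup B) ∧
      TotallyDisconnectedSpace (isomGroup B) ∧ SigmaCompactSpace (isomGroup B) := by
  have := isTopologicalRing_ext F K
  have := module_t2 F K
  have := module_locallyCompact F K
  have := module_totallyDisconnected F K
  have : SigmaCompactSpace K := by
    obtain ⟨n, ⟨e⟩⟩ := exists_homeomorph_pi F K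
    have := sigmaCompactSpace_localField F
    exact e.isClosedEmbedding.sigmaCompactSpace
  letI : TopologicalSpace M := moduleTopology K M
  haveI : IsModuleTopology K M := ⟨rfl⟩
  have := IsModuleTopology.toContinuousAdd K M
  obtain ⟨n, ⟨e⟩⟩ := exists_homeomorph_coords K M
  have : T2Space M := e.symm.t2Space
  have : LocallyCompactSpace M := e.isClosedEmbedding.locallyCompactSpace
  have : TotallyDisconnectedSpace M :=
    ⟨e.isEmbedding.isTotallyDisconnected (isTotallyDisconnected_of_totallyDisconnectedSpace _)⟩
  have : SigmaCompactSpace M := e.isClosedEmbedding.sigmaCompactSpace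
  have hc := isClosedEmbedding_isom hB (Module.finBasis K M)
  exact ⟨isTopologicalGroup_isom hB, hc.isEmbedding.t2Space, hc.locallyCompactSpace,
    ⟨hc.isEmbedding.isTotallyDisconnected (isTotallyDisconnected_of_totallyDisconnectedSpace _)⟩,
    hc.sigmaCompactSpace⟩

theorem isClosed_stab (F : Type*) [Field F] [ValuativeRel F] [TopologicalSpace F]
    [IsNonarchimedeanLocalField F] [Algebra F K] [FiniteDimensional F K] [IsModuleTopology F K]
    (X : Submodule K M) : IsClosed (stab B X : Set (isomGroup B)) := by
  have := isTopologicalRing_ext F K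
  have := module_t2 F K
  letI : TopologicalSpace M := moduleTopology K M
  haveI : IsModuleTopology K M := ⟨rfl⟩
  have := IsModuleTopology.toContinuousAdd K M
  have hX : IsClosed (X : Set M) := by
    have e : (X : Set M) = ⋂ f ∈ X.dualAnnihilator, {v | f v = 0} := by
      ext v
      rw [SetLike.mem_coe, ← Subspace.forall_mem_dualAnnihilator_apply_eq_zero_iff]
      simp only [Set.mem_iInter, Set.mem_ofPred_eq]
    rw [e]
    exact isClosed_biInter fun f _ =>
      isClosed_eq (IsModuleTopology.continuous_of_linearMap (R := K) f) continuous_const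
  have e : (stab B X : Set (isomGroup B)) = ⋂ x ∈ X, {g | g • x ∈ X} := by
    ext g
    simp only [SetLike.mem_coe, mem_stab_iff, Set.mem_iInter, Set.mem_ofPred_eq]
  rw [e]
  exact isClosed_biInter fun x _ => hX.preimage (continuous_isom_smul x)

theorem exists_compact_mul (F : Type*) [Field F] [ValuativeRel F] [TopologicalSpace F]
    [IsNonarchimedeanLocalField F] [Algebra F K] [FiniteDimensional F K] [IsModuleTopology F K]
    [CharZero K] (hB : IsEps ε B) (X : Submodule K M)
    (hX : ∀ x ∈ X, ∀ x' ∈ X, B x x' = 0) :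
    ∃ K0 : Set (isomGroup B), IsCompact K0 ∧ ∀ g, ∃ p ∈ stab B X, ∃ k ∈ K0, g = p * k := by
  obtain ⟨_, _, _, _, _⟩ := isom_topology F hB
  have := isTopologicalRing_ext F K
  have := module_t2 F K
  have := module_locallyCompact F K
  letI : TopologicalSpace M := moduleTopology K M
  haveI : IsModuleTopology K M := ⟨rfl⟩
  have := IsModuleTopology.toContinuousAdd K M
  obtain ⟨n, ⟨e⟩⟩ := exists_homeomorph_coords K M
  have : T2Space M := e.symm.t2Space
  have : LocallyCompactSpace M := e.isClosedEmbedding.locallyCompactSpace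
  have : ContinuousSMul (isomGroup B) M := ⟨continuous_isom_smul₂⟩
  let k := Module.finrank K X
  obtain ⟨C, hC, hCli, hCX⟩ := exists_compact_frames F (K := K) (M := M) k
  let Iso : Set (Fin k → M) := {v | ∀ i j, B (v i) (v j) = 0}
  have hIso : IsClosed Iso := by
    simp only [Iso, Set.ofPred_forall]
    exact isClosed_iInter fun i => isClosed_iInter fun j => isClosed_eq
      (continuous_form.comp ((continuous_apply i).prodMk (continuous_apply j))) continuous_const
  let x : Fin k → M := fun i => Module.finBasis K X i
  have hx : LinearIndependent K x :=
    (Module.finBasis K X).linearIndependent.map' X.subtype (Submodule.ker_subtype X)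
  have hx0 : x ∈ Iso := fun i j => hX _ (Module.finBasis K X i).2 _ (Module.finBasis K X j).2
  have hxX : Submodule.span K (Set.range x) = X := by
    refine Submodule.eq_of_le_of_finrank_eq (Submodule.span_le.2 ?_) ?_
    · rintro _ ⟨i, rfl⟩
      exact (Module.finBasis K X i).2
    · rw [finrank_span_eq_card hx, Fintype.card_fin]
  let O : Set (Fin k → M) := {v | LinearIndependent K v} ∩ Iso
  have horb : MulAction.orbit (isomGroup B) x = O := by
    ext v
    constructor
    · rintro ⟨g, rfl⟩
      refine ⟨hx.map' ((g : M ≃ₗ[K] M) : M →ₗ[K] M) (LinearEquiv.ker _), fun i j => ?_⟩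
      exact (isom_apply g (x i) (x j)).trans (hx0 i j)
    · rintro ⟨h1, h2⟩
      obtain ⟨g, hg⟩ := exists_smul_frame hB hx h1 hx0 h2
      exact ⟨g, funext hg⟩
  have hlc : IsLocallyClosed (MulAction.orbit (isomGroup B) x) := by
    rw [horb]
    exact isOpen_linearIndependent.isLocallyClosed.inter hIso.isLocallyClosed
  have := hlc.locallyCompactSpace
  have : ContinuousSMul (isomGroup B) (MulAction.orbit (isomGroup B) x) :=
    ⟨Continuous.subtype_mk (f := fun p : isomGroup B × MulAction.orbit (isomGroup B) x =>
      p.1 • (p.2 : Fin k → M)) (by fun_prop) _⟩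
  obtain ⟨W, hWc, hW⟩ := exists_compact_mem_nhds (1 : isomGroup B)
  have hCO : C ∩ Iso ⊆ MulAction.orbit (isomGroup B) x := by
    rw [horb]
    exact fun v hv => ⟨hCli v hv.1, hv.2⟩
  obtain ⟨t, htC, ht⟩ := (hC.inter_right hIso).elim_nhdsWithin_subcover
    (fun v => (fun g : isomGroup B => g • v) '' W) (fun v hv => by
      have key := smul_singleton_mem_nhds_of_sigmaCompact hW
        (⟨v, hCO hv⟩ : MulAction.orbit (isomGroup B) x)
      have h2 : (fun g : isomGroup B => g • v) '' W ∈
          𝓝[MulAction.orbit (isomGroup B) x] v := by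
        rw [nhdsWithin_eq_map_subtype_coe (hCO hv), mem_map]
        filter_upwards [key] with z hz
        obtain ⟨g, hg, w, hw, rfl⟩ := hz
        rw [Set.mem_singleton_iff] at hw
        subst hw
        exact ⟨g, hg, rfl⟩
      exact nhdsWithin_mono v hCO h2)
  have hg : ∀ v : Fin k → M, ∃ g : isomGroup B, v ∈ t → g • x = v := by
    intro v
    by_cases hv : v ∈ t
    · obtain ⟨g, hg⟩ := hCO (htC v hv)
      exact ⟨g, fun _ => hg⟩
    · exact ⟨1, fun h => absurd h hv⟩
  choose γ hγ using hg
  refine ⟨(⋃ v ∈ t, (fun g => g * γ v) '' W)⁻¹, ?_, fun g => ?_⟩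
  · exact (t.finite_toSet.isCompact_biUnion fun v _ => hWc.image (continuous_mul_const _)).inv
  · obtain ⟨v, hvC, hv⟩ := hCX (moveBy g⁻¹ X) (finrank_moveBy _ _)
    have hvI : v ∈ Iso := by
      intro i j
      have hi : ∀ i, ∃ y ∈ X, g⁻¹ • y = v i := fun i => by
        have : v i ∈ moveBy g⁻¹ X := by
          rw [← hv]
          exact Submodule.subset_span ⟨i, rfl⟩
        exact this
      obtain ⟨y, hy, e1⟩ := hi i
      obtain ⟨y', hy', e2⟩ := hi j
      rw [← e1, ← e2, isom_apply, hX y hy y' hy']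
    obtain ⟨u, hu, w, hw, e⟩ := Set.mem_iUnion₂.1 (ht ⟨hvC, hvI⟩)
    have hwx : (w * γ u) • x = v := by
      rw [mul_smul, hγ u hu]
      exact e
    refine ⟨g * (w * γ u), ?_, (w * γ u)⁻¹, ?_, by group⟩
    · rw [mem_stab_iff]
      have h3 : ∀ y ∈ X, (w * γ u) • y ∈ moveBy g⁻¹ X := by
        intro y hy
        rw [← hxX] at hy
        rw [← hv]
        induction hy using Submodule.span_induction with
        | zero => rw [smul_zero]; exact Submodule.zero_mem _
        | add a b _ _ ha hb => rw [smul_add]; exact Submodule.add_mem _ ha hb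
        | smul c a _ ha => rw [isom_smul_smul]; exact Submodule.smul_mem _ c ha
        | mem a ha =>
          obtain ⟨i, rfl⟩ := ha
          exact Submodule.subset_span ⟨i, (congrFun hwx i).symm⟩
      intro y hy
      obtain ⟨y', hy', e'⟩ := h3 y hy
      have e'' : g⁻¹ • y' = (w * γ u) • y := e'
      rw [mul_smul, ← e'', smul_inv_smul]
      exact hy'
    · rw [Set.mem_inv, inv_inv]
      exact Set.mem_iUnion₂.2 ⟨u, hu, w, hw, rfl⟩

theorem exists_nhds_relAbs_detOn (F : Type*) [Field F] [ValuativeRel F] [TopologicalSpace F]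
    [IsNonarchimedeanLocalField F] [Algebra F K] [FiniteDimensional F K] [IsModuleTopology F K]
    (X : Submodule K M) :
    ∃ V ∈ 𝓝 (1 : isomGroup B), ∀ q : stab B X, (q : isomGroup B) ∈ V →
      relAbs F K (detOn B X q) = 1 := by
  have := isTopologicalRing_ext F K
  letI : TopologicalSpace M := moduleTopology K M
  haveI : IsModuleTopology K M := ⟨rfl⟩
  have := IsModuleTopology.toContinuousAdd K M
  let b := Module.finBasis K X
  choose f hf using fun i => LinearMap.exists_extend (b.coord i)
  let d : isomGroup B → K := fun g => (Matrix.of fun i j => f i (g • (b j : M))).det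
  have hd : Continuous d := Continuous.matrix_det (continuous_matrix fun i j =>
    (IsModuleTopology.continuous_of_linearMap (R := K) (f i)).comp (continuous_isom_smul _))
  have hdq : ∀ q : stab B X, d q = detOn B X q := by
    intro q
    change _ = LinearMap.det (restr B X q)
    rw [← LinearMap.det_toMatrix b]
    change Matrix.det _ = _
    congr 1
    funext i j
    rw [LinearMap.toMatrix_apply]
    exact LinearMap.congr_fun (hf i) (restr B X q (b j))
  have hd1 : d 1 = 1 := (hdq 1).trans (map_one _)
  have h1 := hd.continuousAt.eventually (eventually_relAbs_eq F K (a := d 1) (by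
    rw [hd1]; exact one_ne_zero))
  refine ⟨_, h1, fun q hq => ?_⟩
  have : relAbs F K (d q) = relAbs F K (d 1) := hq
  rw [← hdq, this, hd1, map_one]

namespace LeviDatum

variable {k : ℕ} (D : LeviDatum B k)

theorem continuous_levi (F : Type*) [Field F] [ValuativeRel F] [TopologicalSpace F]
    [IsNonarchimedeanLocalField F] [Algebra F K] [FiniteDimensional F K] [IsModuleTopology F K] : Continuous D.levi := by
  have := isTopologicalRing_ext F K
  letI : TopologicalSpace M := moduleTopology K M
  haveI : IsModuleTopology K M := ⟨rfl⟩
  letI : TopologicalSpace D.M0 := moduleTopology K D.M0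
  haveI : IsModuleTopology K D.M0 := ⟨rfl⟩
  have := IsModuleTopology.toContinuousAdd K D.M0
  refine continuous_isom_iff.2 fun v => ?_
  exact (IsModuleTopology.continuous_of_linearMap (R := K) D.proj).comp
    ((continuous_isom_smul (v : M)).comp continuous_subtype_val)

theorem continuous_emb (F : Type*) [Field F] [ValuativeRel F] [TopologicalSpace F]
    [IsNonarchimedeanLocalField F] [Algebra F K] [FiniteDimensional F K] [IsModuleTopology F K]
    (hB : IsEps ε B) : Continuous (D.emb hB) := by
  have := isTopologicalRing_ext F K
  letI : TopologicalSpace M := moduleTopology K M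
  haveI : IsModuleTopology K M := ⟨rfl⟩
  have := IsModuleTopology.toContinuousAdd K M
  letI : TopologicalSpace D.M0 := moduleTopology K D.M0
  haveI : IsModuleTopology K D.M0 := ⟨rfl⟩
  refine Continuous.subtype_mk (continuous_isom_iff.2 fun v => ?_) _
  change Continuous fun m : isomGroup (B.restrict D.M0) =>
    v - (D.proj v : M) + (m • D.proj v : D.M0)
  have h1 : Continuous D.M0.subtype := IsModuleTopology.continuous_of_linearMap (R := K) D.M0.subtype
  exact continuous_const.add (h1.comp (continuous_isom_smul _))

end LeviDatum

end IsomTopology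

/-! ## Congruence of nearby matrices -/

section Congruence

open Topology Filter

/-- The `n × n` matrices with `Zᵀ = ε Z`. -/
def epsMatrices (F : Type*) [Field F] (ε : ℤ) (n : ℕ) : Submodule F (Matrix (Fin n) (Fin n) F) where
  carrier := {Z | Z.transpose = (ε : F) • Z}
  zero_mem' := by simp
  add_mem' := by
    intro a b (ha : _ = _) (hb : _ = _)
    change (a + b).transpose = _
    rw [Matrix.transpose_add, ha, hb, smul_add]
  smul_mem' := by
    intro c a (ha : _ = _)
    change (c • a).transpose = _
    rw [Matrix.transpose_smul, ha, smul_comm]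

variable {F : Type*} [Field F] [CharZero F] [ValuativeRel F] [TopologicalSpace F]
  [IsNonarchimedeanLocalField F]

/-- A non-degenerate `ε`-symmetric matrix over a local field is congruent to all `ε`-symmetric
matrices close to it. -/
theorem eventually_congruent {ε : ℤ} (hε : ε = 1 ∨ ε = -1) {n : ℕ} {S0 : Matrix (Fin n) (Fin n) F}
    (hS0 : S0.transpose = (ε : F) • S0) (hdet : S0.det ≠ 0) :
    ∀ᶠ S in 𝓝 S0, S.transpose = (ε : F) • S →
      ∃ C : Matrix (Fin n) (Fin n) F, C.transpose * S * C = S0 := by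
  have hεε : (ε : F) * ε = 1 := by rcases hε with rfl | rfl <;> simp
  let W := epsMatrices F ε n
  have htop : IsModuleTopology F (Matrix (Fin n) (Fin n) F) := inferInstanceAs (IsModuleTopology F (Fin n → Fin n → F))
  have := localField_t2 F
  letI : TopologicalSpace W := moduleTopology F W
  haveI : IsModuleTopology F W := ⟨rfl⟩
  have := IsModuleTopology.toContinuousAdd F W
  have hW : ∀ Z : Matrix (Fin n) (Fin n) F, Z ∈ W ↔ Z.transpose = (ε : F) • Z := fun _ => Iff.rfl
  let sym : Matrix (Fin n) (Fin n) F →ₗ[F] W :=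
    { toFun := fun Z => ⟨(2⁻¹ : F) • (Z + (ε : F) • Z.transpose), by
        rw [hW, Matrix.transpose_smul, Matrix.transpose_add, Matrix.transpose_smul,
          Matrix.transpose_transpose, smul_comm (ε : F)]
        congr 1
        rw [smul_add, smul_smul, hεε, one_smul, add_comm]⟩
      map_add' := fun Z Z' => Subtype.ext (by
        simp only [Matrix.transpose_add, smul_add, Submodule.coe_add]; abel)
      map_smul' := fun a Z => Subtype.ext (by
        simp only [Matrix.transpose_smul, Submodule.coe_smul, RingHom.id_apply]
        rw [smul_comm (ε : F) a, ← smul_add, smul_comm]) }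
  have hsym : ∀ Z : Matrix (Fin n) (Fin n) F, ((sym Z : W) : Matrix (Fin n) (Fin n) F) = (2⁻¹ : F) • (Z + (ε : F) • Z.transpose) := fun _ => rfl
  have hsymc : Continuous sym := IsModuleTopology.continuous_of_linearMap (R := F) sym
  have hsymW : ∀ Z : Matrix (Fin n) (Fin n) F, Z ∈ W → ((sym Z : W) : Matrix (Fin n) (Fin n) F) = Z := by
    intro Z hZ
    rw [hsym, (hW Z).1 hZ, smul_smul, hεε, one_smul, ← two_smul F, smul_smul,
      inv_mul_cancel₀ two_ne_zero, one_smul]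
  let l : Matrix (Fin n) (Fin n) F →ₗ[F] W := (2 : F) • sym ∘ₗ LinearMap.mulLeft F S0
  have hl : ∀ X : Matrix (Fin n) (Fin n) F, ((l X : W) : Matrix (Fin n) (Fin n) F) = S0 * X + X.transpose * S0 := by
    intro X
    change ((2 : F) • ((sym (S0 * X) : W) : Matrix (Fin n) (Fin n) F)) = _
    rw [hsym, smul_smul, mul_inv_cancel₀ two_ne_zero, one_smul, Matrix.transpose_mul, hS0,
      Matrix.mul_smul, smul_smul, hεε, one_smul]
  let q : Matrix (Fin n) (Fin n) F →ₗ[F] Matrix (Fin n) (Fin n) F →ₗ[F] W := LinearMap.mk₂ F (fun X Y => sym (X.transpose * S0 * Y))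
    (fun X X' Y => by rw [Matrix.transpose_add, Matrix.add_mul, Matrix.add_mul, map_add])
    (fun a X Y => by rw [Matrix.transpose_smul, Matrix.smul_mul, Matrix.smul_mul, map_smul])
    (fun X Y Y' => by rw [Matrix.mul_add, map_add])
    (fun a X Y => by rw [Matrix.mul_smul, map_smul])
  have hq : ∀ X : Matrix (Fin n) (Fin n) F, ((q X X : W) : Matrix (Fin n) (Fin n) F) = X.transpose * S0 * X := by
    intro X
    refine hsymW _ ?_
    rw [hW, Matrix.transpose_mul, Matrix.transpose_mul, Matrix.transpose_transpose, hS0,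
      Matrix.smul_mul, Matrix.mul_smul, Matrix.mul_assoc]
  have hsurj : Function.Surjective l := by
    intro Z
    have hZ := (hW Z).1 Z.2
    refine ⟨(2⁻¹ : F) • (S0⁻¹ * (Z : Matrix (Fin n) (Fin n) F)), Subtype.ext ?_⟩
    have h1 : S0 * (S0⁻¹ * (Z : Matrix (Fin n) (Fin n) F)) = Z := by
      rw [← Matrix.mul_assoc, Matrix.mul_nonsing_inv _ hdet.isUnit, Matrix.one_mul]
    have h2 : (S0⁻¹ * (Z : Matrix (Fin n) (Fin n) F)).transpose * S0 = Z := by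
      have h3 : (S0⁻¹).transpose * S0 = (ε : F) • 1 := by
        have h4 : (S0⁻¹).transpose * S0.transpose = 1 := by
          rw [← Matrix.transpose_mul, Matrix.mul_nonsing_inv _ hdet.isUnit, Matrix.transpose_one]
        rw [hS0, Matrix.mul_smul] at h4
        rw [← h4, smul_smul, hεε, one_smul]
      rw [Matrix.transpose_mul, Matrix.mul_assoc, h3, hZ, Matrix.mul_smul, Matrix.mul_one,
        smul_smul, hεε, one_smul]
    rw [hl, Matrix.mul_smul, Matrix.transpose_smul, Matrix.smul_mul, h1, h2, ← smul_add,
      ← two_smul F, smul_smul, inv_mul_cancel₀ two_ne_zero, one_smul]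
  have key := eventually_exists_quadratic_module l hsurj q univ_mem
  have hc : ContinuousAt (fun S : Matrix (Fin n) (Fin n) F => sym (S - S0)) S0 :=
    (hsymc.comp (continuous_id.sub continuous_const)).continuousAt
  have h0 : sym (S0 - S0) = 0 := by rw [sub_self, map_zero]
  have hdc : Continuous fun S : Matrix (Fin n) (Fin n) F => S.det := Continuous.matrix_det continuous_id
  rw [← h0] at key
  filter_upwards [hc.eventually key, hdc.continuousAt.eventually_ne hdet] with S hS hSd hSε
  obtain ⟨X, -, hX⟩ := hS
  have hSW : S - S0 ∈ W := W.sub_mem ((hW S).2 hSε) ((hW S0).2 hS0)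
  have h1 := congrArg Subtype.val hX
  rw [Submodule.coe_add, hl, hq, hsymW _ hSW] at h1
  have h2 : (1 + X).transpose * S0 * (1 + X) = S := by
    rw [Matrix.transpose_add, Matrix.transpose_one, Matrix.add_mul, Matrix.mul_add,
      Matrix.one_mul, Matrix.mul_one, Matrix.add_mul, eq_add_of_sub_eq' h1.symm]
    abel
  have hu : IsUnit (1 + X).det := by
    rw [isUnit_iff_ne_zero]
    intro h0
    apply hSd
    rw [← h2, Matrix.det_mul, h0, mul_zero]
  refine ⟨(1 + X)⁻¹, ?_⟩
  rw [← h2, Matrix.mul_assoc, Matrix.mul_assoc, Matrix.mul_nonsing_inv _ hu, Matrix.mul_one,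
    ← Matrix.mul_assoc, ← Matrix.transpose_mul, Matrix.mul_nonsing_inv _ hu, Matrix.transpose_one,
    Matrix.one_mul]

end Congruence

/-! ## Lagrangian subspaces of the doubled space -/

/-- An `ε`-symmetric form `B` over a quadratic extension `E/F` and `c, κ ∈ E` such that
`tr(c x) = 0` if and only if `x ∈ κ F`, and `tr(c (z + ε ι(z))) = 0` for all `z`. -/
structure IsDoubling {F E V : Type*} [Field F] [Field E] [Algebra F E] [AddCommGroup V]
    [Module E V] (ι : E ≃ₐ[F] E) (ε : ℤ) (c κ : E) (B : LinearMap.BilinForm E V) : Prop where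
  isEps : IsEps ε B
  finrank_eq : Module.finrank F E = 2
  exists_skew : ∃ t : E, t ≠ 0 ∧ ι t = -t
  κ_ne : κ ≠ 0
  trace_iff : ∀ x, Algebra.trace F E (c * x) = 0 ↔ ∃ a : F, x = a • κ
  trace_conj : ∀ z, Algebra.trace F E (c * (z + (ε : E) * ι z)) = 0

section Lagrangians

variable {F : Type*} [Field F] {E : Type*} [Field E] [Algebra F E] {V : Type*} [AddCommGroup V]
  [Module F V] [Module E V] [IsScalarTower F E V]

/-- `L` is a Lagrangian subspace for the form `tr(c B)`. -/
def IsLagrangian (c : E) (B : LinearMap.BilinForm E V) (L : Submodule F V) : Prop :=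
  (∀ x ∈ L, ∀ y ∈ L, Algebra.trace F E (c * B x y) = 0) ∧
    Module.finrank F L = Module.finrank E V

/-- The subspace `L_an` of `L`, as the orthogonal complement of the `E`-span of `L`. -/
def anPart (B : LinearMap.BilinForm E V) (L : Submodule F V) : Submodule E V :=
  B.orthogonal (Submodule.span E (L : Set V))

variable {ι : E ≃ₐ[F] E} {ε : ℤ} {c κ : E} {B : LinearMap.BilinForm E V}

theorem doubledForm_apply (x y : V) : doubledForm F c B x y = Algebra.trace F E (c * B x y) := rfl

theorem toDoubled_smul (g : isomGroup B) (x : V) : toDoubled F c B g • x = g • x := rfl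

theorem mem_translate {L : Submodule F V} {g : isomGroup (doubledForm F c B)} {x : V} :
    x ∈ translate c B L g ↔ g • x ∈ L := by
  constructor
  · rintro ⟨y, hy, rfl⟩
    change g • g⁻¹ • y ∈ L
    rwa [smul_inv_smul]
  · intro h
    exact ⟨g • x, h, inv_smul_smul g x⟩

theorem mem_anPart {L : Submodule F V} {x : V} : x ∈ anPart B L ↔ ∀ y ∈ L, B y x = 0 := by
  constructor
  · intro h y hy
    exact h y (Submodule.subset_span hy)
  · intro h y hy
    induction hy using Submodule.span_induction with
    | zero => simp
    | add a b _ _ ha hb =>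
      change B (a + b) x = 0
      rw [map_add, LinearMap.add_apply, ha, hb, add_zero]
    | smul e a _ ha =>
      change B (e • a) x = 0
      rw [map_smul, LinearMap.smul_apply, ha, smul_zero]
    | mem a ha => exact h a ha

theorem trace_eq_zero_of_forall (hE : Module.finrank F E = 2)
    (htr : ∀ x, Algebra.trace F E (c * x) = 0 ↔ ∃ a : F, x = a • κ) {z : E}
    (h : ∀ e : E, Algebra.trace F E (c * (e * z)) = 0) : z = 0 := by
  by_contra hz
  have : FiniteDimensional F E := Module.finite_of_finrank_pos (by omega)
  have h1 : (⊤ : Submodule F E) ≤ Submodule.span F {κ} := by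
    intro x _
    have := h (x * z⁻¹)
    rw [inv_mul_cancel_right₀ hz, htr] at this
    obtain ⟨a, ha⟩ := this
    rw [ha]
    exact Submodule.smul_mem _ _ (Submodule.mem_span_singleton_self κ)
  have h2 := Submodule.finrank_mono h1
  rw [finrank_top, hE] at h2
  have h3 := finrank_span_le_card (R := F) ({κ} : Set E)
  simp at h3
  omega

namespace IsDoubling

theorem finiteDimensional (h : IsDoubling ι ε c κ B) : FiniteDimensional F E :=
  Module.finite_of_finrank_pos (by rw [h.finrank_eq]; norm_num)

theorem isEps_doubledForm (h : IsDoubling ι ε c κ B) : IsEps ε (doubledForm F c B) where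
  eps := h.isEps.eps
  swap x y := by
    rw [doubledForm_apply, doubledForm_apply, h.isEps.swap x y, mul_left_comm]
    rcases h.isEps.eps with rfl | rfl <;> simp
  sep x hx := by
    refine h.isEps.sep x fun y => trace_eq_zero_of_forall h.finrank_eq h.trace_iff fun e => ?_
    have := hx (e • y)
    rwa [doubledForm_apply, map_smul, smul_eq_mul] at this

theorem finrank_doubled (h : IsDoubling ι ε c κ B) :
    Module.finrank F V = 2 * Module.finrank E V := by
  rw [← h.finrank_eq, Module.finrank_mul_finrank]

variable [FiniteDimensional F V] [FiniteDimensional E V] {L L' : Submodule F V}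

theorem mem_of_forall (h : IsDoubling ι ε c κ B) (hL : IsLagrangian c B L) {x : V}
    (hx : ∀ y ∈ L, Algebra.trace F E (c * B y x) = 0) : x ∈ L := by
  have hT := h.isEps_doubledForm
  have h1 : L ≤ (doubledForm F c B).orthogonal L := fun y hy z hz => hL.1 z hz y hy
  have h2 := LinearMap.BilinForm.finrank_orthogonal hT.nondegenerate L
  have h3 : L = (doubledForm F c B).orthogonal L :=
    Submodule.eq_of_le_of_finrank_eq h1 (by
      rw [h2, h.finrank_doubled, hL.2]
      omega)
  rw [h3]
  exact fun y hy => hx y hy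

theorem mem_anPart_iff (h : IsDoubling ι ε c κ B) (hL : IsLagrangian c B L) {x : V} :
    x ∈ anPart B L ↔ x ∈ L ∧ ∀ y ∈ L, B x y = 0 := by
  rw [mem_anPart]
  constructor
  · intro hx
    exact ⟨h.mem_of_forall hL fun y hy => by rw [hx y hy, mul_zero, map_zero],
      fun y hy => h.isEps.comm_zero (hx y hy)⟩
  · exact fun hx y hy => h.isEps.comm_zero (hx.2 y hy)

theorem anPart_le (h : IsDoubling ι ε c κ B) (hL : IsLagrangian c B L) {x : V}
    (hx : x ∈ anPart B L) : x ∈ L := ((h.mem_anPart_iff hL).1 hx).1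

theorem isotropic_anPart (h : IsDoubling ι ε c κ B) (hL : IsLagrangian c B L) :
    ∀ x ∈ anPart B L, ∀ y ∈ anPart B L, B x y = 0 :=
  fun _ hx y hy => ((h.mem_anPart_iff hL).1 hx).2 y (h.anPart_le hL hy)

theorem finrank_anPart (h : IsDoubling ι ε c κ B) :
    Module.finrank E (anPart B L) + Module.finrank E (Submodule.span E (L : Set V)) =
      Module.finrank E V := by
  have h2 := LinearMap.BilinForm.finrank_orthogonal h.isEps.nondegenerate
    (Submodule.span E (L : Set V))
  have h3 := Submodule.finrank_le (Submodule.span E (L : Set V))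
  unfold anPart
  omega

theorem anDimEq_iff (h : IsDoubling ι ε c κ B) (hL : IsLagrangian c B L) (k : ℕ) :
    anDimEq B L k ↔ Module.finrank E (anPart B L) = k := by
  constructor
  · rintro ⟨U, hU, hk⟩
    have : U = anPart B L := by
      ext x
      rw [hU, h.mem_anPart_iff hL]
    rw [← this, hk]
  · intro hk
    exact ⟨anPart B L, fun x => h.mem_anPart_iff hL, hk⟩

theorem isLagrangian_translate (hL : IsLagrangian c B L) (g : isomGroup (doubledForm F c B)) :
    IsLagrangian c B (translate c B L g) := by
  refine ⟨fun x hx y hy => ?_, ?_⟩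
  · rw [mem_translate] at hx hy
    have := isom_apply g x y
    rw [doubledForm_apply, doubledForm_apply] at this
    rw [← this]
    exact hL.1 _ hx _ hy
  · rw [← hL.2]
    exact finrank_moveBy g⁻¹ L

theorem exists_translate_eq [CharZero F] (h : IsDoubling ι ε c κ B) (hL : IsLagrangian c B L)
    (hL' : IsLagrangian c B L') : ∃ g, translate c B L g = L' := by
  obtain ⟨g, hg⟩ := exists_smul_eq_of_isotropic h.isEps_doubledForm hL'.1 hL.1
    (by rw [hL.2, hL'.2])
  refine ⟨g, ?_⟩
  ext x
  rw [mem_translate, ← SetLike.mem_coe (p := L), ← hg, Set.smul_mem_smul_set_iff]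
  rfl

theorem mem_stratum_iff (h : IsDoubling ι ε c κ B) (hL : IsLagrangian c B L) (k : ℕ)
    (g : isomGroup (doubledForm F c B)) :
    g ∈ stratum c B L k ↔ Module.finrank E (anPart B (translate c B L g)) = k :=
  h.anDimEq_iff (isLagrangian_translate hL g) k

theorem mem_orbitSet_iff (g g' : isomGroup (doubledForm F c B)) :
    g' ∈ orbitSet (toDoubled F c B) (stab (doubledForm F c B) L) g ↔
      ∃ x : isomGroup B, ∀ v, v ∈ translate c B L g' ↔ x • v ∈ translate c B L g := by
  constructor
  · rintro ⟨q, hq, x, rfl⟩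
    refine ⟨x, fun v => ?_⟩
    rw [mem_translate, mem_translate, mul_smul, mul_smul, toDoubled_smul]
    constructor
    · intro hv
      have := (mem_stab_iff L _).1 ((stab (doubledForm F c B) L).inv_mem hq) _ hv
      rwa [inv_smul_smul] at this
    · exact fun hv => (mem_stab_iff L _).1 hq _ hv
  · rintro ⟨x, hx⟩
    refine ⟨g' * (toDoubled F c B x)⁻¹ * g⁻¹, ?_, x, by group⟩
    rw [mem_stab_iff]
    intro y hy
    have h1 := (hx (x⁻¹ • g⁻¹ • y)).2 (by rw [smul_inv_smul, mem_translate, smul_inv_smul]; exact hy)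
    rw [mem_translate] at h1
    rw [mul_smul, mul_smul, ← map_inv]
    exact h1

end IsDoubling

end Lagrangians

section Closure

open Topology Filter

theorem exists_ne_zero_of_mem_nhds {F : Type*} [Field F] [ValuativeRel F] [TopologicalSpace F]
    [IsNonarchimedeanLocalField F] {N : Set F} (hN : N ∈ 𝓝 0) : ∃ t ∈ N, t ≠ 0 := by
  obtain ⟨γ, hγ⟩ := (IsValuativeTopology.mem_nhds_zero_iff _).1 hN
  obtain ⟨b, hb⟩ := ValuativeRel.valuation_surjective (γ : ValuativeRel.ValueGroupWithZero F)
  obtain ⟨a, ha⟩ := exists_one_lt_normAbs F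
  have ha0 : a ≠ 0 := by
    rintro rfl
    simp at ha
  have hb0 : b ≠ 0 := by
    rintro rfl
    rw [map_zero] at hb
    exact γ.ne_zero hb.symm
  refine ⟨b * a⁻¹, hγ ?_, mul_ne_zero hb0 (inv_ne_zero ha0)⟩
  change ValuativeRel.valuation F (b * a⁻¹) < γ
  rw [← hb, ← normAbs_lt_iff, map_mul, map_inv₀]
  exact mul_lt_of_lt_one_right (pos_iff_ne_zero.2 fun h0 => hb0 (by simpa using h0))
    (inv_lt_one_of_one_lt₀ ha)

variable {F : Type*} [Field F] [CharZero F] [ValuativeRel F] [TopologicalSpace F]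
  [IsNonarchimedeanLocalField F] {E : Type*} [Field E] [Algebra F E]
  {V : Type*} [AddCommGroup V] [Module F V] [Module E V] [IsScalarTower F E V]
  [FiniteDimensional F V] [FiniteDimensional E V] {ι : E ≃ₐ[F] E} {ε : ℤ} {c κ : E}
  {B : LinearMap.BilinForm E V} {L : Submodule F V}

namespace IsDoubling

theorem isOpen_finrank_span (h : IsDoubling ι ε c κ B) (L : Submodule F V) (d : ℕ) :
    IsOpen {g : isomGroup (doubledForm F c B) |
      d ≤ Module.finrank E (Submodule.span E (translate c B L g : Set V))} := by
  have := h.finiteDimensional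
  obtain ⟨_, _, _, _, _⟩ := isom_topology F h.isEps_doubledForm
  letI : TopologicalSpace E := moduleTopology F E
  haveI : IsModuleTopology F E := ⟨rfl⟩
  letI : TopologicalSpace V := moduleTopology F V
  haveI : IsModuleTopology F V := ⟨rfl⟩
  have := isTopologicalRing_ext F E
  have := module_t2 F E
  have := isModuleTopology_ext F E V
  rw [isOpen_iff_mem_nhds]
  intro g hg
  obtain ⟨f, hf1, -, hf3⟩ := Submodule.exists_fun_fin_finrank_span_eq E (translate c B L g : Set V)
  let f' : Fin d → V := fun i => f (Fin.castLE hg i)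
  have hf' : LinearIndependent E f' := hf3.comp _ (Fin.castLE_injective hg)
  have hc : Continuous fun g' : isomGroup (doubledForm F c B) => fun i => g'⁻¹ • g • f' i :=
    continuous_pi fun i => (continuous_isom_smul (g • f' i)).comp continuous_inv
  have hmem : (fun i => g⁻¹ • g • f' i) ∈ {v : Fin d → V | LinearIndependent E v} := by
    have : (fun i => g⁻¹ • g • f' i) = f' := funext fun i => inv_smul_smul _ _
    rw [this]
    exact hf'
  filter_upwards [hc.continuousAt.preimage_mem_nhds
    (isOpen_linearIndependent.mem_nhds hmem)] with g' hg'
  have hg'' : LinearIndependent E fun i => g'⁻¹ • g • f' i := hg'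
  have h1 := finrank_span_eq_card hg''
  rw [Fintype.card_fin] at h1
  change d ≤ _
  rw [← h1]
  refine Submodule.finrank_mono (Submodule.span_mono ?_)
  rintro _ ⟨i, rfl⟩
  rw [SetLike.mem_coe, mem_translate, smul_inv_smul, ← mem_translate]
  exact hf1 _

theorem exists_coords (h : IsDoubling ι ε c κ B) {t : E} (ht0 : t ≠ 0) (ht : ι t = -t) (z : E) :
    ∃ a b : F, z = algebraMap F E a + algebraMap F E b * t := by
  have : CharZero E := charZero_of_injective_algebraMap (algebraMap F E).injective
  have := h.finiteDimensional
  have hli : LinearIndependent F ![(1 : E), t] := by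
    rw [LinearIndependent.pair_iff' one_ne_zero]
    intro a ha
    have h1 : ι t = t := by
      rw [← ha, Algebra.smul_def, map_mul, map_one, AlgEquiv.commutes]
    rw [ht] at h1
    exact ht0 (self_eq_neg.1 h1.symm)
  let b := basisOfLinearIndependentOfCardEqFinrank hli (by rw [h.finrank_eq]; rfl)
  refine ⟨b.repr z 0, b.repr z 1, ?_⟩
  conv_lhs => rw [← b.sum_repr z]
  simp [b, Fin.sum_univ_two, Algebra.smul_def]

theorem conj_conj (h : IsDoubling ι ε c κ B) (z : E) : ι (ι z) = z := by
  obtain ⟨t, ht0, ht⟩ := h.exists_skew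
  obtain ⟨a, b, rfl⟩ := h.exists_coords ht0 ht z
  simp [ht]

theorem exists_deformation (h : IsDoubling ι ε c κ B) {y : V} (hy : B y y = 0) :
    ∃ γ : F → isomGroup (doubledForm F c B), Continuous γ ∧
      ∀ t v, γ t • v = v + t • (ι (B v y) • y) := by
  have hT := h.isEps_doubledForm
  letI : TopologicalSpace V := moduleTopology F V
  haveI : IsModuleTopology F V := ⟨rfl⟩
  have := IsModuleTopology.toContinuousSMul F V
  have := IsModuleTopology.toContinuousAdd F V
  let n : V →ₗ[F] V :=
    { toFun := fun v => ι (B v y) • y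
      map_add' := fun v w => by rw [map_add, LinearMap.add_apply, map_add, add_smul]
      map_smul' := fun a v => by
        rw [← algebraMap_smul E a v, map_smul, LinearMap.smul_apply, smul_eq_mul, map_mul,
          AlgEquiv.commutes, mul_smul, algebraMap_smul, RingHom.id_apply] }
  have hn : ∀ v, n v = ι (B v y) • y := fun _ => rfl
  have hnn : ∀ u v, doubledForm F c B (n u) (n v) = 0 := by
    intro u v
    rw [doubledForm_apply, hn, hn, map_smul, map_smul, LinearMap.smul_apply, hy, smul_zero,
      smul_zero, mul_zero, map_zero]
  have hskew : ∀ u v, doubledForm F c B u (n v) + doubledForm F c B (n u) v = 0 := by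
    intro u v
    have e : B u (n v) + B (n u) v = (ι (B v y) * B u y) + (ε : E) * ι (ι (B v y) * B u y) := by
      rw [hn, hn, map_smul, map_smul, LinearMap.smul_apply, smul_eq_mul, smul_eq_mul,
        h.isEps.swap v y, map_mul, h.conj_conj]
      ring
    rw [doubledForm_apply, doubledForm_apply, ← map_add, ← mul_add, e]
    exact h.trace_conj _
  have hpres : ∀ t : F, ∀ u v, doubledForm F c B ((LinearMap.id + t • n : V →ₗ[F] V) u)
      ((LinearMap.id + t • n : V →ₗ[F] V) v) = doubledForm F c B u v := by
    intro t u v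
    have h2 := hskew u v
    have h3 := hnn u v
    simp only [LinearMap.add_apply, LinearMap.id_apply, LinearMap.smul_apply, map_add, map_smul,
      h3, smul_eq_mul]
    linear_combination t * h2
  choose γ hγ using fun t => exists_isom_of_preserving hT (LinearMap.id + t • n) (hpres t)
  refine ⟨γ, continuous_isom_iff.2 fun v => ?_, hγ⟩
  have : (fun t => γ t • v) = fun t => v + t • n v := funext fun t => hγ t v
  rw [this]
  fun_prop

/-- A Lagrangian with `L_an ≠ 0` is a limit of Lagrangians for which the dimension of `L_an` is
smaller by one. -/
theorem mem_closure_stratum (h : IsDoubling ι ε c κ B) (hL : IsLagrangian c B L) {k : ℕ}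
    {g : isomGroup (doubledForm F c B)} (hg : g ∈ stratum c B L (k + 1)) :
    g ∈ closure (stratum c B L k) := by
  have := h.finiteDimensional
  have : CharZero E := charZero_of_injective_algebraMap (algebraMap F E).injective
  have hT := h.isEps_doubledForm
  obtain ⟨_, _, _, _, _⟩ := isom_topology F hT
  letI : TopologicalSpace V := moduleTopology F V
  haveI : IsModuleTopology F V := ⟨rfl⟩
  have := IsModuleTopology.toContinuousSMul F V
  have := IsModuleTopology.toContinuousAdd F V
  set Lg := translate c B L g with hLg
  have hLgL : IsLagrangian c B Lg := isLagrangian_translate hL g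
  rw [h.mem_stratum_iff hL] at hg
  obtain ⟨D, hD⟩ := exists_leviDatum h.isEps (anPart B Lg) (h.isotropic_anPart hLgL)
  obtain ⟨x1, hx1, hx10⟩ : ∃ x ∈ anPart B Lg, x ≠ 0 := by
    refine (Submodule.ne_bot_iff _).1 fun h0 => ?_
    rw [← hLg, h0, finrank_bot] at hg
    omega
  obtain ⟨y1, hxy, hyy⟩ : ∃ y, B x1 y = 1 ∧ B y y = 0 := by
    by_contra hn
    apply hx10
    refine D.separating_X x1 (by rw [hD]; exact hx1) fun y hy => ?_
    by_contra h0
    refine hn ⟨(B x1 y)⁻¹ • y, ?_, ?_⟩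
    · rw [map_smul, smul_eq_mul, inv_mul_cancel₀ h0]
    · rw [map_smul, map_smul, LinearMap.smul_apply, D.isotropic_Y y hy y hy, smul_zero, smul_zero]
  obtain ⟨γ, hγc, hγ'⟩ := h.exists_deformation hyy
  have hγ0 : γ 0 = 1 := by
    refine Subtype.ext (LinearEquiv.ext fun v => ?_)
    change γ 0 • v = v
    rw [hγ', zero_smul, add_zero]
  rw [mem_closure_iff_nhds]
  intro O hO
  have hc : Continuous fun t => g * (γ t)⁻¹ := by fun_prop
  have hO' : (fun t => g * (γ t)⁻¹) ⁻¹' O ∈ 𝓝 (0 : F) :=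
    hc.continuousAt.preimage_mem_nhds (by rw [hγ0]; simpa using hO)
  obtain ⟨t, htO, ht0⟩ := exists_ne_zero_of_mem_nhds hO'
  refine ⟨g * (γ t)⁻¹, htO, ?_⟩
  rw [h.mem_stratum_iff hL]
  set L' := translate c B L (g * (γ t)⁻¹) with hL'
  have hmem : ∀ v ∈ Lg, v + t • (ι (B v y1) • y1) ∈ L' := by
    intro v hv
    rw [hL', mem_translate, mul_smul, ← hγ', inv_smul_smul, ← mem_translate]
    exact hv
  have hmem' : ∀ v ∈ L', ∃ u ∈ Lg, v = u + t • (ι (B u y1) • y1) := by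
    intro v hv
    rw [hL', mem_translate, mul_smul, ← mem_translate] at hv
    exact ⟨_, hv, by rw [← hγ', smul_inv_smul]⟩
  have hx1L : ∀ e : E, e • x1 ∈ Lg := fun e => h.anPart_le hLgL (Submodule.smul_mem _ e hx1)
  have hy1 : y1 ∈ Submodule.span E (L' : Set V) := by
    obtain ⟨τ, hτ0, hτ⟩ := h.exists_skew
    have h1 := hmem _ (hx1L 1)
    have h2 := hmem _ (hx1L τ)
    rw [map_smul, LinearMap.smul_apply, hxy, smul_eq_mul, mul_one] at h1 h2
    rw [map_one, one_smul, one_smul] at h1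
    rw [hτ] at h2
    have h3 : (2 * algebraMap F E t * τ) • y1 ∈ Submodule.span E (L' : Set V) := by
      have h4 := Submodule.sub_mem _ (Submodule.smul_mem _ τ (Submodule.subset_span h1))
        (Submodule.subset_span (R := E) h2)
      convert h4 using 1
      rw [← algebraMap_smul E t, ← algebraMap_smul E t]
      module
    have h5 : 2 * algebraMap F E t * τ ≠ 0 :=
      mul_ne_zero (mul_ne_zero two_ne_zero (by simpa using ht0)) hτ0
    exact (Submodule.smul_mem_iff _ h5).1 h3
  have hspan : Submodule.span E (L' : Set V) =
      Submodule.span E (Lg : Set V) ⊔ Submodule.span E {y1} := by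
    apply le_antisymm
    · refine Submodule.span_le.2 fun v hv => ?_
      obtain ⟨u, hu, rfl⟩ := hmem' v hv
      refine Submodule.add_mem _ (Submodule.mem_sup_left (Submodule.subset_span hu))
        (Submodule.mem_sup_right ?_)
      rw [← algebraMap_smul E t]
      exact Submodule.smul_mem _ _ (Submodule.smul_mem _ _ (Submodule.mem_span_singleton_self y1))
    · refine sup_le (Submodule.span_le.2 fun v hv => ?_)
        (Submodule.span_le.2 (by simpa using hy1))
      have h1 := Submodule.sub_mem _ (Submodule.subset_span (R := E) (hmem v hv))
        (Submodule.smul_mem _ (algebraMap F E t) (Submodule.smul_mem _ (ι (B v y1)) hy1))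
      rw [algebraMap_smul, add_sub_cancel_right] at h1
      exact h1
  have hy1n : y1 ∉ Submodule.span E (Lg : Set V) := by
    intro hy
    have h1 : B x1 y1 = 0 := h.isEps.comm_zero (hx1 y1 hy)
    rw [hxy] at h1
    exact one_ne_zero h1
  have e1 := h.finrank_anPart (L := L')
  have e2 := h.finrank_anPart (L := Lg)
  rw [hspan, Submodule.finrank_sup_span_singleton hy1n] at e1
  rw [← hLg] at hg
  omega

theorem closure_stratum (h : IsDoubling ι ε c κ B) (hL : IsLagrangian c B L) (k : ℕ) :
    closure (stratum c B L k) = {g | k ≤ Module.finrank E (anPart B (translate c B L g))} := by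
  apply subset_antisymm
  · refine closure_minimal (fun g hg => ?_) ?_
    · exact ((h.mem_stratum_iff hL k g).1 hg).ge
    · rw [← isOpen_compl_iff]
      convert h.isOpen_finrank_span L (Module.finrank E V + 1 - k) using 1
      · ext g
        rw [Set.mem_compl_iff, Set.mem_ofPred_eq, Set.mem_ofPred_eq]
        have := h.finrank_anPart (L := translate c B L g)
        omega
  · have key : ∀ d : ℕ, stratum c B L (k + d) ⊆ closure (stratum c B L k) := by
      intro d
      induction d with
      | zero => exact subset_closure
      | succ d ih =>
        intro g hg
        exact closure_minimal ih isClosed_closure (h.mem_closure_stratum hL hg)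
    intro g hg
    obtain ⟨d, hd⟩ := Nat.exists_eq_add_of_le hg
    exact key d ((h.mem_stratum_iff hL _ g).2 hd)

end IsDoubling

end Closure

/-! ## Lagrangian subspaces and rational forms -/

section Forms

variable {F : Type*} [Field F] {E : Type*} [Field E] [Algebra F E]
  {U : Type*} [AddCommGroup U] [Module F U] [Module E U] [IsScalarTower F E U]
  {U' : Type*} [AddCommGroup U'] [Module F U'] [Module E U'] [IsScalarTower F E U']

/-- `P` is an `F`-form of the `E`-space `U`, on which the form `B` takes values in `κ F`. -/
structure IsKForm (κ : E) (B : LinearMap.BilinForm E U) (P : Submodule F U) : Prop where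
  span_eq : Submodule.span E (P : Set U) = ⊤
  finrank_eq : Module.finrank F P = Module.finrank E U
  rational : ∀ x ∈ P, ∀ y ∈ P, ∃ a : F, B x y = a • κ

variable {κ : E} {B : LinearMap.BilinForm E U} {B' : LinearMap.BilinForm E U'}
  {P : Submodule F U} {P' : Submodule F U'} {ε : ℤ}

theorem IsKForm.exists_basis [FiniteDimensional F U] (hP : IsKForm κ B P) :
    ∃ b : Module.Basis (Fin (Module.finrank E U)) E U, P = Submodule.span F (Set.range b) := by
  let p : Module.Basis (Fin (Module.finrank E U)) F P := Module.finBasisOfFinrankEq F P hP.finrank_eq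
  let w : Fin (Module.finrank E U) → U := fun i => (p i : U)
  have hw : P = Submodule.span F (Set.range w) := by
    have h1 := congrArg (Submodule.map P.subtype) p.span_eq
    rw [Submodule.map_span, Submodule.map_subtype_top, ← Set.range_comp] at h1
    exact h1.symm
  have hs : (⊤ : Submodule E U) ≤ Submodule.span E (Set.range w) := by
    rw [← hP.span_eq, Submodule.span_le, hw]
    exact Submodule.span_subset_span F E _
  have hli : LinearIndependent E w := linearIndependent_of_top_le_span_of_card_eq_finrank hs (by simp)
  refine ⟨Module.Basis.mk hli hs, ?_⟩
  rw [hw, Module.Basis.coe_mk]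

theorem isKForm_span {I : Type*} [Fintype I] (b : Module.Basis I E U)
    (hb : ∀ i j, ∃ a : F, B (b i) (b j) = a • κ) :
    IsKForm κ B (Submodule.span F (Set.range b)) where
  span_eq := by
    rw [Submodule.span_span_of_tower, b.span_eq]
  finrank_eq := by
    rw [finrank_span_eq_card, Module.finrank_eq_card_basis b]
    exact b.linearIndependent.restrict_scalars (R := F) (by
      intro x y hxy
      simpa [Algebra.smul_def] using hxy)
  rational x hx y hy := by
    induction hx using Submodule.span_induction with
    | zero => exact ⟨0, by simp⟩
    | add u v _ _ hu hv =>
      obtain ⟨a, ha⟩ := hu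
      obtain ⟨a', ha'⟩ := hv
      exact ⟨a + a', by rw [map_add, LinearMap.add_apply, ha, ha', add_smul]⟩
    | smul t u _ hu =>
      obtain ⟨a, ha⟩ := hu
      exact ⟨t * a, by rw [← algebraMap_smul E t u, map_smul, LinearMap.smul_apply, ha,
        algebraMap_smul, mul_smul]⟩
    | mem u hu =>
      obtain ⟨i, rfl⟩ := hu
      induction hy using Submodule.span_induction with
      | zero => exact ⟨0, by simp⟩
      | add u v _ _ hu hv =>
        obtain ⟨a, ha⟩ := hu
        obtain ⟨a', ha'⟩ := hv
        exact ⟨a + a', by rw [map_add, ha, ha', add_smul]⟩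
      | smul t u _ hu =>
        obtain ⟨a, ha⟩ := hu
        exact ⟨t * a, by rw [← algebraMap_smul E t u, map_smul, ha, algebraMap_smul, mul_smul]⟩
      | mem u hu =>
        obtain ⟨j, rfl⟩ := hu
        exact hb i j

/-- The Gram matrix of a family with a non-degenerate form is invertible if the family is a
basis. -/
theorem det_gram_ne_zero {n : ℕ} (hB : IsEps ε B) (b : Module.Basis (Fin n) E U)
    {S : Matrix (Fin n) (Fin n) F} (hS : ∀ i j, B (b i) (b j) = S i j • κ) : S.det ≠ 0 := by
  intro h0
  obtain ⟨v, hv0, hv⟩ := Matrix.exists_mulVec_eq_zero_iff.2 h0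
  apply hv0
  have h1 : ∑ j, (algebraMap F E (v j)) • b j = 0 := by
    refine hB.sep' _ fun y => ?_
    rw [← b.sum_repr y, map_sum B, LinearMap.sum_apply]
    refine Finset.sum_eq_zero fun i _ => ?_
    rw [map_smul, LinearMap.smul_apply, map_sum]
    have h2 := congrFun hv i
    rw [Matrix.mulVec, dotProduct, Pi.zero_apply] at h2
    have h3 : ∑ j, B (b i) ((algebraMap F E (v j)) • b j) = (∑ j, S i j * v j) • κ := by
      rw [Finset.sum_smul]
      refine Finset.sum_congr rfl fun j _ => ?_
      rw [map_smul, hS, mul_comm, mul_smul, smul_eq_mul, mul_smul_comm, Algebra.smul_def (v j),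
        Algebra.smul_def (S i j)]
      rw [Algebra.smul_def]
      ring
    rw [h3, h2, zero_smul, smul_zero]
  have h2 := Fintype.linearIndependent_iff.1 b.linearIndependent _ h1
  funext j
  simpa using h2 j

theorem exists_isometry_of_gram {I : Type*} (b : Module.Basis I E U) (w : I → U')
    (h : ∀ i j, B' (w i) (w j) = B (b i) (b j)) :
    ∃ e : U →ₗ[E] U', (∀ i, e (b i) = w i) ∧ ∀ x y, B' (e x) (e y) = B x y := by
  refine ⟨b.constr E w, fun i => b.constr_basis E w i, fun x y => ?_⟩
  have : B'.compl₁₂ (b.constr E w) (b.constr E w) = B := by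
    refine b.ext fun i => b.ext fun j => ?_
    rw [LinearMap.compl₁₂_apply, b.constr_basis, b.constr_basis, h]
  rw [← this, LinearMap.compl₁₂_apply]

end Forms

section Parts

variable {F : Type*} [Field F] {E : Type*} [Field E] [Algebra F E]
  {V : Type*} [AddCommGroup V] [Module F V] [Module E V] [IsScalarTower F E V]
  {κ c : E} {B : LinearMap.BilinForm E V} {L L' : Submodule F V} {ε : ℤ} {k : ℕ} {ι : E ≃ₐ[F] E}
  [FiniteDimensional F V] [FiniteDimensional E V]

/-- The part of an `F`-subspace in the middle space `M0`. -/
def LeviDatum.formPart (D : LeviDatum B k) (L : Submodule F V) : Submodule F D.M0 :=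
  L.comap (D.M0.subtype.restrictScalars F)

theorem LeviDatum.mem_formPart (D : LeviDatum B k) {v : D.M0} :
    v ∈ D.formPart L ↔ (v : V) ∈ L := Iff.rfl

/-- The `F`-subspace `X ⊕ P` for an `F`-subspace `P` of `M0`. -/
def LeviDatum.lagrangian (D : LeviDatum B k) (P : Submodule F D.M0) : Submodule F V :=
  D.X.restrictScalars F ⊔ P.map (D.M0.subtype.restrictScalars F)

theorem LeviDatum.mem_lagrangian (D : LeviDatum B k) (hB : IsEps ε B) {P : Submodule F D.M0}
    {x : V} : x ∈ D.lagrangian P ↔ D.projY x = 0 ∧ D.proj x ∈ P := by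
  constructor
  · intro hx
    obtain ⟨y, hy, _, ⟨z, hz, rfl⟩, rfl⟩ := Submodule.mem_sup.1 hx
    change D.projY (y + (z : V)) = 0 ∧ D.proj (y + (z : V)) ∈ P
    have hy' : y ∈ D.X := hy
    rw [map_add, map_add, D.proj_of_mem hy', D.projY_of_mem_X ⟨y, hy'⟩, D.projY_of_mem_M0,
      D.proj_coe, zero_add, zero_add]
    exact ⟨rfl, hz⟩
  · rintro ⟨h1, h2⟩
    rw [← D.decomp hB x, h1, Submodule.coe_zero, add_zero, add_comm]
    exact Submodule.add_mem_sup (D.projX ε x).2 ⟨_, h2, rfl⟩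

theorem LeviDatum.formPart_lagrangian (D : LeviDatum B k) (hB : IsEps ε B)
    (P : Submodule F D.M0) : D.formPart (D.lagrangian P) = P := by
  ext v
  rw [D.mem_formPart, D.mem_lagrangian hB, D.projY_of_mem_M0, D.proj_coe]
  simp

theorem LeviDatum.finrank_lagrangian (D : LeviDatum B k)
    (P : Submodule F D.M0) :
    Module.finrank F (D.lagrangian P) = Module.finrank F E * k + Module.finrank F P := by
  have h1 := Submodule.finrank_sup_add_finrank_inf_eq (D.X.restrictScalars F)
    (P.map (D.M0.subtype.restrictScalars F))
  have h2 : D.X.restrictScalars F ⊓ P.map (D.M0.subtype.restrictScalars F) = ⊥ := by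
    rw [eq_bot_iff]
    rintro _ ⟨hx, z, hz, rfl⟩
    have h3 := D.proj_of_mem (x := (z : V)) hx
    rw [D.proj_coe] at h3
    rw [h3]
    simp
  have h4 : Module.finrank F (D.X.restrictScalars F) = Module.finrank F E * k := by
    have := Module.finrank_mul_finrank F E D.X
    rw [D.finrank_X] at this
    exact this.symm
  have h5 : Module.finrank F (P.map (D.M0.subtype.restrictScalars F)) = Module.finrank F P :=
    (Submodule.equivMapOfInjective _ Subtype.val_injective P).finrank_eq.symm
  rw [h2, finrank_bot, h4, h5] at h1
  exact h1

namespace IsDoubling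

theorem exists_leviDatum [CharZero E] (h : IsDoubling ι ε c κ B) (hL : IsLagrangian c B L)
    (hk : Module.finrank E (anPart B L) = k) : ∃ D : LeviDatum B k, D.X = anPart B L := by
  subst hk
  exact BaseChangeDoubling.exists_leviDatum h.isEps _ (h.isotropic_anPart hL)

theorem eq_lagrangian (h : IsDoubling ι ε c κ B) (hL : IsLagrangian c B L) (D : LeviDatum B k)
    (hD : D.X = anPart B L) : L = D.lagrangian (D.formPart L) := by
  ext x
  rw [D.mem_lagrangian h.isEps, D.mem_formPart]
  have hX : ((D.projX ε x : D.X) : V) ∈ L := h.anPart_le hL (hD ▸ (D.projX ε x).2)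
  have key : D.projY x = 0 → (x ∈ L ↔ (D.proj x : V) ∈ L) := by
    intro h0
    have h1 := D.decomp h.isEps x
    rw [h0, Submodule.coe_zero, add_zero] at h1
    constructor
    · intro hx
      rw [← h1] at hx
      exact (Submodule.add_mem_iff_left L hX).1 hx
    · intro hx
      rw [← h1]
      exact L.add_mem hx hX
  constructor
  · intro hx
    have h0 : D.projY x = 0 := by
      refine Subtype.ext (D.separating_Y _ (D.projY x).2 fun x' hx' => ?_)
      rw [D.form_projY ⟨x', hx'⟩]
      exact ((h.mem_anPart_iff hL).1 (hD ▸ hx')).2 x hx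
    exact ⟨h0, (key h0).1 hx⟩
  · exact fun hx => (key hx.1).2 hx.2

theorem mem_iff (h : IsDoubling ι ε c κ B) (hL : IsLagrangian c B L) (D : LeviDatum B k)
    (hD : D.X = anPart B L) {x : V} : x ∈ L ↔ D.projY x = 0 ∧ (D.proj x : V) ∈ L := by
  conv_lhs => rw [h.eq_lagrangian hL D hD]
  exact D.mem_lagrangian h.isEps

/-- The part of a Lagrangian in `M0` is an `F`-form of `M0`. -/
theorem isKForm_formPart (h : IsDoubling ι ε c κ B) (hL : IsLagrangian c B L)
    (D : LeviDatum B k) (hD : D.X = anPart B L) :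
    IsKForm κ (B.restrict D.M0) (D.formPart L) where
  span_eq := by
    have h1 : (B.restrict D.M0).orthogonal
        (Submodule.span E (D.formPart L : Set D.M0)) = ⊥ := by
      rw [eq_bot_iff]
      intro v hv
      have hv' : (v : V) ∈ D.X := by
        rw [hD, mem_anPart]
        intro y hy
        obtain ⟨hy1, hy2⟩ := (h.mem_iff hL D hD).1 hy
        have h2 : B (D.proj y : V) (v : V) = 0 := hv _ (Submodule.subset_span hy2)
        rw [D.form_decomp h.isEps y, D.proj_coe, h2, D.projX_of_mem_M0 h.isEps, D.projY_of_mem_M0]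
        simp
      have h3 := D.proj_of_mem hv'
      rw [D.proj_coe] at h3
      exact h3
    have h2 := LinearMap.BilinForm.finrank_orthogonal (D.isEps_M0 h.isEps).nondegenerate
      (Submodule.span E (D.formPart L : Set D.M0))
    rw [h1, finrank_bot] at h2
    have h3 := Submodule.finrank_le (Submodule.span E (D.formPart L : Set D.M0))
    exact Submodule.eq_top_of_finrank_eq (by omega)
  finrank_eq := by
    have h1 := D.finrank_lagrangian (D.formPart L)
    rw [← h.eq_lagrangian hL D hD, hL.2, h.finrank_eq] at h1
    have h2 := D.finrank_M0
    omega
  rational x hx y hy := (h.trace_iff _).1 (hL.1 _ hx _ hy)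

theorem isLagrangian_lagrangian (h : IsDoubling ι ε c κ B) (D : LeviDatum B k)
    {P : Submodule F D.M0} (hP : IsKForm κ (B.restrict D.M0) P) :
    IsLagrangian c B (D.lagrangian P) := by
  refine ⟨fun x hx y hy => ?_, ?_⟩
  · rw [D.mem_lagrangian h.isEps] at hx hy
    rw [h.trace_iff, D.form_decomp h.isEps, hx.1, hy.1]
    obtain ⟨a, ha⟩ := hP.rational _ hx.2 _ hy.2
    refine ⟨a, ?_⟩
    rw [← ha]
    simp
  · rw [D.finrank_lagrangian, hP.finrank_eq, h.finrank_eq]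
    have h2 := D.finrank_M0
    omega

theorem anPart_lagrangian (h : IsDoubling ι ε c κ B) (D : LeviDatum B k)
    {P : Submodule F D.M0} (hP : IsKForm κ (B.restrict D.M0) P) :
    anPart B (D.lagrangian P) = D.X := by
  have hle : D.X ≤ anPart B (D.lagrangian P) := by
    intro x hx
    rw [mem_anPart]
    intro y hy
    rw [D.mem_lagrangian h.isEps] at hy
    rw [D.form_decomp h.isEps, hy.1, D.proj_of_mem hx, D.projY_of_mem_X ⟨x, hx⟩]
    simp
  refine le_antisymm ?_ hle
  intro x hx
  have hxL := h.anPart_le (h.isLagrangian_lagrangian D hP) hx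
  obtain ⟨h1, -⟩ := (D.mem_lagrangian h.isEps).1 hxL
  have h2 : D.proj x = 0 := by
    refine (D.isEps_M0 h.isEps).sep' _ fun y => ?_
    have hy : y ∈ Submodule.span E (P : Set D.M0) := by rw [hP.span_eq]; trivial
    induction hy using Submodule.span_induction with
    | zero => simp
    | add a b _ _ ha hb => rw [map_add, LinearMap.add_apply, ha, hb, add_zero]
    | smul e a _ ha => rw [map_smul, LinearMap.smul_apply, ha, smul_zero]
    | mem a ha =>
      have h3 := mem_anPart.1 hx (a : V) (Submodule.mem_sup_right ⟨a, ha, rfl⟩)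
      rw [D.form_decomp h.isEps, D.proj_coe, D.projX_of_mem_M0 h.isEps, D.projY_of_mem_M0] at h3
      simpa using h3
  rw [← D.decomp h.isEps x, h1, h2]
  simp

/-- An isometry of the middle spaces compatible with two Lagrangians extends to an isometry of `V`
that carries one Lagrangian to the other. -/
theorem exists_mem_iff (h : IsDoubling ι ε c κ B) (hL : IsLagrangian c B L)
    (hL' : IsLagrangian c B L') (D D' : LeviDatum B k) (hD : D.X = anPart B L)
    (hD' : D'.X = anPart B L') (e : D.M0 →ₗ[E] D'.M0)
    (he : ∀ v w, B (e v : V) (e w : V) = B (v : V) (w : V))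
    (heL : ∀ v : D.M0, (v : V) ∈ L → (e v : V) ∈ L') :
    ∃ g : isomGroup B, ∀ v, v ∈ L ↔ g • v ∈ L' := by
  obtain ⟨g, hg1, hg2, -⟩ := LeviDatum.exists_extend h.isEps D D'
    (LinearEquiv.ofFinrankEq D.X D'.X (by rw [D.finrank_X, D'.finrank_X])) e he
  have h1 : ∀ v ∈ L, toDoubled F c B g • v ∈ L' := by
    intro v hv
    rw [toDoubled_smul]
    obtain ⟨hv1, hv2⟩ := (h.mem_iff hL D hD).1 hv
    rw [← D.decomp h.isEps v, hv1, Submodule.coe_zero, add_zero, smul_add, hg1, hg2]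
    exact L'.add_mem (heL _ hv2) (h.anPart_le hL' (hD' ▸ Submodule.coe_mem _))
  have h2 := smul_coe_eq_of_forall h1 (by rw [hL.2, hL'.2])
  refine ⟨g, fun v => ?_⟩
  rw [← toDoubled_smul (F := F) (c := c), ← SetLike.mem_coe (p := L'), ← h2,
    Set.smul_mem_smul_set_iff]
  rfl

/-- An isometry in the stabilizer of `L_an` maps one Lagrangian into another if and only if its
Levi component does so in the middle space. -/
theorem forall_smul_mem_iff (h : IsDoubling ι ε c κ B) (hL : IsLagrangian c B L)
    (hL' : IsLagrangian c B L') (D : LeviDatum B k) (hD : D.X = anPart B L)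
    (hD' : D.X = anPart B L') (p : stab B D.X) :
    (∀ v ∈ L, (p : isomGroup B) • v ∈ L') ↔
      ∀ v : D.M0, (v : V) ∈ L → ((D.levi p • v : D.M0) : V) ∈ L' := by
  have hX : ∀ x ∈ D.X, x ∈ L' := fun x hx => h.anPart_le hL' (hD' ▸ hx)
  constructor
  · intro hp v hv
    have h1 := D.smul_sub_proj_mem p v.2
    have h2 := L'.sub_mem (hp _ hv) (hX _ h1)
    rw [sub_sub_cancel] at h2
    exact h2
  · intro hp v hv
    obtain ⟨hv1, hv2⟩ := (h.mem_iff hL D hD).1 hv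
    rw [← D.decomp h.isEps v, hv1, Submodule.coe_zero, add_zero, smul_add]
    refine L'.add_mem ?_ (hX _ (stab_smul_mem p (D.projX ε v).2))
    have h1 := D.smul_sub_proj_mem p (D.proj v).2
    have h2 := L'.add_mem (hX _ h1) (hp _ hv2)
    convert h2 using 1
    exact (sub_add_cancel _ _).symm

theorem smul_anPart_mem {g : isomGroup B}
    (hg : ∀ v, v ∈ L ↔ g • v ∈ L') {x : V} (hx : x ∈ anPart B L) : g • x ∈ anPart B L' := by
  rw [mem_anPart] at hx ⊢
  intro y hy
  have := hx (g⁻¹ • y) ((hg _).2 (by rwa [smul_inv_smul]))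
  rwa [isom_inv_apply] at this

theorem isLagrangian_of_isKForm (h : IsDoubling ι ε c κ B) {P : Submodule F V}
    (hP : IsKForm κ B P) : IsLagrangian c B P :=
  ⟨fun x hx y hy => (h.trace_iff _).2 (hP.rational x hx y hy), hP.finrank_eq⟩

theorem anPart_of_isKForm (h : IsDoubling ι ε c κ B) {P : Submodule F V}
    (hP : IsKForm κ B P) : anPart B P = ⊥ := by
  have := h.finrank_anPart (L := P)
  rw [hP.span_eq, finrank_top] at this
  exact Submodule.finrank_eq_zero.1 (by omega)

theorem isKForm_of_isLagrangian (h : IsDoubling ι ε c κ B) (hL : IsLagrangian c B L)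
    (h0 : Module.finrank E (anPart B L) = 0) : IsKForm κ B L where
  span_eq := by
    have := h.finrank_anPart (L := L)
    exact Submodule.eq_top_of_finrank_eq (by omega)
  finrank_eq := hL.2
  rational x hx y hy := (h.trace_iff _).1 (hL.1 x hx y hy)

end IsDoubling

end Parts

section OpenOrbits

open Topology Filter

variable {F : Type*} [Field F] [CharZero F] {E : Type*} [Field E] [Algebra F E]
  {V : Type*} [AddCommGroup V] [Module F V] [Module E V] [IsScalarTower F E V]
  [FiniteDimensional F V] [FiniteDimensional E V] {ι : E ≃ₐ[F] E} {ε : ℤ} {c κ : E}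
  {B : LinearMap.BilinForm E V} {L : Submodule F V}

namespace IsDoubling

theorem form_eq_smul (h : IsDoubling ι ε c κ B) (hL : IsLagrangian c B L) {x y : V} (hx : x ∈ L)
    (hy : y ∈ L) : B x y = ((2 : F)⁻¹ * doubledForm F κ⁻¹ B x y) • κ := by
  obtain ⟨a, ha⟩ := (h.trace_iff _).1 (hL.1 x hx y hy)
  have h1 : κ⁻¹ * a • κ = algebraMap F E a := by
    rw [Algebra.smul_def, mul_left_comm, inv_mul_cancel₀ h.κ_ne, mul_one]
  rw [doubledForm_apply, ha, h1, Algebra.trace_algebraMap, h.finrank_eq, nsmul_eq_mul,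
    Nat.cast_ofNat, inv_mul_cancel_left₀ two_ne_zero]

variable [ValuativeRel F] [TopologicalSpace F] [IsNonarchimedeanLocalField F]

/-- The orbits of `Isom(V)` on a stratum are open in it. -/
theorem eventually_mem_orbitSet (h : IsDoubling ι ε c κ B) (hL : IsLagrangian c B L) {k : ℕ}
    {g : isomGroup (doubledForm F c B)} (hg : g ∈ stratum c B L k) :
    ∀ᶠ g' in 𝓝[stratum c B L k] g,
      g' ∈ orbitSet (toDoubled F c B) (stab (doubledForm F c B) L) g := by
  have := h.finiteDimensional
  have : CharZero E := charZero_of_injective_algebraMap (algebraMap F E).injective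
  obtain ⟨_, _, _, _, _⟩ := isom_topology F h.isEps_doubledForm
  letI : TopologicalSpace V := moduleTopology F V
  haveI : IsModuleTopology F V := ⟨rfl⟩
  have hLg := isLagrangian_translate hL g
  obtain ⟨D, hD⟩ := h.exists_leviDatum hLg ((h.mem_stratum_iff hL k g).1 hg)
  have hP := h.isKForm_formPart hLg D hD
  have hM0 := D.isEps_M0 h.isEps
  have : FiniteDimensional F D.M0 := FiniteDimensional.trans F E D.M0
  obtain ⟨b, hb⟩ := hP.exists_basis
  have hbL : ∀ i, (b i : V) ∈ translate c B L g := fun i => by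
    have : b i ∈ D.formPart (translate c B L g) := by
      rw [hb]
      exact Submodule.subset_span ⟨i, rfl⟩
    exact this
  let S : isomGroup (doubledForm F c B) →
      Matrix (Fin (Module.finrank E D.M0)) (Fin (Module.finrank E D.M0)) F := fun g' i j =>
    (2 : F)⁻¹ * doubledForm F κ⁻¹ B (g'⁻¹ • g • (b i : V)) (g'⁻¹ • g • (b j : V))
  have hSg : ∀ i j, B.restrict D.M0 (b i) (b j) = S g i j • κ := fun i j => by
    change B (b i : V) (b j : V) = _
    rw [h.form_eq_smul hLg (hbL i) (hbL j)]
    simp only [S, inv_smul_smul]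
  have hSt : ∀ g', (S g').transpose = (ε : F) • S g' := fun g' => by
    ext i j
    rw [Matrix.transpose_apply, Matrix.smul_apply, smul_eq_mul]
    change (2 : F)⁻¹ * Algebra.trace F E (κ⁻¹ * B _ _) =
      ε * ((2 : F)⁻¹ * Algebra.trace F E (κ⁻¹ * B _ _))
    rw [h.isEps.swap (g'⁻¹ • g • (b i : V))]
    rcases h.isEps.eps with rfl | rfl <;> simp
  have hSc : Continuous S := by
    refine continuous_matrix fun i j => continuous_const.mul ?_
    have hv : ∀ v : V, Continuous fun g' : isomGroup (doubledForm F c B) => g'⁻¹ • v := fun v =>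
      (continuous_isom_smul v).comp continuous_inv
    exact (continuous_form (B := doubledForm F κ⁻¹ B)).comp ((hv _).prodMk (hv _))
  rw [eventually_nhdsWithin_iff]
  filter_upwards [hSc.continuousAt.eventually
    (eventually_congruent h.isEps.eps (hSt g) (det_gram_ne_zero hM0 b hSg))] with g' hg' hgk
  obtain ⟨C, hC⟩ := hg' (hSt g')
  rw [mem_orbitSet_iff]
  have hL' := isLagrangian_translate hL g'
  obtain ⟨D', hD'⟩ := h.exists_leviDatum hL' ((h.mem_stratum_iff hL k g').1 hgk)
  have hwL : ∀ i, g'⁻¹ • g • (b i : V) ∈ translate c B L g' := fun i => by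
    rw [mem_translate, smul_inv_smul, ← mem_translate]
    exact hbL i
  let p : Fin (Module.finrank E D.M0) → D'.M0 := fun i => D'.proj (g'⁻¹ • g • (b i : V))
  have hp : ∀ i j, B (p i : V) (p j : V) = S g' i j • κ := fun i j => by
    rw [← h.form_eq_smul hL' (hwL i) (hwL j), D'.form_decomp h.isEps (g'⁻¹ • g • (b i : V)),
      ((h.mem_iff hL' D' hD').1 (hwL i)).1, ((h.mem_iff hL' D' hD').1 (hwL j)).1]
    simp [p]
  let w : Fin (Module.finrank E D.M0) → D'.M0 := fun j => ∑ i, C i j • p i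
  have hw : ∀ i j, B.restrict D'.M0 (w i) (w j) = B.restrict D.M0 (b i) (b j) := by
    intro i j
    rw [hSg, ← hC]
    change B (w i : V) (w j : V) = _
    have hw' : ∀ i, (w i : V) = ∑ l, algebraMap F E (C l i) • (p l : V) := fun i => by
      simp only [w, Submodule.coe_sum, Submodule.coe_smul_of_tower, algebraMap_smul]
    rw [hw', hw', map_sum B, LinearMap.sum_apply]
    simp only [map_sum, map_smul, LinearMap.smul_apply, hp, smul_eq_mul]
    rw [Matrix.mul_apply, Finset.sum_smul, Finset.sum_comm]
    refine Finset.sum_congr rfl fun l _ => ?_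
    rw [Matrix.mul_apply, Finset.sum_mul, Finset.sum_smul]
    refine Finset.sum_congr rfl fun l' _ => ?_
    simp only [Algebra.smul_def, Matrix.transpose_apply, map_mul]
    ring
  obtain ⟨e, he, he'⟩ := exists_isometry_of_gram b w hw
  obtain ⟨x, hx⟩ := h.exists_mem_iff hLg hL' D D' hD hD' e he' (by
    intro v hv
    have hv' : v ∈ Submodule.span F (Set.range b) := hb ▸ hv
    have hle : Submodule.span F (Set.range b) ≤
        (D'.formPart (translate c B L g')).comap (e.restrictScalars F) := by
      rw [Submodule.span_le]
      rintro _ ⟨i, rfl⟩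
      change e (b i) ∈ D'.formPart (translate c B L g')
      rw [he]
      exact Submodule.sum_mem _ fun l _ => Submodule.smul_mem _ _
        ((h.mem_iff hL' D' hD').1 (hwL l)).2
    exact hle hv')
  exact ⟨x⁻¹, fun v => by rw [hx, smul_inv_smul]⟩

end IsDoubling

end OpenOrbits

section Strata

open Topology Filter

variable {F : Type*} [Field F] [CharZero F] [ValuativeRel F] [TopologicalSpace F]
  [IsNonarchimedeanLocalField F] {E : Type*} [Field E] [Algebra F E]
  {V : Type*} [AddCommGroup V] [Module F V] [Module E V] [IsScalarTower F E V]
  [FiniteDimensional F V] [FiniteDimensional E V] {ι : E ≃ₐ[F] E} {ε : ℤ} {c κ : E}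
  {B : LinearMap.BilinForm E V} {L : Submodule F V}

theorem finrank_anPart_mul {q : isomGroup (doubledForm F c B)}
    (hq : q ∈ stab (doubledForm F c B) L) (g : isomGroup (doubledForm F c B)) (x : isomGroup B) :
    Module.finrank E (anPart B (translate c B L (q * g * toDoubled F c B x))) =
      Module.finrank E (anPart B (translate c B L g)) := by
  obtain ⟨y, hy⟩ := (IsDoubling.mem_orbitSet_iff (L := L) g (q * g * toDoubled F c B x)).1
    ⟨q, hq, x, rfl⟩
  have : moveBy y (anPart B (translate c B L (q * g * toDoubled F c B x))) =
      anPart B (translate c B L g) := by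
    apply le_antisymm
    · rintro _ ⟨v, hv, rfl⟩
      exact IsDoubling.smul_anPart_mem hy hv
    · intro v hv
      refine ⟨y⁻¹ • v, ?_, smul_inv_smul y v⟩
      have hy' : ∀ w, w ∈ translate c B L g ↔
          y⁻¹ • w ∈ translate c B L (q * g * toDoubled F c B x) := fun w => by
        rw [hy, smul_inv_smul]
      exact IsDoubling.smul_anPart_mem hy' hv
  rw [← this, finrank_moveBy]

namespace IsDoubling

/-- The orbits of `Isom(V)` on the `k`-th stratum. -/
theorem orbitDecomposition (h : IsDoubling ι ε c κ B) (hL : IsLagrangian c B L) {k : ℕ}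
    {I : Type*} {z : I → isomGroup (doubledForm F c B)}
    (hz : ∀ i, Module.finrank E (anPart B (translate c B L (z i))) = k)
    (hex : ∀ L' : Submodule F V, IsLagrangian c B L' → Module.finrank E (anPart B L') = k →
      ∃ i, ∃ x : isomGroup B, ∀ v, v ∈ L' ↔ x • v ∈ translate c B L (z i))
    (huniq : ∀ i i', (∃ x : isomGroup B, ∀ v, v ∈ translate c B L (z i') ↔
      x • v ∈ translate c B L (z i)) → i = i') :
    OrbitDecomposition (toDoubled F c B) (stab (doubledForm F c B) L)
      (closure (stratum c B L k)) (closure (stratum c B L (k + 1))) z := by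
  have hZ : closure (stratum c B L k) \ closure (stratum c B L (k + 1)) = stratum c B L k := by
    ext g
    rw [h.closure_stratum hL, h.closure_stratum hL, h.mem_stratum_iff hL, Set.mem_sdiff,
      Set.mem_ofPred_eq, Set.mem_ofPred_eq]
    omega
  have hm : ∀ k, ∀ q ∈ stab (doubledForm F c B) L, ∀ g ∈ closure (stratum c B L k), ∀ x,
      q * g * toDoubled F c B x ∈ closure (stratum c B L k) := by
    intro k q hq g hg x
    rw [h.closure_stratum hL, Set.mem_ofPred_eq] at hg ⊢
    rwa [finrank_anPart_mul hq]
  refine ⟨isClosed_closure, isClosed_closure, ?_, hm k, hm (k + 1), fun i => ?_, fun g hg => ?_,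
    fun i i' hi => ?_, fun g hg => ?_⟩
  · rw [h.closure_stratum hL, h.closure_stratum hL]
    intro g hg
    rw [Set.mem_ofPred_eq] at hg ⊢
    omega
  · rw [hZ, h.mem_stratum_iff hL, hz]
  · rw [hZ, h.mem_stratum_iff hL] at hg
    obtain ⟨i, hi⟩ := hex _ (isLagrangian_translate hL g) hg
    exact ⟨i, (mem_orbitSet_iff _ _).2 hi⟩
  · exact huniq i i' ((mem_orbitSet_iff _ _).1 hi)
  · rw [hZ] at hg ⊢
    exact h.eventually_mem_orbitSet hL hg

end IsDoubling

end Strata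

/-! ## The characters of the stabilizers -/

section Characters

theorem ofReal_zpow_cpow_half {a : ℝ} (ha : 0 < a) (n : ℤ) :
    ((a ^ n : ℝ) : ℂ) ^ (1 / 2 : ℂ) = (a : ℂ) ^ ((n : ℂ) / 2) := by
  have h1 : (1 / 2 : ℂ) = ((1 / 2 : ℝ) : ℂ) := by push_cast; rfl
  have h2 : ((n : ℂ) / 2) = (((n : ℝ) * (1 / 2) : ℝ) : ℂ) := by push_cast; ring
  rw [h1, h2, ← Complex.ofReal_cpow (zpow_nonneg ha.le n), ← Complex.ofReal_cpow ha.le,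
    Real.rpow_mul ha.le, Real.rpow_intCast]

theorem LeviDatum.posPow_modulus_mul (F : Type*) [Field F] [ValuativeRel F] [TopologicalSpace F]
    [IsNonarchimedeanLocalField F] {K M : Type*} [Field K] [CharZero K] [Algebra F K]
    [AddCommGroup M] [Module K M] [FiniteDimensional K M] {ε : ℤ} {B : LinearMap.BilinForm K M}
    {k : ℕ} (hB : IsEps ε B) (D : LeviDatum B k) (p : stab B D.X) (z : ℂ) :
    posPow (modulus B D.X F) (1 / 2) p * posPow ((relAbs F K).comp (detOn B D.X)) z p =
      ((relAbs F K (detOn B D.X p) : ℝ) : ℂ) ^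
        (z + ((Module.finrank K M : ℂ) - k - ε) / 2) := by
  have h0 : 0 < (relAbs F K (detOn B D.X p) : ℝ) :=
    NNReal.coe_pos.2 (pos_iff_ne_zero.2 (relAbs_detOn_ne_zero F p))
  change ((modulus B D.X F p : ℝ) : ℂ) ^ (1 / 2 : ℂ) * ((relAbs F K (detOn B D.X p) : ℝ) : ℂ) ^ z = _
  rw [D.modulus_eq F hB, NNReal.coe_zpow, ofReal_zpow_cpow_half h0,
    ← Complex.cpow_add _ _ (by exact_mod_cast h0.ne'), add_comm]
  push_cast
  rfl

variable {F : Type*} [Field F] [CharZero F] [ValuativeRel F] [TopologicalSpace F]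
  [IsNonarchimedeanLocalField F] {E : Type*} [Field E] [Algebra F E]
  {V : Type*} [AddCommGroup V] [Module F V] [Module E V] [IsScalarTower F E V]
  [FiniteDimensional F V] [FiniteDimensional E V] {ι : E ≃ₐ[F] E} {ε : ℤ} {c κ : E}
  {B : LinearMap.BilinForm E V} {L : Submodule F V}

/-- The character `δ^{1/2} |det|^s` of the stabilizer of `L`. -/
noncomputable def siegelHom (c : E) (B : LinearMap.BilinForm E V) (L : Submodule F V) (s : ℂ) :
    stab (doubledForm F c B) L →* ℂ :=
  posPow (modulus (doubledForm F c B) L F) (1 / 2) *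
    posPow ((relAbs F F).comp (detOn (doubledForm F c B) L)) s

theorem IsDoubling.siegelHom_apply (h : IsDoubling ι ε c κ B) (hL : IsLagrangian c B L) (s : ℂ)
    (q : stab (doubledForm F c B) L) :
    siegelHom c B L s q = ((relAbs F F (detOn (doubledForm F c B) L q) : ℝ) : ℂ) ^
      (s + ((Module.finrank E V : ℂ) - ε) / 2) := by
  obtain ⟨N, D, hN, rfl⟩ : ∃ N, ∃ D : LeviDatum (doubledForm F c B) N,
      N = Module.finrank E V ∧ D.X = L := by
    obtain ⟨D, hD⟩ := BaseChangeDoubling.exists_leviDatum h.isEps_doubledForm L hL.1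
    exact ⟨_, D, hL.2, hD⟩
  refine (D.posPow_modulus_mul F h.isEps_doubledForm q s).trans ?_
  congr 2
  rw [h.finrank_doubled, hN]
  push_cast
  ring

theorem mem_filt_iff (c : E) (B : LinearMap.BilinForm E V) (L : Submodule F V) (s : ℂ) (k : ℕ)
    (f : isomGroup (doubledForm F c B) → ℂ) :
    f ∈ filt c B L s k ↔ (∀ (q : stab (doubledForm F c B) L) g, f (q * g) =
      siegelHom c B L s q * f g) ∧
      (∃ U : Subgroup (isomGroup (doubledForm F c B)), IsOpen (U : Set (isomGroup (doubledForm F c B))) ∧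
        ∀ u ∈ U, ∀ g, f (g * u) = f g) ∧
      ∀ g ∈ closure (stratum c B L k), f g = 0 := by
  have h1 : ∀ (q : stab (doubledForm F c B) L) (v : ℂ),
      twist (posPow (modulus (doubledForm F c B) L F) (1 / 2))
        (siegelChar (doubledForm F c B) L s) q v = siegelHom c B L s q * v := fun q v =>
    (mul_assoc _ _ _).symm
  constructor
  · rintro ⟨⟨h2, h3⟩, h4⟩
    exact ⟨fun q g => by rw [h2, h1], h3, h4⟩
  · rintro ⟨h2, h3, h4⟩
    exact ⟨⟨fun q g => by rw [h2, h1], h3⟩, h4⟩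

theorem relAbs_norm (F : Type*) [Field F] [ValuativeRel F] [TopologicalSpace F]
    [IsNonarchimedeanLocalField F] (E : Type*) [Field E] [Algebra F E] (x : E) :
    relAbs F F (Algebra.norm F x) = relAbs F E x := by
  change normAbs F (Algebra.norm F (Algebra.norm F x)) = normAbs F (Algebra.norm F x)
  rw [Algebra.norm_self, MonoidHom.id_apply]

/-- The `F`-valued form on a rational form is non-degenerate. -/
theorem IsKForm.isEps [FiniteDimensional F E] {U : Type*} [AddCommGroup U] [Module F U]
    [Module E U] [IsScalarTower F E U] {B : LinearMap.BilinForm E U} {P : Submodule F U}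
    (hB : IsEps ε B) (hP : IsKForm κ B P) (hκ : κ ≠ 0) :
    IsEps ε ((doubledForm F κ⁻¹ B).restrict P) where
  eps := hB.eps
  swap x y := by
    change Algebra.trace F E (κ⁻¹ * B (y : U) (x : U)) =
      (ε : F) * Algebra.trace F E (κ⁻¹ * B (x : U) (y : U))
    rw [hB.swap (x : U)]
    rcases hB.eps with rfl | rfl <;> simp
  sep x hx := by
    refine Subtype.ext (hB.sep _ fun y => ?_)
    have hy : y ∈ Submodule.span E (P : Set U) := by rw [hP.span_eq]; trivial
    induction hy using Submodule.span_induction with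
    | zero => simp
    | add a b _ _ ha hb => rw [map_add, ha, hb, add_zero]
    | smul e a _ ha => rw [map_smul, ha, smul_zero]
    | mem y hy =>
      obtain ⟨a, ha⟩ := hP.rational _ x.2 y hy
      have h1 : Algebra.trace F E (κ⁻¹ * B (x : U) y) = 0 := hx ⟨y, hy⟩
      have h2 : κ⁻¹ * a • κ = algebraMap F E a := by
        rw [Algebra.smul_def, mul_left_comm, inv_mul_cancel₀ hκ, mul_one]
      rw [ha, h2, Algebra.trace_algebraMap, nsmul_eq_mul] at h1
      have h3 : a = 0 := (mul_eq_zero.1 h1).resolve_left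
        (Nat.cast_ne_zero.2 Module.finrank_pos.ne')
      rw [ha, h3, zero_smul]

theorem IsDoubling.relAbs_det_lagrangian (h : IsDoubling ι ε c κ B) {k : ℕ} (D : LeviDatum B k)
    {P : Submodule F D.M0} (hP : IsKForm κ (B.restrict D.M0) P) (p : stab B D.X)
    (f : Module.End F (D.lagrangian P)) (hf : ∀ x, (f x : V) = (p : isomGroup B) • (x : V)) :
    relAbs F F (LinearMap.det f) = relAbs F E (detOn B D.X p) := by
  have := h.finiteDimensional
  let π : D.lagrangian P →ₗ[F] P :=
    { toFun := fun x => ⟨D.proj (x : V), ((D.mem_lagrangian h.isEps).1 x.2).2⟩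
      map_add' := fun x y => Subtype.ext (by simp)
      map_smul' := fun a x => Subtype.ext (by
        change D.proj (a • (x : V)) = a • D.proj (x : V)
        rw [← algebraMap_smul E a, map_smul, algebraMap_smul]) }
  have hπ : ∀ x, ((π x : P) : D.M0) = D.proj (x : V) := fun x => rfl
  have hPL : ∀ v : P, ((v : D.M0) : V) ∈ D.lagrangian P := fun v =>
    Submodule.mem_sup_right ⟨_, v.2, rfl⟩
  have hsurj : Function.Surjective π := fun v =>
    ⟨⟨_, hPL v⟩, Subtype.ext (by rw [hπ, D.proj_coe])⟩
  have hXL : ∀ x ∈ D.X, x ∈ D.lagrangian P := fun x hx => Submodule.mem_sup_left hx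
  let W : Submodule F (D.lagrangian P) := LinearMap.ker π
  have hWX : ∀ x : D.lagrangian P, x ∈ W ↔ (x : V) ∈ D.X := by
    intro x
    rw [LinearMap.mem_ker]
    constructor
    · intro h0
      have h1 := D.decomp h.isEps (x : V)
      rw [((D.mem_lagrangian h.isEps).1 x.2).1, ← hπ, h0] at h1
      simp only [Submodule.coe_zero, zero_add, add_zero] at h1
      rw [← h1]
      exact Submodule.coe_mem _
    · exact fun hx => Subtype.ext (D.proj_of_mem hx)
  have hW : W ≤ W.comap f := by
    intro x hx
    rw [Submodule.mem_comap, hWX, hf]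
    exact stab_smul_mem p ((hWX x).1 hx)
  have : Module.Free F W := Module.Free.of_divisionRing F W
  have : Module.Free F (D.lagrangian P ⧸ W) := Module.Free.of_divisionRing F _
  have hproj : ∀ x : D.lagrangian P, D.levi p • D.proj (x : V) = D.proj (f x : V) := by
    intro x
    have h1 := D.decomp h.isEps (x : V)
    rw [((D.mem_lagrangian h.isEps).1 x.2).1, Submodule.coe_zero, add_zero] at h1
    conv_rhs => rw [hf, ← h1, smul_add, map_add, D.proj_of_mem (stab_smul_mem p (Submodule.coe_mem _)), add_zero]
    rfl
  let m : P →ₗ[F] P := π ∘ₗ f ∘ₗ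
    ((D.M0.subtype.restrictScalars F ∘ₗ P.subtype).codRestrict (D.lagrangian P) hPL)
  have hm : ∀ v : P, ((m v : P) : D.M0) = D.levi p • (v : D.M0) := by
    intro v
    refine (hproj ⟨_, hPL v⟩).symm.trans ?_
    rw [D.proj_coe]
  have : FiniteDimensional F D.M0 := FiniteDimensional.trans F E D.M0
  have hPε := hP.isEps (D.isEps_M0 h.isEps) h.κ_ne
  obtain ⟨g, hg⟩ := exists_isom_of_preserving hPε m (fun v w => by
    change Algebra.trace F E (κ⁻¹ * B.restrict D.M0 (m v : D.M0) (m w : D.M0)) =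
      Algebra.trace F E (κ⁻¹ * B.restrict D.M0 (v : D.M0) (w : D.M0))
    rw [hm, hm, isom_apply])
  have hdetm : relAbs F F (LinearMap.det m) = 1 := by
    have h1 : ((g : P ≃ₗ[F] P) : P →ₗ[F] P) = m := LinearMap.ext hg
    rw [← h1]
    exact relAbs_eq_one_of_sq F (det_isom_sq hPε g)
  have hdetQ : LinearMap.det (W.mapQ W f hW) = LinearMap.det m := by
    let e : (D.lagrangian P ⧸ W) ≃ₗ[F] P := π.quotKerEquivOfSurjective hsurj
    rw [← LinearMap.det_conj _ e]
    congr 1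
    refine LinearMap.ext fun v => ?_
    obtain ⟨x, rfl⟩ := hsurj v
    have h1 : e.symm (π x) = Submodule.Quotient.mk x := by
      rw [LinearEquiv.symm_apply_eq]
      rfl
    simp only [LinearMap.comp_apply, LinearEquiv.coe_coe]
    rw [h1]
    refine Subtype.ext ?_
    rw [hm, hπ, hproj]
    rfl
  have hdetW : LinearMap.det (f.restrict hW) = Algebra.norm F (detOn B D.X p) := by
    let e : W ≃ₗ[F] D.X :=
      { toFun := fun x => ⟨(x : D.lagrangian P), (hWX _).1 x.2⟩
        invFun := fun x => ⟨⟨x, hXL _ x.2⟩, (hWX _).2 x.2⟩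
        left_inv := fun x => rfl
        right_inv := fun x => rfl
        map_add' := fun x y => rfl
        map_smul' := fun a x => rfl }
    rw [← LinearMap.det_conj _ e]
    change _ = Algebra.norm F (LinearMap.det (restr B D.X p))
    rw [← LinearMap.det_restrictScalars]
    congr 1
    refine LinearMap.ext fun x => Subtype.ext ?_
    exact hf _
  rw [LinearMap.det_eq_det_mul_det W f hW, map_mul, hdetQ, hdetm, mul_one, hdetW, relAbs_norm]

end Characters

/-! ## The graded pieces -/

theorem nonempty_quotient_equiv {G A W : Type*} [Group G] [AddCommGroup A] [Module ℂ A]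
    [AddCommMonoid W] [Module ℂ W] (ρ : Representation ℂ G A) (N : Submodule ℂ A)
    (hN : ∀ g, N ≤ N.comap (ρ g)) (Θ : A →ₗ[ℂ] W) (hΘ : Function.Surjective Θ)
    (hker : ∀ f, f ∈ N ↔ Θ f = 0) (σ : Representation ℂ G W)
    (hσ : ∀ g f, Θ (ρ g f) = σ g (Θ f)) : Nonempty ((ρ.quotient N hN).Equiv σ) := by
  let : AddCommGroup W := Module.addCommMonoidToAddCommGroup ℂ
  let e : (A ⧸ N) →ₗ[ℂ] W := N.liftQ Θ fun f hf => (hker f).1 hf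
  have he : Function.Bijective e := by
    constructor
    · rw [← LinearMap.ker_eq_bot, LinearMap.ker_eq_bot']
      intro x hx
      obtain ⟨f, rfl⟩ := Submodule.Quotient.mk_surjective _ x
      rw [Submodule.Quotient.mk_eq_zero, hker]
      exact hx
    · intro w
      obtain ⟨f, rfl⟩ := hΘ w
      exact ⟨Submodule.Quotient.mk f, rfl⟩
  refine ⟨Representation.Equiv.mk (LinearEquiv.ofBijective e he) fun g => ?_⟩
  refine LinearMap.ext fun x => ?_
  obtain ⟨f, rfl⟩ := Submodule.Quotient.mk_surjective _ x
  exact hσ g f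

theorem nonempty_equiv_directSum {G A I : Type*} [Group G] [AddCommMonoid A] [Module ℂ A]
    {V W : I → Type*} [∀ i, AddCommMonoid (V i)] [∀ i, Module ℂ (V i)]
    [∀ i, AddCommMonoid (W i)] [∀ i, Module ℂ (W i)] {τ : Representation ℂ G A}
    {ρ : ∀ i, Representation ℂ G (V i)} {σ : ∀ i, Representation ℂ G (W i)}
    (h : Nonempty (τ.Equiv (Representation.directSum ρ))) (e : ∀ i, Nonempty ((ρ i).Equiv (σ i))) :
    Nonempty (τ.Equiv (Representation.directSum σ)) :=
  h.elim fun e1 => (nonempty_directSum_equiv ρ σ e).elim fun e2 => ⟨e1.trans e2⟩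

section Graded

open Topology Filter

variable {F : Type*} [Field F] [CharZero F] [ValuativeRel F] [TopologicalSpace F]
  [IsNonarchimedeanLocalField F] {E : Type*} [Field E] [Algebra F E]
  [TopologicalSpace E] [IsModuleTopology F E]
  {V : Type*} [AddCommGroup V] [Module F V] [Module E V] [IsScalarTower F E V]
  [FiniteDimensional F V] [FiniteDimensional E V] {ι : E ≃ₐ[F] E} {ε : ℤ} {c κ : E}
  {B : LinearMap.BilinForm E V} {L : Submodule F V}

namespace IsDoubling

theorem continuous_toDoubled (h : IsDoubling ι ε c κ B) : Continuous (toDoubled F c B) := by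
  have := h.finiteDimensional
  have := isTopologicalRing_ext F E
  letI : TopologicalSpace V := moduleTopology F V
  haveI : IsModuleTopology F V := ⟨rfl⟩
  have := isModuleTopology_ext F E V
  exact continuous_isom_iff.2 fun v => continuous_isom_smul (B := B) v

/-- The quotient `J_k(s)` is the direct sum of the compact inductions attached to the orbits on the
`k`-th stratum. -/
theorem nonempty_gradedRep_equiv [IsTopologicalGroup (isomGroup B)] (h : IsDoubling ι ε c κ B) (hL : IsLagrangian c B L) {k : ℕ}
    {I : Type*} {z : I → isomGroup (doubledForm F c B)}
    (hz : ∀ i, Module.finrank E (anPart B (translate c B L (z i))) = k)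
    (hex : ∀ L' : Submodule F V, IsLagrangian c B L' → Module.finrank E (anPart B L') = k →
      ∃ i, ∃ x : isomGroup B, ∀ v, v ∈ L' ↔ x • v ∈ translate c B L (z i))
    (huniq : ∀ i i', (∃ x : isomGroup B, ∀ v, v ∈ translate c B L (z i') ↔
      x • v ∈ translate c B L (z i)) → i = i') (s : ℂ) :
    Nonempty ((gradedRep c B L s k).Equiv (Representation.directSum fun i =>
      compIndRep (stabAt (toDoubled F c B) (stab (doubledForm F c B) L) (z i))
        (charAt (toDoubled F c B) (siegelHom c B L s) (z i)))) := by
  have := h.finiteDimensional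
  obtain ⟨_, _, _, _, _⟩ := isom_topology F h.isEps
  obtain ⟨_, _, _, _, _⟩ := isom_topology F h.isEps_doubledForm
  obtain ⟨K0, hK0, hK⟩ := exists_compact_mul F h.isEps_doubledForm L hL.1
  obtain ⟨O, hO, hO1⟩ := exists_nhds_relAbs_detOn (B := doubledForm F c B) F L
  obtain ⟨Θ, hΘ, hker, hΘρ⟩ := (h.orbitDecomposition hL hz hex huniq).exists_restriction
    h.continuous_toDoubled (isClosed_stab F L) (χ := siegelHom c B L s)
    ⟨O, hO, fun q hq => by rw [h.siegelHom_apply hL, hO1 q hq]; simp⟩ hK0 hK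
    (mem_filt_iff c B L s (k + 1)) (filtRep c B L s (k + 1)) (fun g f x => rfl)
  refine nonempty_quotient_equiv (filtRep c B L s (k + 1)) _ _ Θ hΘ (fun f => ?_) _ hΘρ
  rw [hker]
  exact ⟨fun hf => hf.2, fun hf => ⟨f.2.1, hf⟩⟩

theorem mem_stabAt_iff {g : isomGroup (doubledForm F c B)} {x : isomGroup B} :
    x ∈ stabAt (toDoubled F c B) (stab (doubledForm F c B) L) g ↔
      ∀ v ∈ translate c B L g, x • v ∈ translate c B L g := by
  have h0 : x ∈ stabAt (toDoubled F c B) (stab (doubledForm F c B) L) g ↔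
      g * toDoubled F c B x * g⁻¹ ∈ stab (doubledForm F c B) L := Iff.rfl
  rw [h0, mem_stab_iff]
  constructor
  · intro hx v hv
    rw [mem_translate] at hv ⊢
    have := hx _ hv
    rwa [mul_smul, mul_smul, inv_smul_smul, toDoubled_smul] at this
  · intro hx y hy
    have h1 := hx (g⁻¹ • y) (by rwa [mem_translate, smul_inv_smul])
    rw [mem_translate] at h1
    rwa [mul_smul, mul_smul, toDoubled_smul]

theorem charAt_siegelHom (h : IsDoubling ι ε c κ B) (hL : IsLagrangian c B L) {k : ℕ}
    (D : LeviDatum B k) {P : Submodule F D.M0} (hP : IsKForm κ (B.restrict D.M0) P)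
    {z : isomGroup (doubledForm F c B)} (hz : translate c B L z = D.lagrangian P) (s : ℂ)
    (x : stabAt (toDoubled F c B) (stab (doubledForm F c B) L) z)
    (hx : (x : isomGroup B) ∈ stab B D.X) :
    charAt (toDoubled F c B) (siegelHom c B L s) z x =
      posPow (modulus B D.X F) (1 / 2) ⟨x, hx⟩ *
        posPow ((relAbs F E).comp (detOn B D.X)) (s + (k : ℂ) / 2) ⟨x, hx⟩ := by
  have := h.finiteDimensional
  have : CharZero E := charZero_of_injective_algebraMap (algebraMap F E).injective
  rw [D.posPow_modulus_mul F h.isEps]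
  let q : stab (doubledForm F c B) L := ((MulAut.conj z).toMonoidHom.comp (toDoubled F c B)).subgroupComap _ x
  have hq : ∀ v : V, (q : isomGroup (doubledForm F c B)) • v = z • (x : isomGroup B) • z⁻¹ • v :=
    fun v => by
      change (z * toDoubled F c B x * z⁻¹) • v = _
      rw [mul_smul, mul_smul, toDoubled_smul]
  change siegelHom c B L s q = _
  rw [h.siegelHom_apply hL]
  have hmem : ∀ v ∈ D.lagrangian P, (x : isomGroup B) • v ∈ D.lagrangian P := by
    rw [← hz]
    exact mem_stabAt_iff.1 x.2
  let f : Module.End F (D.lagrangian P) :=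
    (((x : isomGroup B) : V ≃ₗ[E] V).restrictScalars F : V →ₗ[F] V).restrict hmem
  have hdet := h.relAbs_det_lagrangian D hP ⟨x, hx⟩ f fun v => rfl
  have hzmem : ∀ v, v ∈ D.lagrangian P ↔ z • v ∈ L := fun v => by rw [← hz, mem_translate]
  have hdet' : detOn (doubledForm F c B) L q = LinearMap.det f := by
    let e : L ≃ₗ[F] D.lagrangian P :=
      { toFun := fun v => ⟨z⁻¹ • (v : V), (hzmem _).2 (by rw [smul_inv_smul]; exact v.2)⟩
        invFun := fun v => ⟨z • (v : V), (hzmem _).1 v.2⟩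
        left_inv := fun v => Subtype.ext (smul_inv_smul z (v : V))
        right_inv := fun v => Subtype.ext (inv_smul_smul z (v : V))
        map_add' := fun v w => Subtype.ext (smul_add z⁻¹ (v : V) w)
        map_smul' := fun a v => Subtype.ext
          (map_smul ((z⁻¹ : isomGroup (doubledForm F c B)) : V ≃ₗ[F] V) a (v : V)) }
    change LinearMap.det (restr (doubledForm F c B) L q) = _
    rw [← LinearMap.det_conj _ e]
    congr 1
    refine LinearMap.ext fun v => Subtype.ext ?_
    change z⁻¹ • (q : isomGroup (doubledForm F c B)) • z • (v : V) = (x : isomGroup B) • (v : V)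
    rw [hq, inv_smul_smul, inv_smul_smul]
  rw [hdet', hdet]
  congr 1
  ring

/-- The compact induction attached to the orbit of the Lagrangian `X ⊕ P`, as an induction in
stages. -/
theorem nonempty_compIndRep_equiv_normIndRep [IsTopologicalGroup (isomGroup B)]
    (h : IsDoubling ι ε c κ B)
    (hL : IsLagrangian c B L) {k : ℕ} (D : LeviDatum B k) {P : Submodule F D.M0}
    (hP : IsKForm κ (B.restrict D.M0) P) {z : isomGroup (doubledForm F c B)}
    (hz : translate c B L z = D.lagrangian P) (s : ℂ) :
    Nonempty ((compIndRep (stabAt (toDoubled F c B) (stab (doubledForm F c B) L) z)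
        (charAt (toDoubled F c B) (siegelHom c B L s) z)).Equiv (normIndRep F B D.X
      (inducingRep (F := F) D (rationalIsom (B.restrict D.M0) P) (s + (k : ℂ) / 2)))) := by
  have := h.finiteDimensional
  have : CharZero E := charZero_of_injective_algebraMap (algebraMap F E).injective
  obtain ⟨_, _, _, _, _⟩ := isom_topology F h.isEps
  obtain ⟨_, _, _, _, _⟩ := isom_topology F (D.isEps_M0 h.isEps)
  have hLag := h.isLagrangian_lagrangian D hP
  have hX := h.anPart_lagrangian D hP
  have hstabX : ∀ {x : isomGroup B},
      (∀ v, v ∈ D.lagrangian P ↔ x • v ∈ D.lagrangian P) → x ∈ stab B D.X := by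
    intro x hx
    rw [mem_stab_iff]
    intro v hv
    rw [← hX] at hv ⊢
    exact smul_anPart_mem hx hv
  have hmemP : ∀ (v : D.M0), (v : V) ∈ D.lagrangian P ↔ v ∈ P := fun v => by
    rw [← D.mem_formPart, D.formPart_lagrangian h.isEps]
  obtain ⟨K1, hK1, hK⟩ := exists_compact_mul F h.isEps D.X D.isotropic_X
  let ψ : stab B D.X →* ℂ := posPow (modulus B D.X F) (1 / 2) *
    posPow ((relAbs F E).comp (detOn B D.X)) (s + (k : ℂ) / 2)
  have hiff : ∀ (x : isomGroup B), (∀ v ∈ D.lagrangian P, x • v ∈ D.lagrangian P) ↔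
      ∀ v, v ∈ D.lagrangian P ↔ x • v ∈ D.lagrangian P := by
    intro x
    refine ⟨fun hx v => ⟨hx v, fun hv => ?_⟩, fun hx v hv => (hx v).1 hv⟩
    have h1 := smul_coe_eq_of_forall (g := toDoubled F c B x) (X := D.lagrangian P)
      (X' := D.lagrangian P) hx le_rfl
    have h2 : toDoubled F c B x • v ∈ toDoubled F c B x • (D.lagrangian P : Set V) := by
      rw [h1]
      exact hv
    exact Set.smul_mem_smul_set_iff.1 h2
  have hstab : ∀ m : isomGroup (B.restrict D.M0), m ∈ rationalIsom (B.restrict D.M0) P ↔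
      ∀ v ∈ P, m • v ∈ P := by
    intro m
    constructor
    · intro hm v hv
      have h1 : m • (P : Set D.M0) = P := hm
      have h2 : m • v ∈ m • (P : Set D.M0) := Set.smul_mem_smul_set hv
      rwa [h1] at h2
    · intro hm
      have : FiniteDimensional F D.M0 := FiniteDimensional.trans F E D.M0
      exact smul_coe_eq_of_forall (g := toDoubled F c (B.restrict D.M0) m) (X := P) (X' := P)
        hm le_rfl
  refine nonempty_compInd_equiv_unInd (isClosed_stab F D.X) hK1 hK D.levi (D.continuous_levi F)
    (D.emb h.isEps) (D.continuous_emb F h.isEps) (D.levi_emb h.isEps) ψ (fun m => ?_)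
    (rationalIsom (B.restrict D.M0) P) (fun x => ?_) _
    (fun x hx => h.charAt_siegelHom hL D hP hz s x hx) _ (fun p f m => ?_)
  · change posPow (modulus B D.X F) (1 / 2) _ *
      posPow ((relAbs F E).comp (detOn B D.X)) (s + (k : ℂ) / 2) _ = 1
    rw [D.posPow_modulus_mul F h.isEps, D.detOn_emb h.isEps]
    simp
  · rw [mem_stabAt_iff, hz]
    constructor
    · intro hx
      refine ⟨hstabX ((hiff x).1 hx), (hstab _).2 fun v hv => ?_⟩
      exact (hmemP _).1 ((h.forall_smul_mem_iff hLag hLag D hX.symm hX.symm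
        ⟨x, hstabX ((hiff x).1 hx)⟩).1 hx v ((hmemP v).2 hv))
    · rintro ⟨hx, hx'⟩
      refine (h.forall_smul_mem_iff hLag hLag D hX.symm hX.symm
        ⟨x, hx⟩).2 fun v hv => ?_
      exact (hmemP _).2 ((hstab _).1 hx' v ((hmemP v).1 hv))
  · exact (mul_assoc _ _ _).symm

/-- The description of `J_k(s)` by the orbits of `Isom(M0)` on the `F`-forms of `M0`. -/
theorem nonempty_gradedRep_equiv_normIndRep (h : IsDoubling ι ε c κ B)
    (hL : IsLagrangian c B L) {k : ℕ} (D : LeviDatum B k) {I : Type*} (P : I → Submodule F D.M0)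
    (hP : ∀ i, IsKForm κ (B.restrict D.M0) (P i))
    (hex : ∀ P' : Submodule F D.M0, IsKForm κ (B.restrict D.M0) P' →
      ∃ i, ∃ e : isomGroup (B.restrict D.M0), ∀ v, v ∈ P' → e • v ∈ P i)
    (huniq : ∀ i i', (∃ e : isomGroup (B.restrict D.M0), ∀ v, v ∈ P i' → e • v ∈ P i) → i = i')
    (s : ℂ) :
    Nonempty ((gradedRep c B L s k).Equiv (Representation.directSum fun i => normIndRep F B D.X
      (inducingRep (F := F) D (rationalIsom (B.restrict D.M0) (P i)) (s + (k : ℂ) / 2)))) := by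
  have := h.finiteDimensional
  have : CharZero E := charZero_of_injective_algebraMap (algebraMap F E).injective
  obtain ⟨_, _, _, _, _⟩ := isom_topology F h.isEps
  obtain ⟨_, _, _, _, _⟩ := isom_topology F (D.isEps_M0 h.isEps)
  have hLag := fun i => h.isLagrangian_lagrangian D (hP i)
  have hX := fun i => h.anPart_lagrangian D (hP i)
  choose z hz using fun i => h.exists_translate_eq hL (hLag i)
  have hstabX : ∀ {i i'} {x : isomGroup B},
      (∀ v, v ∈ D.lagrangian (P i) ↔ x • v ∈ D.lagrangian (P i')) → x ∈ stab B D.X := by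
    intro i i' x hx
    rw [mem_stab_iff]
    intro v hv
    rw [← hX i'] 
    rw [← hX i] at hv
    exact smul_anPart_mem hx hv
  have hmemP : ∀ i (v : D.M0), (v : V) ∈ D.lagrangian (P i) ↔ v ∈ P i := fun i v => by
    rw [← D.mem_formPart, D.formPart_lagrangian h.isEps]
  have e1 := h.nonempty_gradedRep_equiv hL (k := k) (z := z)
    (fun i => by rw [hz, hX, D.finrank_X])
    (by
      intro L' hL' hk
      obtain ⟨g, hg⟩ := exists_smul_eq_of_isotropic h.isEps (h.isotropic_anPart hL') D.isotropic_X
        (by rw [hk, D.finrank_X])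
      have hL'' := isLagrangian_translate hL' (toDoubled F c B g⁻¹)
      have hmem : ∀ v, v ∈ translate c B L' (toDoubled F c B g⁻¹) ↔ g⁻¹ • v ∈ L' := fun v => by
        rw [mem_translate, toDoubled_smul]
      have hD'' : D.X = anPart B (translate c B L' (toDoubled F c B g⁻¹)) := by
        ext v
        rw [← SetLike.mem_coe (p := D.X), ← hg, Set.mem_smul_set_iff_inv_smul_mem, SetLike.mem_coe]
        constructor
        · intro hv
          have h1 := smul_anPart_mem (L := L') (L' := translate c B L' (toDoubled F c B g⁻¹)) (g := g)
            (fun w => by rw [hmem, inv_smul_smul]) hv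
          rwa [smul_inv_smul] at h1
        · exact smul_anPart_mem hmem
      obtain ⟨i, e, he⟩ := hex _ (h.isKForm_formPart hL'' D hD'')
      obtain ⟨x, hx⟩ := h.exists_mem_iff hL'' (hLag i) D D hD'' (hX i).symm
        ((e : D.M0 ≃ₗ[E] D.M0) : D.M0 →ₗ[E] D.M0) (fun v w => isom_apply e v w)
        (fun v hv => (hmemP i _).2 (he v hv))
      refine ⟨i, x * g, fun v => ?_⟩
      rw [hz, mul_smul, ← hx, hmem, inv_smul_smul])
    (by
      rintro i i' ⟨x, hx⟩
      rw [hz, hz] at hx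
      refine huniq i i' ⟨D.levi ⟨x, hstabX hx⟩, fun v hv => ?_⟩
      have := (h.forall_smul_mem_iff (hLag i') (hLag i) D (hX i').symm (hX i).symm ⟨x, hstabX hx⟩).1
        (fun v hv => (hx v).1 hv) v ((hmemP i' v).2 hv)
      exact (hmemP i _).1 this) s
  exact nonempty_equiv_directSum e1 fun i =>
    h.nonempty_compIndRep_equiv_normIndRep hL D (hP i) (hz i) s

end IsDoubling

end Graded

/-! ## The filtration -/

theorem nonempty_ccInfRep_equiv {G : Type*} [Group G] [TopologicalSpace G]
    [SeparatelyContinuousMul G] {S S' : Subgroup G} (h : S = S') :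
    Nonempty ((ccInfRep S).Equiv (ccInfRep S')) := by
  subst h
  exact ⟨Representation.Equiv.refl _⟩

theorem exists_submodule_finrank_eq {K M : Type*} [Field K] [AddCommGroup M] [Module K M] {d : ℕ}
    (hd : d ≤ Module.finrank K M) : ∃ A : Submodule K M, Module.finrank K A = d := by
  obtain ⟨f, hf⟩ := exists_linearIndependent_of_le_finrank hd
  exact ⟨Submodule.span K (Set.range f), by rw [finrank_span_eq_card hf, Fintype.card_fin]⟩

section Filtration

open Topology Filter

variable {F : Type*} [Field F] [CharZero F] [ValuativeRel F] [TopologicalSpace F]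
  [IsNonarchimedeanLocalField F] {E : Type*} [Field E] [Algebra F E]
  [TopologicalSpace E] [IsModuleTopology F E]
  {V : Type*} [AddCommGroup V] [Module F V] [Module E V] [IsScalarTower F E V]
  [FiniteDimensional F V] [FiniteDimensional E V] {ι : E ≃ₐ[F] E} {ε : ℤ} {c κ : E}
  {B : LinearMap.BilinForm E V} {L : Submodule F V}

namespace IsDoubling

theorem filt_zero (h : IsDoubling ι ε c κ B) (hL : IsLagrangian c B L) (s : ℂ) :
    filt c B L s 0 = ⊥ := by
  rw [eq_bot_iff]
  intro f hf
  refine funext fun g => hf.2 g ?_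
  rw [h.closure_stratum hL]
  exact Nat.zero_le _

theorem filt_le (h : IsDoubling ι ε c κ B) (hL : IsLagrangian c B L) (s : ℂ) (k : ℕ) :
    filt c B L s k ≤ filt c B L s (k + 1) := by
  intro f hf
  refine ⟨hf.1, fun g hg => hf.2 g ?_⟩
  rw [h.closure_stratum hL, Set.mem_ofPred_eq] at hg ⊢
  omega

theorem filt_eq_degPS (h : IsDoubling ι ε c κ B) (hL : IsLagrangian c B L) (s : ℂ) {r : ℕ}
    (hr : ∀ X : Submodule E V, (∀ x ∈ X, ∀ y ∈ X, B x y = 0) → Module.finrank E X ≤ r) :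
    filt c B L s (r + 1) = degPS (doubledForm F c B) L s := by
  refine le_antisymm (fun f hf => hf.1) fun f hf => ⟨hf, fun g hg => ?_⟩
  rw [h.closure_stratum hL, Set.mem_ofPred_eq] at hg
  have := hr _ (h.isotropic_anPart (isLagrangian_translate hL g))
  omega

theorem nonempty_gradedRep_zero_equiv (h : IsDoubling ι ε c κ B) (hL : IsLagrangian c B L)
    (s : ℂ) : Nonempty ((gradedRep c B L s 0).Equiv (filtRep c B L s 1)) := by
  refine nonempty_quotient_equiv (filtRep c B L s 1) _ _ LinearMap.id Function.surjective_id
    (fun f => ?_) _ (fun g f => rfl)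
  change (f : isomGroup (doubledForm F c B) → ℂ) ∈ filt c B L s 0 ↔ f = 0
  rw [h.filt_zero hL, Submodule.mem_bot]
  exact Submodule.coe_eq_zero

/-- The description of `I_1(s)` by the orbits of `Isom(V)` on the `F`-forms of `V`. -/
theorem nonempty_filtRep_one_equiv (h : IsDoubling ι ε c κ B) (hL : IsLagrangian c B L)
    {I : Type*} (P : I → Submodule F V) (hP : ∀ i, IsKForm κ B (P i))
    (hex : ∀ P' : Submodule F V, IsKForm κ B P' →
      ∃ i, ∃ e : isomGroup B, ∀ v, v ∈ P' → e • v ∈ P i)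
    (huniq : ∀ i i', (∃ e : isomGroup B, ∀ v, v ∈ P i' → e • v ∈ P i) → i = i') (s : ℂ) :
    Nonempty ((filtRep c B L s 1).Equiv (Representation.directSum fun i =>
      ccInfRep (rationalIsom B (P i)))) := by
  have := h.finiteDimensional
  have : CharZero E := charZero_of_injective_algebraMap (algebraMap F E).injective
  obtain ⟨_, _, _, _, _⟩ := isom_topology F h.isEps
  have hLag := fun i => h.isLagrangian_of_isKForm (hP i)
  choose z hz using fun i => h.exists_translate_eq hL (hLag i)
  have hiff : ∀ {P' P'' : Submodule F V}, IsKForm κ B P' → IsKForm κ B P'' →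
      ∀ x : isomGroup B, (∀ v ∈ P', x • v ∈ P'') → ∀ v, v ∈ P' ↔ x • v ∈ P'' := by
    intro P' P'' hP' hP'' x hx v
    refine ⟨hx v, fun hv => ?_⟩
    have h1 := smul_coe_eq_of_forall (g := toDoubled F c B x) (X := P') (X' := P'') hx
      (by rw [hP'.finrank_eq, hP''.finrank_eq])
    have h2 : toDoubled F c B x • v ∈ toDoubled F c B x • (P' : Set V) := by
      rw [h1]
      exact hv
    exact Set.smul_mem_smul_set_iff.1 h2
  have e1 := h.nonempty_gradedRep_equiv hL (k := 0) (z := z)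
    (fun i => by rw [hz, h.anPart_of_isKForm (hP i), finrank_bot])
    (by
      intro L' hL' hk
      have hP' := h.isKForm_of_isLagrangian hL' hk
      obtain ⟨i, e, he⟩ := hex L' hP'
      exact ⟨i, e, fun v => by rw [hz]; exact hiff hP' (hP i) e he v⟩)
    (by
      rintro i i' ⟨x, hx⟩
      rw [hz, hz] at hx
      exact huniq i i' ⟨x, fun v hv => (hx v).1 hv⟩) s
  have e2 := nonempty_equiv_directSum (σ := fun i => ccInfRep (rationalIsom B (P i))) e1 fun i => by
    have hS : stabAt (toDoubled F c B) (stab (doubledForm F c B) L) (z i) =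
        rationalIsom B (P i) := by
      ext x
      rw [mem_stabAt_iff, hz]
      constructor
      · intro hx
        exact smul_coe_eq_of_forall (g := toDoubled F c B x) hx le_rfl
      · intro hx v hv
        have h1 : x • (P i : Set V) = P i := hx
        have h2 : x • v ∈ x • (P i : Set V) := Set.smul_mem_smul_set hv
        rwa [h1] at h2
    have hχ : charAt (toDoubled F c B) (siegelHom c B L s) (z i) = 1 := by
      ext x
      obtain ⟨D, hD⟩ := h.exists_leviDatum (hLag i)
        (by rw [h.anPart_of_isKForm (hP i), finrank_bot])
      have hDX : D.X = ⊥ := by rw [hD, h.anPart_of_isKForm (hP i)]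
      have hx : (x : isomGroup B) ∈ stab B D.X := by
        rw [mem_stab_iff, hDX]
        intro v hv
        rw [Submodule.mem_bot] at hv ⊢
        rw [hv, smul_zero]
      rw [h.charAt_siegelHom hL D (h.isKForm_formPart (hLag i) D hD)
        (by rw [hz]; exact h.eq_lagrangian (hLag i) D hD) s x hx, D.posPow_modulus_mul F h.isEps]
      have h1 : detOn B D.X ⟨x, hx⟩ = 1 :=
        LinearMap.det_eq_one_of_finrank_eq_zero D.finrank_X _
      rw [h1]
      simp
    obtain ⟨e⟩ := nonempty_compInd_equiv_ccInf _ _ hχ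
    obtain ⟨e'⟩ := nonempty_ccInfRep_equiv hS
    exact ⟨e.trans e'⟩
  exact (h.nonempty_gradedRep_zero_equiv hL s).elim fun e => e2.elim fun e' => ⟨e.symm.trans e'⟩

/-- If there is an isotropic `E`-subspace of dimension `r`, then all strata up to the `r`-th one are
non-empty. -/
theorem exists_isLagrangian (h : IsDoubling ι ε c κ B) (hL : IsLagrangian c B L)
    {X : Submodule E V} (hX : ∀ x ∈ X, ∀ y ∈ X, B x y = 0) {k : ℕ} (hk : k ≤ Module.finrank E X) :
    ∃ L' : Submodule F V, IsLagrangian c B L' ∧ Module.finrank E (anPart B L') = k := by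
  have := h.finiteDimensional
  have : CharZero E := charZero_of_injective_algebraMap (algebraMap F E).injective
  have hXF : Module.finrank F (X.restrictScalars F) = 2 * Module.finrank E X := by
    rw [← h.finrank_eq]
    exact (Module.finrank_mul_finrank F E X).symm
  have hle : Module.finrank F (X.restrictScalars F) ≤ Module.finrank F L := by
    obtain ⟨D, hD⟩ := BaseChangeDoubling.exists_leviDatum h.isEps X hX
    have := D.finrank_M0
    rw [hXF, hL.2]
    omega
  obtain ⟨A, hA⟩ : ∃ A : Submodule F L, Module.finrank F A = Module.finrank F (X.restrictScalars F) :=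
    exists_submodule_finrank_eq hle
  obtain ⟨g, hg⟩ := exists_smul_eq_of_isotropic h.isEps_doubledForm
    (X := X.restrictScalars F) (X' := A.map L.subtype) (fun x hx y hy => by
      rw [doubledForm_apply, hX x hx y hy, mul_zero, map_zero])
    (by
      rintro _ ⟨x, -, rfl⟩ _ ⟨y, -, rfl⟩
      exact hL.1 _ x.2 _ y.2)
    (by rw [← hA]; exact (Submodule.finrank_map_subtype_eq L A).symm)
  have hLg := isLagrangian_translate hL g
  have hXL : ∀ x ∈ X, x ∈ translate c B L g := by
    intro x hx
    rw [mem_translate]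
    have h1 : g • x ∈ g • ((X.restrictScalars F : Submodule F V) : Set V) :=
      Set.smul_mem_smul_set hx
    rw [hg] at h1
    exact Submodule.map_subtype_le L A h1
  have hXan : X ≤ anPart B (translate c B L g) := by
    intro x hx
    rw [mem_anPart]
    intro y hy
    refine trace_eq_zero_of_forall h.finrank_eq h.trace_iff fun e => ?_
    have := hLg.1 y hy (e • x) (hXL _ (X.smul_mem e hx))
    rwa [map_smul, smul_eq_mul] at this
  have hmem : g ∈ closure (stratum c B L k) := by
    rw [h.closure_stratum hL, Set.mem_ofPred_eq]
    exact hk.trans (Submodule.finrank_mono hXan)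
  obtain ⟨g', hg'⟩ := closure_nonempty_iff.1 ⟨g, hmem⟩
  exact ⟨_, isLagrangian_translate hL g', (h.mem_stratum_iff hL k g').1 hg'⟩

end IsDoubling

end Filtration

/-! ## Quadratic extensions -/

section Quadratic

variable {F : Type*} [Field F] [CharZero F] {E : Type*} [Field E] [Algebra F E]
  (hE : Module.finrank F E = 2) (ι : E ≃ₐ[F] E) (hι : ι ≠ 1)

theorem algebraMap_trace_quadratic (hE : Module.finrank F E = 2) {ι : E ≃ₐ[F] E} (hι : ι ≠ 1)
    (x : E) : algebraMap F E (Algebra.trace F E x) = x + ι x := by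
  have : FiniteDimensional F E := Module.finite_of_finrank_pos (by omega)
  have : Algebra.IsQuadraticExtension F E := ⟨hE⟩
  classical
  have hu : (Finset.univ : Finset (E ≃ₐ[F] E)) = {1, ι} := by
    symm
    rw [← Finset.card_eq_iff_eq_univ, Finset.card_pair hι.symm, ← Nat.card_eq_fintype_card,
      IsGalois.card_aut_eq_finrank, hE]
  rw [trace_eq_sum_automorphisms, hu, Finset.sum_pair hι.symm]
  rfl

theorem conj_conj_quadratic (hE : Module.finrank F E = 2) {ι : E ≃ₐ[F] E} (hι : ι ≠ 1) (x : E) :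
    ι (ι x) = x := by
  have h1 := congrArg ι (algebraMap_trace_quadratic hE hι x)
  rw [AlgEquiv.commutes, algebraMap_trace_quadratic hE hι, map_add, add_comm] at h1
  exact (add_left_cancel h1).symm

theorem conj_eq_neg_of_trace (hE : Module.finrank F E = 2) {ι : E ≃ₐ[F] E} (hι : ι ≠ 1) {τ : E}
    (hτ : Algebra.trace F E τ = 0) : ι τ = -τ := by
  have h1 := algebraMap_trace_quadratic hE hι τ
  rw [hτ, map_zero] at h1
  exact eq_neg_of_add_eq_zero_right h1.symm

theorem exists_eq_algebraMap_of_conj_eq (hE : Module.finrank F E = 2) {ι : E ≃ₐ[F] E} (hι : ι ≠ 1)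
    {x : E} (hx : ι x = x) : ∃ a : F, x = algebraMap F E a := by
  have : CharZero E := charZero_of_injective_algebraMap (algebraMap F E).injective
  refine ⟨2⁻¹ * Algebra.trace F E x, ?_⟩
  rw [map_mul, algebraMap_trace_quadratic hE hι, hx, ← two_mul, map_inv₀, map_ofNat,
    inv_mul_cancel_left₀ two_ne_zero]

theorem trace_eq_zero_iff (hE : Module.finrank F E = 2) {ι : E ≃ₐ[F] E} (hι : ι ≠ 1) {x : E} :
    Algebra.trace F E x = 0 ↔ ι x = -x := by
  refine ⟨conj_eq_neg_of_trace hE hι, fun hx => ?_⟩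
  have h1 := algebraMap_trace_quadratic hE hι x
  rw [hx, add_neg_cancel] at h1
  exact (map_eq_zero _).1 h1

variable {V : Type*} [AddCommGroup V] [Module E V] {B : LinearMap.BilinForm E V}

theorem isDoubling_of_symm (hE : Module.finrank F E = 2) {ι : E ≃ₐ[F] E} (hι : ι ≠ 1) {τ : E}
    (hτ0 : τ ≠ 0) (hτ : Algebra.trace F E τ = 0) (hB : IsEps 1 B) :
    IsDoubling ι 1 τ 1 B where
  isEps := hB
  finrank_eq := hE
  exists_skew := ⟨τ, hτ0, conj_eq_neg_of_trace hE hι hτ⟩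
  κ_ne := one_ne_zero
  trace_iff x := by
    rw [trace_eq_zero_iff hE hι, map_mul, conj_eq_neg_of_trace hE hι hτ, neg_mul, neg_inj,
      mul_right_inj' hτ0]
    constructor
    · intro hx
      obtain ⟨a, ha⟩ := exists_eq_algebraMap_of_conj_eq hE hι hx
      exact ⟨a, by rw [ha, Algebra.algebraMap_eq_smul_one]⟩
    · rintro ⟨a, rfl⟩
      rw [← Algebra.algebraMap_eq_smul_one, AlgEquiv.commutes]
  trace_conj z := by
    rw [trace_eq_zero_iff hE hι, map_mul, map_add, map_mul, conj_conj_quadratic hE hι,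
      conj_eq_neg_of_trace hE hι hτ]
    simp [add_comm]

theorem isDoubling_of_alt (hE : Module.finrank F E = 2) {ι : E ≃ₐ[F] E} (hι : ι ≠ 1) {τ : E}
    (hτ0 : τ ≠ 0) (hτ : Algebra.trace F E τ = 0) (hB : IsEps (-1) B) :
    IsDoubling ι (-1) 1 τ B where
  isEps := hB
  finrank_eq := hE
  exists_skew := ⟨τ, hτ0, conj_eq_neg_of_trace hE hι hτ⟩
  κ_ne := hτ0
  trace_iff x := by
    have h1 := conj_eq_neg_of_trace hE hι hτ
    rw [one_mul, trace_eq_zero_iff hE hι]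
    constructor
    · intro hx
      obtain ⟨a, ha⟩ := exists_eq_algebraMap_of_conj_eq hE hι (x := x * τ⁻¹) (by
        rw [map_mul, map_inv₀, h1, hx, inv_neg, neg_mul_neg])
      exact ⟨a, by rw [Algebra.smul_def, ← ha, inv_mul_cancel_right₀ hτ0]⟩
    · rintro ⟨a, rfl⟩
      rw [Algebra.smul_def, map_mul, AlgEquiv.commutes, h1, mul_neg]
  trace_conj z := by
    rw [trace_eq_zero_iff hE hι, one_mul, map_add, map_mul, conj_conj_quadratic hE hι]
    simp

end Quadratic

/-! ## Galois descent -/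

section Descent

variable {F : Type*} [Field F] [CharZero F] {E : Type*} [Field E] [Algebra F E]
  {U : Type*} [AddCommGroup U] [Module F U] [Module E U] [IsScalarTower F E U]

/-- The fixed points of a semilinear involution are an `F`-form. -/
theorem span_eqLocus_eq_top {ι : E ≃ₐ[F] E} {τ : E} (hτ0 : τ ≠ 0) (hτ : ι τ = -τ)
    (θ : U →ₗ[F] U) (hθ : ∀ (e : E) u, θ (e • u) = ι e • θ u) (hθθ : ∀ u, θ (θ u) = u) :
    Submodule.span E (LinearMap.eqLocus θ LinearMap.id : Set U) = ⊤ := by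
  have : CharZero E := charZero_of_injective_algebraMap (algebraMap F E).injective
  rw [eq_top_iff]
  intro u _
  have h1 : u + θ u ∈ Submodule.span E (LinearMap.eqLocus θ LinearMap.id : Set U) := by
    refine Submodule.subset_span ?_
    change θ (u + θ u) = u + θ u
    rw [map_add, hθθ, add_comm]
  have h2 : τ • (u - θ u) ∈ Submodule.span E (LinearMap.eqLocus θ LinearMap.id : Set U) := by
    refine Submodule.subset_span ?_
    change θ (τ • (u - θ u)) = τ • (u - θ u)
    rw [hθ, map_sub, hθθ, hτ, neg_smul, ← smul_neg, neg_sub]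
  have h3 := Submodule.smul_mem _ (2⁻¹ : E) (Submodule.add_mem _ h1 (Submodule.smul_mem _ τ⁻¹ h2))
  rw [inv_smul_smul₀ hτ0] at h3
  have h4 : u + θ u + (u - θ u) = (2 : E) • u := by rw [two_smul]; abel
  rwa [h4, inv_smul_smul₀ two_ne_zero] at h3

theorem finrank_eqLocus [FiniteDimensional F U] (hE : Module.finrank F E = 2) {ι : E ≃ₐ[F] E}
    {τ : E} (hτ0 : τ ≠ 0) (hτ : ι τ = -τ)
    (θ : U →ₗ[F] U) (hθ : ∀ (e : E) u, θ (e • u) = ι e • θ u) (hθθ : ∀ u, θ (θ u) = u) :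
    Module.finrank F (LinearMap.eqLocus θ LinearMap.id) = Module.finrank E U := by
  have : CharZero E := charZero_of_injective_algebraMap (algebraMap F E).injective
  let P : Submodule F U := LinearMap.eqLocus θ LinearMap.id
  have hP : ∀ u, u ∈ P ↔ θ u = u := fun u => Iff.rfl
  let t : U →ₗ[F] U := (LinearMap.lsmul E U τ).restrictScalars F
  have ht : ∀ u, t u = τ • u := fun _ => rfl
  have htinj : Function.Injective t := fun u v huv => by
    rw [ht, ht] at huv
    exact smul_right_injective U hτ0 huv
  have h1 : P ⊔ P.map t = ⊤ := by
    rw [eq_top_iff]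
    intro u _
    have h2 : (2⁻¹ : F) • (u + θ u) ∈ P := P.smul_mem _ (by rw [hP, map_add, hθθ, add_comm])
    have h3 : (2⁻¹ : F) • (τ⁻¹ • (u - θ u)) ∈ P := P.smul_mem _ (by
      rw [hP, hθ, map_sub, hθθ, map_inv₀, hτ, inv_neg, neg_smul, ← smul_neg, neg_sub])
    have h4 := Submodule.add_mem_sup h2 (Submodule.mem_map_of_mem (f := t) h3)
    rw [map_smul, ht, smul_inv_smul₀ hτ0, ← smul_add] at h4
    have h5 : u + θ u + (u - θ u) = (2 : F) • u := by rw [two_smul]; abel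
    rwa [h5, inv_smul_smul₀ two_ne_zero] at h4
  have h2 : P ⊓ P.map t = ⊥ := by
    rw [eq_bot_iff]
    rintro _ ⟨h3, w, hw, rfl⟩
    have h4 : θ (τ • w) = τ • w := h3
    rw [hθ, hτ, (hP w).1 hw, neg_smul, neg_eq_iff_add_eq_zero, ← two_smul E] at h4
    rw [ht]
    exact (smul_eq_zero.1 h4).resolve_left two_ne_zero
  have h3 := Submodule.finrank_sup_add_finrank_inf_eq P (P.map t)
  rw [h1, h2, finrank_top, finrank_bot, ← (Submodule.equivMapOfInjective t htinj P).finrank_eq,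
    ← Module.finrank_mul_finrank F E U, hE] at h3
  change Module.finrank F P = _
  omega

end Descent

/-! ## Rational forms and cocycles -/

section Cocycles

variable {F : Type*} [Field F] [CharZero F] {E : Type*} [Field E] [Algebra F E]
  {U N : Type*} [AddCommGroup U] [Module F U] [Module E U] [IsScalarTower F E U]
  [AddCommGroup N] [Module F N] {B : LinearMap.BilinForm E U} {j : N →ₗ[F] U}

theorem galConj_apply (hj : IsFForm B j) (ι : E ≃ₐ[F] E) (x : N) : galConj hj ι (j x) = j x := by
  have := galConj_smul_apply hj ι 1 x
  rwa [one_smul, map_one, one_smul] at this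

theorem galConj_galConj (hj : IsFForm B j) {ι : E ≃ₐ[F] E} (hι : ∀ e, ι (ι e) = e) (u : U) :
    galConj hj ι (galConj hj ι u) = u := by
  induction u using galConj_induction hj with
  | h e x => rw [galConj_smul_apply, galConj_smul_apply, hι]
  | hadd u v hu hv => rw [map_add, map_add, hu, hv]

theorem galConj_galAct_smul (hj : IsFForm B j) (ι : E ≃ₐ[F] E) (g : isomGroup B) (u : U) :
    galAct hj ι g • galConj hj ι u = galConj hj ι (g • u) := by
  change galConj hj ι (g • (galConj hj ι).symm (galConj hj ι u)) = _
  rw [LinearEquiv.symm_apply_apply]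

theorem mem_twistedForm {hj : IsFForm B j} {ι : E ≃ₐ[F] E} {g : Cocycle hj ι} {u : U} :
    u ∈ twistedForm hj ι g ↔ (g : isomGroup B) • galConj hj ι u = u := Iff.rfl

theorem cocycle_smul_smul (hj : IsFForm B j) {ι : E ≃ₐ[F] E} (hι : ∀ e, ι (ι e) = e)
    (g : Cocycle hj ι) (u : U) :
    (g : isomGroup B) • galConj hj ι ((g : isomGroup B) • galConj hj ι u) = u := by
  rw [← galConj_galAct_smul, galConj_galConj hj hι, ← mul_smul, g.2, one_smul]

theorem isKForm_twistedForm [FiniteDimensional F U] (hE : Module.finrank F E = 2) {ι : E ≃ₐ[F] E}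
    (hι : ι ≠ 1) {τ : E} (hτ0 : τ ≠ 0) (hτ : ι τ = -τ) (hj : IsFForm B j) (g : Cocycle hj ι) :
    IsKForm 1 B (twistedForm hj ι g) := by
  have hι2 := conj_conj_quadratic hE hι
  let θ : U →ₗ[F] U := (((g : isomGroup B) : U ≃ₗ[E] U).restrictScalars F : U →ₗ[F] U) ∘ₗ
    (galConj hj ι : U →ₗ[F] U)
  have hsemi : ∀ (e : E) u, θ (e • u) = ι e • θ u := by
    intro e u
    change ((g : isomGroup B) : U ≃ₗ[E] U) (galConj hj ι (e • u)) =
      ι e • ((g : isomGroup B) : U ≃ₗ[E] U) (galConj hj ι u)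
    rw [galConj_smul, map_smul]
  refine ⟨span_eqLocus_eq_top hτ0 hτ θ hsemi (cocycle_smul_smul hj hι2 g),
    finrank_eqLocus hE hτ0 hτ θ hsemi (cocycle_smul_smul hj hι2 g), fun x hx y hy => ?_⟩
  rw [mem_twistedForm] at hx hy
  have h1 : ι (B x y) = B x y := by
    rw [← form_galConj hj, ← isom_apply (g : isomGroup B), hx, hy]
  obtain ⟨a, ha⟩ := exists_eq_algebraMap_of_conj_eq hE hι h1
  exact ⟨a, by rw [ha, Algebra.algebraMap_eq_smul_one]⟩

theorem IsKForm.isFForm [FiniteDimensional F U] {P : Submodule F U} (hP : IsKForm 1 B P) :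
    IsFForm B P.subtype where
  isBaseChange := by
    have : FiniteDimensional E U := Module.Finite.of_restrictScalars_finite F E U
    have hs : Function.Surjective (P.subtype.liftBaseChange E) := by
      rw [← LinearMap.range_eq_top, eq_top_iff, ← hP.span_eq, Submodule.span_le]
      intro x hx
      exact ⟨1 ⊗ₜ ⟨x, hx⟩, by simp⟩
    have hb : Function.Bijective (P.subtype.liftBaseChange E) :=
      ⟨(LinearMap.injective_iff_surjective_of_finrank_eq_finrank
        (by rw [Module.finrank_baseChange, hP.finrank_eq])).2 hs, hs⟩
    exact IsBaseChange.of_equiv (LinearEquiv.ofBijective _ hb) fun x => by simp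
  rational x y := by
    obtain ⟨a, ha⟩ := hP.rational _ x.2 _ y.2
    exact ⟨a, ha.trans (Algebra.algebraMap_eq_smul_one a).symm⟩

/-- Every `F`-form of `U` is attached to a cocycle. -/
theorem exists_twistedForm_eq [FiniteDimensional F U] (hE : Module.finrank F E = 2)
    {ι : E ≃ₐ[F] E} (hι : ι ≠ 1) {τ : E} (hτ0 : τ ≠ 0) (hτ : ι τ = -τ) (hj : IsFForm B j)
    {P : Submodule F U} (hP : IsKForm 1 B P) : ∃ g : Cocycle hj ι, twistedForm hj ι g = P := by
  have hι2 := conj_conj_quadratic hE hι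
  let θ := galConj hj ι
  let θ' := galConj hP.isFForm ι
  have hθ : ∀ u, θ (θ u) = u := galConj_galConj hj hι2
  have hθ' : ∀ u, θ' (θ' u) = u := galConj_galConj hP.isFForm hι2
  let g : isomGroup B := ⟨{ (θ.trans θ') with
    map_smul' := fun e u => by
      change galConj hP.isFForm ι (galConj hj ι (e • u)) = e • galConj hP.isFForm ι (galConj hj ι u)
      rw [galConj_smul, galConj_smul, hι2] }, fun x y => by
    change B (galConj hP.isFForm ι (galConj hj ι x)) (galConj hP.isFForm ι (galConj hj ι y)) = B x y
    rw [form_galConj, form_galConj, hι2]⟩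
  have hg : ∀ u, g • u = θ' (θ u) := fun u => rfl
  let g' : Cocycle hj ι := ⟨g, by
    refine Subtype.ext (LinearEquiv.ext fun u => ?_)
    change (g * galAct hj ι g) • u = u
    rw [mul_smul, ← hθ u, galConj_galAct_smul, hg, hg, hθ, hθ']⟩
  refine ⟨g', (Submodule.eq_of_le_of_finrank_eq ?_ ?_).symm⟩
  · intro u hu
    rw [mem_twistedForm]
    change g • θ u = u
    rw [hg, hθ]
    exact galConj_apply hP.isFForm ι ⟨u, hu⟩
  · rw [hP.finrank_eq, (isKForm_twistedForm hE hι hτ0 hτ hj g').finrank_eq]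

/-- Two cocycles are cohomologous if and only if their `F`-forms are conjugate. -/
theorem cohomologous_iff [FiniteDimensional F U] (hE : Module.finrank F E = 2)
    {ι : E ≃ₐ[F] E} (hι : ι ≠ 1) {τ : E} (hτ0 : τ ≠ 0) (hτ : ι τ = -τ) (hj : IsFForm B j)
    (g g' : Cocycle hj ι) : (cohomologous hj ι).r g g' ↔
      ∃ h : isomGroup B, ∀ v, v ∈ twistedForm hj ι g → h • v ∈ twistedForm hj ι g' := by
  constructor
  · rintro ⟨h, hh⟩
    refine ⟨h, fun v hv => ?_⟩
    rw [mem_twistedForm] at hv ⊢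
    rw [← galConj_galAct_smul, hh, mul_smul, mul_smul, inv_smul_smul, hv]
  · rintro ⟨h, hh⟩
    have key : ∀ u : U, ((g' : isomGroup B) * galAct hj ι h) • galConj hj ι u =
        (h * g : isomGroup B) • galConj hj ι u := by
      intro u
      have hu : u ∈ Submodule.span E (twistedForm hj ι g : Set U) := by
        rw [(isKForm_twistedForm hE hι hτ0 hτ hj g).span_eq]
        trivial
      have hlin : ∀ (x : isomGroup B) (e : E) (w : U), x • (e • w) = e • (x • w) := fun x e w =>
        map_smul (x : U ≃ₗ[E] U) e w
      induction hu using Submodule.span_induction with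
      | zero => simp
      | add a b _ _ ha hb => rw [map_add, smul_add, smul_add, ha, hb]
      | smul e a _ ha => rw [galConj_smul, hlin, hlin, ha]
      | mem v hv =>
        have h1 := mem_twistedForm.1 (hh v hv)
        have h2 := mem_twistedForm.1 hv
        rw [mul_smul, galConj_galAct_smul, h1, mul_smul, h2]
    refine ⟨h, ?_⟩
    rw [eq_mul_inv_iff_mul_eq]
    refine Subtype.ext (LinearEquiv.ext fun u => ?_)
    obtain ⟨v, rfl⟩ := (galConj hj ι).surjective u
    exact key v

variable {ι : E ≃ₐ[F] E}

theorem exists_smul_mem_twistedForm [FiniteDimensional F U] (hE : Module.finrank F E = 2)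
    (hι : ι ≠ 1) {τ : E} (hτ0 : τ ≠ 0) (hτ : ι τ = -τ) (hj : IsFForm B j)
    (c : Representatives hj ι) {P : Submodule F U} (hP : IsKForm 1 B P) :
    ∃ x, ∃ e : isomGroup B, ∀ v, v ∈ P → e • v ∈ twistedForm hj ι (c.1 x) := by
  obtain ⟨g, rfl⟩ := exists_twistedForm_eq hE hι hτ0 hτ hj hP
  refine ⟨Quotient.mk _ g, ?_⟩
  rw [← cohomologous_iff hE hι hτ0 hτ hj]
  exact Quotient.exact (c.2 (Quotient.mk _ g)).symm

theorem eq_of_smul_mem_twistedForm [FiniteDimensional F U] (hE : Module.finrank F E = 2)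
    (hι : ι ≠ 1) {τ : E} (hτ0 : τ ≠ 0) (hτ : ι τ = -τ) (hj : IsFForm B j)
    (c : Representatives hj ι) (x x' : H1 hj ι) (h : ∃ e : isomGroup B,
      ∀ v, v ∈ twistedForm hj ι (c.1 x') → e • v ∈ twistedForm hj ι (c.1 x)) : x = x' := by
  rw [← cohomologous_iff hE hι hτ0 hτ hj] at h
  rw [← c.2 x, ← c.2 x']
  exact (Quotient.sound h).symm

end Cocycles

/-! ## Symplectic spaces -/

section Symplectic

theorem form_span_eq_zero {F E U I I' : Type*} [Field F] [Field E] [Algebra F E] [AddCommGroup U]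
    [Module F U] [Module E U] [IsScalarTower F E U] {B : LinearMap.BilinForm E U} {v : I → U}
    {w : I' → U} (h : ∀ i j, B (v i) (w j) = 0) {x y : U} (hx : x ∈ Submodule.span F (Set.range v))
    (hy : y ∈ Submodule.span F (Set.range w)) : B x y = 0 := by
  induction hx using Submodule.span_induction with
  | zero => simp
  | add a b _ _ ha hb => rw [map_add, LinearMap.add_apply, ha, hb, add_zero]
  | smul t a _ ha => rw [← algebraMap_smul E t a, map_smul, LinearMap.smul_apply, ha, smul_zero]
  | mem x hx =>
    obtain ⟨i, rfl⟩ := hx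
    induction hy using Submodule.span_induction with
    | zero => simp
    | add a b _ _ ha hb => rw [map_add, ha, hb, add_zero]
    | smul t a _ ha => rw [← algebraMap_smul E t a, map_smul, ha, smul_zero]
    | mem y hy =>
      obtain ⟨j, rfl⟩ := hy
      exact h i j

variable {K M : Type*} [Field K] [CharZero K] [AddCommGroup M] [Module K M] [FiniteDimensional K M]
  {B : LinearMap.BilinForm K M}

/-- `b` is a symplectic basis. -/
structure IsSymplecticBasis {n : ℕ} (B : LinearMap.BilinForm K M)
    (b : Module.Basis (Fin n ⊕ Fin n) K M) : Prop where
  inl_inl : ∀ i j, B (b (Sum.inl i)) (b (Sum.inl j)) = 0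
  inr_inr : ∀ i j, B (b (Sum.inr i)) (b (Sum.inr j)) = 0
  inl_inr : ∀ i j, B (b (Sum.inl i)) (b (Sum.inr j)) = if i = j then 1 else 0

theorem exists_isSymplecticBasis (hB : IsEps (-1) B) :
    ∃ (n : ℕ) (b : Module.Basis (Fin n ⊕ Fin n) K M), IsSymplecticBasis B b := by
  classical
  have hself : ∀ v, B v v = 0 := by
    intro v
    have h1 := hB.swap v v
    rw [Int.cast_neg, Int.cast_one, neg_one_mul] at h1
    exact self_eq_neg.1 h1
  let p : ℕ → Prop := fun d => ∃ X : Submodule K M, (∀ x ∈ X, ∀ y ∈ X, B x y = 0) ∧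
    Module.finrank K X = d
  have hp0 : p 0 := ⟨⊥, by simp, finrank_bot K M⟩
  obtain ⟨X, hX, hXd⟩ : p (Nat.findGreatest p (Module.finrank K M)) :=
    Nat.findGreatest_spec (Nat.zero_le _) hp0
  have hmax : ∀ X' : Submodule K M, (∀ x ∈ X', ∀ y ∈ X', B x y = 0) →
      Module.finrank K X' ≤ Module.finrank K X := by
    intro X' hX'
    rw [hXd]
    exact Nat.le_findGreatest (Submodule.finrank_le X') ⟨X', hX', rfl⟩
  obtain ⟨n, D, hmaxD⟩ : ∃ n, ∃ D : LeviDatum B n, ∀ X' : Submodule K M,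
      (∀ x ∈ X', ∀ y ∈ X', B x y = 0) → Module.finrank K X' ≤ n := by
    obtain ⟨D, -⟩ := exists_leviDatum hB X hX
    exact ⟨_, D, hmax⟩
  have hM0 : D.M0 = ⊥ := by
    rw [eq_bot_iff]
    intro v hv
    by_contra hv0
    have hvX : v ∉ D.X := fun hvX => hv0
      (by
        have h1 := D.proj_of_mem hvX
        have h2 := D.proj_coe ⟨v, hv⟩
        rw [h1] at h2
        have h3 := congrArg Subtype.val h2
        rw [Submodule.mem_bot]
        exact h3.symm)
    have h1 := hmaxD (D.X ⊔ Submodule.span K {v}) (by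
      intro x hx y hy
      obtain ⟨x1, hx1, x2, hx2, rfl⟩ := Submodule.mem_sup.1 hx
      obtain ⟨y1, hy1, y2, hy2, rfl⟩ := Submodule.mem_sup.1 hy
      obtain ⟨a, rfl⟩ := Submodule.mem_span_singleton.1 hx2
      obtain ⟨a', rfl⟩ := Submodule.mem_span_singleton.1 hy2
      have e1 := (D.orthogonal x1 (Submodule.mem_sup_left hx1) v hv).1
      have e2 := (D.orthogonal y1 (Submodule.mem_sup_left hy1) v hv).2
      simp only [map_add, map_smul, LinearMap.add_apply, LinearMap.smul_apply, hself, e1, e2,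
        D.isotropic_X x1 hx1 y1 hy1, smul_zero, add_zero])
    rw [Submodule.finrank_sup_span_singleton hvX, D.finrank_X] at h1
    omega
  have hc : IsCompl D.X D.Y := by
    constructor
    · rw [Submodule.disjoint_def]
      exact fun x hx hy => D.separating_X x hx fun y hy' => D.isotropic_Y x hy y hy'
    · rw [codisjoint_iff]
      have := D.isCompl.sup_eq_top
      rwa [hM0, bot_sup_eq] at this
  let bX : Module.Basis (Fin n) K D.X := Module.finBasisOfFinrankEq K D.X D.finrank_X
  let bY : Module.Basis (Fin n) K D.Y := bX.dualBasis.map D.equivY.symm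
  have hbY : ∀ i j, B (bX i : M) (bY j : M) = if i = j then 1 else 0 := by
    intro i j
    have h1 : D.equivY (bY j) = bX.dualBasis j := by simp [bY]
    have h2 := LinearMap.congr_fun h1 (bX i)
    rw [D.equivY_apply, Module.Basis.dualBasis_apply_self] at h2
    rw [h2]
  let b : Module.Basis (Fin n ⊕ Fin n) K M :=
    (bX.prod bY).map (Submodule.prodEquivOfIsCompl D.X D.Y hc)
  have hl : ∀ i, b (Sum.inl i) = bX i := fun i => by simp [b]
  have hr : ∀ i, b (Sum.inr i) = bY i := fun i => by simp [b]
  refine ⟨n, b, fun i j => ?_, fun i j => ?_, fun i j => ?_⟩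
  · rw [hl, hl]
    exact D.isotropic_X _ (bX i).2 _ (bX j).2
  · rw [hr, hr]
    exact D.isotropic_Y _ (bY i).2 _ (bY j).2
  · rw [hl, hr, hbY]

theorem exists_isometry_of_alt {M' : Type*} [AddCommGroup M'] [Module K M']
    [FiniteDimensional K M'] {B' : LinearMap.BilinForm K M'} (hB : IsEps (-1) B)
    (hB' : IsEps (-1) B') (hd : Module.finrank K M = Module.finrank K M') :
    ∃ f : M →ₗ[K] M', ∀ x y, B' (f x) (f y) = B x y := by
  obtain ⟨n, b, hb⟩ := exists_isSymplecticBasis hB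
  obtain ⟨n', b', hb'⟩ := exists_isSymplecticBasis hB'
  have hn : n = n' := by
    have h1 := Module.finrank_eq_card_basis b
    have h2 := Module.finrank_eq_card_basis b'
    simp only [Fintype.card_sum, Fintype.card_fin] at h1 h2
    omega
  subst hn
  obtain ⟨f, -, hf⟩ := exists_isometry_of_gram (B := B) (B' := B') b b' (by
    rintro (i | i) (j | j)
    · rw [hb.inl_inl, hb'.inl_inl]
    · rw [hb.inl_inr, hb'.inl_inr]
    · rw [hB.swap (b (Sum.inl j)), hB'.swap (b' (Sum.inl j)), hb.inl_inr, hb'.inl_inr]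
    · rw [hb.inr_inr, hb'.inr_inr])
  exact ⟨f, hf⟩

end Symplectic

section SymplecticForms

variable {F : Type*} [Field F] [CharZero F] [ValuativeRel F] [TopologicalSpace F]
  [IsNonarchimedeanLocalField F] {E : Type*} [Field E] [Algebra F E]
  {U : Type*} [AddCommGroup U] [Module F U] [Module E U] [IsScalarTower F E U]
  [FiniteDimensional F U] [FiniteDimensional E U] {ι : E ≃ₐ[F] E} {c κ : E}
  {B : LinearMap.BilinForm E U}

/-- All `F`-forms of a symplectic space are conjugate. -/
theorem IsDoubling.exists_smul_mem_of_alt (h : IsDoubling ι (-1) c κ B) {P P' : Submodule F U}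
    (hP : IsKForm κ B P) (hP' : IsKForm κ B P') :
    ∃ e : isomGroup B, ∀ v, v ∈ P → e • v ∈ P' := by
  have := h.finiteDimensional
  have hL := h.isLagrangian_of_isKForm hP
  have hL' := h.isLagrangian_of_isKForm hP'
  obtain ⟨f, hf⟩ := exists_isometry_of_alt (hP.isEps h.isEps h.κ_ne) (hP'.isEps h.isEps h.κ_ne)
    (by rw [hP.finrank_eq, hP'.finrank_eq])
  obtain ⟨b, hb⟩ := hP.exists_basis
  have hbP : ∀ i, b i ∈ P := fun i => by
    rw [hb]
    exact Submodule.subset_span ⟨i, rfl⟩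
  obtain ⟨e, he, he'⟩ := exists_isometry_of_gram (B := B) (B' := B) b
    (fun i => (f ⟨b i, hbP i⟩ : U)) (fun i j => by
      rw [h.form_eq_smul hL' (f ⟨b i, hbP i⟩).2 (f ⟨b j, hbP j⟩).2,
        h.form_eq_smul hL (hbP i) (hbP j)]
      congr 2
      exact hf ⟨b i, hbP i⟩ ⟨b j, hbP j⟩)
  obtain ⟨g, hg⟩ := exists_isom_of_preserving h.isEps e he'
  refine ⟨g, fun v hv => ?_⟩
  rw [hg]
  have hle : Submodule.span F (Set.range b) ≤ P'.comap (e.restrictScalars F) := by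
    rw [Submodule.span_le]
    rintro _ ⟨i, rfl⟩
    change e (b i) ∈ P'
    rw [he]
    exact Submodule.coe_mem _
  rw [hb] at hv
  exact hle hv

end SymplecticForms

section Similitude

variable {F : Type*} [Field F] {E : Type*} [Field E] [Algebra F E]
  {U N : Type*} [AddCommGroup U] [Module F U] [Module E U] [IsScalarTower F E U]
  [AddCommGroup N] [Module F N] [FiniteDimensional F U] [FiniteDimensional E U]
  {B : LinearMap.BilinForm E U} {j : N →ₗ[F] U} {X Y : Submodule F N}

theorem similitude_apply (hj : IsFForm B j) (hXY : IsCompl X Y) (τ : E) (x : N) :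
    similitude hj hXY τ (j x) = τ • j (X.projection Y hXY x) + j (Y.projection X hXY.symm x) := by
  unfold similitude
  rw [LinearMap.add_apply, LinearMap.smul_apply, hj.isBaseChange.lift_eq, hj.isBaseChange.lift_eq]
  rfl

theorem form_similitude (hj : IsFForm B j) (hXY : IsCompl X Y)
    (hX : ∀ x ∈ X, ∀ x' ∈ X, B (j x) (j x') = 0) (hY : ∀ y ∈ Y, ∀ y' ∈ Y, B (j y) (j y') = 0)
    (τ : E) (u v : U) :
    B (similitude hj hXY τ u) (similitude hj hXY τ v) = τ * B u v := by
  induction u using galConj_induction hj with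
  | hadd u u' hu hu' => simp only [map_add, LinearMap.add_apply, hu, hu', mul_add]
  | h e x =>
    induction v using galConj_induction hj with
    | hadd v v' hv hv' => simp only [map_add, hv, hv', mul_add]
    | h e' y =>
      have hdec : ∀ z : N, z = X.projection Y hXY z + Y.projection X hXY.symm z := fun z =>
        (Submodule.projection_add_projection_eq_self hXY z).symm
      have hmX : ∀ z, X.projection Y hXY z ∈ X := fun z => Submodule.projection_apply_mem hXY z
      have hmY : ∀ z, Y.projection X hXY.symm z ∈ Y := fun z =>
        Submodule.projection_apply_mem hXY.symm z
      have e1 := hX _ (hmX x) _ (hmX y)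
      have e2 := hY _ (hmY x) _ (hmY y)
      have e3 : B (j x) (j y) = B (j (X.projection Y hXY x)) (j (Y.projection X hXY.symm y)) +
          B (j (Y.projection X hXY.symm x)) (j (X.projection Y hXY y)) := by
        conv_lhs => rw [hdec x, hdec y]
        simp only [map_add, LinearMap.add_apply, e1, e2]
        ring
      simp only [map_smul, LinearMap.smul_apply, similitude_apply, map_add, LinearMap.add_apply,
        e1, e2, e3, smul_eq_mul]
      ring

variable {ε : ℤ}

theorem similitude_bijective (hB : IsEps ε B) (hj : IsFForm B j) (hXY : IsCompl X Y)
    (hX : ∀ x ∈ X, ∀ x' ∈ X, B (j x) (j x') = 0) (hY : ∀ y ∈ Y, ∀ y' ∈ Y, B (j y) (j y') = 0)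
    {τ : E} (hτ : τ ≠ 0) : Function.Bijective (similitude hj hXY τ) := by
  have hinj : Function.Injective (similitude hj hXY τ) := by
    rw [← LinearMap.ker_eq_bot, LinearMap.ker_eq_bot']
    intro u hu
    refine hB.sep u fun v => ?_
    have h1 := form_similitude hj hXY hX hY τ u v
    rw [hu, map_zero, LinearMap.zero_apply, eq_comm] at h1
    exact (mul_eq_zero.1 h1).resolve_left hτ
  exact ⟨hinj, LinearMap.injective_iff_surjective.1 hinj⟩

/-- The image of the `F`-form under the similitude `c_τ`. -/
noncomputable def similitudeForm (hj : IsFForm B j) (hXY : IsCompl X Y) (τ : E) : Submodule F U :=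
  (LinearMap.range j).map ((similitude hj hXY τ).restrictScalars F)

theorem span_range_eq_top (hj : IsFForm B j) :
    Submodule.span E (LinearMap.range j : Set U) = ⊤ := by
  rw [eq_top_iff]
  intro u _
  induction u using galConj_induction hj with
  | h e x => exact Submodule.smul_mem _ _ (Submodule.subset_span ⟨x, rfl⟩)
  | hadd u v hu hv => exact Submodule.add_mem _ (hu trivial) (hv trivial)

theorem isKForm_similitudeForm (hB : IsEps ε B) (hj : IsFForm B j) (hXY : IsCompl X Y)
    (hX : ∀ x ∈ X, ∀ x' ∈ X, B (j x) (j x') = 0) (hY : ∀ y ∈ Y, ∀ y' ∈ Y, B (j y) (j y') = 0)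
    {τ : E} (hτ : τ ≠ 0) : IsKForm τ B (similitudeForm hj hXY τ) where
  span_eq := by
    have h1 := congrArg (Submodule.map (similitude hj hXY τ)) (span_range_eq_top hj)
    rw [Submodule.map_span, Submodule.map_top,
      LinearMap.range_eq_top.2 (similitude_bijective hB hj hXY hX hY hτ).2] at h1
    exact h1
  finrank_eq := by
    have hjinj : Function.Injective j := by
      have h1 : Function.Injective (TensorProduct.mk F E N 1) :=
        Module.FaithfullyFlat.tensorProduct_mk_injective N
      intro x y hxy
      refine h1 (hj.isBaseChange.equiv.injective ?_)
      change hj.isBaseChange.equiv (1 ⊗ₜ x) = hj.isBaseChange.equiv (1 ⊗ₜ y)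
      rw [hj.isBaseChange.equiv_tmul, hj.isBaseChange.equiv_tmul, hxy]
    have h1 := (Submodule.equivMapOfInjective ((similitude hj hXY τ).restrictScalars F)
      (similitude_bijective hB hj hXY hX hY hτ).1 (LinearMap.range j)).finrank_eq
    rw [LinearMap.finrank_range_of_inj hjinj] at h1
    refine h1.symm.trans ?_
    rw [← hj.isBaseChange.equiv.finrank_eq, Module.finrank_baseChange]
  rational := by
    rintro _ ⟨_, ⟨x, rfl⟩, rfl⟩ _ ⟨_, ⟨y, rfl⟩, rfl⟩
    obtain ⟨a, ha⟩ := hj.rational x y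
    refine ⟨a, (form_similitude hj hXY hX hY τ _ _).trans ?_⟩
    rw [ha, Algebra.smul_def, mul_comm]

theorem twistedIsom_eq (hB : IsEps ε B) (hj : IsFForm B j) (hXY : IsCompl X Y)
    (hX : ∀ x ∈ X, ∀ x' ∈ X, B (j x) (j x') = 0) (hY : ∀ y ∈ Y, ∀ y' ∈ Y, B (j y) (j y') = 0)
    {τ : E} (hτ : τ ≠ 0) : twistedIsom hj hXY τ = rationalIsom B (similitudeForm hj hXY τ) := by
  have hbij := similitude_bijective hB hj hXY hX hY hτ
  let s : U ≃ₗ[E] U := LinearEquiv.ofBijective _ hbij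
  have hs : ∀ v, s v = similitude hj hXY τ v := fun v => rfl
  have hcoe : (similitudeForm hj hXY τ : Set U) = s '' (LinearMap.range j : Set U) := rfl
  ext g
  constructor
  · rintro ⟨h, hh, hg⟩
    change g • (similitudeForm hj hXY τ : Set U) = similitudeForm hj hXY τ
    have hh' : h • (LinearMap.range j : Set U) = LinearMap.range j := hh
    rw [hcoe]
    conv_rhs => rw [← hh']
    ext v
    constructor
    · rintro ⟨_, ⟨w, hw, rfl⟩, rfl⟩
      exact ⟨h • w, Set.smul_mem_smul_set hw, (hg w).symm⟩
    · rintro ⟨_, ⟨w, hw, rfl⟩, rfl⟩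
      exact ⟨s w, ⟨w, hw, rfl⟩, hg w⟩
  · intro hg
    have hg' : g • (similitudeForm hj hXY τ : Set U) = similitudeForm hj hXY τ := hg
    have hss : ∀ u v, B (s u) (s v) = τ * B u v := form_similitude hj hXY hX hY τ
    let h : isomGroup B := ⟨(s.trans (g : U ≃ₗ[E] U)).trans s.symm, fun x y => by
      change B (s.symm (g • s x)) (s.symm (g • s y)) = B x y
      refine mul_left_cancel₀ hτ ?_
      rw [← hss, s.apply_symm_apply, s.apply_symm_apply, isom_apply, hss]⟩
    have hh : ∀ v, s (h • v) = g • s v := fun v => s.apply_symm_apply _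
    refine ⟨h, ?_, fun v => (hh v).symm⟩
    change h • (LinearMap.range j : Set U) = LinearMap.range j
    have h1 : s '' (h • (LinearMap.range j : Set U)) = s '' (LinearMap.range j : Set U) := by
      rw [← hcoe, ← hg', hcoe]
      ext v
      constructor
      · rintro ⟨_, ⟨w, hw, rfl⟩, rfl⟩
        exact ⟨s w, ⟨w, hw, rfl⟩, (hh w).symm⟩
      · rintro ⟨_, ⟨w, hw, rfl⟩, rfl⟩
        exact ⟨h • w, Set.smul_mem_smul_set hw, hh w⟩
    exact s.injective.image_injective h1

end Similitude

section Polarized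

variable {F : Type*} [Field F] {E : Type*} [Field E] [CharZero E] [Algebra F E]
  {V : Type*} [AddCommGroup V] [Module F V] [Module E V] [IsScalarTower F E V]
  [FiniteDimensional F V] [FiniteDimensional E V] {B : LinearMap.BilinForm E V}

theorem finrank_isotropic_le_of_alt (hB : IsEps (-1) B) {n : ℕ}
    (hn : Module.finrank E V = 2 * n) (X : Submodule E V) (hX : ∀ x ∈ X, ∀ y ∈ X, B x y = 0) :
    Module.finrank E X ≤ n := by
  obtain ⟨D, -⟩ := exists_leviDatum hB X hX
  have := D.finrank_M0
  omega

theorem nonempty_polarizedDatum [CharZero F] (hB : IsEps (-1) B) {n : ℕ}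
    (hn : Module.finrank E V = 2 * n) {k : ℕ} (hk : k ≤ n) : Nonempty (PolarizedDatum F B k) := by
  obtain ⟨n', b, hb⟩ := exists_isSymplecticBasis hB
  have hn' : n' = n := by
    have h1 := Module.finrank_eq_card_basis b
    simp only [Fintype.card_sum, Fintype.card_fin] at h1
    omega
  subst hn'
  let v : Fin k → V := fun i => b (Sum.inl (Fin.castLE hk i))
  have hv : LinearIndependent E v := b.linearIndependent.comp _
    (Sum.inl_injective.comp (Fin.castLE_injective hk))
  obtain ⟨D⟩ : Nonempty (LeviDatum B k) := by
    obtain ⟨D, -⟩ := exists_leviDatum hB (Submodule.span E (Set.range v))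
      (fun x hx y hy => form_span_eq_zero (fun i j => hb.inl_inl _ _) hx hy)
    rw [finrank_span_eq_card hv, Fintype.card_fin] at D
    exact ⟨D⟩
  obtain ⟨l, w, hw⟩ := exists_isSymplecticBasis (D.isEps_M0 hB)
  let M0F : Submodule F D.M0 := Submodule.span F (Set.range w)
  have hrat : ∀ i j, ∃ a : F, B.restrict D.M0 (w i) (w j) = a • (1 : E) := by
    rintro (i | i) (j | j)
    · exact ⟨0, by rw [hw.inl_inl, zero_smul]⟩
    · refine ⟨if i = j then 1 else 0, ?_⟩
      rw [hw.inl_inr]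
      split_ifs <;> simp
    · refine ⟨if j = i then -1 else 0, ?_⟩
      rw [(D.isEps_M0 hB).swap (w (Sum.inl j)), hw.inl_inr]
      split_ifs <;> simp
    · exact ⟨0, by rw [hw.inr_inr, zero_smul]⟩
  have : FiniteDimensional F D.M0 :=
    inferInstanceAs (FiniteDimensional F (D.M0.restrictScalars F))
  have hK : IsKForm (1 : E) (B.restrict D.M0) M0F := isKForm_span w hrat
  let XF : Submodule F D.M0 := Submodule.span F (Set.range fun i => w (Sum.inl i))
  let YF : Submodule F D.M0 := Submodule.span F (Set.range fun i => w (Sum.inr i))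
  have hX0 : ∀ x ∈ XF, ∀ y ∈ XF, B.restrict D.M0 x y = 0 := fun x hx y hy =>
    form_span_eq_zero (fun i j => hw.inl_inl i j) hx hy
  have hY0 : ∀ x ∈ YF, ∀ y ∈ YF, B.restrict D.M0 x y = 0 := fun x hx y hy =>
    form_span_eq_zero (fun i j => hw.inr_inr i j) hx hy
  exact ⟨{
    toLeviDatum := D
    M0F := M0F
    isFForm := hK.isFForm
    XF := XF.submoduleOf M0F
    YF := YF.submoduleOf M0F
    isotropic_XF := fun x hx y hy => hX0 _ hx _ hy
    isotropic_YF := fun x hx y hy => hY0 _ hx _ hy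
    isCompl_XF := by
      constructor
      · rw [Submodule.disjoint_def]
        intro x hx hy
        refine Subtype.ext ((D.isEps_M0 hB).sep _ fun z => ?_)
        have h1 : B.restrict D.M0 (x : D.M0) = 0 := w.ext fun i => by
          rcases i with i | i
          · exact hX0 _ hx _ (Submodule.subset_span ⟨i, rfl⟩)
          · exact hY0 _ hy _ (Submodule.subset_span ⟨i, rfl⟩)
        rw [h1, LinearMap.zero_apply]
      · rw [codisjoint_iff, eq_top_iff]
        rintro ⟨x, hx⟩ -
        have h1 : M0F ≤ (XF.submoduleOf M0F ⊔ YF.submoduleOf M0F).map M0F.subtype := by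
          rw [Submodule.span_le]
          rintro _ ⟨i | i, rfl⟩
          · exact ⟨⟨w (Sum.inl i), Submodule.subset_span ⟨_, rfl⟩⟩,
              Submodule.mem_sup_left (Submodule.subset_span ⟨i, rfl⟩), rfl⟩
          · exact ⟨⟨w (Sum.inr i), Submodule.subset_span ⟨_, rfl⟩⟩,
              Submodule.mem_sup_right (Submodule.subset_span ⟨i, rfl⟩), rfl⟩
        obtain ⟨y, hy, hyx⟩ := h1 hx
        have : y = ⟨x, hx⟩ := Subtype.ext hyx
        exact this ▸ hy }⟩

end Polarized

/-! ## The base change of an ε-symmetric form -/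

section BaseChange

variable {F : Type*} [Field F] {E : Type*} [Field E] [Algebra F E] {N : Type*} [AddCommGroup N]
  [Module F N] [FiniteDimensional F N]

theorem IsEps.extForm {ε : ℤ} {q : LinearMap.BilinForm F N} (hq : IsEps ε q) :
    IsEps ε (extForm E q) where
  eps := hq.eps
  swap x y := by
    induction x using TensorProduct.induction_on with
    | zero => simp
    | add x x' hx hx' => rw [map_add, map_add, LinearMap.add_apply, hx, hx', mul_add]
    | tmul a v =>
      induction y using TensorProduct.induction_on with
      | zero => simp
      | add y y' hy hy' => rw [map_add, map_add, LinearMap.add_apply, hy, hy', mul_add]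
      | tmul b w =>
        rw [LinearMap.BilinForm.baseChange_tmul, LinearMap.BilinForm.baseChange_tmul, hq.swap v w,
          Algebra.smul_def, Algebra.smul_def, map_mul, map_intCast]
        ring
  sep x hx := by
    classical
    have hnd : q.Nondegenerate := by
      refine ⟨hq.sep, fun y hy => hq.sep y fun x => ?_⟩
      rw [hq.swap x y, hy, mul_zero]
    let b := Module.finBasis F N
    let d := q.dualBasis hnd b
    have hsum := (d.baseChange E).sum_repr x
    refine (d.baseChange E).ext_elem fun i => ?_
    have h1 := hx (1 ⊗ₜ b i)
    rw [← hsum] at h1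
    simp only [map_sum, LinearMap.sum_apply, map_smul, LinearMap.smul_apply,
      Module.Basis.baseChange_apply, LinearMap.BilinForm.baseChange_tmul, d,
      LinearMap.BilinForm.apply_dualBasis_left] at h1
    simpa [d] using h1

theorem isLagrangian_orthLagrangian [CharZero F] (hE : Module.finrank F E = 2) {ι : E ≃ₐ[F] E}
    (hι : ι ≠ 1) {τ : E} (hτ0 : τ ≠ 0) (hτ : Algebra.trace F E τ = 0)
    (q : LinearMap.BilinForm F N) : IsLagrangian τ (extForm E q) (orthLagrangian N τ) := by
  have hconj := conj_eq_neg_of_trace hE hι hτ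
  constructor
  · rintro _ ⟨x, rfl⟩ _ ⟨y, rfl⟩
    change Algebra.trace F E (τ * extForm E q (τ ⊗ₜ x) (τ ⊗ₜ y)) = 0
    rw [LinearMap.BilinForm.baseChange_tmul, mul_smul_comm, map_smul,
      (trace_eq_zero_iff hE hι).2 (by rw [map_mul, map_mul, hconj]; ring), smul_zero]
  · rw [orthLagrangian, LinearMap.finrank_range_of_inj, Module.finrank_baseChange]
    intro x y hxy
    change τ ⊗ₜ[F] x = τ ⊗ₜ[F] y at hxy
    have h1 : τ⁻¹ • (τ ⊗ₜ[F] x) = τ⁻¹ • (τ ⊗ₜ[F] y) := by rw [hxy]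
    rw [TensorProduct.smul_tmul', TensorProduct.smul_tmul', smul_eq_mul, inv_mul_cancel₀ hτ0] at h1
    exact Module.FaithfullyFlat.tensorProduct_mk_injective N h1

theorem similitudeForm_eq_sympLagrangian [FiniteDimensional F E] {q : LinearMap.BilinForm F N} {X Y : Submodule F N}
    (hXY : IsCompl X Y) (τ : E) :
    similitudeForm (isFForm_baseChange (E := E) q) hXY.symm τ = sympLagrangian X Y τ := by
  have : FiniteDimensional F (E ⊗[F] N) := FiniteDimensional.trans F E _
  have h1 := similitude_apply (isFForm_baseChange (E := E) q) hXY.symm τ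
  have h2 : ∀ v : N, τ • TensorProduct.mk F E N 1 v = TensorProduct.mk F E N τ v := fun v => by
    simp [TensorProduct.smul_tmul']
  refine le_antisymm ?_ (sup_le ?_ ?_)
  · rintro _ ⟨_, ⟨v, rfl⟩, rfl⟩
    change similitude (isFForm_baseChange (E := E) q) hXY.symm τ (TensorProduct.mk F E N 1 v) ∈ _
    rw [h1, h2, add_comm]
    exact Submodule.add_mem_sup (Submodule.mem_map_of_mem (Submodule.projection_apply_mem _ _))
      (Submodule.mem_map_of_mem (Submodule.projection_apply_mem _ _))
  · rintro _ ⟨x, hx, rfl⟩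
    refine ⟨_, ⟨x, rfl⟩, ?_⟩
    change similitude (isFForm_baseChange (E := E) q) hXY.symm τ (TensorProduct.mk F E N 1 x) = _
    rw [h1, Submodule.projection_apply_of_mem_right hXY.symm hx,
      Submodule.projection_apply_of_mem_left hXY hx, map_zero, smul_zero, zero_add]
  · rintro _ ⟨y, hy, rfl⟩
    refine ⟨_, ⟨y, rfl⟩, ?_⟩
    change similitude (isFForm_baseChange (E := E) q) hXY.symm τ (TensorProduct.mk F E N 1 y) = _
    rw [h1, Submodule.projection_apply_of_mem_left hXY.symm hy,
      Submodule.projection_apply_of_mem_right hXY hy, map_zero, add_zero, h2]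

end BaseChange

section Strata

variable {F : Type*} [Field F] [CharZero F] [ValuativeRel F] [TopologicalSpace F]
  [IsNonarchimedeanLocalField F] {E : Type*} [Field E] [Algebra F E]
  [TopologicalSpace E] [IsModuleTopology F E]
  {V : Type*} [AddCommGroup V] [Module F V] [Module E V] [IsScalarTower F E V]
  [FiniteDimensional F V] [FiniteDimensional E V] {ι : E ≃ₐ[F] E} {ε : ℤ} {c κ τ : E}
  {B : LinearMap.BilinForm E V} {L : Submodule F V} {k : ℕ}

theorem IsDoubling.nonempty_rationalDatum (h : IsDoubling ι ε c 1 B) (hL : IsLagrangian c B L)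
    {r : ℕ} (hr : ∃ X : Submodule E V, (∀ x ∈ X, ∀ y ∈ X, B x y = 0) ∧ Module.finrank E X = r)
    (hk : k ≤ r) : Nonempty (RationalDatum F B k) := by
  obtain ⟨X, hX, rfl⟩ := hr
  have : CharZero E := charZero_of_injective_algebraMap (algebraMap F E).injective
  obtain ⟨L', hL', hk'⟩ := h.exists_isLagrangian hL hX hk
  obtain ⟨D, hD⟩ := h.exists_leviDatum hL' hk'
  have : FiniteDimensional F D.M0 :=
    inferInstanceAs (FiniteDimensional F (D.M0.restrictScalars F))
  exact ⟨{ toLeviDatum := D, M0F := D.formPart L', isFForm := (h.isKForm_formPart hL' D hD).isFForm }⟩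

theorem nonempty_gradedRep_equiv_orthRep (hE : Module.finrank F E = 2) (hι : ι ≠ 1)
    (hτ0 : τ ≠ 0) (hτ : Algebra.trace F E τ = 0) (hB : IsEps 1 B) (hL : IsLagrangian τ B L)
    (D : RationalDatum F B k) (r : D.Reps ι) (s : ℂ) :
    Nonempty ((gradedRep τ B L s k).Equiv (D.orthRep r s)) :=
  have : FiniteDimensional F D.M0 :=
    inferInstanceAs (FiniteDimensional F (D.M0.restrictScalars F))
  have hconj := conj_eq_neg_of_trace hE hι hτ
  (isDoubling_of_symm hE hι hτ0 hτ hB).nonempty_gradedRep_equiv_normIndRep hL D.toLeviDatum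
    (fun x => twistedForm D.isFForm ι (r.1 x))
    (fun x => isKForm_twistedForm hE hι hτ0 hconj D.isFForm (r.1 x))
    (fun _ hP => exists_smul_mem_twistedForm hE hι hτ0 hconj D.isFForm r hP)
    (fun x x' => eq_of_smul_mem_twistedForm hE hι hτ0 hconj D.isFForm r x x') s

theorem nonempty_normIndRep_inducingRep_equiv (D : LeviDatum B k)
    {S S' : Subgroup (isomGroup (B.restrict D.M0))} (h : S = S') (z : ℂ) :
    Nonempty ((normIndRep F B D.X (inducingRep (F := F) D S z)).Equiv
      (normIndRep F B D.X (inducingRep (F := F) D S' z))) := by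
  subst h
  exact ⟨Representation.Equiv.refl _⟩

theorem nonempty_equiv_trans {G : Type*} [Group G] {M N P : Type*} [AddCommMonoid M] [Module ℂ M]
    [AddCommMonoid N] [Module ℂ N] [AddCommMonoid P] [Module ℂ P] {ρ : Representation ℂ G M}
    {σ : Representation ℂ G N} {π : Representation ℂ G P} (h : Nonempty (ρ.Equiv σ))
    (h' : Nonempty (σ.Equiv π)) : Nonempty (ρ.Equiv π) :=
  h.elim fun e => h'.elim fun e' => ⟨e.trans e'⟩

theorem nonempty_equiv_symm {G : Type*} [Group G] {M N : Type*} [AddCommMonoid M] [Module ℂ M]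
    [AddCommMonoid N] [Module ℂ N] {ρ : Representation ℂ G M}
    {σ : Representation ℂ G N} (h : Nonempty (ρ.Equiv σ)) : Nonempty (σ.Equiv ρ) :=
  h.elim fun e => ⟨e.symm⟩

theorem nonempty_gradedRep_equiv_sympRep (hE : Module.finrank F E = 2) (hι : ι ≠ 1)
    (hτ0 : τ ≠ 0) (hτ : Algebra.trace F E τ = 0) (hB : IsEps (-1) B) (hL : IsLagrangian 1 B L)
    (D : PolarizedDatum F B k) (s : ℂ) :
    Nonempty ((gradedRep 1 B L s k).Equiv (D.sympRep τ s)) := by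
  have : FiniteDimensional F D.M0 :=
    inferInstanceAs (FiniteDimensional F (D.M0.restrictScalars F))
  have hB0 := D.isEps_M0 hB
  have h0 := isDoubling_of_alt hE hι hτ0 hτ hB0
  have hK := isKForm_similitudeForm hB0 D.isFForm D.isCompl_XF D.isotropic_XF D.isotropic_YF hτ0
  refine nonempty_equiv_trans (nonempty_equiv_trans
    ((isDoubling_of_alt hE hι hτ0 hτ hB).nonempty_gradedRep_equiv_normIndRep hL D.toLeviDatum
      (fun _ : Unit => similitudeForm D.isFForm D.isCompl_XF τ) (fun _ => hK)
      (fun _ hP => ⟨(), h0.exists_smul_mem_of_alt hP hK⟩) (fun _ _ _ => rfl) s)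
    (nonempty_directSum_unique _)) ?_
  exact nonempty_normIndRep_inducingRep_equiv D.toLeviDatum (twistedIsom_eq hB0 D.isFForm
    D.isCompl_XF D.isotropic_XF D.isotropic_YF hτ0).symm _

theorem nonempty_filtRep_one_equiv_of_symm (hE : Module.finrank F E = 2) (hι : ι ≠ 1)
    (hτ0 : τ ≠ 0) (hτ : Algebra.trace F E τ = 0) (hB : IsEps 1 B) (hL : IsLagrangian τ B L)
    {N : Type*} [AddCommGroup N] [Module F N] {j : N →ₗ[F] V} (hj : IsFForm B j)
    (r : Representatives hj ι) (s : ℂ) :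
    Nonempty ((filtRep τ B L s 1).Equiv (Representation.directSum fun x : H1 hj ι =>
      ccInfRep (rationalIsom B (twistedForm hj ι (r.1 x))))) :=
  have hconj := conj_eq_neg_of_trace hE hι hτ
  (isDoubling_of_symm hE hι hτ0 hτ hB).nonempty_filtRep_one_equiv hL
    (fun x => twistedForm hj ι (r.1 x))
    (fun x => isKForm_twistedForm hE hι hτ0 hconj hj (r.1 x))
    (fun _ hP => exists_smul_mem_twistedForm hE hι hτ0 hconj hj r hP)
    (fun x x' => eq_of_smul_mem_twistedForm hE hι hτ0 hconj hj r x x') s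

theorem nonempty_filtRep_one_equiv_of_alt (hE : Module.finrank F E = 2) (hι : ι ≠ 1)
    (hτ0 : τ ≠ 0) (hτ : Algebra.trace F E τ = 0) (hB : IsEps (-1) B) (hL : IsLagrangian 1 B L)
    {N : Type*} [AddCommGroup N] [Module F N] {j : N →ₗ[F] V} (hj : IsFForm B j)
    {X Y : Submodule F N} (hXY : IsCompl X Y)
    (hX : ∀ x ∈ X, ∀ x' ∈ X, B (j x) (j x') = 0) (hY : ∀ y ∈ Y, ∀ y' ∈ Y, B (j y) (j y') = 0)
    (s : ℂ) : Nonempty ((filtRep 1 B L s 1).Equiv (ccInfRep (twistedIsom hj hXY τ))) := by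
  have h := isDoubling_of_alt hE hι hτ0 hτ hB
  have hK := isKForm_similitudeForm hB hj hXY hX hY hτ0
  refine nonempty_equiv_trans (nonempty_equiv_trans
    (h.nonempty_filtRep_one_equiv hL (fun _ : Unit => similitudeForm hj hXY τ) (fun _ => hK)
      (fun _ hP => ⟨(), h.exists_smul_mem_of_alt hP hK⟩) (fun _ _ _ => rfl) s)
    (nonempty_directSum_unique _)) ?_
  exact nonempty_ccInfRep_equiv (twistedIsom_eq hB hj hXY hX hY hτ0).symm

theorem nonempty_gradedRep_zero_equiv_of_symm (hE : Module.finrank F E = 2) (hι : ι ≠ 1)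
    (hτ0 : τ ≠ 0) (hτ : Algebra.trace F E τ = 0) (hB : IsEps 1 B) (hL : IsLagrangian τ B L)
    {N : Type*} [AddCommGroup N] [Module F N] {j : N →ₗ[F] V} (hj : IsFForm B j) (s s' : ℂ) :
    Nonempty ((gradedRep τ B L s 0).Equiv (gradedRep τ B L s' 0)) := by
  have h := isDoubling_of_symm hE hι hτ0 hτ hB
  have key := nonempty_filtRep_one_equiv_of_symm hE hι hτ0 hτ hB hL hj
    ⟨Quotient.out, Quotient.out_eq⟩
  exact nonempty_equiv_trans (h.nonempty_gradedRep_zero_equiv hL s) <|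
    nonempty_equiv_trans (key s) <| nonempty_equiv_trans (nonempty_equiv_symm (key s')) <|
    nonempty_equiv_symm (h.nonempty_gradedRep_zero_equiv hL s')

theorem nonempty_gradedRep_zero_equiv_of_alt (hE : Module.finrank F E = 2) (hι : ι ≠ 1)
    (hτ0 : τ ≠ 0) (hτ : Algebra.trace F E τ = 0) (hB : IsEps (-1) B) (hL : IsLagrangian 1 B L)
    {N : Type*} [AddCommGroup N] [Module F N] {j : N →ₗ[F] V} (hj : IsFForm B j)
    {X Y : Submodule F N} (hXY : IsCompl X Y)
    (hX : ∀ x ∈ X, ∀ x' ∈ X, B (j x) (j x') = 0) (hY : ∀ y ∈ Y, ∀ y' ∈ Y, B (j y) (j y') = 0)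
    (s s' : ℂ) : Nonempty ((gradedRep 1 B L s 0).Equiv (gradedRep 1 B L s' 0)) := by
  have h := isDoubling_of_alt hE hι hτ0 hτ hB
  have key := nonempty_filtRep_one_equiv_of_alt hE hι hτ0 hτ hB hL hj hXY hX hY
  exact nonempty_equiv_trans (h.nonempty_gradedRep_zero_equiv hL s) <|
    nonempty_equiv_trans (key s) <| nonempty_equiv_trans (nonempty_equiv_symm (key s')) <|
    nonempty_equiv_symm (h.nonempty_gradedRep_zero_equiv hL s')

end Strata

end BaseChangeDoubling

theorem proposition4p5
    {F : Type*} [Field F] [CharZero F] [ValuativeRel F] [TopologicalSpace F]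
    [IsNonarchimedeanLocalField F]
    {E : Type*} [Field E] [Algebra F E] [TopologicalSpace E] [IsModuleTopology F E]
    (hE : Module.finrank F E = 2) (ι : E ≃ₐ[F] E) (hι : ι ≠ 1)
    (τ : E) (hτ : τ ≠ 0) (hτ0 : Algebra.trace F E τ = 0)
    -- the quadratic space `V_F`, and the Witt index `r` of `V = V_F ⊗ E`
    {VF : Type*} [AddCommGroup VF] [Module F VF] [FiniteDimensional F VF]
    (qV : LinearMap.BilinForm F VF) (hqV : qV.IsSymm) (hqV0 : qV.Nondegenerate)
    (m : ℕ) (hm : Module.finrank F VF = 2 * m)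
    (r : ℕ)
    (hr : IsGreatest {k : ℕ | ∃ X : Submodule E (E ⊗[F] VF),
      (∀ x ∈ X, ∀ y ∈ X, extForm E qV x y = 0) ∧ Module.finrank E X = k} r)
    -- the symplectic space `W_F` with its complete polarization `W_F = X_F ⊕ Y_F`
    {WF : Type*} [AddCommGroup WF] [Module F WF] [FiniteDimensional F WF]
    (qW : LinearMap.BilinForm F WF) (hqW : qW.IsAlt) (hqW0 : qW.Nondegenerate)
    (n : ℕ) (hn : Module.finrank F WF = 2 * n)
    (XF YF : Submodule F WF) (hXF : ∀ x ∈ XF, ∀ x' ∈ XF, qW x x' = 0)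
    (hYF : ∀ y ∈ YF, ∀ y' ∈ YF, qW y y' = 0) (hXY : IsCompl XF YF) :
    -- the orthogonal case
    ((∀ s : ℂ,
        filt τ (extForm E qV) (orthLagrangian VF τ) s 0 = ⊥ ∧
        (∀ k ≤ r, filt τ (extForm E qV) (orthLagrangian VF τ) s k ≤
          filt τ (extForm E qV) (orthLagrangian VF τ) s (k + 1)) ∧
        filt τ (extForm E qV) (orthLagrangian VF τ) s (r + 1) =
          degPS (doubledForm F τ (extForm E qV)) (orthLagrangian VF τ) s ∧
        (∀ k ≤ r, Nonempty (RationalDatum F (extForm E qV) k) ∧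
          ∀ (D : RationalDatum F (extForm E qV) k) (c : D.Reps ι),
            Nonempty ((gradedRep τ (extForm E qV) (orthLagrangian VF τ) s k).Equiv
              (D.orthRep c s))) ∧
        Nonempty ((gradedRep τ (extForm E qV) (orthLagrangian VF τ) s 0).Equiv
          (filtRep τ (extForm E qV) (orthLagrangian VF τ) s 1)) ∧
        (∀ c : Representatives (isFForm_baseChange (E := E) qV) ι,
          Nonempty ((filtRep τ (extForm E qV) (orthLagrangian VF τ) s 1).Equiv
            (Representation.directSum fun x : H1 (isFForm_baseChange (E := E) qV) ι =>
              ccInfRep (rationalIsom (extForm E qV)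
                (twistedForm (isFForm_baseChange (E := E) qV) ι (c.1 x))))))) ∧
      (∀ s s' : ℂ, Nonempty ((gradedRep τ (extForm E qV) (orthLagrangian VF τ) s 0).Equiv
        (gradedRep τ (extForm E qV) (orthLagrangian VF τ) s' 0)))) ∧
    -- the symplectic case
    ((∀ s : ℂ,
        filt 1 (extForm E qW) (sympLagrangian XF YF τ) s 0 = ⊥ ∧
        (∀ k ≤ n, filt 1 (extForm E qW) (sympLagrangian XF YF τ) s k ≤
          filt 1 (extForm E qW) (sympLagrangian XF YF τ) s (k + 1)) ∧
        filt 1 (extForm E qW) (sympLagrangian XF YF τ) s (n + 1) =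
          degPS (doubledForm F 1 (extForm E qW)) (sympLagrangian XF YF τ) s ∧
        (∀ k ≤ n, Nonempty (PolarizedDatum F (extForm E qW) k) ∧
          ∀ D : PolarizedDatum F (extForm E qW) k,
            Nonempty ((gradedRep 1 (extForm E qW) (sympLagrangian XF YF τ) s k).Equiv
              (D.sympRep τ s))) ∧
        Nonempty ((gradedRep 1 (extForm E qW) (sympLagrangian XF YF τ) s 0).Equiv
          (filtRep 1 (extForm E qW) (sympLagrangian XF YF τ) s 1)) ∧
        Nonempty ((filtRep 1 (extForm E qW) (sympLagrangian XF YF τ) s 1).Equiv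
          (ccInfRep (twistedIsom (isFForm_baseChange (E := E) qW) hXY τ)))) ∧
      (∀ s s' : ℂ, Nonempty ((gradedRep 1 (extForm E qW) (sympLagrangian XF YF τ) s 0).Equiv
        (gradedRep 1 (extForm E qW) (sympLagrangian XF YF τ) s' 0)))) := by
  have hF2 : FiniteDimensional F E := Module.finite_of_finrank_pos (by omega)
  have : CharZero E := charZero_of_injective_algebraMap (algebraMap F E).injective
  have : FiniteDimensional F (E ⊗[F] VF) := FiniteDimensional.trans F E _
  have : FiniteDimensional F (E ⊗[F] WF) := FiniteDimensional.trans F E _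
  have hBV : IsEps 1 (extForm E qV) := IsEps.extForm
    ⟨Or.inl rfl, fun x y => by rw [Int.cast_one, one_mul]; exact hqV.eq y x, hqV0.1⟩
  have hBW : IsEps (-1) (extForm E qW) := IsEps.extForm
    ⟨Or.inr rfl, fun x y => by rw [Int.cast_neg, Int.cast_one, neg_one_mul]; exact (LinearMap.IsAlt.neg hqW x y).symm,
      hqW0.1⟩
  have hV := isDoubling_of_symm hE hι hτ hτ0 hBV
  have hW := isDoubling_of_alt hE hι hτ hτ0 hBW
  have hLV := isLagrangian_orthLagrangian hE hι hτ hτ0 qV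
  have hXF' : ∀ x ∈ XF, ∀ x' ∈ XF, extForm E qW (TensorProduct.mk F E WF 1 x)
      (TensorProduct.mk F E WF 1 x') = 0 := fun x hx x' hx' => by
    rw [TensorProduct.mk_apply, TensorProduct.mk_apply, LinearMap.BilinForm.baseChange_tmul,
      hXF x hx x' hx', zero_smul]
  have hYF' : ∀ y ∈ YF, ∀ y' ∈ YF, extForm E qW (TensorProduct.mk F E WF 1 y)
      (TensorProduct.mk F E WF 1 y') = 0 := fun y hy y' hy' => by
    rw [TensorProduct.mk_apply, TensorProduct.mk_apply, LinearMap.BilinForm.baseChange_tmul,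
      hYF y hy y' hy', zero_smul]
  have hLW : IsLagrangian 1 (extForm E qW) (sympLagrangian XF YF τ) := by
    rw [← similitudeForm_eq_sympLagrangian (q := qW) hXY]
    exact hW.isLagrangian_of_isKForm
      (isKForm_similitudeForm hBW (isFForm_baseChange qW) hXY.symm hYF' hXF' hτ)
  have hnE : Module.finrank E (E ⊗[F] WF) = 2 * n := by rw [Module.finrank_baseChange, hn]
  exact ⟨⟨fun s => ⟨hV.filt_zero hLV s, fun k _ => hV.filt_le hLV s k,
      hV.filt_eq_degPS hLV s fun X hX => hr.2 ⟨X, hX, rfl⟩,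
      fun k hk => ⟨hV.nonempty_rationalDatum hLV hr.1 hk,
        fun D c => nonempty_gradedRep_equiv_orthRep hE hι hτ hτ0 hBV hLV D c s⟩,
      hV.nonempty_gradedRep_zero_equiv hLV s,
      fun c => nonempty_filtRep_one_equiv_of_symm hE hι hτ hτ0 hBV hLV _ c s⟩,
      nonempty_gradedRep_zero_equiv_of_symm hE hι hτ hτ0 hBV hLV (isFForm_baseChange qV)⟩,
    ⟨fun s => ⟨hW.filt_zero hLW s, fun k _ => hW.filt_le hLW s k,
      hW.filt_eq_degPS hLW s (finrank_isotropic_le_of_alt hBW hnE),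
      fun k hk => ⟨nonempty_polarizedDatum hBW hnE hk,
        fun D => nonempty_gradedRep_equiv_sympRep hE hι hτ hτ0 hBW hLW D s⟩,
      hW.nonempty_gradedRep_zero_equiv hLW s,
      nonempty_filtRep_one_equiv_of_alt hE hι hτ hτ0 hBW hLW _ hXY hXF' hYF' s⟩,
      nonempty_gradedRep_zero_equiv_of_alt hE hι hτ hτ0 hBW hLW (isFForm_baseChange qW) hXY hXF' hYF'⟩⟩
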